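/- **Pointwise derivative estimates and bounded total speed.** Let $3\le \mathfrak q_0<\infty$, and let $\varphi:\mathbb R^3\to\mathbb R$ be a smooth function supported in the closed unit ball $\overline{B}(0,1)$ with $\varphi=1$ on $B(0,1/2)$. For $N>0$ let $P_N$ be the Littlewood–Paley projection $\widehat{P_Nf}(\xi)=\big(\varphi(\xi/N)-\varphi(2\xi/N)\big)\hat f(\xi)$, acting on functions that are tempered distributions. Let $$\|f\|_{L^{3,\mathfrak q_0}}=\Big(3\int_0^\infty \alpha^{\mathfrak q_0}\,\big|\{x\in\mathbb R^3:|f(x)|>\alpha\}\big|^{\mathfrak q_0/3}\,\frac{d\alpha}{\alpha}\Big)^{1/\mathfrak q_0}.$$ There is a constant $C>0$, depending only on $\mathfrak q_0$ and $\varphi$, such that the following holds for all $t_0\in\mathbb R$, $T>0$ and $M\ge 1$. Let $u:[t_0-T,t_0]\times\mathbb R^3\to\mathbb R^3$, $p:[t_0-T,t_0]\times\mathbb R^3\to\mathbb R$ be a classical solution of the Navier–Stokes equations, i.e. $u,p$ are smooth on $[t_0-T,t_0]\times\mathbb R^3$ and satisfy there $$\partial_t u-\Delta u+u\cdot\nabla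 u+\nabla p=0,\qquad \nabla\cdot u=0,$$ and suppose that $\|u\|_{L^\infty_tL^{3,\mathfrak q_0}_x([t_0-T,t_0]\times\mathbb R^3)}\le M$. Let $\omega=\nabla\times u$. (i) For every $N>0$, $P_Nu(t,\cdot)$ and $P_N\omega(t,\cdot)$ are well-defined continuous functions for all $t\in[t_0-T,t_0]$. For all $(t,x)\in[t_0-T/2,t_0]\times\mathbb R^3$ the derivatives below exist (the time derivative being one-sided at $t=t_0$), and $$|P_Nu(t,x)|\le CMN,\qquad |\nabla P_Nu(t,x)|\le CMN^2,\qquad |\partial_tP_Nu(t,x)|\le CM^2N^3,$$ $$|P_N\omega(t,x)|\le CMN^2,\qquad |\nabla P_N\omega(t,x)|\le CMN^3,\qquad |\partial_tP_N\omega(t,x)|\le CM^2N^4.$$ (ii) For every interval $I\subset[t_0-T/2,t_0]$, $$\|u\|_{L^1_tL^\infty_x(I\times\mathbb R^3)}\le CM^4|I|^{1/2}.$$ -/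

import Mathlib

open MeasureTheory Set Filter Topology
open scoped ENNReal ContDiff SchwartzMap Laplacian

noncomputable section

namespace LorentzNS

/-- Physical space `ℝ³` with the Euclidean norm. -/
abbrev E3 := EuclideanSpace ℝ (Fin 3)

/-- `ℂ³`, in which Fourier multipliers of vector fields take their values. -/
abbrev C3 := EuclideanSpace ℂ (Fin 3)

/-- The inclusion `ℝ³ ⊆ ℂ³`. -/
def toC3 (v : E3) : C3 := WithLp.toLp 2 fun i => (v i : ℂ)

/-! ### Vector calculus and the Navier-Stokes equations -/

/-- The partial derivative `∂ᵢ vⱼ` at `x`. -/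
def pderiv (i j : Fin 3) (v : E3 → E3) (x : E3) : ℝ :=
  fderiv ℝ v x (EuclideanSpace.single i 1) j

/-- `∇ · v`. -/
def divergence (v : E3 → E3) (x : E3) : ℝ := ∑ i, pderiv i i v x

/-- `∇ × v`. -/
def curl (v : E3 → E3) (x : E3) : E3 :=
  !₂[pderiv 1 2 v x - pderiv 2 1 v x,
     pderiv 2 0 v x - pderiv 0 2 v x,
     pderiv 0 1 v x - pderiv 1 0 v x]

/-- `(u, p)` is a classical solution of the incompressible Navier-Stokes equations (viscosity one,
no force) on the closed slab `[a, b] × ℝ³`: both functions are smooth on the slab and the equations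
hold at each of its points, with one-sided time derivatives at `t = a` and `t = b`. -/
structure IsClassicalSolution (a b : ℝ) (u : ℝ → E3 → E3) (p : ℝ → E3 → ℝ) : Prop where
  smooth_u : ContDiffOn ℝ ∞ (fun z : ℝ × E3 => u z.1 z.2) (Icc a b ×ˢ univ)
  smooth_p : ContDiffOn ℝ ∞ (fun z : ℝ × E3 => p z.1 z.2) (Icc a b ×ˢ univ)
  momentum : ∀ t ∈ Icc a b, ∀ x,
    derivWithin (fun s => u s x) (Icc a b) t - Δ (u t) x + fderiv ℝ (u t) x (u t x)
      + gradient (p t) x = 0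
  incompressible : ∀ t ∈ Icc a b, ∀ x, divergence (u t) x = 0

/-! ### Lorentz and mixed norms -/

/-- The Lorentz quasinorm `(p ∫₀^∞ α^q |{|f| > α}|^{q/p} dα/α)^{1/q}` of a vector field, for finite
`p` and `q`, with values in `[0, ∞]`. -/
def lorentzNorm (p q : ℝ) (f : E3 → E3) : ℝ≥0∞ :=
  (ENNReal.ofReal p *
    ∫⁻ α in Ioi (0 : ℝ), ENNReal.ofReal (α ^ q) * (volume {x | α < ‖f x‖}) ^ (q / p)
      / ENNReal.ofReal α) ^ (1 / q)

/-- `‖u‖_{L^∞_t L^{p,q}_x(I × ℝ³)}`. -/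
def supLorentzNorm (p q : ℝ) (I : Set ℝ) (u : ℝ → E3 → E3) : ℝ≥0∞ :=
  essSup (fun t => lorentzNorm p q (u t)) (volume.restrict I)

/-- `‖u‖_{L^1_t L^∞_x(I × ℝ³)}`. -/
def totalSpeed (I : Set ℝ) (u : ℝ → E3 → E3) : ℝ≥0∞ :=
  ∫⁻ t in I, eLpNorm (u t) ∞ volume

/-! ### Littlewood-Paley projections -/

/-- A smooth bump function on the unit ball that equals one on the ball of radius one half. -/
structure IsLPBump (φ : E3 → ℝ) : Prop where
  smooth : ContDiff ℝ ∞ φ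
  support_subset : Function.support φ ⊆ Metric.closedBall 0 1
  eq_one : ∀ ξ ∈ Metric.ball (0 : E3) (1 / 2), φ ξ = 1

/-- The symbol `φ(ξ/N) - φ(ξ/(N/2))` of `P_N = P_{≤ N} - P_{≤ N/2}`. -/
def lpSymbol (φ : E3 → ℝ) (N : ℝ) (ξ : E3) : ℂ :=
  ((φ (N⁻¹ • ξ) - φ ((N / 2)⁻¹ • ξ) : ℝ) : ℂ)

/-- The locally integrable function `f` is (represents) the tempered distribution `T`: the two
agree on test functions. -/
def Represents (f : E3 → C3) (T : 𝓢'(E3, C3)) : Prop :=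
  LocallyIntegrable f volume ∧
    ∀ ψ : 𝓢(E3, ℂ), HasCompactSupport ψ → T ψ = ∫ x, ψ x • f x

set_option maxHeartbeats 1000000 in
/-- Test functions are dense in the Schwartz space. -/
theorem exists_testFunction_tendsto (ψ : 𝓢(E3, ℂ)) :
    ∃ a : ℕ → 𝓢(E3, ℂ), (∀ n, HasCompactSupport (a n)) ∧ Tendsto a atTop (𝓝 ψ) := by
  let b : ContDiffBump (0 : E3) := ⟨1, 2, one_pos, one_lt_two⟩
  have hb : ContDiff ℝ ∞ (b : E3 → ℝ) := b.contDiff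
  let B : 𝓢(E3, ℝ) := b.hasCompactSupport.toSchwartzMap hb
  let c : ℕ → ℝ := fun n => ((n : ℝ) + 1)⁻¹
  have hc0 : ∀ n, 0 < c n := fun n => by positivity
  have hc1 : ∀ n, c n ≤ 1 := fun n => inv_le_one_of_one_le₀ (by linarith [n.cast_nonneg (α := ℝ)])
  have hχ : ∀ n, ContDiff ℝ ∞ (fun x : E3 => b (c n • x)) := fun n =>
    hb.comp (contDiff_const_smul (c n))
  have hcs : ∀ n, HasCompactSupport (fun x : E3 => b (c n • x) • ψ x) := fun n =>
    HasCompactSupport.smul_right (b.hasCompactSupport.comp_smul (hc0 n).ne')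
  let a : ℕ → 𝓢(E3, ℂ) := fun n =>
    (hcs n).toSchwartzMap ((hχ n).smul (ψ.smooth ⊤))
  refine ⟨a, hcs, ?_⟩
  rw [(schwartz_withSeminorms ℝ E3 ℂ).tendsto_nhds_atTop]
  rintro ⟨k, m⟩ ε hε
  let S : ℕ → ℝ := fun j => SchwartzMap.seminorm ℝ (k + 1) j ψ
  let D : ℕ → ℝ := fun i => SchwartzMap.seminorm ℝ 0 i B
  have hS0 : ∀ j, 0 ≤ S j := fun j => apply_nonneg _ _
  have hD0 : ∀ j, 0 ≤ D j := fun j => apply_nonneg _ _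
  let K : ℝ := ∑ i ∈ Finset.range (m + 1), (m.choose i : ℝ) * D i * S (m - i) + S m
  have hK0 : 0 ≤ K := add_nonneg
    (Finset.sum_nonneg fun i _ => mul_nonneg (mul_nonneg (Nat.cast_nonneg _) (hD0 i)) (hS0 _))
    (hS0 m)
  have key : ∀ n, SchwartzMap.seminorm ℝ k m (a n - ψ) ≤ c n * K := by
    intro n
    refine SchwartzMap.seminorm_le_bound ℝ k m _ (mul_nonneg (hc0 n).le hK0) fun x => ?_
    rcases lt_or_ge ‖x‖ ((n : ℝ) + 1) with hx | hx
    · have hev : (⇑(a n - ψ) : E3 → ℂ) =ᶠ[𝓝 x] fun _ => 0 := by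
        have : ∀ᶠ y : E3 in 𝓝 x, ‖y‖ < (n : ℝ) + 1 :=
          continuous_norm.continuousAt.eventually (gt_mem_nhds hx)
        filter_upwards [this] with y hy
        have h1 : b (c n • y) = 1 := by
          apply b.one_of_mem_closedBall
          rw [mem_closedBall_zero_iff, norm_smul, Real.norm_of_nonneg (hc0 n).le]
          change ((n : ℝ) + 1)⁻¹ * ‖y‖ ≤ 1
          rw [inv_mul_le_iff₀ (by positivity)]
          linarith
        change b (c n • y) • ψ y - ψ y = 0
        rw [h1, one_smul, sub_self]
      rw [(hev.iteratedFDeriv ℝ m).self_of_nhds]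
      have : iteratedFDeriv ℝ m (fun _ : E3 => (0 : ℂ)) x = 0 := by
        simp
      rw [this, norm_zero, mul_zero]
      exact mul_nonneg (hc0 n).le hK0
    · have hpt : ∀ j, ‖x‖ ^ k * ‖iteratedFDeriv ℝ j ψ x‖ ≤ c n * S j := by
        intro j
        have h1 : ‖x‖ ^ (k + 1) * ‖iteratedFDeriv ℝ j ψ x‖ ≤ S j :=
          SchwartzMap.le_seminorm ℝ (k + 1) j ψ x
        change _ ≤ ((n : ℝ) + 1)⁻¹ * S j
        rw [le_inv_mul_iff₀ (by positivity)]
        refine le_trans ?_ h1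
        rw [pow_succ', mul_assoc]
        exact mul_le_mul_of_nonneg_right hx (by positivity)
      have hχb : ∀ i, ‖iteratedFDeriv ℝ i (fun y : E3 => b (c n • y)) x‖ ≤ D i := by
        intro i
        rw [iteratedFDeriv_comp_const_smul (i := i) (c n) (hb.of_le (mod_cast le_top)), norm_smul,
          norm_pow, Real.norm_of_nonneg (hc0 n).le]
        have h1 : ‖c n • x‖ ^ 0 * ‖iteratedFDeriv ℝ i B (c n • x)‖ ≤ D i :=
          SchwartzMap.le_seminorm ℝ 0 i B (c n • x)
        rw [pow_zero, one_mul] at h1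
        exact (mul_le_of_le_one_left (norm_nonneg _)
          (pow_le_one₀ (hc0 n).le (hc1 n))).trans h1
      have hsub : iteratedFDeriv ℝ m (⇑(a n - ψ)) x =
          iteratedFDeriv ℝ m (fun y => b (c n • y) • ψ y) x - iteratedFDeriv ℝ m ψ x := by
        have h2 : (⇑(a n - ψ) : E3 → ℂ) = (fun y => b (c n • y) • ψ y) - ⇑ψ := rfl
        rw [h2]
        exact iteratedFDeriv_sub_apply
          (((hχ n).smul (ψ.smooth ⊤)).of_le (mod_cast le_top)).contDiffAt
          ((ψ.smooth ⊤).of_le (mod_cast le_top)).contDiffAt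
      rw [hsub]
      have hprod := norm_iteratedFDeriv_smul_le (hχ n) (ψ.smooth ⊤) x (n := m)
        (mod_cast le_top)
      calc ‖x‖ ^ k * ‖iteratedFDeriv ℝ m (fun y => b (c n • y) • ψ y) x
              - iteratedFDeriv ℝ m ψ x‖
          ≤ ‖x‖ ^ k * (∑ i ∈ Finset.range (m + 1),
              (m.choose i : ℝ) * ‖iteratedFDeriv ℝ i (fun y : E3 => b (c n • y)) x‖
                * ‖iteratedFDeriv ℝ (m - i) ψ x‖ + ‖iteratedFDeriv ℝ m ψ x‖) := by
            gcongr
            exact (norm_sub_le _ _).trans (add_le_add hprod le_rfl)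
        _ ≤ ‖x‖ ^ k * (∑ i ∈ Finset.range (m + 1),
              (m.choose i : ℝ) * D i * ‖iteratedFDeriv ℝ (m - i) ψ x‖
                + ‖iteratedFDeriv ℝ m ψ x‖) := by
            gcongr with i _
            exact hχb i
        _ = ∑ i ∈ Finset.range (m + 1), (m.choose i : ℝ) * D i *
              (‖x‖ ^ k * ‖iteratedFDeriv ℝ (m - i) ψ x‖)
                + ‖x‖ ^ k * ‖iteratedFDeriv ℝ m ψ x‖ := by
            rw [mul_add, Finset.mul_sum]
            congr 1
            exact Finset.sum_congr rfl fun i _ => by ring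
        _ ≤ ∑ i ∈ Finset.range (m + 1), (m.choose i : ℝ) * D i * (c n * S (m - i))
                + c n * S m := by
            refine add_le_add (Finset.sum_le_sum fun i _ => ?_) (hpt m)
            exact mul_le_mul_of_nonneg_left (hpt _) (mul_nonneg (Nat.cast_nonneg _) (hD0 i))
        _ = c n * K := by
            change _ = c n * (∑ i ∈ Finset.range (m + 1), (m.choose i : ℝ) * D i * S (m - i) + S m)
            rw [mul_add, Finset.mul_sum]
            congr 1
            exact Finset.sum_congr rfl fun i _ => by ring
  have hlim : Tendsto (fun n => c n * K) atTop (𝓝 0) := by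
    have h := (tendsto_one_div_add_atTop_nhds_zero_nat (𝕜 := ℝ)).mul_const K
    simpa [c] using h
  obtain ⟨n₀, hn₀⟩ := eventually_atTop.1 (hlim.eventually (gt_mem_nhds hε))
  exact ⟨n₀, fun n hn => (key n).trans_lt (hn₀ n hn)⟩

/-- A function represents at most one tempered distribution. -/
theorem Represents.unique {f : E3 → C3} {T₁ T₂ : 𝓢'(E3, C3)} (h₁ : Represents f T₁)
    (h₂ : Represents f T₂) : T₁ = T₂ := by
  ext1 ψ
  obtain ⟨a, ha, hlim⟩ := exists_testFunction_tendsto ψ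
  refine tendsto_nhds_unique ((T₁.continuous.tendsto ψ).comp hlim) ?_
  exact ((T₂.continuous.tendsto ψ).comp hlim).congr fun n =>
    (h₂.2 _ (ha n)).trans (h₁.2 _ (ha n)).symm

/-- A tempered distribution is represented by at most one continuous function. -/
theorem Represents.function_unique {f g : E3 → C3} {T : 𝓢'(E3, C3)} (hf : Continuous f)
    (hg : Continuous g) (h₁ : Represents f T) (h₂ : Represents g T) : f = g := by
  refine (Continuous.ae_eq_iff_eq volume hf hg).1 ?_
  refine ae_eq_of_integral_contDiff_smul_eq h₁.1 h₂.1 fun η hη hηs => ?_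
  have hs : HasCompactSupport (fun x => (η x : ℂ)) :=
    hηs.comp_left (g := fun r : ℝ => (r : ℂ)) Complex.ofReal_zero
  have hd : ContDiff ℝ ∞ (fun x => (η x : ℂ)) := Complex.ofRealCLM.contDiff.comp hη
  have e₁ := h₁.2 (hs.toSchwartzMap hd) hs
  have e₂ := h₂.2 (hs.toSchwartzMap hd) hs
  have e := e₁.symm.trans e₂
  simpa using e

/-- `g = P_N f`: the vector field `f` is a tempered distribution `T`, and the tempered
distribution `P_N T`, given by `(P_N T)^ = (φ(ξ/N) - φ(ξ/(N/2))) T^`, is the continuous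
function `g`. -/
def IsLPProjection (φ : E3 → ℝ) (N : ℝ) (f : E3 → E3) (g : E3 → C3) : Prop :=
  Continuous g ∧ ∃ T : 𝓢'(E3, C3), Represents (fun x => toC3 (f x)) T ∧
    Represents g (TemperedDistribution.fourierMultiplierCLM C3 (lpSymbol φ N) T)

open Classical in
/-- The function `P_N f`, with value `0` if there is no such function. It is unique:
see `lpProj_eq`. -/
def lpProj (φ : E3 → ℝ) (N : ℝ) (f : E3 → E3) : E3 → C3 :=
  if h : ∃ g, IsLPProjection φ N f g then h.choose else 0

/-- `P_N f` is well defined. -/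
theorem lpProj_eq {φ : E3 → ℝ} {N : ℝ} {f : E3 → E3} {g : E3 → C3}
    (h : IsLPProjection φ N f g) : lpProj φ N f = g := by
  have hex : ∃ g, IsLPProjection φ N f g := ⟨g, h⟩
  rw [lpProj, dif_pos hex]
  obtain ⟨hc, T, hT, hg⟩ := hex.choose_spec
  obtain ⟨hc', T', hT', hg'⟩ := h
  obtain rfl := hT.unique hT'
  exact hg.function_unique hc hc' hg'

end LorentzNS

end

open MeasureTheory Set Filter Topology
open scoped ENNReal ContDiff SchwartzMap Laplacian

noncomputable section

namespace LorentzNS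

section

/-! ### Weak `L³` -/

/-! The Lorentz bound enters only through weak `L³`: `L^{3,q}` embeds there with constant `q / 3 *
M`, and continuity in time upgrades the bound from almost every time to every time
(`NSFlow.of_supLorentzNorm_le`). Splitting a weak `L³` field at height `M r` shows that `|u|` and
`|u|²` integrated against a kernel `g(r(y - x))` are of size `M / r²` and `M² / r`. Everything is
built on such pairings, called `dil`.

Frequency-localized bounds. `P_N u` is `N³` times a pairing with `r = N`, hence of size `M N`; space
derivatives fall on the kernel and cost one `N` each. The time derivative must avoid the pressure,
about which nothing is assumed. Since the symbol of `P_1` vanishes near the origin, its kernel is a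
Laplacian `Δκ` (`lpKernel_eq`). Testing the equation with the divergence-free field `Δκ e_k - ∇∂_k
κ` removes the pressure, and as `u` is divergence free its pairing with the gradient part is zero.
What remains is a linear term of size `M` and a quadratic one of size `M²`, both independent of the
scale (`NSFlow.hasDerivAt_pair_lapS`, `exists_dil_bounds`, `NSFlow.exists_lp_bounds`).

Total speed on `(c, c + ℓ)`. Let `v` be the deviation of `u` from the heat flow started at `s = c -
ℓ`. The same elimination of pressure, applied to the Laplacian of the heat kernel and then
integrated over heat times, gives Duhamel's formula as an inequality (`NSFlow.exists_duhamel`): the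
deviation is at most the integral over past times and heat times `σ` of `σ^{-3/2}` times the average
of `|u|²` at length `√σ`. Cauchy-Schwarz then yields `∫ |v|² ≤ C M⁴ √ℓ`, and similarly `∫ |u|²
|e^{(t-s)Δ} u(s)|² ≤ C M⁴ / √ℓ` for `t` between `c` and `c + ℓ`. So `v` has finite energy even
though `u` need not.

An energy estimate for `v`, localized by a cut-off at radius `R`, bounds its dissipation on the
interval by `C M⁴ √ℓ` as `R → ∞`. The cubic term in `v` is an exact divergence, the remaining source
is `|u|² |e^{(t-s)Δ} u(s)|²`, and all other terms contain a derivative of the cut-off. For the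
pressure term one needs that `p`, paired with a divergence `div f`, is controlled by `M²` times `L²`
norms of `div f` and its gradient (`NSFlow.exists_abs_pair_p_le`). This comes from averaging the
momentum equation at dyadic scales: the residual vanishes at large scales, tends to the pressure
pairing at small ones, and its dyadic increments form geometric series.

Sobolev embedding is used in the sharp Lorentz form `∫ |{|w|² > α}|^{1/3} dα ≤ C ∫ |∇w|²`
(`exists_lorS_le`), that is `L^{6,2}`. It pairs with weak `L³`, and at this endpoint the sup norms
of heat averages of `|v|²` are integrable in heat time with weight `σ^{-1/2}`
(`lintegral_havSup_le`).

Finally Duhamel is applied again, from time `c`, in the sup norm, with `u = v + e^{(s-c+ℓ)Δ} u(c-ℓ)`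
in the quadratic term. The heat part is `O(M / √ℓ)` there, the part from `v` is controlled by the
Lorentz bound, and integration over `(c, c + ℓ)` gives `C M⁴ √ℓ`
(`NSFlow.exists_lintegral_eLpNorm_le`). Restricting to the second half of the time interval leaves
room for the start at `c - ℓ`. -/

/-- `f` lies in weak `L³` with constant `M`. -/
def WeakL3 (M : ℝ) (f : E3 → E3) : Prop :=
  ∀ α : ℝ, 0 < α → volume {x | α < ‖f x‖} ≤ ENNReal.ofReal ((M / α) ^ 3)

theorem lintegral_Ioc_rpow {p b : ℝ} (hp : 0 < p) (hb : 0 ≤ b) :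
    ∫⁻ t in Ioc 0 b, ENNReal.ofReal (t ^ (p - 1)) = ENNReal.ofReal (b ^ p / p) := by
  have hint : IntervalIntegrable (fun t : ℝ => t ^ (p - 1)) volume 0 b :=
    intervalIntegral.intervalIntegrable_rpow' (by linarith)
  rw [← ofReal_integral_eq_lintegral_ofReal
    ((intervalIntegrable_iff_integrableOn_Ioc_of_le hb).1 hint)]
  · rw [← intervalIntegral.integral_of_le hb, integral_rpow (Or.inl (by linarith))]
    simp [hp.ne']
  · filter_upwards [ae_restrict_mem measurableSet_Ioc] with t ht
    exact Real.rpow_nonneg ht.1.le _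

theorem lintegral_Ioi_rpow {p b : ℝ} (hp : p < 0) (hb : 0 < b) :
    ∫⁻ t in Ioi b, ENNReal.ofReal (t ^ (p - 1)) = ENNReal.ofReal (b ^ p / -p) := by
  rw [← ofReal_integral_eq_lintegral_ofReal (integrableOn_Ioi_rpow_of_lt (by linarith) hb)]
  · rw [integral_Ioi_rpow_of_lt (by linarith) hb]
    congr 1
    rw [sub_add_cancel]
    rw [neg_div, div_neg]
  · filter_upwards [ae_restrict_mem measurableSet_Ioi] with t ht
    exact Real.rpow_nonneg (hb.trans ht).le _

/-- Layer cake over a superlevel set: for heights below `l` the set itself bounds the distribution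
function, above `l` the weak bound at the running height does, and the tail converges because `p <
3`. -/
theorem WeakL3.setLIntegral_rpow_le {M : ℝ} {f : E3 → E3} (hf : WeakL3 M f) (hM : 0 ≤ M)
    (hm : Measurable f) {p l : ℝ} (hp : 0 < p) (hp3 : p < 3) (hl : 0 < l) :
    ∫⁻ x in {x | l < ‖f x‖}, ENNReal.ofReal (‖f x‖ ^ p) ≤
      ENNReal.ofReal (3 / (3 - p) * M ^ 3 * l ^ (p - 3)) := by
  rw [lintegral_rpow_eq_lintegral_meas_lt_mul _ (ae_of_all _ fun x => norm_nonneg _)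
    hm.norm.aemeasurable hp]
  rw [← Ioc_union_Ioi_eq_Ioi hl.le, lintegral_union measurableSet_Ioi
    (Ioc_disjoint_Ioi le_rfl)]
  have hS : MeasurableSet {x | l < ‖f x‖} := measurableSet_lt measurable_const hm.norm
  have h1 : ∫⁻ t in Ioc 0 l, (volume.restrict {x | l < ‖f x‖}) {a | t < ‖f a‖} *
      ENNReal.ofReal (t ^ (p - 1)) ≤ ENNReal.ofReal ((M / l) ^ 3 * (l ^ p / p)) := by
    rw [ENNReal.ofReal_mul (by positivity), ← lintegral_Ioc_rpow hp hl.le,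
      ← lintegral_const_mul _ (by fun_prop)]
    gcongr with t
    rw [Measure.restrict_apply' hS]
    exact (measure_mono inter_subset_right).trans (hf l hl)
  have h2 : ∫⁻ t in Ioi l, (volume.restrict {x | l < ‖f x‖}) {a | t < ‖f a‖} *
      ENNReal.ofReal (t ^ (p - 1)) ≤ ENNReal.ofReal (M ^ 3 * (l ^ (p - 3) / -(p - 3))) := by
    rw [ENNReal.ofReal_mul (by positivity), ← lintegral_Ioi_rpow (by linarith) hl,
      ← lintegral_const_mul _ (by fun_prop)]
    refine setLIntegral_mono' measurableSet_Ioi fun t ht => ?_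
    have ht0 : 0 < t := hl.trans ht
    refine (mul_le_mul_left ((Measure.restrict_apply_le _ _).trans (hf t ht0)) _).trans ?_
    rw [← ENNReal.ofReal_mul (by positivity), ← ENNReal.ofReal_mul (by positivity)]
    refine ENNReal.ofReal_le_ofReal (le_of_eq ?_)
    have h3 : t ^ (p - 1) = t ^ 3 * t ^ (p - 3 - 1) := by
      rw [← Real.rpow_natCast, ← Real.rpow_add ht0]; congr 1; push_cast; ring
    rw [h3]; field_simp
  refine (mul_le_mul_right (add_le_add h1 h2) _).trans ?_
  rw [← ENNReal.ofReal_add (by positivity)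
    (mul_nonneg (by positivity) (div_nonneg (by positivity) (by linarith))),
    ← ENNReal.ofReal_mul hp.le]
  refine ENNReal.ofReal_le_ofReal (le_of_eq ?_)
  have h3 : l ^ p = l ^ 3 * l ^ (p - 3) := by
    rw [← Real.rpow_natCast, ← Real.rpow_add hl]; congr 1; push_cast; ring
  rw [h3]
  have h4 : 3 - p ≠ 0 := by linarith
  rw [neg_sub]
  field_simp
  ring

theorem WeakL3.setLIntegral_norm_le {M : ℝ} {f : E3 → E3} (hf : WeakL3 M f) (hM : 0 ≤ M)
    (hm : Measurable f) {l : ℝ} (hl : 0 < l) :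
    ∫⁻ x in {x | l < ‖f x‖}, ENNReal.ofReal ‖f x‖ ≤ ENNReal.ofReal (3 * M ^ 3 / l ^ 2) := by
  have h := hf.setLIntegral_rpow_le hM hm one_pos (by norm_num) hl
  simp only [Real.rpow_one] at h
  refine h.trans (ENNReal.ofReal_le_ofReal ?_)
  have : l ^ ((1 : ℝ) - 3) = (l ^ 2)⁻¹ := by
    rw [← Real.rpow_natCast, ← Real.rpow_neg hl.le]; norm_num
  rw [this]
  rw [div_eq_mul_inv (3 * M ^ 3)]
  have : 0 ≤ M ^ 3 * (l ^ 2)⁻¹ := by positivity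
  nlinarith

theorem WeakL3.setLIntegral_sq_le {M : ℝ} {f : E3 → E3} (hf : WeakL3 M f) (hM : 0 ≤ M)
    (hm : Measurable f) {l : ℝ} (hl : 0 < l) :
    ∫⁻ x in {x | l < ‖f x‖}, ENNReal.ofReal (‖f x‖ ^ 2) ≤ ENNReal.ofReal (3 * M ^ 3 / l) := by
  have h := hf.setLIntegral_rpow_le hM hm two_pos (by norm_num) hl
  simp only [Real.rpow_two] at h
  refine h.trans (ENNReal.ofReal_le_ofReal (le_of_eq ?_))
  have : l ^ ((2 : ℝ) - 3) = l⁻¹ := by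
    rw [show (2 : ℝ) - 3 = -1 by norm_num, Real.rpow_neg_one]
  rw [this]
  norm_num
  rfl

/-- The layer cake stops at height `l`, and the weak bound makes its integrand at most the constant
`4 M³`. -/
theorem WeakL3.lintegral_min_pow_le {M : ℝ} {f : E3 → E3} (hf : WeakL3 M f) (hM : 0 ≤ M)
    (hm : Measurable f) {l : ℝ} (hl : 0 < l) :
    ∫⁻ x, ENNReal.ofReal (min ‖f x‖ l ^ 4) ≤ ENNReal.ofReal (4 * M ^ 3 * l) := by
  have h0 : ∫⁻ x, ENNReal.ofReal (min ‖f x‖ l ^ 4) =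
      ∫⁻ x, ENNReal.ofReal (min ‖f x‖ l ^ (4 : ℝ)) := by
    simp_rw [← Real.rpow_natCast]; norm_num
  rw [h0, lintegral_rpow_eq_lintegral_meas_lt_mul _
    (ae_of_all _ fun x => le_min (norm_nonneg _) hl.le)
    (hm.norm.min measurable_const).aemeasurable (by norm_num : (0 : ℝ) < 4)]
  have h1 : ∫⁻ t in Ioi 0, volume {a | t < min ‖f a‖ l} * ENNReal.ofReal (t ^ ((4 : ℝ) - 1)) ≤
      ∫⁻ t in Ioc 0 l, ENNReal.ofReal (M ^ 3) * ENNReal.ofReal (t ^ ((1 : ℝ) - 1)) := by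
    rw [← Ioc_union_Ioi_eq_Ioi hl.le, lintegral_union measurableSet_Ioi
      (Ioc_disjoint_Ioi le_rfl)]
    have h2 : ∫⁻ t in Ioi l, volume {a | t < min ‖f a‖ l} *
        ENNReal.ofReal (t ^ ((4 : ℝ) - 1)) = 0 := by
      rw [setLIntegral_congr_fun (g := fun _ => 0) measurableSet_Ioi, lintegral_zero]
      intro t ht
      have : {a | t < min ‖f a‖ l} = ∅ :=
        eq_empty_of_forall_notMem fun a (ha : t < min ‖f a‖ l) =>
          lt_asymm (lt_min_iff.1 ha).2 (mem_Ioi.1 ht)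
      simp only [this, measure_empty, zero_mul]
    rw [h2, add_zero]
    refine setLIntegral_mono' measurableSet_Ioc fun t ht => ?_
    have h3 : volume {a | t < min ‖f a‖ l} ≤ ENNReal.ofReal ((M / t) ^ 3) :=
      (measure_mono (t := {a | t < ‖f a‖}) fun a (ha : t < min ‖f a‖ l) =>
        (lt_min_iff.1 ha).1).trans (hf t ht.1)
    refine (mul_le_mul_left h3 _).trans ?_
    have := ht.1
    rw [← ENNReal.ofReal_mul (by positivity), ← ENNReal.ofReal_mul (by positivity)]
    refine ENNReal.ofReal_le_ofReal (le_of_eq ?_)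
    have h4 : t ^ ((4 : ℝ) - 1) = t ^ 3 := by
      rw [← Real.rpow_natCast]; norm_num
    rw [h4]; simp; field_simp
  refine (mul_le_mul_right h1 _).trans ?_
  rw [lintegral_const_mul _ (by fun_prop), lintegral_Ioc_rpow one_pos hl.le,
    ← ENNReal.ofReal_mul (by positivity), ← ENNReal.ofReal_mul (by norm_num)]
  simp [mul_assoc]

/-- A weak `L³` field has `∫_E |f|² ≤ C M² |E|^{1/3}`. -/
theorem WeakL3.setLIntegral_sq_le_measure {M : ℝ} {f : E3 → E3} (hf : WeakL3 M f) (hM : 0 < M)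
    (hm : Measurable f) (E : Set E3) :
    ∫⁻ x in E, ENNReal.ofReal (‖f x‖ ^ 2) ≤ ENNReal.ofReal (4 * M ^ 2) * volume E ^ (1 / 3 : ℝ) := by
  rcases eq_or_ne (volume E) ⊤ with hE | hE
  · rw [hE, ENNReal.top_rpow_of_pos (by norm_num), ENNReal.mul_top]
    · exact le_top
    · simp; positivity
  rcases eq_or_ne (volume E) 0 with hE0 | hE0
  · rw [setLIntegral_measure_zero _ _ hE0]; exact zero_le
  obtain ⟨m, hm0, hmE⟩ : ∃ m : ℝ, 0 < m ∧ volume E = ENNReal.ofReal (m ^ 3) := by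
    have hpos : 0 < (volume E).toReal := ENNReal.toReal_pos hE0 hE
    refine ⟨(volume E).toReal ^ (1 / 3 : ℝ), by positivity, ?_⟩
    rw [← Real.rpow_natCast, ← Real.rpow_mul hpos.le]
    norm_num [ENNReal.ofReal_toReal hE]
  -- With `|E| = m³`, splitting at height `M / m` makes both parts a multiple of `M² m`.
  have hl : 0 < M / m := by positivity
  have key : ∀ x, ENNReal.ofReal (‖f x‖ ^ 2) ≤ ENNReal.ofReal ((M / m) ^ 2) +
      {x | M / m < ‖f x‖}.indicator (fun x => ENNReal.ofReal (‖f x‖ ^ 2)) x := by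
    intro x
    by_cases h : M / m < ‖f x‖
    · rw [indicator_of_mem (by exact h)]; exact le_add_self
    · rw [indicator_of_notMem (by exact h), add_zero]
      push Not at h
      gcongr
  refine (lintegral_mono key).trans ?_
  rw [lintegral_add_left measurable_const, setLIntegral_const]
  have h1 : ∫⁻ x in E, {x | M / m < ‖f x‖}.indicator (fun x => ENNReal.ofReal (‖f x‖ ^ 2)) x ≤
      ENNReal.ofReal (3 * M ^ 3 / (M / m)) := by
    refine (setLIntegral_le_lintegral _ _).trans ?_
    rw [lintegral_indicator (measurableSet_lt measurable_const hm.norm)]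
    exact hf.setLIntegral_sq_le hM.le hm hl
  refine (add_le_add le_rfl h1).trans ?_
  rw [hmE, ENNReal.ofReal_rpow_of_nonneg (by positivity) (by norm_num),
    ← Real.rpow_natCast m, ← Real.rpow_mul hm0.le, ← ENNReal.ofReal_mul (by positivity),
    ← ENNReal.ofReal_mul (by positivity), ← ENNReal.ofReal_add (by positivity) (by positivity)]
  refine ENNReal.ofReal_le_ofReal (le_of_eq ?_)
  norm_num
  field_simp
  ring

/-- The pointwise splitting of `|f|²` at height `l`. -/
theorem ofReal_sq_le_min_add (f : E3 → E3) (l : ℝ) (x : E3) :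
    ENNReal.ofReal (‖f x‖ ^ 2) ≤ ENNReal.ofReal (min ‖f x‖ l ^ 2) +
      {x | l < ‖f x‖}.indicator (fun x => ENNReal.ofReal (‖f x‖ ^ 2)) x := by
  by_cases h : l < ‖f x‖
  · rw [indicator_of_mem (by exact h)]; exact le_add_self
  · rw [indicator_of_notMem (by exact h), add_zero, min_eq_left (not_lt.1 h)]

end

section

/-! ### Pairing tempered functions with dilated Schwartz functions -/

/-- The standard basis of `ℝ³`. -/
def e3 (i : Fin 3) : E3 := EuclideanSpace.single i 1

/-- The partial derivative `∂ᵢ` on Schwartz functions. -/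
def dS (i : Fin 3) (g : 𝓢(E3, ℝ)) : 𝓢(E3, ℝ) := LineDeriv.lineDerivOp (e3 i) g

theorem dS_apply (i : Fin 3) (g : 𝓢(E3, ℝ)) (z : E3) : dS i g z = fderiv ℝ g z (e3 i) := rfl

theorem hasTemperateGrowth_coord (i : Fin 3) :
    Function.HasTemperateGrowth (fun z : E3 => z i) :=
  (EuclideanSpace.proj i : E3 →L[ℝ] ℝ).hasTemperateGrowth

/-- The radial derivative `z · ∇` on Schwartz functions. -/
def eulerS (g : 𝓢(E3, ℝ)) : 𝓢(E3, ℝ) :=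
  ∑ i, SchwartzMap.smulLeftCLM ℝ (fun z : E3 => z i) (dS i g)

theorem sum_coord_smul_e3 (z : E3) : ∑ i, z i • e3 i = z := by
  have := (EuclideanSpace.basisFun (Fin 3) ℝ).sum_repr z
  simpa [e3] using this

theorem fderiv_apply_eq_sum (g : 𝓢(E3, ℝ)) (z v : E3) :
    fderiv ℝ g z v = ∑ i, v i * dS i g z := by
  conv_lhs => rw [← sum_coord_smul_e3 v]
  simp [dS_apply]

theorem eulerS_apply (g : 𝓢(E3, ℝ)) (z : E3) : eulerS g z = fderiv ℝ g z z := by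
  rw [fderiv_apply_eq_sum, eulerS, sum_apply]
  refine Finset.sum_congr rfl fun i _ => ?_
  rw [SchwartzMap.smulLeftCLM_apply_apply (hasTemperateGrowth_coord i), smul_eq_mul]

theorem exists_decay (g : 𝓢(E3, ℝ)) (k : ℕ) :
    ∃ C : ℝ, 0 < C ∧ ∀ z, |g z| ≤ C / (1 + ‖z‖) ^ k := by
  refine ⟨2 ^ k * ((Finset.Iic (k, 0)).sup fun m => SchwartzMap.seminorm ℝ m.1 m.2) g + 1, by positivity,
    fun z => ?_⟩
  have h := SchwartzMap.one_add_le_sup_seminorm_apply (𝕜 := ℝ) (m := (k, 0)) le_rfl le_rfl g z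
  rw [norm_iteratedFDeriv_zero] at h
  rw [le_div_iff₀ (by positivity), mul_comm, ← Real.norm_eq_abs]
  linarith

theorem one_add_norm_le_dil {ρ r X : ℝ} (hρ : 0 < ρ) (hr : ρ ≤ r) {x y : E3} (hx : ‖x‖ ≤ X) :
    1 + ‖y‖ ≤ (1 + X) * (1 + ρ⁻¹) * (1 + ‖r • (y - x)‖) := by
  have hX : 0 ≤ X := (norm_nonneg x).trans hx
  have h1 : ‖y‖ ≤ ‖y - x‖ + X := by
    calc ‖y‖ = ‖(y - x) + x‖ := by simp
      _ ≤ _ := (norm_add_le _ _).trans (by linarith)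
  have h2 : ‖y - x‖ ≤ ρ⁻¹ * ‖r • (y - x)‖ := by
    rw [norm_smul, Real.norm_of_nonneg (hρ.le.trans hr), le_inv_mul_iff₀ hρ]
    gcongr
  have hi : 0 < ρ⁻¹ := inv_pos.2 hρ
  have hn := norm_nonneg (r • (y - x))
  set a := ‖r • (y - x)‖
  have : 0 ≤ X * (ρ⁻¹ * a) := by positivity
  have : 0 ≤ X * a := by positivity
  have : 0 ≤ X * ρ⁻¹ := by positivity
  nlinarith

/-- The constant is uniform for `r` bounded below and `x` bounded, as domination requires when
differentiating in `(r, x)`. -/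
theorem exists_dil_decay (g : 𝓢(E3, ℝ)) (k : ℕ) {ρ X : ℝ} (hρ : 0 < ρ) :
    ∃ C : ℝ, 0 < C ∧ ∀ r, ρ ≤ r → ∀ x : E3, ‖x‖ ≤ X → ∀ y,
      |g (r • (y - x))| ≤ C / (1 + ‖y‖) ^ k := by
  rcases lt_or_ge X 0 with hX | hX
  · exact ⟨1, one_pos, fun r _ x hx => absurd ((norm_nonneg x).trans hx) (not_le.2 hX)⟩
  obtain ⟨C, hC, h⟩ := exists_decay g k
  refine ⟨C * ((1 + X) * (1 + ρ⁻¹)) ^ k, by positivity, fun r hr x hx y => (h _).trans ?_⟩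
  rw [div_le_div_iff₀ (by positivity) (by positivity), mul_assoc, ← mul_pow]
  gcongr
  exact one_add_norm_le_dil hρ hr hx

/-- A continuous function which is integrable against `(1 + |y|)⁻⁴`. -/
structure Tempered (w : E3 → ℝ) : Prop where
  cont : Continuous w
  int : Integrable fun y => w y / (1 + ‖y‖) ^ 4

/-- A continuous family of functions with uniform bounds against `(1 + |y|)⁻⁴`. -/
structure UnifTempered (w : ℝ → E3 → ℝ) : Prop where
  cont : Continuous fun z : ℝ × E3 => w z.1 z.2
  bound : ∃ B : ℝ, ∀ t, Integrable (fun y => w t y / (1 + ‖y‖) ^ 4) ∧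
    ∫ y, |w t y| / (1 + ‖y‖) ^ 4 ≤ B

theorem UnifTempered.tempered {w : ℝ → E3 → ℝ} (hw : UnifTempered w) (t : ℝ) :
    Tempered (w t) :=
  ⟨hw.cont.comp (by fun_prop : Continuous fun y : E3 => (t, y)), (hw.bound.choose_spec t).1⟩

/-- The pairing of `w` with the dilated and translated kernel `y ↦ g (r (y - x))`. -/
def dil (g : 𝓢(E3, ℝ)) (w : E3 → ℝ) (r : ℝ) (x : E3) : ℝ := ∫ y, w y * g (r • (y - x))

theorem Tempered.integrable_mul {w : E3 → ℝ} (hw : Tempered w) {f : E3 → ℝ}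
    (hf : AEStronglyMeasurable f) {C : ℝ} (h : ∀ y, |f y| ≤ C / (1 + ‖y‖) ^ 4) :
    Integrable fun y => w y * f y := by
  refine (hw.int.norm.const_mul C).mono (hw.cont.aestronglyMeasurable.mul hf)
    (ae_of_all _ fun y => ?_)
  have := h y
  simp only [norm_mul, norm_div, Real.norm_eq_abs, abs_abs]
  have hp : |(1 + ‖y‖) ^ 4| = (1 + ‖y‖) ^ 4 := abs_of_nonneg (by positivity)
  rw [hp]
  calc |w y| * |f y| ≤ |w y| * (C / (1 + ‖y‖) ^ 4) := by gcongr
    _ = C * (|w y| / (1 + ‖y‖) ^ 4) := by ring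
    _ ≤ |C| * (|w y| / (1 + ‖y‖) ^ 4) := by gcongr; exact le_abs_self C

theorem Tempered.integrable_dil {w : E3 → ℝ} (hw : Tempered w) (g : 𝓢(E3, ℝ)) {r : ℝ}
    (hr : 0 < r) (x : E3) : Integrable fun y => w y * g (r • (y - x)) := by
  obtain ⟨C, _, h⟩ := exists_dil_decay g 4 hr (X := ‖x‖)
  exact hw.integrable_mul (by fun_prop) (h r le_rfl x le_rfl)

theorem Tempered.integrable_schwartz {w : E3 → ℝ} (hw : Tempered w) (g : 𝓢(E3, ℝ)) :
    Integrable fun y => w y * g y := by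
  simpa using hw.integrable_dil g one_pos 0

/-- The derivative of `dil` in `(r, x)`. -/
def dilDeriv (g : 𝓢(E3, ℝ)) (w : E3 → ℝ) (q : ℝ × E3) : ℝ × E3 →L[ℝ] ℝ :=
  (q.1⁻¹ * dil (eulerS g) w q.1 q.2) • ContinuousLinearMap.fst ℝ ℝ E3 -
    ∑ i, (q.1 * dil (dS i g) w q.1 q.2) •
      (EuclideanSpace.proj i : E3 →L[ℝ] ℝ).comp (ContinuousLinearMap.snd ℝ ℝ E3)

/-- All derivatives fall on the kernel: the one in `r` produces the Euler operator `z · ∇`, those in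
`x` the factor `-r`. The result consists of pairings of the same kind, so the argument can be
iterated. -/
theorem Tempered.hasFDerivAt_dil {w : E3 → ℝ} (hw : Tempered w) (g : 𝓢(E3, ℝ)) {q : ℝ × E3}
    (hq : 0 < q.1) :
    HasFDerivAt (fun q : ℝ × E3 => dil g w q.1 q.2) (dilDeriv g w q) q := by
  let A : ℝ × E3 →L[ℝ] ℝ := ContinuousLinearMap.fst ℝ ℝ E3
  let P : Fin 3 → (ℝ × E3 →L[ℝ] ℝ) := fun i =>
    (EuclideanSpace.proj i : E3 →L[ℝ] ℝ).comp (ContinuousLinearMap.snd ℝ ℝ E3)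
  let F' : ℝ × E3 → E3 → (ℝ × E3 →L[ℝ] ℝ) := fun q y =>
    (q.1⁻¹ * (w y * eulerS g (q.1 • (y - q.2)))) • A -
      ∑ i, (q.1 * (w y * dS i g (q.1 • (y - q.2)))) • P i
  have hpt : ∀ y, ∀ q : ℝ × E3, 0 < q.1 →
      HasFDerivAt (fun q : ℝ × E3 => w y * g (q.1 • (y - q.2))) (F' q y) q := by
    intro y q hq
    have h1 : HasFDerivAt (fun q : ℝ × E3 => q.1 • (y - q.2))
        (q.1 • (-ContinuousLinearMap.snd ℝ ℝ E3) + A.smulRight (y - q.2)) q := by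
      have := (hasFDerivAt_fst (𝕜 := ℝ) (p := q)).smul
        ((hasFDerivAt_snd (𝕜 := ℝ) (p := q)).const_sub y)
      exact this
    have h2 := ((g.hasFDerivAt (q.1 • (y - q.2))).comp q h1).const_mul (w y)
    refine h2.congr_fderiv ?_
    ext v
    · simp only [F', A, P, _root_.smul_apply, ContinuousLinearMap.comp_apply,
        _root_.add_apply, _root_.sub_apply, ContinuousLinearMap.inl_apply,
        eulerS_apply, map_smul, map_add]
      simp
      field_simp
    · simp only [F', A, P, _root_.smul_apply, ContinuousLinearMap.comp_apply,
        _root_.add_apply, _root_.sub_apply, ContinuousLinearMap.inr_apply]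
      simp [fderiv_apply_eq_sum, Finset.mul_sum]
      refine Finset.sum_congr rfl fun i _ => by ring
  have hρ : 0 < q.1 / 2 := by linarith
  have hball : ∀ q' ∈ Metric.ball q (min (q.1 / 2) 1), q.1 / 2 ≤ q'.1 ∧ q'.1 ≤ 2 * q.1 ∧
      ‖q'.2‖ ≤ ‖q.2‖ + 1 := by
    intro q' hq'
    rw [Metric.mem_ball, Prod.dist_eq, max_lt_iff, lt_min_iff, lt_min_iff] at hq'
    obtain ⟨⟨h1, _⟩, _, h2⟩ := hq'
    rw [Real.dist_eq, abs_lt] at h1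
    rw [dist_eq_norm] at h2
    refine ⟨by linarith, by linarith, ?_⟩
    calc ‖q'.2‖ = ‖q.2 + (q'.2 - q.2)‖ := by simp
      _ ≤ _ := (norm_add_le _ _).trans (by linarith)
  obtain ⟨C₀, hC₀, hd₀⟩ := exists_dil_decay (eulerS g) 4 hρ (X := ‖q.2‖ + 1)
  choose C hC hd using fun i => exists_dil_decay (dS i g) 4 hρ (X := ‖q.2‖ + 1)
  have hint : ∀ (h : 𝓢(E3, ℝ)), Integrable fun y => w y * h (q.1 • (y - q.2)) :=
    fun h => hw.integrable_dil h hq _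
  have hmeasw : Measurable w := hw.cont.measurable
  have key := hasFDerivAt_integral_of_dominated_of_fderiv_le (𝕜 := ℝ) (μ := volume)
    (F := fun (q : ℝ × E3) y => w y * g (q.1 • (y - q.2))) (F' := F') (x₀ := q)
    (s := Metric.ball q (min (q.1 / 2) 1))
    (bound := fun y => (2 / q.1 * C₀ * ‖A‖ + ∑ i, 2 * q.1 * C i * ‖P i‖) *
      ‖w y / (1 + ‖y‖) ^ 4‖)
    (Metric.ball_mem_nhds _ (by positivity)) ?_ (hint g) ?_ ?_ (hw.int.norm.const_mul _) ?_
  · refine key.congr_fderiv ?_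
    simp only [F']
    rw [integral_sub, integral_finsetSum]
    · simp only [dilDeriv, integral_smul_const, integral_const_mul]
      rfl
    · exact fun i _ => ((hint _).const_mul _).smul_const _
    · exact ((hint _).const_mul _).smul_const _
    · exact integrable_finsetSum _ fun i _ => ((hint _).const_mul _).smul_const _
  · exact Eventually.of_forall fun q' => by
      have := hw.cont
      exact (by fun_prop : Continuous fun y => w y * g (q'.1 • (y - q'.2))).aestronglyMeasurable
  · have := hw.cont
    exact (by simp only [F']; fun_prop : Continuous (F' q)).aestronglyMeasurable
  · refine ae_of_all _ fun y q' hq' => ?_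
    obtain ⟨h1, h2, h3⟩ := hball q' hq'
    have hq'0 : 0 < q'.1 := hρ.trans_le h1
    have hw4 : ‖w y / (1 + ‖y‖) ^ 4‖ = |w y| / (1 + ‖y‖) ^ 4 := by
      rw [norm_div, Real.norm_eq_abs, Real.norm_of_nonneg (by positivity)]
    rw [hw4, add_mul, Finset.sum_mul]
    refine (norm_sub_le _ _).trans (add_le_add ?_ ((norm_sum_le _ _).trans
      (Finset.sum_le_sum fun i _ => ?_)))
    · rw [norm_smul, norm_mul, norm_mul, Real.norm_eq_abs, Real.norm_eq_abs, Real.norm_eq_abs,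
        abs_of_pos (inv_pos.2 hq'0)]
      have h4 : q'.1⁻¹ ≤ 2 / q.1 := by
        rw [← inv_div]; gcongr
      calc q'.1⁻¹ * (|w y| * |eulerS g (q'.1 • (y - q'.2))|) * ‖A‖
          ≤ 2 / q.1 * (|w y| * (C₀ / (1 + ‖y‖) ^ 4)) * ‖A‖ := by
            gcongr
            exact hd₀ _ h1 _ h3 y
        _ = _ := by ring
    · rw [norm_smul, norm_mul, norm_mul, Real.norm_eq_abs, Real.norm_eq_abs, Real.norm_eq_abs,
        abs_of_pos hq'0]
      calc q'.1 * (|w y| * |dS i g (q'.1 • (y - q'.2))|) * ‖P i‖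
          ≤ 2 * q.1 * (|w y| * (C i / (1 + ‖y‖) ^ 4)) * ‖P i‖ := by
            gcongr
            exact hd i _ h1 _ h3 y
        _ = _ := by ring
  · exact ae_of_all _ fun y q' hq' => hpt y q' (hρ.trans_le (hball q' hq').1)

/-- The induction must run over all kernels at once, since differentiating changes the kernel. -/
theorem Tempered.contDiffOn_dil_nat {w : E3 → ℝ} (hw : Tempered w) (n : ℕ) : ∀ g : 𝓢(E3, ℝ),
    ContDiffOn ℝ n (fun q : ℝ × E3 => dil g w q.1 q.2) {q | 0 < q.1} := by
  have ho : IsOpen {q : ℝ × E3 | 0 < q.1} := isOpen_lt continuous_const continuous_fst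
  induction n with
  | zero =>
    intro g
    refine contDiffOn_zero.2 fun q hq => ?_
    exact (hw.hasFDerivAt_dil g hq).continuousAt.continuousWithinAt
  | succ n ih =>
    intro g
    push_cast
    rw [contDiffOn_succ_iff_fderiv_of_isOpen ho]
    refine ⟨fun q hq => (hw.hasFDerivAt_dil g hq).differentiableAt.differentiableWithinAt,
      by simp, ?_⟩
    refine ContDiffOn.congr (f := dilDeriv g w) ?_ fun q hq => (hw.hasFDerivAt_dil g hq).fderiv
    have h1 : ContDiffOn ℝ n (fun q : ℝ × E3 => q.1⁻¹) {q | 0 < q.1} :=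
      contDiff_fst.contDiffOn.inv fun q hq => ne_of_gt hq
    refine ContDiffOn.sub ((h1.mul (ih _)).smul contDiffOn_const)
      (ContDiffOn.sum fun i _ => (contDiff_fst.contDiffOn.mul (ih _)).smul contDiffOn_const)

theorem Tempered.contDiffOn_dil {w : E3 → ℝ} (hw : Tempered w) (g : 𝓢(E3, ℝ)) :
    ContDiffOn ℝ ∞ (fun q : ℝ × E3 => dil g w q.1 q.2) {q | 0 < q.1} :=
  contDiffOn_infty.2 fun n => hw.contDiffOn_dil_nat n g

theorem Tempered.contDiff_dil {w : E3 → ℝ} (hw : Tempered w) (g : 𝓢(E3, ℝ)) {r : ℝ}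
    (hr : 0 < r) : ContDiff ℝ ∞ (dil g w r) := by
  rw [← contDiffOn_univ]
  exact (hw.contDiffOn_dil g).comp (f := fun x => (r, x)) (by fun_prop) fun x _ => hr

theorem Tempered.fderiv_dil {w : E3 → ℝ} (hw : Tempered w) (g : 𝓢(E3, ℝ)) {r : ℝ}
    (hr : 0 < r) (x : E3) (i : Fin 3) :
    fderiv ℝ (dil g w r) x (e3 i) = -(r * dil (dS i g) w r x) := by
  have h := (hw.hasFDerivAt_dil g (q := (r, x)) hr).comp x
    (f := fun x => (r, x)) ((hasFDerivAt_const r x).prodMk (hasFDerivAt_id x))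
  have h2 : HasFDerivAt (dil g w r) _ x := h
  rw [h2.fderiv]
  simp only [dilDeriv, e3]
  fin_cases i <;> simp [Fin.sum_univ_three]

theorem Tempered.hasDerivAt_dil_left {w : E3 → ℝ} (hw : Tempered w) (g : 𝓢(E3, ℝ)) {r : ℝ}
    (hr : 0 < r) (x : E3) :
    HasDerivAt (fun r => dil g w r x) (r⁻¹ * dil (eulerS g) w r x) r := by
  have h := (hw.hasFDerivAt_dil g (q := (r, x)) hr).comp_hasDerivAt r
    (f := fun r => (r, x)) ((hasDerivAt_id r).prodMk (hasDerivAt_const r x))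
  refine h.congr_deriv ?_
  simp [dilDeriv]

/-- Only the integrals of `|w t|` against the weight are bounded, so no dominating function uniform
in `t` is at hand. Instead the pairing is a locally uniform limit of integrals over balls, which are
continuous. -/
theorem UnifTempered.continuousOn_dil {w : ℝ → E3 → ℝ} (hw : UnifTempered w) (g : 𝓢(E3, ℝ)) :
    ContinuousOn (fun q : ℝ × ℝ × E3 => dil g (w q.1) q.2.1 q.2.2) {q | 0 < q.2.1} := by
  obtain ⟨B, hB⟩ := hw.bound
  have hlim : TendstoLocallyUniformlyOn
      (fun (n : ℕ) (q : ℝ × ℝ × E3) =>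
        ∫ y in Metric.closedBall (0 : E3) n, w q.1 y * g (q.2.1 • (y - q.2.2)))
      (fun q => dil g (w q.1) q.2.1 q.2.2) atTop {q | 0 < q.2.1} := by
    rw [Metric.tendstoLocallyUniformlyOn_iff]
    intro ε hε q₀ hq₀
    have hρ : 0 < q₀.2.1 / 2 := by have : 0 < q₀.2.1 := hq₀; linarith
    -- One power beyond the weight: it makes the tail outside the ball of radius `n` of order `1 /
    -- (n + 1)`.
    obtain ⟨C, hC, hd⟩ := exists_dil_decay g 5 hρ (X := ‖q₀.2.2‖ + 1)
    have ho : IsOpen {q : ℝ × ℝ × E3 | q₀.2.1 / 2 < q.2.1 ∧ ‖q.2.2‖ < ‖q₀.2.2‖ + 1} :=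
      (isOpen_lt (by fun_prop) (by fun_prop)).and (isOpen_lt (by fun_prop) (by fun_prop))
    refine ⟨{q | q₀.2.1 / 2 < q.2.1 ∧ ‖q.2.2‖ < ‖q₀.2.2‖ + 1},
      mem_nhdsWithin_of_mem_nhds (ho.mem_nhds ⟨?_, ?_⟩), ?_⟩
    · linarith
    · linarith
    · have h0 : Tendsto (fun n : ℕ => C * |B| * (1 / ((n : ℝ) + 1))) atTop (𝓝 0) := by
        simpa using (tendsto_one_div_add_atTop_nhds_zero_nat (𝕜 := ℝ)).const_mul (C * |B|)
      filter_upwards [h0.eventually (gt_mem_nhds hε)] with n hn q hq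
      have hq0 : 0 < q.2.1 := hρ.trans hq.1
      have hint := (hw.tempered q.1).integrable_dil g hq0 q.2.2
      refine lt_of_le_of_lt ?_ hn
      rw [Real.dist_eq, dil, ← integral_add_compl Metric.isClosed_closedBall.measurableSet hint,
        add_sub_cancel_left]
      have hb : ∀ y ∈ (Metric.closedBall (0 : E3) n)ᶜ, ‖w q.1 y * g (q.2.1 • (y - q.2.2))‖ ≤
          C * (1 / ((n : ℝ) + 1)) * (|w q.1 y| / (1 + ‖y‖) ^ 4) := by
        intro y hy
        have hy' : (n : ℝ) < ‖y‖ := by simpa using hy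
        have h5 := hd _ hq.1.le _ hq.2.le y
        rw [norm_mul, Real.norm_eq_abs, Real.norm_eq_abs]
        have hnn : (0 : ℝ) < n + 1 := by positivity
        calc |w q.1 y| * |g (q.2.1 • (y - q.2.2))| ≤ |w q.1 y| * (C / (1 + ‖y‖) ^ 5) := by gcongr
          _ = C * (1 / (1 + ‖y‖)) * (|w q.1 y| / (1 + ‖y‖) ^ 4) := by field_simp
          _ ≤ _ := by
            gcongr C * ?_ * _
            exact one_div_le_one_div_of_le hnn (by linarith)
      have hI : Integrable fun y => |w q.1 y| / (1 + ‖y‖) ^ 4 := by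
        refine (hB q.1).1.norm.congr (ae_of_all _ fun y => ?_)
        simp only [norm_div, Real.norm_eq_abs]
        rw [abs_of_nonneg (by positivity : (0 : ℝ) ≤ (1 + ‖y‖) ^ 4)]
      rw [← Real.norm_eq_abs]
      have hm := Metric.isClosed_closedBall (x := (0 : E3)) (ε := n) |>.measurableSet.compl
      refine (norm_integral_le_of_norm_le (hI.const_mul _).integrableOn
        ((ae_restrict_mem hm).mono hb)).trans ?_
      rw [integral_const_mul]
      calc C * (1 / ((n : ℝ) + 1)) * ∫ y in (Metric.closedBall (0 : E3) n)ᶜ,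
            |w q.1 y| / (1 + ‖y‖) ^ 4 ≤ C * (1 / ((n : ℝ) + 1)) * |B| := by
            gcongr
            exact ((setIntegral_le_integral hI (ae_of_all _ fun y => by positivity)).trans
              (hB q.1).2).trans (le_abs_self B)
        _ = _ := by ring
  refine hlim.continuousOn (Frequently.of_forall fun n => Continuous.continuousOn ?_)
  refine continuous_parametric_integral_of_continuous ?_ (isCompact_closedBall _ _)
  have := hw.cont
  fun_prop

end

section

/-! ### Calculus for the Navier-Stokes equations -/

theorem two_le_infty : (2 : ℕ∞ω) ≤ ((⊤ : ℕ∞) : ℕ∞ω) :=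
  WithTop.coe_le_coe.2 (le_top : (2 : ℕ∞) ≤ ⊤)

theorem one_le_infty : (1 : ℕ∞ω) ≤ ((⊤ : ℕ∞) : ℕ∞ω) :=
  WithTop.coe_le_coe.2 (le_top : (1 : ℕ∞) ≤ ⊤)

/-- The partial derivative `∂ᵢ f`. -/
def pd (i : Fin 3) (f : E3 → ℝ) (x : E3) : ℝ := fderiv ℝ f x (e3 i)

theorem pd_schwartz (i : Fin 3) (g : 𝓢(E3, ℝ)) : pd i g = dS i g := rfl

theorem contDiff_pd {n m : ℕ∞ω} {f : E3 → ℝ} (hf : ContDiff ℝ n f) (h : m + 1 ≤ n) (i : Fin 3) :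
    ContDiff ℝ m (pd i f) :=
  (hf.fderiv_right h).clm_apply contDiff_const

theorem pd_mul {f g : E3 → ℝ} (hf : ContDiff ℝ 1 f) (hg : ContDiff ℝ 1 g) (i : Fin 3) (x : E3) :
    pd i (fun y => f y * g y) x = pd i f x * g x + f x * pd i g x := by
  have h1 := (hf.differentiable one_ne_zero x)
  have h2 := (hg.differentiable one_ne_zero x)
  rw [pd, fderiv_fun_mul h1 h2]
  simp [pd]
  ring

theorem hasCompactSupport_pd {f : E3 → ℝ} (hf : HasCompactSupport f) (i : Fin 3) :
    HasCompactSupport (pd i f) := hf.fderiv_apply ℝ (e3 i)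

theorem integral_pd_mul {f g : E3 → ℝ} (hf : ContDiff ℝ 1 f) (hg : ContDiff ℝ 1 g)
    (hs : HasCompactSupport g) (i : Fin 3) :
    ∫ x, pd i f x * g x = -∫ x, f x * pd i g x := by
  have hc : ∀ {a b : E3 → ℝ}, Continuous a → Continuous b → HasCompactSupport b →
      Integrable fun x => a x * b x := fun ha hb hbs =>
    (ha.mul hb).integrable_of_hasCompactSupport hbs.mul_left
  rw [eq_comm, neg_eq_iff_eq_neg]
  exact integral_mul_fderiv_eq_neg_fderiv_mul_of_integrable
    (hc (contDiff_pd hf (m := 0) (by norm_num) i).continuous hg.continuous hs)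
    (hc hf.continuous (contDiff_pd hg (m := 0) (by norm_num) i).continuous
      (hasCompactSupport_pd hs i)) (hc hf.continuous hg.continuous hs)
    (fun x _ => hf.differentiable one_ne_zero x) (fun x _ => hg.differentiable one_ne_zero x)

theorem pd_comm {f : E3 → ℝ} (hf : ContDiff ℝ 2 f) (i j : Fin 3) (x : E3) :
    pd i (pd j f) x = pd j (pd i f) x := by
  have hd : DifferentiableAt ℝ (fderiv ℝ f) x :=
    (hf.fderiv_right (m := 1) (by norm_num)).differentiable one_ne_zero x
  have h : ∀ a b : Fin 3, pd a (pd b f) x = fderiv ℝ (fderiv ℝ f) x (e3 a) (e3 b) := by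
    intro a b
    have : pd b f = fun y => fderiv ℝ f y (e3 b) := rfl
    rw [pd, this, fderiv_clm_apply hd (differentiableAt_const _)]
    simp
  rw [h, h]
  exact (hf.contDiffAt.isSymmSndFDerivAt (by simp)) _ _

theorem dS_comm (i j : Fin 3) (g : 𝓢(E3, ℝ)) : dS i (dS j g) = dS j (dS i g) := by
  ext x
  exact pd_comm (g.smooth 2) i j x

/-- The Laplacian on Schwartz functions. -/
def lapS (g : 𝓢(E3, ℝ)) : 𝓢(E3, ℝ) := ∑ i, dS i (dS i g)

theorem dS_sum {ι : Type*} (s : Finset ι) (i : Fin 3) (g : ι → 𝓢(E3, ℝ)) :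
    dS i (∑ j ∈ s, g j) = ∑ j ∈ s, dS i (g j) :=
  map_sum (LineDeriv.lineDerivOpCLM ℝ 𝓢(E3, ℝ) (e3 i)) g s

theorem dS_smul (i : Fin 3) (c : ℝ) (g : 𝓢(E3, ℝ)) : dS i (c • g) = c • dS i g :=
  map_smul (LineDeriv.lineDerivOpCLM ℝ 𝓢(E3, ℝ) (e3 i)) c g

theorem continuous_dS (i : Fin 3) : Continuous (dS i) :=
  (LineDeriv.lineDerivOpCLM ℝ 𝓢(E3, ℝ) (e3 i)).continuous

theorem continuous_lapS : Continuous lapS :=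
  continuous_finsetSum _ fun i _ => (continuous_dS i).comp (continuous_dS i)

theorem dS_lapS (i : Fin 3) (g : 𝓢(E3, ℝ)) : dS i (lapS g) = lapS (dS i g) := by
  simp only [lapS, dS_sum]
  exact Finset.sum_congr rfl fun j _ => by rw [dS_comm, dS_comm i j]

theorem hasCompactSupport_dS {g : 𝓢(E3, ℝ)} (hg : HasCompactSupport g) (i : Fin 3) :
    HasCompactSupport (dS i g) := hasCompactSupport_pd hg i

/-- Differentiation under the integral sign for compactly supported integrands. -/
theorem hasDerivAt_integral_of_compact {a b : ℝ} {F F' : ℝ → E3 → ℝ} {K : Set E3}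
    (hK : IsCompact K)
    (hF : ContinuousOn (fun z : ℝ × E3 => F z.1 z.2) (Ioo a b ×ˢ univ))
    (hF' : ContinuousOn (fun z : ℝ × E3 => F' z.1 z.2) (Ioo a b ×ˢ univ))
    (hFK : ∀ t ∈ Ioo a b, ∀ y ∉ K, F t y = 0) (hFK' : ∀ t ∈ Ioo a b, ∀ y ∉ K, F' t y = 0)
    (hd : ∀ t ∈ Ioo a b, ∀ y, HasDerivAt (fun s => F s y) (F' t y) t) {t : ℝ}
    (ht : t ∈ Ioo a b) :
    HasDerivAt (fun t => ∫ y, F t y) (∫ y, F' t y) t := by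
  obtain ⟨ε, hε, hball⟩ := Metric.isOpen_iff.1 isOpen_Ioo t ht
  have hsub : Metric.closedBall t (ε / 2) ⊆ Ioo a b :=
    (Metric.closedBall_subset_ball (by linarith)).trans hball
  have hcont : ∀ {G : ℝ → E3 → ℝ}, ContinuousOn (fun z : ℝ × E3 => G z.1 z.2) (Ioo a b ×ˢ univ) →
      ∀ s ∈ Ioo a b, Continuous (G s) := fun hG s hs => by
    rw [← continuousOn_univ]
    exact hG.comp (f := fun y => (s, y)) (by fun_prop) fun y _ => ⟨hs, mem_univ _⟩
  have hcs : ∀ {f : E3 → ℝ}, (∀ y ∉ K, f y = 0) → HasCompactSupport f := fun h =>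
    HasCompactSupport.intro hK h
  obtain ⟨C, hC⟩ := ((isCompact_closedBall t (ε / 2)).prod hK).exists_bound_of_continuousOn
    (hF'.mono (prod_mono hsub (subset_univ K)))
  refine (hasDerivAt_integral_of_dominated_loc_of_deriv_le (s := Metric.closedBall t (ε / 2))
    (bound := K.indicator fun _ => C) (Metric.closedBall_mem_nhds _ (by linarith)) ?_ ?_ ?_ ?_ ?_
    ?_).2
  · filter_upwards [Ioo_mem_nhds ht.1 ht.2] with s hs
    exact (hcont hF s hs).aestronglyMeasurable
  · exact (hcont hF t ht).integrable_of_hasCompactSupport (hcs (hFK t ht))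
  · exact (hcont hF' t ht).aestronglyMeasurable
  · refine ae_of_all _ fun y s hs => ?_
    by_cases hy : y ∈ K
    · rw [indicator_of_mem hy]; exact hC (s, y) ⟨hs, hy⟩
    · rw [indicator_of_notMem hy, hFK' s (hsub hs) y hy, norm_zero]
  · exact (integrable_indicator_iff hK.measurableSet).2
      (integrableOn_const hK.measure_lt_top.ne)
  · exact ae_of_all _ fun y s hs => hd s (hsub hs) y

/-- A classical solution, extended to a continuous function of space-time, which is
bounded in weak `L³` uniformly in time. -/
structure NSFlow (a b M : ℝ) (u : ℝ → E3 → E3) (p : ℝ → E3 → ℝ) : Prop where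
  lt : a < b
  one_le : 1 ≤ M
  sol : IsClassicalSolution a b u p
  cont : Continuous fun z : ℝ × E3 => u z.1 z.2
  weak : ∀ t, WeakL3 M (u t)

theorem integrable_one_add_norm_pow_inv {k : ℕ} (hk : 4 ≤ k) :
    Integrable fun y : E3 => 1 / (1 + ‖y‖) ^ k := by
  have h := integrable_one_add_norm (E := E3) (μ := volume) (r := k)
    (by simp; exact_mod_cast hk)
  refine h.congr (ae_of_all _ fun y => ?_)
  simp only [one_div]
  rw [Real.rpow_neg (by positivity), Real.rpow_natCast]

/-- Where `|u| ≤ 1` the weight `(1 + |y|)⁻⁴` is integrable in dimension three; where `|u| > 1` the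
weak bound makes `|u|²` itself integrable. -/
theorem UnifTempered.of_weakL3 {M : ℝ} (hM : 0 ≤ M) {u : ℝ → E3 → E3}
    (hc : Continuous fun z : ℝ × E3 => u z.1 z.2) (hu : ∀ t, WeakL3 M (u t)) {w : ℝ → E3 → ℝ}
    (hw : Continuous fun z : ℝ × E3 => w z.1 z.2) (h : ∀ t y, |w t y| ≤ 1 + ‖u t y‖ ^ 2) :
    UnifTempered w := by
  have hI := integrable_one_add_norm_pow_inv (k := 4) le_rfl
  have hbd : ∀ t, ∫⁻ y, ENNReal.ofReal (|w t y| / (1 + ‖y‖) ^ 4) ≤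
      ENNReal.ofReal (2 * ∫ y : E3, 1 / (1 + ‖y‖) ^ 4) + ENNReal.ofReal (3 * M ^ 3) := by
    intro t
    have hm : Measurable (u t) := (hc.comp (by fun_prop : Continuous fun y : E3 => (t, y))).measurable
    have hpt : ∀ y, ENNReal.ofReal (|w t y| / (1 + ‖y‖) ^ 4) ≤
        ENNReal.ofReal (2 * (1 / (1 + ‖y‖) ^ 4)) +
        {y | 1 < ‖u t y‖}.indicator (fun y => ENNReal.ofReal (‖u t y‖ ^ 2)) y := by
      intro y
      have h1 : 1 ≤ (1 + ‖y‖) ^ 4 := one_le_pow₀ (by linarith [norm_nonneg y])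
      have h2 := h t y
      by_cases hy : 1 < ‖u t y‖
      · rw [indicator_of_mem (by exact hy), ← ENNReal.ofReal_add (by positivity) (by positivity)]
        refine ENNReal.ofReal_le_ofReal ?_
        calc |w t y| / (1 + ‖y‖) ^ 4 ≤ (1 + ‖u t y‖ ^ 2) / (1 + ‖y‖) ^ 4 := by gcongr
          _ = 1 / (1 + ‖y‖) ^ 4 + ‖u t y‖ ^ 2 / (1 + ‖y‖) ^ 4 := by ring
          _ ≤ 2 * (1 / (1 + ‖y‖) ^ 4) + ‖u t y‖ ^ 2 := by
            have h3 : ‖u t y‖ ^ 2 / (1 + ‖y‖) ^ 4 ≤ ‖u t y‖ ^ 2 := div_le_self (by positivity) h1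
            have h4 : 0 ≤ 1 / (1 + ‖y‖) ^ 4 := by positivity
            linarith
      · rw [indicator_of_notMem (by exact hy), add_zero]
        refine ENNReal.ofReal_le_ofReal ?_
        have h3 : ‖u t y‖ ^ 2 ≤ 1 := pow_le_one₀ (norm_nonneg _) (not_lt.1 hy)
        rw [← mul_div_assoc, mul_one]
        gcongr
        linarith
    refine (lintegral_mono hpt).trans ?_
    rw [lintegral_add_left (by fun_prop), lintegral_indicator
      (measurableSet_lt measurable_const hm.norm),
      ← ofReal_integral_eq_lintegral_ofReal (hI.const_mul 2) (ae_of_all _ fun y => by positivity),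
      integral_const_mul]
    gcongr
    simpa using (hu t).setLIntegral_sq_le hM hm one_pos
  refine ⟨hw, (2 * ∫ y : E3, 1 / (1 + ‖y‖) ^ 4) + 3 * M ^ 3, fun t => ?_⟩
  have hwt : Continuous (w t) := hw.comp (by fun_prop : Continuous fun y : E3 => (t, y))
  have hpos : ∀ y : E3, 1 + ‖y‖ ≠ 0 := fun y => by positivity
  have hcd : Continuous fun y : E3 => |w t y| / (1 + ‖y‖) ^ 4 :=
    hwt.abs.div (by fun_prop) fun y => pow_ne_zero _ (hpos y)
  have hcd' : Continuous fun y : E3 => w t y / (1 + ‖y‖) ^ 4 :=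
    hwt.div (by fun_prop) fun y => pow_ne_zero _ (hpos y)
  have hnn : 0 ≤ ∫ y : E3, 1 / (1 + ‖y‖) ^ 4 := integral_nonneg fun y => by positivity
  have hint : Integrable fun y => |w t y| / (1 + ‖y‖) ^ 4 :=
    ⟨hcd.aestronglyMeasurable, (hasFiniteIntegral_iff_ofReal
      (ae_of_all _ fun y => by positivity)).2 ((hbd t).trans_lt
      (ENNReal.add_lt_top.2 ⟨ENNReal.ofReal_lt_top, ENNReal.ofReal_lt_top⟩))⟩
  refine ⟨hint.mono hcd'.aestronglyMeasurable (ae_of_all _ fun y => ?_), ?_⟩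
  · simp only [norm_div, Real.norm_eq_abs, abs_abs]; rfl
  · rw [← ENNReal.ofReal_le_ofReal_iff (by positivity), ofReal_integral_eq_lintegral_ofReal hint
      (ae_of_all _ fun y => by positivity), ENNReal.ofReal_add (by positivity) (by positivity)]
    exact hbd t

theorem abs_coord_le (v : E3) (i : Fin 3) : |v i| ≤ ‖v‖ := by
  simpa using PiLp.norm_apply_le v i

variable {a b M : ℝ} {u : ℝ → E3 → E3} {p : ℝ → E3 → ℝ}

namespace NSFlow

theorem M_pos (h : NSFlow a b M u p) : 0 < M := one_pos.trans_le h.one_le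

theorem cont_comp (h : NSFlow a b M u p) (j : Fin 3) : Continuous fun z : ℝ × E3 => u z.1 z.2 j :=
  (EuclideanSpace.proj j : E3 →L[ℝ] ℝ).continuous.comp h.cont

theorem cont_slice (h : NSFlow a b M u p) (t : ℝ) : Continuous (u t) :=
  h.cont.comp (by fun_prop : Continuous fun y : E3 => (t, y))

theorem tempered_comp (h : NSFlow a b M u p) (j : Fin 3) : UnifTempered fun t y => u t y j :=
  .of_weakL3 h.M_pos.le h.cont h.weak (h.cont_comp j) fun t y => by
    have := abs_coord_le (u t y) j
    nlinarith [norm_nonneg (u t y), sq_nonneg (‖u t y‖ - 1)]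

theorem tempered_prod (h : NSFlow a b M u p) (i j : Fin 3) :
    UnifTempered fun t y => u t y i * u t y j :=
  .of_weakL3 h.M_pos.le h.cont h.weak ((h.cont_comp i).mul (h.cont_comp j)) fun t y => by
    rw [abs_mul]
    have h1 := mul_le_mul (abs_coord_le (u t y) i) (abs_coord_le (u t y) j) (abs_nonneg _)
      (norm_nonneg _)
    nlinarith

theorem contDiff_slice (h : NSFlow a b M u p) {t : ℝ} (ht : t ∈ Icc a b) :
    ContDiff ℝ ∞ (u t) := by
  rw [← contDiffOn_univ]
  exact h.sol.smooth_u.comp (f := fun y => (t, y)) (by fun_prop) fun y _ => ⟨ht, mem_univ _⟩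

theorem contDiff_p (h : NSFlow a b M u p) {t : ℝ} (ht : t ∈ Icc a b) : ContDiff ℝ ∞ (p t) := by
  rw [← contDiffOn_univ]
  exact h.sol.smooth_p.comp (f := fun y => (t, y)) (by fun_prop) fun y _ => ⟨ht, mem_univ _⟩

theorem contDiff_comp (h : NSFlow a b M u p) {t : ℝ} (ht : t ∈ Icc a b) (j : Fin 3) :
    ContDiff ℝ ∞ (fun y => u t y j) :=
  (EuclideanSpace.proj j : E3 →L[ℝ] ℝ).contDiff.comp (h.contDiff_slice ht)

theorem contDiffOn_comp (h : NSFlow a b M u p) (j : Fin 3) :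
    ContDiffOn ℝ ∞ (fun z : ℝ × E3 => u z.1 z.2 j) (Ioo a b ×ˢ univ) :=
  (EuclideanSpace.proj j : E3 →L[ℝ] ℝ).contDiff.comp_contDiffOn
    (h.sol.smooth_u.mono (prod_mono Ioo_subset_Icc_self le_rfl))

/-- The time derivative of the `j`-th component. -/
def dt (u : ℝ → E3 → E3) (j : Fin 3) (t : ℝ) (y : E3) : ℝ :=
  fderiv ℝ (fun z : ℝ × E3 => u z.1 z.2 j) (t, y) (1, 0)

theorem isOpen_slab : IsOpen (Ioo a b ×ˢ (univ : Set E3)) := isOpen_Ioo.prod isOpen_univ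

theorem hasDerivAt_comp (h : NSFlow a b M u p) (j : Fin 3) {t : ℝ} (ht : t ∈ Ioo a b) (y : E3) :
    HasDerivAt (fun s => u s y j) (dt u j t y) t := by
  have h1 : HasFDerivAt (fun z : ℝ × E3 => u z.1 z.2 j) _ (t, y) :=
    (((h.contDiffOn_comp j).contDiffAt (isOpen_slab.mem_nhds ⟨ht, mem_univ _⟩)).differentiableAt
      (by simp)).hasFDerivAt
  exact h1.comp_hasDerivAt t (f := fun s => (s, y)) ((hasDerivAt_id t).prodMk (hasDerivAt_const t y))

theorem continuousOn_dt (h : NSFlow a b M u p) (j : Fin 3) :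
    ContinuousOn (fun z : ℝ × E3 => dt u j z.1 z.2) (Ioo a b ×ˢ univ) :=
  ((h.contDiffOn_comp j).continuousOn_fderiv_of_isOpen isOpen_slab (by simp)).clm_apply
    continuousOn_const

theorem pderiv_eq (h : NSFlow a b M u p) {t : ℝ} (ht : t ∈ Icc a b) (i j : Fin 3) (x : E3) :
    pderiv i j (u t) x = pd i (fun y => u t y j) x := by
  have h1 : HasFDerivAt (fun y => u t y j) _ x :=
    (EuclideanSpace.proj j : E3 →L[ℝ] ℝ).hasFDerivAt.comp x
      ((h.contDiff_slice ht).differentiable (by simp) x).hasFDerivAt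
  rw [pd, h1.fderiv]
  rfl

theorem sum_pd_eq_zero (h : NSFlow a b M u p) {t : ℝ} (ht : t ∈ Icc a b) (x : E3) :
    ∑ i, pd i (fun y => u t y i) x = 0 := by
  have := h.sol.incompressible t ht x
  rw [divergence] at this
  rw [← this]
  exact Finset.sum_congr rfl fun i _ => (h.pderiv_eq ht i i x).symm

theorem laplacian_comp (h : NSFlow a b M u p) {t : ℝ} (ht : t ∈ Icc a b) (j : Fin 3) (x : E3) :
    (Δ (u t) x) j = ∑ i, pd i (pd i (fun y => u t y j)) x := by
  have hs : ContDiff ℝ 2 (u t) := (h.contDiff_slice ht).of_le two_le_infty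
  have h1 := hs.contDiffAt (x := x) |>.laplacian_CLM_comp_left
    (l := (EuclideanSpace.proj j : E3 →L[ℝ] ℝ))
  have h2 : (Δ (u t) x) j = Δ (fun y => u t y j) x := h1.symm
  rw [h2, InnerProductSpace.laplacian_eq_iteratedFDeriv_orthonormalBasis _
    (EuclideanSpace.basisFun (Fin 3) ℝ)]
  refine Finset.sum_congr rfl fun i _ => ?_
  have hsj : ContDiff ℝ 2 (fun y => u t y j) := (h.contDiff_comp ht j).of_le two_le_infty
  have hd : DifferentiableAt ℝ (fderiv ℝ fun y => u t y j) x :=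
    (hsj.fderiv_right (m := 1) (by norm_num)).differentiable one_ne_zero x
  rw [iteratedFDeriv_two_apply]
  have : pd i (fun y => u t y j) = fun y => fderiv ℝ (fun y => u t y j) y (e3 i) := rfl
  rw [pd, this, fderiv_clm_apply hd (differentiableAt_const _)]
  simp [e3]

theorem momentum_comp (h : NSFlow a b M u p) {t : ℝ} (ht : t ∈ Ioo a b) (j : Fin 3) (x : E3) :
    dt u j t x = ∑ i, pd i (pd i (fun y => u t y j)) x
      - ∑ i, u t x i * pd i (fun y => u t y j) x - pd j (p t) x := by
  have ht' := Ioo_subset_Icc_self ht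
  have hm := h.sol.momentum t ht' x
  have h1 := congrArg (fun v : E3 => v j) hm
  simp only [PiLp.add_apply, PiLp.sub_apply, PiLp.zero_apply] at h1
  have h2 : (derivWithin (fun s => u s x) (Icc a b) t) j = dt u j t x := by
    rw [derivWithin_of_mem_nhds (Icc_mem_nhds ht.1 ht.2)]
    have h3 : DifferentiableAt ℝ (fun s => u s x) t :=
      ((h.sol.smooth_u.contDiffAt (prod_mem_nhds (Icc_mem_nhds ht.1 ht.2) univ_mem)).differentiableAt
        (x := (t, x)) (by simp)).comp t (f := fun s => (s, x)) (by fun_prop)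
    exact ((EuclideanSpace.proj j : E3 →L[ℝ] ℝ).hasFDerivAt.comp_hasDerivAt t
      h3.hasDerivAt).unique (h.hasDerivAt_comp j ht x)
  have h4 : (fderiv ℝ (u t) x (u t x)) j = ∑ i, u t x i * pd i (fun y => u t y j) x := by
    have h5 : HasFDerivAt (fun y => u t y j) _ x :=
      (EuclideanSpace.proj j : E3 →L[ℝ] ℝ).hasFDerivAt.comp x
        ((h.contDiff_slice ht').differentiable (by simp) x).hasFDerivAt
    simp only [pd, h5.fderiv]
    conv_lhs => rw [← sum_coord_smul_e3 (u t x)]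
    simp
  have h6 : (gradient (p t) x) j = pd j (p t) x := by
    have h7 : HasGradientAt (p t) _ x :=
      ((h.contDiff_p ht').differentiable (by simp) x).hasGradientAt
    rw [pd, h7.hasFDerivAt.fderiv, InnerProductSpace.toDual_apply_apply, e3,
      EuclideanSpace.inner_single_right]
    simp only [conj_trivial, one_mul]
  rw [h2, h.laplacian_comp ht', h4, h6] at h1
  linarith

end NSFlow

end

section

/-! ### Weak formulation without pressure -/

/-- The `L²` pairing. -/
def pair (w g : E3 → ℝ) : ℝ := ∫ y, w y * g y

/-- A continuous norm on Schwartz functions that controls `(1 + |y|)⁴ |g|`. -/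
def decayNorm (g : 𝓢(E3, ℝ)) : ℝ :=
  8 * (SchwartzMap.seminorm ℝ 0 0 g + SchwartzMap.seminorm ℝ 4 0 g)

theorem continuous_decayNorm : Continuous decayNorm := by
  have h : ∀ k n : ℕ, Continuous (SchwartzMap.seminorm ℝ k n : 𝓢(E3, ℝ) → ℝ) := fun k n =>
    (schwartz_withSeminorms ℝ E3 ℝ).continuous_seminorm (k, n)
  exact continuous_const.mul ((h 0 0).add (h 4 0))

theorem abs_le_decayNorm (g : 𝓢(E3, ℝ)) (y : E3) : |g y| ≤ decayNorm g / (1 + ‖y‖) ^ 4 := by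
  have h0 := SchwartzMap.norm_le_seminorm ℝ g y
  have h4 := SchwartzMap.norm_pow_mul_le_seminorm ℝ g 4 y
  rw [Real.norm_eq_abs] at h0 h4
  rw [le_div_iff₀ (by positivity), decayNorm]
  have h := add_pow_le zero_le_one (norm_nonneg y) 4
  norm_num at h
  nlinarith [mul_le_mul_of_nonneg_left h (abs_nonneg (g y))]

/-- Continuity in the test function, uniformly in time. This carries identities from compactly
supported to all Schwartz functions, also under time integrals. -/
theorem UnifTempered.exists_abs_pair_le {w : ℝ → E3 → ℝ} (hw : UnifTempered w) :
    ∃ B, 0 ≤ B ∧ ∀ t, ∀ g : 𝓢(E3, ℝ), |pair (w t) g| ≤ B * decayNorm g := by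
  obtain ⟨B, hB⟩ := hw.bound
  refine ⟨B, (integral_nonneg fun y => by positivity).trans (hB 0).2, fun t g => ?_⟩
  have hI : Integrable fun y => |w t y| / (1 + ‖y‖) ^ 4 := by
    refine (hB t).1.norm.congr (ae_of_all _ fun y => ?_)
    simp only [norm_div, Real.norm_eq_abs]
    rw [abs_of_nonneg (by positivity : (0 : ℝ) ≤ (1 + ‖y‖) ^ 4)]
  have hg0 : 0 ≤ decayNorm g := by
    have := abs_le_decayNorm g 0
    simp only [norm_zero, add_zero, one_pow, div_one] at this
    exact (abs_nonneg _).trans this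
  rw [← Real.norm_eq_abs]
  refine (norm_integral_le_of_norm_le (hI.const_mul (decayNorm g)) (ae_of_all _ fun y => ?_)).trans ?_
  · rw [norm_mul, Real.norm_eq_abs, Real.norm_eq_abs]
    calc |w t y| * |g y| ≤ |w t y| * (decayNorm g / (1 + ‖y‖) ^ 4) := by
          gcongr; exact abs_le_decayNorm g y
      _ = _ := by ring
  · rw [integral_const_mul, mul_comm]
    exact mul_le_mul_of_nonneg_right (hB t).2 hg0

theorem Tempered.pair_sub {w : E3 → ℝ} (hw : Tempered w) (f g : 𝓢(E3, ℝ)) :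
    pair w (f - g : 𝓢(E3, ℝ)) = pair w f - pair w g := by
  rw [pair, pair, pair, ← integral_sub (hw.integrable_schwartz f) (hw.integrable_schwartz g)]
  exact integral_congr_ae (ae_of_all _ fun y => by simp [mul_sub])

theorem Tempered.pair_add {w : E3 → ℝ} (hw : Tempered w) (f g : 𝓢(E3, ℝ)) :
    pair w (f + g : 𝓢(E3, ℝ)) = pair w f + pair w g := by
  rw [pair, pair, pair, ← integral_add (hw.integrable_schwartz f) (hw.integrable_schwartz g)]
  exact integral_congr_ae (ae_of_all _ fun y => by simp [mul_add])

theorem pair_smul (w : E3 → ℝ) (c : ℝ) (f : 𝓢(E3, ℝ)) :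
    pair w (c • f : 𝓢(E3, ℝ)) = c * pair w f := by
  rw [pair, pair, ← integral_const_mul]
  exact integral_congr_ae (ae_of_all _ fun y => by simp; ring)

theorem Tempered.pair_sum {w : E3 → ℝ} (hw : Tempered w) {ι : Type*} (s : Finset ι)
    (f : ι → 𝓢(E3, ℝ)) : pair w (∑ i ∈ s, f i : 𝓢(E3, ℝ)) = ∑ i ∈ s, pair w (f i) := by
  classical
  induction s using Finset.induction_on with
  | empty => simp [pair]
  | insert i s hi ih => rw [Finset.sum_insert hi, Finset.sum_insert hi, hw.pair_add, ih]

theorem dil_one_zero (g : 𝓢(E3, ℝ)) (w : E3 → ℝ) : dil g w 1 0 = pair w g := by simp [dil, pair]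

theorem UnifTempered.continuous_pair {w : ℝ → E3 → ℝ} (hw : UnifTempered w) (g : 𝓢(E3, ℝ)) :
    Continuous fun t => pair (w t) g := by
  have h := (hw.continuousOn_dil g).comp_continuous
    (f := fun t : ℝ => ((t, 1, 0) : ℝ × ℝ × E3)) (by fun_prop) fun t => (show (0 : ℝ) < 1 from one_pos)
  exact h.congr fun t => dil_one_zero g (w t)

theorem UnifTempered.tendsto_pair {w : ℝ → E3 → ℝ} (hw : UnifTempered w) {a : ℕ → 𝓢(E3, ℝ)}
    {g : 𝓢(E3, ℝ)} (ha : Tendsto a atTop (𝓝 g)) (t : ℝ) :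
    Tendsto (fun n => pair (w t) (a n)) atTop (𝓝 (pair (w t) g)) := by
  obtain ⟨B, hB, h⟩ := hw.exists_abs_pair_le
  rw [tendsto_iff_norm_sub_tendsto_zero]
  have h1 : Tendsto (fun n => B * decayNorm (a n - g)) atTop (𝓝 0) := by
    have := (continuous_decayNorm.tendsto (g - g)).comp (ha.sub_const g)
    have h0 : decayNorm (g - g) = 0 := by simp [decayNorm]
    rw [h0] at this
    simpa using this.const_mul B
  refine squeeze_zero (fun n => norm_nonneg _) (fun n => ?_) h1
  rw [Real.norm_eq_abs, ← (hw.tempered t).pair_sub]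
  exact h t _

/-- Compactly supported Schwartz functions are sequentially dense. -/
theorem exists_compact_tendsto (ψ : 𝓢(E3, ℝ)) :
    ∃ a : ℕ → 𝓢(E3, ℝ), (∀ n, HasCompactSupport (a n)) ∧ Tendsto a atTop (𝓝 ψ) := by
  obtain ⟨a, ha, hl⟩ := exists_testFunction_tendsto (SchwartzMap.postcompCLM Complex.ofRealCLM ψ)
  refine ⟨fun n => SchwartzMap.postcompCLM Complex.reCLM (a n), fun n => ?_, ?_⟩
  · exact (ha n).comp_left (g := Complex.re) Complex.zero_re
  · have h := ((SchwartzMap.postcompCLM (𝕜 := ℝ) (E := E3) Complex.reCLM).continuous.tendsto _).comp hl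
    have h2 : SchwartzMap.postcompCLM Complex.reCLM (SchwartzMap.postcompCLM Complex.ofRealCLM ψ)
      = ψ := by ext x; simp
    rwa [h2] at h

variable {a b M : ℝ} {u : ℝ → E3 → E3} {p : ℝ → E3 → ℝ}

/-- The nonlinear term of the pressure-free weak formulation. -/
def nonlin (u : ℝ → E3 → E3) (κ : 𝓢(E3, ℝ)) (k : Fin 3) (t : ℝ) : ℝ :=
  ∑ i, pair (fun y => u t y i * u t y k) (dS i (lapS κ)) -
    ∑ i, ∑ j, pair (fun y => u t y i * u t y j) (dS i (dS j (dS k κ)))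

namespace NSFlow

/-- The momentum equation tested against `η`, with all derivatives moved onto `η`; the convective
term becomes a divergence because `∇ · u = 0`. Compact support is essential while the pressure is
present, since it may grow arbitrarily. -/
theorem hasDerivAt_pair (h : NSFlow a b M u p) {η : 𝓢(E3, ℝ)} (hη : HasCompactSupport η)
    (j : Fin 3) {t : ℝ} (ht : t ∈ Ioo a b) :
    HasDerivAt (fun t => pair (fun y => u t y j) η) (pair (fun y => u t y j) (lapS η) +
      ∑ i, pair (fun y => u t y i * u t y j) (dS i η) + pair (p t) (dS j η)) t := by
  have ht' := Ioo_subset_Icc_self ht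
  have hη1 : ContDiff ℝ 1 η := (η.smooth ⊤).of_le one_le_infty
  have hu : ∀ i, ContDiff ℝ ∞ fun y => u t y i := fun i => h.contDiff_comp ht' i
  have hu1 : ∀ i, ContDiff ℝ 1 fun y => u t y i := fun i => (hu i).of_le one_le_infty
  have hpd : ∀ i j, ContDiff ℝ 1 (pd i fun y => u t y j) := fun i j =>
    contDiff_pd ((hu j).of_le two_le_infty) (by norm_num) i
  have hpdd : ∀ i j, Continuous (pd i (pd i fun y => u t y j)) := fun i j =>
    (contDiff_pd (m := 0) (hpd i j) (by norm_num) i).continuous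
  have hp1 : ContDiff ℝ 1 (p t) := (h.contDiff_p ht').of_le one_le_infty
  have hcs : ∀ {f : E3 → ℝ}, Continuous f → Integrable fun y => f y * η y := fun hf =>
    (hf.mul η.continuous).integrable_of_hasCompactSupport hη.mul_left
  have hI1 : ∀ i, Integrable fun y => (u t y i * pd i (fun y => u t y j) y) * η y := fun i =>
    hcs ((hu1 i).continuous.mul (hpd i j).continuous)
  have hI2 : ∀ i, Integrable fun y => pd i (fun y => u t y i * u t y j) y * η y := fun i =>
    hcs (contDiff_pd (m := 0) ((hu1 i).mul (hu1 j)) (by norm_num) i).continuous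
  have hI3 : ∀ i, Integrable fun y => pd i (pd i fun y => u t y j) y * η y := fun i =>
    hcs (hpdd i j)
  have h1 := hasDerivAt_integral_of_compact (a := a) (b := b) (K := tsupport η)
    (F := fun t y => u t y j * η y) (F' := fun t y => dt u j t y * η y) hη
    ((h.cont_comp j).mul (by fun_prop)).continuousOn
    ((h.continuousOn_dt j).mul (by fun_prop))
    (fun t _ y hy => by rw [image_eq_zero_of_notMem_tsupport hy, mul_zero])
    (fun t _ y hy => by rw [image_eq_zero_of_notMem_tsupport hy, mul_zero])
    (fun t ht y => (h.hasDerivAt_comp j ht y).mul_const _) ht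
  refine h1.congr_deriv ?_
  have e1 : ∀ i, ∫ y, pd i (pd i fun y => u t y j) y * η y =
      pair (fun y => u t y j) (dS i (dS i η)) := by
    intro i
    rw [integral_pd_mul (hpd i j) hη1 hη, pd_schwartz, integral_pd_mul (hu1 j)
      ((dS i η).smooth 1) (hasCompactSupport_dS hη i), neg_neg]
    rfl
  have e2 : ∑ i, ∫ y, (u t y i * pd i (fun y => u t y j) y) * η y =
      -∑ i, pair (fun y => u t y i * u t y j) (dS i η) := by
    have e3' : ∀ i, pair (fun y => u t y i * u t y j) (dS i η) =
        -∫ y, pd i (fun y => u t y i * u t y j) y * η y := fun i => by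
      rw [integral_pd_mul ((hu1 i).mul (hu1 j)) hη1 hη, neg_neg]; rfl
    simp only [e3', Finset.sum_neg_distrib, neg_neg]
    rw [← integral_finsetSum _ fun i _ => hI1 i, ← integral_finsetSum _ fun i _ => hI2 i]
    refine integral_congr_ae (ae_of_all _ fun y => ?_)
    simp only [pd_mul (hu1 _) (hu1 j), ← Finset.sum_mul, Finset.sum_add_distrib]
    rw [h.sum_pd_eq_zero ht' y]
    ring
  have e3' : ∫ y, pd j (p t) y * η y = -pair (p t) (dS j η) := integral_pd_mul hp1 hη1 hη j
  have e4 : ∫ y, dt u j t y * η y = (∑ i, ∫ y, pd i (pd i fun y => u t y j) y * η y) -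
      (∑ i, ∫ y, (u t y i * pd i (fun y => u t y j) y) * η y) - ∫ y, pd j (p t) y * η y := by
    rw [← integral_finsetSum _ fun i _ => hI3 i, ← integral_finsetSum _ fun i _ => hI1 i,
      ← integral_sub, ← integral_sub]
    · refine integral_congr_ae (ae_of_all _ fun y => ?_)
      simp only [h.momentum_comp ht j y, ← Finset.sum_mul]
      ring
    · exact (integrable_finsetSum _ fun i _ => hI3 i).sub (integrable_finsetSum _ fun i _ => hI1 i)
    · exact hcs (contDiff_pd (m := 0) hp1 (by norm_num) j).continuous
    · exact integrable_finsetSum _ fun i _ => hI3 i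
    · exact integrable_finsetSum _ fun i _ => hI1 i
  rw [e4, e2, e3', lapS, ((h.tempered_comp j).tempered t).pair_sum]
  simp only [e1]
  ring

theorem sum_pair_dS (h : NSFlow a b M u p) {t : ℝ} (ht : t ∈ Icc a b) (κ : 𝓢(E3, ℝ)) :
    ∑ j, pair (fun y => u t y j) (dS j κ) = 0 := by
  have hcomp : ∀ κ : 𝓢(E3, ℝ), HasCompactSupport κ →
      ∑ j, pair (fun y => u t y j) (dS j κ) = 0 := by
    intro κ hκ
    have hu : ∀ i, ContDiff ℝ 1 fun y => u t y i := fun i =>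
      (h.contDiff_comp ht i).of_le one_le_infty
    have e : ∀ j, pair (fun y => u t y j) (dS j κ) = -∫ y, pd j (fun y => u t y j) y * κ y :=
      fun j => by rw [integral_pd_mul (hu j) (κ.smooth 1) hκ, neg_neg]; rfl
    simp only [e, Finset.sum_neg_distrib]
    rw [← integral_finsetSum]
    · simp [← Finset.sum_mul, h.sum_pd_eq_zero ht]
    · exact fun i _ => ((contDiff_pd (m := 0) (hu i) (by norm_num) i).continuous.mul
        κ.continuous).integrable_of_hasCompactSupport hκ.mul_left
  obtain ⟨c, hc, hl⟩ := exists_compact_tendsto κ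
  refine tendsto_nhds_unique (tendsto_finsetSum _ fun j _ =>
    (h.tempered_comp j).tendsto_pair (((continuous_dS j).tendsto κ).comp hl) t) ?_
  simp only [Function.comp_apply, hcomp _ (hc _)]
  exact tendsto_const_nhds

theorem continuous_nonlin (h : NSFlow a b M u p) (κ : 𝓢(E3, ℝ)) (k : Fin 3) :
    Continuous (nonlin u κ k) :=
  (continuous_finsetSum _ fun i _ => (h.tempered_prod i k).continuous_pair _).sub
    (continuous_finsetSum _ fun i _ => continuous_finsetSum _ fun j _ =>
      (h.tempered_prod i j).continuous_pair _)

/-- This is the equation for `u` tested with the divergence-free field `Δκ e_k - ∇∂_k κ`. Its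
gradient part pairs to zero with `u`, and the two pressure terms cancel. -/
theorem hasDerivAt_pair_lapS (h : NSFlow a b M u p) {κ : 𝓢(E3, ℝ)} (hκ : HasCompactSupport κ)
    (k : Fin 3) {t : ℝ} (ht : t ∈ Ioo a b) :
    HasDerivAt (fun t => pair (fun y => u t y k) (lapS κ))
      (pair (fun y => u t y k) (lapS (lapS κ)) + nonlin u κ k t) t := by
  have hdS := fun i => hasCompactSupport_dS hκ i
  have hlap : HasCompactSupport (lapS κ) := by
    have : (lapS κ : E3 → ℝ) = ∑ i, (dS i (dS i κ) : E3 → ℝ) := by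
      ext x; simp [lapS, sum_apply]
    rw [this, Fin.sum_univ_three]
    exact ((hasCompactSupport_dS (hdS 0) 0).add (hasCompactSupport_dS (hdS 1) 1)).add
      (hasCompactSupport_dS (hdS 2) 2)
  have hT := fun j => (h.tempered_comp j).tempered t
  have h1 := HasDerivAt.fun_sum (u := Finset.univ) fun (j : Fin 3) _ =>
    h.hasDerivAt_pair (hasCompactSupport_dS (hdS k) j) j ht
  have h2 := (h.hasDerivAt_pair hlap k ht).sub h1
  -- The subtracted pairing with `∇∂_k κ` vanishes at nearby times, but its derivative formula
  -- supplies the pressure term needed for the cancellation.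
  have hev : (fun t => pair (fun y => u t y k) (lapS κ)) =ᶠ[𝓝 t]
      (fun t => pair (fun y => u t y k) (lapS κ)) -
        fun t => ∑ j, pair (fun y => u t y j) (dS j (dS k κ)) := by
    filter_upwards [Ioo_mem_nhds ht.1 ht.2] with s hs
    rw [Pi.sub_apply, h.sum_pair_dS (Ioo_subset_Icc_self hs), sub_zero]
  refine (h2.congr_of_eventuallyEq hev).congr_deriv ?_
  have e1 : ∑ j, pair (fun y => u t y j) (lapS (dS j (dS k κ))) = 0 := by
    simp only [← dS_lapS]
    exact h.sum_pair_dS (Ioo_subset_Icc_self ht) _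
  have hp : ContDiff ℝ ∞ (p t) := h.contDiff_p (Ioo_subset_Icc_self ht)
  have e2 : ∑ j, pair (p t) (dS j (dS j (dS k κ))) = pair (p t) (dS k (lapS κ)) := by
    have hI : ∀ i, Integrable fun y => p t y * dS i (dS i (dS k κ)) y := fun i => (hp.continuous.mul
      (dS i (dS i (dS k κ))).continuous).integrable_of_hasCompactSupport
      (hasCompactSupport_dS (hasCompactSupport_dS (hdS k) i) i).mul_left
    simp only [pair]
    rw [← integral_finsetSum _ fun i _ => hI i]
    refine integral_congr_ae (ae_of_all _ fun y => ?_)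
    simp only [← Finset.mul_sum]
    rw [dS_lapS k κ, lapS, sum_apply]
  rw [Finset.sum_add_distrib, Finset.sum_add_distrib, e1, e2, nonlin,
    Finset.sum_comm (f := fun i j => pair (fun y => u t y i * u t y j) (dS i (dS j (dS k κ))))]
  ring

/-- With the pressure gone, the time-integrated identity passes to the limit from compactly
supported to Schwartz `κ`. In this form it also reaches the end points of the time interval. -/
theorem pair_lapS_sub (h : NSFlow a b M u p) (κ : 𝓢(E3, ℝ)) (k : Fin 3) {t₁ t₂ : ℝ}
    (h₁ : a ≤ t₁) (h₁₂ : t₁ ≤ t₂) (h₂ : t₂ ≤ b) :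
    pair (fun y => u t₂ y k) (lapS κ) - pair (fun y => u t₁ y k) (lapS κ) =
      ∫ t in t₁..t₂, (pair (fun y => u t y k) (lapS (lapS κ)) + nonlin u κ k t) := by
  have hcont : ∀ κ : 𝓢(E3, ℝ), Continuous fun t =>
      pair (fun y => u t y k) (lapS (lapS κ)) + nonlin u κ k t := fun κ =>
    ((h.tempered_comp k).continuous_pair _).add (h.continuous_nonlin κ k)
  have hcomp : ∀ κ : 𝓢(E3, ℝ), HasCompactSupport κ →
      ∫ t in t₁..t₂, (pair (fun y => u t y k) (lapS (lapS κ)) + nonlin u κ k t) =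
      pair (fun y => u t₂ y k) (lapS κ) - pair (fun y => u t₁ y k) (lapS κ) := by
    intro κ hκ
    refine intervalIntegral.integral_eq_sub_of_hasDerivAt_of_le h₁₂
      ((h.tempered_comp k).continuous_pair _).continuousOn (fun t ht => ?_)
      ((hcont κ).intervalIntegrable _ _)
    exact h.hasDerivAt_pair_lapS hκ k ⟨h₁.trans_lt ht.1, ht.2.trans_le h₂⟩
  obtain ⟨c, hc, hl⟩ := exists_compact_tendsto κ
  have hl1 := (continuous_lapS.tendsto κ).comp hl
  have hl2 := (continuous_lapS.tendsto _).comp hl1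
  have hd := fun i => ((continuous_dS i).tendsto _).comp hl1
  have hd3 := fun i j => ((continuous_dS i).tendsto _).comp
    (((continuous_dS j).tendsto _).comp (((continuous_dS k).tendsto _).comp hl))
  have key : Tendsto (fun n => ∫ t in t₁..t₂,
      (pair (fun y => u t y k) (lapS (lapS (c n))) + nonlin u (c n) k t)) atTop
      (𝓝 (∫ t in t₁..t₂, (pair (fun y => u t y k) (lapS (lapS κ)) + nonlin u κ k t))) := by
    obtain ⟨B₀, hB₀, hb₀⟩ := (h.tempered_comp k).exists_abs_pair_le
    choose B hB hb using fun i j => (h.tempered_prod i j).exists_abs_pair_le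
    have hbdd : ∀ {f : ℕ → 𝓢(E3, ℝ)} {g : 𝓢(E3, ℝ)}, Tendsto f atTop (𝓝 g) →
        ∃ D, ∀ n, decayNorm (f n) ≤ D := fun hf => by
      obtain ⟨D, hD⟩ := ((continuous_decayNorm.tendsto _).comp hf).bddAbove_range
      exact ⟨D, fun n => hD ⟨n, rfl⟩⟩
    obtain ⟨D₀, hD₀⟩ := hbdd hl2
    choose D₁ hD₁ using fun i => hbdd (hd i)
    choose D₂ hD₂ using fun i j => hbdd (hd3 i j)
    refine intervalIntegral.tendsto_integral_filter_of_dominated_convergence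
      (fun _ => B₀ * D₀ + (∑ i, B i k * D₁ i + ∑ i, ∑ j, B i j * D₂ i j))
      (Eventually.of_forall fun n => (hcont (c n)).aestronglyMeasurable)
      (Eventually.of_forall fun n => ae_of_all _ fun t _ => ?_) (by simp)
      (ae_of_all _ fun t _ => ?_)
    · rw [nonlin]
      refine (norm_add_le _ _).trans (add_le_add ((hb₀ t _).trans (by
        gcongr; exact hD₀ n)) ((norm_sub_le _ _).trans (add_le_add ?_ ?_)))
      · exact (norm_sum_le _ _).trans (Finset.sum_le_sum fun i _ => (hb i k t _).trans (by
          have := hB i k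
          gcongr; exact hD₁ i n))
      · refine (norm_sum_le _ _).trans (Finset.sum_le_sum fun i _ => (norm_sum_le _ _).trans
          (Finset.sum_le_sum fun j _ => (hb i j t _).trans (by
          have := hB i j
          gcongr; exact hD₂ i j n)))
    · exact ((h.tempered_comp k).tendsto_pair hl2 t).add ((tendsto_finsetSum _ fun i _ =>
        (h.tempered_prod i k).tendsto_pair (hd i) t).sub (tendsto_finsetSum _ fun i _ =>
        tendsto_finsetSum _ fun j _ => (h.tempered_prod i j).tendsto_pair (hd3 i j) t))
  refine tendsto_nhds_unique ?_ key
  simp only [hcomp _ (hc _)]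
  exact ((h.tempered_comp k).tendsto_pair hl1 t₂).sub ((h.tempered_comp k).tendsto_pair hl1 t₁)

end NSFlow

end

section

/-! ### Scale-invariant bounds -/

/-- The averaging kernel `(1 + r|y - x|)⁻⁴`. -/
def bk (r : ℝ) (x y : E3) : ℝ := 1 / (1 + ‖r • (y - x)‖) ^ 4

/-- Averages against the kernel `bk`. -/
def av (F : E3 → ℝ≥0∞) (r : ℝ) (x : E3) : ℝ≥0∞ := ∫⁻ y, F y * ENNReal.ofReal (bk r x y)

/-- The mass of the kernel `bk` at unit scale. -/
def K0 : ℝ := ∫ z : E3, 1 / (1 + ‖z‖) ^ 4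

theorem K0_nonneg : 0 ≤ K0 := integral_nonneg fun z => by positivity

theorem bk_nonneg (r : ℝ) (x y : E3) : 0 ≤ bk r x y := by unfold bk; positivity

theorem bk_le_one (r : ℝ) (x y : E3) : bk r x y ≤ 1 := by
  unfold bk
  rw [div_le_one (by positivity)]
  exact one_le_pow₀ (by linarith [norm_nonneg (r • (y - x))])

theorem bk_comm (r : ℝ) (x y : E3) : bk r x y = bk r y x := by
  rw [bk, bk, ← neg_sub x y, smul_neg, norm_neg]

theorem continuous_bk : Continuous fun q : ℝ × E3 × E3 => bk q.1 q.2.1 q.2.2 := by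
  unfold bk
  exact continuous_const.div (by fun_prop) fun q => by positivity

theorem measurable_bk (r : ℝ) (x : E3) : Measurable (bk r x) :=
  (continuous_bk.comp (by fun_prop : Continuous fun y : E3 => (r, x, y))).measurable

theorem lintegral_bk {r : ℝ} (hr : 0 < r) (x : E3) :
    ∫⁻ y, ENNReal.ofReal (bk r x y) = ENNReal.ofReal (K0 / r ^ 3) := by
  have hI := integrable_one_add_norm_pow_inv (k := 4) le_rfl
  have h1 : Integrable fun y : E3 => 1 / (1 + ‖r • y‖) ^ 4 := hI.comp_smul hr.ne'
  have h2 : Integrable fun y => bk r x y := h1.comp_sub_right x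
  rw [← ofReal_integral_eq_lintegral_ofReal h2 (ae_of_all _ (bk_nonneg r x))]
  congr 1
  have h3 := integral_sub_right_eq_self (μ := volume) (fun y : E3 => 1 / (1 + ‖r • y‖) ^ 4) x
  have h4 := Measure.integral_comp_smul volume (fun y : E3 => 1 / (1 + ‖y‖) ^ 4) r
  simp only [bk]
  rw [h3, h4, K0]
  simp only [finrank_euclideanSpace, Fintype.card_fin, smul_eq_mul]
  rw [abs_of_pos (by positivity)]
  ring

theorem av_mono {F G : E3 → ℝ≥0∞} (h : ∀ y, F y ≤ G y) (r : ℝ) (x : E3) : av F r x ≤ av G r x :=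
  lintegral_mono fun y => mul_le_mul_left (h y) _

theorem av_add {F : E3 → ℝ≥0∞} (hF : Measurable F) (G : E3 → ℝ≥0∞) (r : ℝ) (x : E3) :
    av (fun y => F y + G y) r x = av F r x + av G r x := by
  simp only [av, add_mul]
  exact lintegral_add_left (hF.mul (measurable_bk r x).ennreal_ofReal) _

/-- Below height `l` the mass `K0 / r³` of the kernel is used, above it only that the kernel is at
most one. -/
theorem av_le_of_split {F : E3 → ℝ≥0∞} {f : E3 → E3} {l A B : ℝ} (hA : 0 ≤ A) (hB : 0 ≤ B)
    (hm : Measurable f) (h : ∀ y, ¬l < ‖f y‖ → F y ≤ ENNReal.ofReal A)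
    (hB : ∫⁻ y in {y | l < ‖f y‖}, F y ≤ ENNReal.ofReal B) {r : ℝ} (hr : 0 < r) (x : E3) :
    av F r x ≤ ENNReal.ofReal (A * (K0 / r ^ 3) + B) := by
  have hS : MeasurableSet {y | l < ‖f y‖} := measurableSet_lt measurable_const hm.norm
  have hpt : ∀ y, F y * ENNReal.ofReal (bk r x y) ≤
      ENNReal.ofReal A * ENNReal.ofReal (bk r x y) + {y | l < ‖f y‖}.indicator F y := by
    intro y
    by_cases hy : l < ‖f y‖
    · rw [indicator_of_mem (by exact hy)]
      exact le_add_left ((mul_le_mul_right (ENNReal.ofReal_le_one.2 (bk_le_one r x y)) _).trans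
        (mul_one _).le)
    · exact le_add_right (mul_le_mul_left (h y hy) _)
  refine (lintegral_mono hpt).trans ?_
  rw [lintegral_add_left ((measurable_bk r x).ennreal_ofReal.const_mul _),
    lintegral_const_mul _ (measurable_bk r x).ennreal_ofReal, lintegral_bk hr,
    lintegral_indicator hS, ENNReal.ofReal_add (by have := K0_nonneg; positivity) (by assumption),
    ENNReal.ofReal_mul hA]
  gcongr

/-- The height `M * r` is the natural size of a critical field at length `1/r`; it makes the low and
high parts equal up to constants. -/
theorem WeakL3.av_norm_le {M : ℝ} {f : E3 → E3} (hf : WeakL3 M f) (hM : 0 < M) (hm : Measurable f)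
    {r : ℝ} (hr : 0 < r) (x : E3) :
    av (fun y => ENNReal.ofReal ‖f y‖) r x ≤ ENNReal.ofReal ((3 + K0) * (M / r ^ 2)) := by
  refine (av_le_of_split (l := M * r) (A := M * r) (by positivity)
    (by positivity) hm (fun y hy => ENNReal.ofReal_le_ofReal (not_lt.1 hy))
    (hf.setLIntegral_norm_le hM.le hm (by positivity)) hr x).trans
    (ENNReal.ofReal_le_ofReal (le_of_eq ?_))
  field_simp
  ring

/-- Same splitting height as for the first power: both parts are multiples of `M² / r`. -/
theorem WeakL3.av_sq_le {M : ℝ} {f : E3 → E3} (hf : WeakL3 M f) (hM : 0 < M) (hm : Measurable f)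
    {r : ℝ} (hr : 0 < r) (x : E3) :
    av (fun y => ENNReal.ofReal (‖f y‖ ^ 2)) r x ≤ ENNReal.ofReal ((3 + K0) * (M ^ 2 / r)) := by
  refine (av_le_of_split (l := M * r) (A := (M * r) ^ 2) (by positivity)
    (by positivity) hm (fun y hy => ENNReal.ofReal_le_ofReal
      (pow_le_pow_left₀ (norm_nonneg _) (not_lt.1 hy) 2))
    (hf.setLIntegral_sq_le hM.le hm (by positivity)) hr x).trans
    (ENNReal.ofReal_le_ofReal (le_of_eq ?_))
  field_simp
  ring

theorem exists_ofReal_abs_dil_le (g : 𝓢(E3, ℝ)) : ∃ C : ℝ, 0 < C ∧ ∀ (w : E3 → ℝ) (r : ℝ) (x : E3),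
    ENNReal.ofReal |dil g w r x| ≤ ENNReal.ofReal C * av (fun y => ENNReal.ofReal |w y|) r x := by
  obtain ⟨C, hC, h⟩ := exists_decay g 4
  refine ⟨C, hC, fun w r x => ?_⟩
  rw [← Real.norm_eq_abs, ofReal_norm]
  refine (enorm_integral_le_lintegral_enorm _).trans ?_
  rw [av, ← lintegral_const_mul' _ _ ENNReal.ofReal_ne_top]
  refine lintegral_mono fun y => ?_
  rw [enorm_mul, ← ofReal_norm, ← ofReal_norm, mul_left_comm, ← ENNReal.ofReal_mul hC.le]
  refine mul_le_mul_right (ENNReal.ofReal_le_ofReal ((h _).trans (le_of_eq ?_))) _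
  rw [bk]
  ring

theorem exists_abs_dil_le_of_norm (g : 𝓢(E3, ℝ)) : ∃ C : ℝ, 0 < C ∧ ∀ {M : ℝ} {f : E3 → E3},
    WeakL3 M f → 0 < M → Measurable f → ∀ {w : E3 → ℝ}, (∀ y, |w y| ≤ ‖f y‖) →
    ∀ {r : ℝ}, 0 < r → ∀ x, |dil g w r x| ≤ C * (M / r ^ 2) := by
  obtain ⟨C, hC, h⟩ := exists_ofReal_abs_dil_le g
  have := K0_nonneg
  refine ⟨C * (3 + K0), by positivity, fun {M f} hf hM hm w hw r hr x => ?_⟩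
  rw [← ENNReal.ofReal_le_ofReal_iff (by positivity), mul_assoc, ENNReal.ofReal_mul hC.le]
  exact (h w r x).trans (mul_le_mul_right ((av_mono (fun y => ENNReal.ofReal_le_ofReal (hw y)) r
    x).trans (hf.av_norm_le hM hm hr x)) _)

theorem exists_abs_dil_le_of_sq (g : 𝓢(E3, ℝ)) : ∃ C : ℝ, 0 < C ∧ ∀ {M : ℝ} {f : E3 → E3},
    WeakL3 M f → 0 < M → Measurable f → ∀ {w : E3 → ℝ}, (∀ y, |w y| ≤ ‖f y‖ ^ 2) →
    ∀ {r : ℝ}, 0 < r → ∀ x, |dil g w r x| ≤ C * (M ^ 2 / r) := by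
  obtain ⟨C, hC, h⟩ := exists_ofReal_abs_dil_le g
  have := K0_nonneg
  refine ⟨C * (3 + K0), by positivity, fun {M f} hf hM hm w hw r hr x => ?_⟩
  rw [← ENNReal.ofReal_le_ofReal_iff (by positivity), mul_assoc, ENNReal.ofReal_mul hC.le]
  exact (h w r x).trans (mul_le_mul_right ((av_mono (fun y => ENNReal.ofReal_le_ofReal (hw y)) r
    x).trans (hf.av_sq_le hM hm hr x)) _)

/-! ### Dilated and translated test functions -/

/-- The Schwartz function `y ↦ g (r (y - x))`. -/
def dilS (g : 𝓢(E3, ℝ)) {r : ℝ} (hr : 0 < r) (x : E3) : 𝓢(E3, ℝ) :=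
  SchwartzMap.compSubConstCLM ℝ x (SchwartzMap.compCLMOfContinuousLinearEquiv ℝ
    (ContinuousLinearEquiv.smulLeft (Units.mk0 r hr.ne') : E3 ≃L[ℝ] E3) g)

theorem dilS_apply (g : 𝓢(E3, ℝ)) {r : ℝ} (hr : 0 < r) (x y : E3) :
    dilS g hr x y = g (r • (y - x)) := rfl

theorem pair_dilS (w : E3 → ℝ) (g : 𝓢(E3, ℝ)) {r : ℝ} (hr : 0 < r) (x : E3) :
    pair w (dilS g hr x) = dil g w r x := rfl

theorem dS_dilS (i : Fin 3) (g : 𝓢(E3, ℝ)) {r : ℝ} (hr : 0 < r) (x : E3) :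
    dS i (dilS g hr x) = r • dilS (dS i g) hr x := by
  ext y
  have h1 : HasFDerivAt (fun y : E3 => r • (y - x)) (r • ContinuousLinearMap.id ℝ E3) y :=
    ((hasFDerivAt_id y).sub_const x).const_smul r
  have h2 := (g.hasFDerivAt (r • (y - x))).comp y h1
  have h3 : (dilS g hr x : E3 → ℝ) = g ∘ fun y => r • (y - x) := rfl
  rw [dS_apply, h3, h2.fderiv]
  simp [dilS_apply, dS_apply]

theorem dilS_sum {ι : Type*} (s : Finset ι) (g : ι → 𝓢(E3, ℝ)) {r : ℝ} (hr : 0 < r) (x : E3) :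
    dilS (∑ i ∈ s, g i) hr x = ∑ i ∈ s, dilS (g i) hr x := by
  ext y; simp [dilS_apply, sum_apply]

theorem lapS_dilS (g : 𝓢(E3, ℝ)) {r : ℝ} (hr : 0 < r) (x : E3) :
    lapS (dilS g hr x) = r ^ 2 • dilS (lapS g) hr x := by
  simp only [lapS, dS_dilS, dS_smul, dilS_sum, Finset.smul_sum, smul_smul, pow_two]

theorem lapS_smul (c : ℝ) (g : 𝓢(E3, ℝ)) : lapS (c • g) = c • lapS g := by
  simp only [lapS, dS_smul, Finset.smul_sum]

/-- The nonlinear term of the pressure-free weak formulation at scale `r⁻¹`. -/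
def nonlinDil (u : ℝ → E3 → E3) (κ : 𝓢(E3, ℝ)) (k : Fin 3) (r : ℝ) (x : E3) (t : ℝ) : ℝ :=
  ∑ i, dil (dS i (lapS κ)) (fun y => u t y i * u t y k) r x -
    ∑ i, ∑ j, dil (dS i (dS j (dS k κ))) (fun y => u t y i * u t y j) r x

theorem nonlin_dilS (u : ℝ → E3 → E3) (κ : 𝓢(E3, ℝ)) (k : Fin 3) {r : ℝ} (hr : 0 < r) (x : E3)
    (t : ℝ) : nonlin u (dilS κ hr x) k t = r ^ 3 * nonlinDil u κ k r x t := by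
  simp only [nonlin, nonlinDil, lapS_dilS, dS_dilS, dS_smul, smul_smul, pair_smul, pair_dilS,
    mul_sub, Finset.mul_sum]
  simp only [pow_succ, pow_zero, one_mul]

variable {a b M : ℝ} {u : ℝ → E3 → E3} {p : ℝ → E3 → ℝ}

namespace NSFlow

theorem dil_lapS_sub (h : NSFlow a b M u p) (κ : 𝓢(E3, ℝ)) (k : Fin 3) {t₁ t₂ : ℝ}
    (h₁ : a ≤ t₁) (h₁₂ : t₁ ≤ t₂) (h₂ : t₂ ≤ b) {r : ℝ} (hr : 0 < r) (x : E3) :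
    dil (lapS κ) (fun y => u t₂ y k) r x - dil (lapS κ) (fun y => u t₁ y k) r x =
      ∫ t in t₁..t₂, (r ^ 2 * dil (lapS (lapS κ)) (fun y => u t y k) r x +
        r * nonlinDil u κ k r x t) := by
  have h := h.pair_lapS_sub (dilS κ hr x) k h₁ h₁₂ h₂
  simp only [lapS_dilS, lapS_smul, smul_smul, pair_smul, pair_dilS, nonlin_dilS] at h
  rw [← mul_sub] at h
  have hr2 : r ^ 2 ≠ 0 := by positivity
  rw [← mul_right_inj' hr2, h, ← intervalIntegral.integral_const_mul]
  congr 1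
  ext t
  ring

theorem continuousOn_dil_comp (h : NSFlow a b M u p) (g : 𝓢(E3, ℝ)) (k : Fin 3) :
    ContinuousOn (fun q : ℝ × ℝ × E3 => dil g (fun y => u q.1 y k) q.2.1 q.2.2)
      {q | 0 < q.2.1} := (h.tempered_comp k).continuousOn_dil g

theorem continuousOn_nonlinDil (h : NSFlow a b M u p) (κ : 𝓢(E3, ℝ)) (k : Fin 3) :
    ContinuousOn (fun q : ℝ × ℝ × E3 => nonlinDil u κ k q.2.1 q.2.2 q.1) {q | 0 < q.2.1} :=
  (continuousOn_finsetSum _ fun i _ => (h.tempered_prod i k).continuousOn_dil _).sub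
    (continuousOn_finsetSum _ fun i _ => continuousOn_finsetSum _ fun j _ =>
      (h.tempered_prod i j).continuousOn_dil _)

theorem exists_abs_dil_comp_le (g : 𝓢(E3, ℝ)) : ∃ C : ℝ, 0 < C ∧ ∀ {a b M : ℝ} {u : ℝ → E3 → E3}
    {p : ℝ → E3 → ℝ}, NSFlow a b M u p → ∀ (k : Fin 3) (t : ℝ) {r : ℝ}, 0 < r → ∀ x,
    |dil g (fun y => u t y k) r x| ≤ C * (M / r ^ 2) := by
  obtain ⟨C, hC, H⟩ := exists_abs_dil_le_of_norm g
  exact ⟨C, hC, fun h k t _ hr x => H (h.weak t) h.M_pos (h.cont_slice t).measurable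
    (fun y => abs_coord_le _ _) hr x⟩

theorem exists_abs_nonlinDil_le (κ : 𝓢(E3, ℝ)) : ∃ C : ℝ, 0 < C ∧ ∀ {a b M : ℝ}
    {u : ℝ → E3 → E3} {p : ℝ → E3 → ℝ}, NSFlow a b M u p → ∀ (k : Fin 3) (t : ℝ) {r : ℝ}, 0 < r →
    ∀ x, |nonlinDil u κ k r x t| ≤ C * (M ^ 2 / r) := by
  choose C hC H using fun i => exists_abs_dil_le_of_sq (dS i (lapS κ))
  choose D hD H' using fun i j k => exists_abs_dil_le_of_sq (dS i (dS j (dS k κ)))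
  have hprod : ∀ (v : E3) (i j : Fin 3), |v i * v j| ≤ ‖v‖ ^ 2 := fun v i j => by
    rw [abs_mul, pow_two]
    exact mul_le_mul (abs_coord_le v i) (abs_coord_le v j) (abs_nonneg _) (norm_nonneg _)
  -- Summing over `k` as well makes the constant independent of the component.
  refine ⟨∑ i, C i + ∑ k, ∑ i, ∑ j, D i j k, ?_, fun {a b M u p} h k t r hr x => ?_⟩
  · exact add_pos (Finset.sum_pos (fun i _ => hC i) Finset.univ_nonempty)
      (Finset.sum_pos (fun k _ => Finset.sum_pos (fun i _ => Finset.sum_pos (fun j _ => hD i j k)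
        Finset.univ_nonempty) Finset.univ_nonempty) Finset.univ_nonempty)
  · have hM := h.M_pos
    have hm := (h.cont_slice t).measurable
    rw [add_mul]
    refine (abs_sub _ _).trans (add_le_add ?_ ?_)
    · rw [Finset.sum_mul]
      exact (Finset.abs_sum_le_sum_abs _ _).trans (Finset.sum_le_sum fun i _ =>
        H i (h.weak t) hM hm (fun y => hprod _ _ _) hr x)
    · refine le_trans ?_ (mul_le_mul_of_nonneg_right (Finset.single_le_sum
        (f := fun k => ∑ i, ∑ j, D i j k) (fun k _ => Finset.sum_nonneg fun i _ =>
        Finset.sum_nonneg fun j _ => (hD i j k).le) (Finset.mem_univ k)) (by positivity))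
      rw [Finset.sum_mul]
      refine (Finset.abs_sum_le_sum_abs _ _).trans (Finset.sum_le_sum fun i _ => ?_)
      rw [Finset.sum_mul]
      exact (Finset.abs_sum_le_sum_abs _ _).trans (Finset.sum_le_sum fun j _ =>
        H' i j k (h.weak t) hM hm (fun y => hprod _ _ _) hr x)

/-- The time derivative of a frequency-localized component. -/
theorem hasDerivWithinAt_dil (h : NSFlow a b M u p) (κ : 𝓢(E3, ℝ)) (k : Fin 3) {r : ℝ}
    (hr : 0 < r) (x : E3) {t : ℝ} (ht : t ∈ Icc a b) :
    HasDerivWithinAt (fun t => dil (lapS κ) (fun y => u t y k) r x)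
      (r ^ 2 * dil (lapS (lapS κ)) (fun y => u t y k) r x + r * nonlinDil u κ k r x t)
      (Icc a b) t := by
  set F : ℝ → ℝ := fun t => r ^ 2 * dil (lapS (lapS κ)) (fun y => u t y k) r x +
    r * nonlinDil u κ k r x t
  have hc : Continuous F := by
    have h1 : Continuous fun t => dil (lapS (lapS κ)) (fun y => u t y k) r x :=
      (h.continuousOn_dil_comp (lapS (lapS κ)) k).comp_continuous (f := fun t => (t, r, x))
        (by fun_prop) fun t => hr
    have h2 : Continuous fun t => nonlinDil u κ k r x t :=
      (h.continuousOn_nonlinDil κ k).comp_continuous (f := fun t => (t, r, x))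
        (by fun_prop) fun t => hr
    exact (h1.const_mul _).add (h2.const_mul _)
  -- The integrated identity presents the pairing as a primitive of the globally continuous `F`,
  -- which gives one-sided derivatives at `a` and `b` as well.
  have h1 : HasDerivAt (fun t => (∫ s in a..t, F s) + dil (lapS κ) (fun y => u a y k) r x) (F t) t :=
    (intervalIntegral.integral_hasDerivAt_right (hc.intervalIntegrable _ _)
      (hc.stronglyMeasurableAtFilter _ _) hc.continuousAt).add_const _
  refine h1.hasDerivWithinAt.congr (fun s hs => ?_) ?_
  · rw [← h.dil_lapS_sub κ k le_rfl hs.1 hs.2 hr x, sub_add_cancel]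
  · rw [← h.dil_lapS_sub κ k le_rfl ht.1 ht.2 hr x, sub_add_cancel]

end NSFlow

end

section

/-! ### Fourier multipliers as convolutions -/

section Fourier

open FourierTransform

theorem fourier_fourier_apply (f : 𝓢(E3, ℂ)) (x : E3) : 𝓕 (𝓕 f) x = f (-x) := by
  have h := SchwartzMap.fourierInv_apply_eq (𝓕 f)
  rw [fourierInv_fourier_eq] at h
  conv_rhs => rw [h]
  simp

/-- After one more Fourier transform both sides become the same product of reflected functions, by
the convolution theorem; injectivity of the transform finishes. -/
theorem fourier_smulLeft_fourierInv (G ψ : 𝓢(E3, ℂ)) (y : E3) :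
    𝓕 (SchwartzMap.smulLeftCLM ℂ G (𝓕⁻ ψ)) y = ∫ z, ψ z * 𝓕 G (y - z) := by
  have h : 𝓕 (SchwartzMap.smulLeftCLM ℂ G (𝓕⁻ ψ)) =
      SchwartzMap.convolution (ContinuousLinearMap.mul ℂ ℂ) ψ (𝓕 G) := by
    have hinj : Function.Injective (𝓕 : 𝓢(E3, ℂ) → 𝓢(E3, ℂ)) :=
      Function.LeftInverse.injective (g := 𝓕⁻) fun f => fourierInv_fourier_eq f
    apply hinj
    ext x
    rw [SchwartzMap.fourier_convolution, SchwartzMap.pairing_apply_apply, fourier_fourier_apply,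
      fourier_fourier_apply, SchwartzMap.smulLeftCLM_apply_apply G.hasTemperateGrowth,
      SchwartzMap.fourierInv_apply_eq]
    simp [mul_comm]
  rw [h, SchwartzMap.convolution_apply, convolution_def]
  rfl

/-- The partial derivative on complex-valued Schwartz functions. -/
def dC (i : Fin 3) (g : 𝓢(E3, ℂ)) : 𝓢(E3, ℂ) := LineDeriv.lineDerivOp (e3 i) g

theorem inner_e3 (x : E3) (i : Fin 3) : inner ℝ x (e3 i) = x i := by
  simp [e3, EuclideanSpace.inner_single_right]

theorem dC_fourier (f : 𝓢(E3, ℂ)) (i : Fin 3) :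
    dC i (𝓕 f) = 𝓕 (-(2 * Real.pi * Complex.I) •
      SchwartzMap.smulLeftCLM ℂ (fun x : E3 => x i) f) := by
  rw [dC, SchwartzMap.lineDerivOp_fourier_eq]
  simp only [inner_e3]

/-- Multipliers commute with derivatives, since the latter are multiplications by coordinates on the
Fourier side. -/
theorem dC_fourier_smulLeft_fourierInv (G ψ : 𝓢(E3, ℂ)) (i : Fin 3) :
    dC i (𝓕 (SchwartzMap.smulLeftCLM ℂ G (𝓕⁻ ψ))) =
      𝓕 (SchwartzMap.smulLeftCLM ℂ G (𝓕⁻ (dC i ψ))) := by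
  rw [dC_fourier]
  congr 1
  rw [dC, SchwartzMap.fourierInv_lineDerivOp_eq]
  ext x
  simp only [inner_e3, map_smul, _root_.smul_apply,
    SchwartzMap.smulLeftCLM_apply_apply G.hasTemperateGrowth,
    SchwartzMap.smulLeftCLM_apply_apply (hasTemperateGrowth_coord i), smul_eq_mul, Complex.real_smul]
  ring

theorem fourier_comp_smul {f g : 𝓢(E3, ℂ)} {N : ℝ} (hN : 0 < N) (h : ∀ ξ, f ξ = g (N⁻¹ • ξ))
    (z : E3) : 𝓕 f z = (N : ℂ) ^ 3 * 𝓕 g (N • z) := by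
  rw [SchwartzMap.fourier_coe, SchwartzMap.fourier_coe, Real.fourier_eq, Real.fourier_eq]
  have h1 := Measure.integral_comp_smul volume
    (fun ξ : E3 => Real.fourierChar (-inner ℝ ξ (N • z)) • g ξ) N⁻¹
  have h2 : ∀ v : E3, Real.fourierChar (-inner ℝ v z) • f v =
      Real.fourierChar (-inner ℝ (N⁻¹ • v) (N • z)) • g (N⁻¹ • v) := fun v => by
    rw [h, real_inner_smul_left, real_inner_smul_right, ← mul_assoc, inv_mul_cancel₀ hN.ne',
      one_mul]
  simp only [h2]
  rw [h1]
  simp only [finrank_euclideanSpace, Fintype.card_fin]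
  rw [abs_of_pos (by positivity), Complex.real_smul]
  congr 1
  simp

end Fourier

/-! ### Littlewood-Paley kernels -/

variable {φ : E3 → ℝ}

theorem lpSymbol_eq_comp (φ : E3 → ℝ) (N : ℝ) (ξ : E3) :
    lpSymbol φ N ξ = lpSymbol φ 1 (N⁻¹ • ξ) := by
  simp only [lpSymbol, smul_smul]
  congr 4
  · norm_num
  · rw [← mul_inv]; congr 1; ring_nf

theorem IsLPBump.contDiff_lpSymbol (hφ : IsLPBump φ) (N : ℝ) : ContDiff ℝ ∞ (lpSymbol φ N) := by
  have := hφ.smooth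
  unfold lpSymbol
  exact Complex.ofRealCLM.contDiff.comp ((this.comp (contDiff_const_smul _)).sub
    (this.comp (contDiff_const_smul _)))

theorem IsLPBump.lpSymbol_one_eq_zero (hφ : IsLPBump φ) {ξ : E3} (hξ : 1 < ‖ξ‖) :
    lpSymbol φ 1 ξ = 0 := by
  have h : ∀ ξ : E3, 1 < ‖ξ‖ → φ ξ = 0 := fun ξ hξ => by
    by_contra hne
    have := hφ.support_subset (Function.mem_support.2 hne)
    rw [mem_closedBall_zero_iff] at this
    linarith
  rw [lpSymbol, h, h]
  · simp
  · rw [norm_smul]; norm_num; linarith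
  · rw [norm_smul]; norm_num; linarith

theorem IsLPBump.lpSymbol_one_eq_zero_of_lt (hφ : IsLPBump φ) {ξ : E3} (hξ : ‖ξ‖ < 1 / 4) :
    lpSymbol φ 1 ξ = 0 := by
  rw [lpSymbol, hφ.eq_one, hφ.eq_one]
  · simp
  · rw [mem_ball_zero_iff, norm_smul]; norm_num; linarith
  · rw [mem_ball_zero_iff, norm_smul]; norm_num; linarith

theorem IsLPBump.hasCompactSupport_lpSymbol (hφ : IsLPBump φ) {N : ℝ} (hN : 0 < N) :
    HasCompactSupport (lpSymbol φ N) := by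
  refine HasCompactSupport.intro (isCompact_closedBall 0 N) fun ξ hξ => ?_
  rw [lpSymbol_eq_comp]
  refine hφ.lpSymbol_one_eq_zero ?_
  rw [mem_closedBall_zero_iff, not_le] at hξ
  rw [norm_smul, norm_inv, Real.norm_of_nonneg hN.le, ← div_eq_inv_mul, lt_div_iff₀ hN]
  linarith

/-- The symbol of `P_N` as a Schwartz function. -/
def lpSchwartz (hφ : IsLPBump φ) {N : ℝ} (hN : 0 < N) : 𝓢(E3, ℂ) :=
  (hφ.hasCompactSupport_lpSymbol hN).toSchwartzMap (hφ.contDiff_lpSymbol N)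

/-- The symbol of `Δ⁻¹ P_1`. -/
def invLapSymbol (φ : E3 → ℝ) (ξ : E3) : ℂ :=
  ((-(4 * Real.pi ^ 2 * ‖ξ‖ ^ 2)⁻¹ : ℝ) : ℂ) * lpSymbol φ 1 ξ

/-- The singularity of `|ξ|⁻²` does no harm because the symbol of `P_1` vanishes on the ball of
radius `1/4`. -/
theorem IsLPBump.contDiff_invLapSymbol (hφ : IsLPBump φ) : ContDiff ℝ ∞ (invLapSymbol φ) := by
  rw [contDiff_iff_contDiffAt]
  intro ξ
  by_cases hξ : ξ = 0
  · refine (contDiffAt_const (c := (0 : ℂ))).congr_of_eventuallyEq ?_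
    filter_upwards [Metric.ball_mem_nhds ξ (by norm_num : (0 : ℝ) < 1 / 4)] with η hη
    rw [hξ, mem_ball_zero_iff] at hη
    rw [invLapSymbol, hφ.lpSymbol_one_eq_zero_of_lt hη, mul_zero]
  · refine ContDiffAt.mul ?_ (hφ.contDiff_lpSymbol 1).contDiffAt
    refine Complex.ofRealCLM.contDiff.contDiffAt.comp ξ (ContDiffAt.neg (ContDiffAt.inv ?_ ?_))
    · exact contDiffAt_const.mul (contDiff_norm_sq ℝ).contDiffAt
    · have := norm_pos_iff.2 hξ
      have := Real.pi_pos
      positivity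

/-- The symbol of `Δ⁻¹ P_1` as a Schwartz function. -/
def invLapSchwartz (hφ : IsLPBump φ) : 𝓢(E3, ℂ) :=
  ((hφ.hasCompactSupport_lpSymbol one_pos).mul_left (f := fun ξ =>
    ((-(4 * Real.pi ^ 2 * ‖ξ‖ ^ 2)⁻¹ : ℝ) : ℂ))).toSchwartzMap hφ.contDiff_invLapSymbol

section Kernels

open FourierTransform

/-- The convolution kernel of `P_1`. -/
def lpKernel (hφ : IsLPBump φ) : 𝓢(E3, ℂ) := 𝓕 (lpSchwartz hφ one_pos)

/-- The convolution kernel of `Δ⁻¹ P_1`. -/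
def invLapKernel (hφ : IsLPBump φ) : 𝓢(E3, ℂ) := 𝓕 (invLapSchwartz hφ)

/-- Having the kernel of `P_1` as a Laplacian is what opens it to the pressure-free weak
formulation. -/
theorem lpKernel_eq (hφ : IsLPBump φ) :
    lpKernel hφ = ∑ i, dC i (dC i (invLapKernel hφ)) := by
  have h1 : ∀ i, dC i (dC i (invLapKernel hφ)) = 𝓕 (-(2 * Real.pi * Complex.I) •
      SchwartzMap.smulLeftCLM ℂ (fun x : E3 => x i) (-(2 * Real.pi * Complex.I) •
      SchwartzMap.smulLeftCLM ℂ (fun x : E3 => x i) (invLapSchwartz hφ))) := fun i => by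
    rw [invLapKernel, dC_fourier, dC_fourier]
  have hsum : ∀ f : Fin 3 → 𝓢(E3, ℂ), ∑ i, 𝓕 (f i) = 𝓕 (∑ i, f i) := fun f =>
    (map_sum (FourierTransform.fourierCLM ℂ 𝓢(E3, ℂ)) f _).symm
  simp only [h1]
  rw [hsum, lpKernel]
  congr 1
  ext ξ
  simp only [_root_.sum_apply, _root_.smul_apply,
    SchwartzMap.smulLeftCLM_apply_apply (hasTemperateGrowth_coord _), smul_eq_mul,
    Complex.real_smul]
  have hI : Complex.I ^ 2 = -1 := Complex.I_sq
  have e1 : lpSchwartz hφ one_pos ξ = lpSymbol φ 1 ξ := rfl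
  have e2 : invLapSchwartz hφ ξ = invLapSymbol φ ξ := rfl
  rw [e1, e2, invLapSymbol]
  by_cases hξ : ξ = 0
  · rw [hφ.lpSymbol_one_eq_zero_of_lt (by rw [hξ, norm_zero]; norm_num)]
    simp
  · have hn := norm_pos_iff.2 hξ
    have hsq : ‖ξ‖ ^ 2 = ξ 0 ^ 2 + ξ 1 ^ 2 + ξ 2 ^ 2 := by
      rw [EuclideanSpace.norm_sq_eq, Fin.sum_univ_three]
      simp
    have hne : (ξ 0 ^ 2 + ξ 1 ^ 2 + ξ 2 ^ 2 : ℂ) ≠ 0 := by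
      have : ξ 0 ^ 2 + ξ 1 ^ 2 + ξ 2 ^ 2 ≠ 0 := by rw [← hsq]; positivity
      intro h0
      exact this (Complex.ofReal_eq_zero.1 (by push_cast; exact h0))
    have hpi : (Real.pi : ℂ) ≠ 0 := by exact_mod_cast Real.pi_ne_zero
    rw [Fin.sum_univ_three, hsq]
    push_cast
    field_simp
    linear_combination (4 * (ξ 0 ^ 2 + ξ 1 ^ 2 + ξ 2 ^ 2 : ℂ)) * lpSymbol φ 1 ξ * hI

theorem fourierMultiplier_lp_apply (hφ : IsLPBump φ) {N : ℝ} (hN : 0 < N) (ψ : 𝓢(E3, ℂ)) (y : E3) :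
    𝓕 (SchwartzMap.smulLeftCLM ℂ (lpSymbol φ N) (𝓕⁻ ψ)) y =
      ∫ z, ψ z * ((N : ℂ) ^ 3 * lpKernel hφ (N • (y - z))) := by
  have h := fourier_smulLeft_fourierInv (lpSchwartz hφ hN) ψ y
  have h1 := fourier_comp_smul (f := lpSchwartz hφ hN) (g := lpSchwartz hφ one_pos) hN
    fun ξ => lpSymbol_eq_comp φ N ξ
  simp only [h1] at h
  exact h

end Kernels

/-! ### Complex kernels -/

/-- Real part of a Schwartz function. -/
def reS (K : 𝓢(E3, ℂ)) : 𝓢(E3, ℝ) := SchwartzMap.postcompCLM Complex.reCLM K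

/-- Imaginary part of a Schwartz function. -/
def imS (K : 𝓢(E3, ℂ)) : 𝓢(E3, ℝ) := SchwartzMap.postcompCLM Complex.imCLM K

theorem reS_apply (K : 𝓢(E3, ℂ)) (x : E3) : reS K x = (K x).re := rfl

theorem imS_apply (K : 𝓢(E3, ℂ)) (x : E3) : imS K x = (K x).im := rfl

theorem reS_dC (i : Fin 3) (K : 𝓢(E3, ℂ)) : reS (dC i K) = dS i (reS K) := by
  ext x
  have h : HasFDerivAt (reS K) _ x := Complex.reCLM.hasFDerivAt.comp x (K.hasFDerivAt x)
  rw [dS_apply, h.fderiv]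
  rfl

theorem imS_dC (i : Fin 3) (K : 𝓢(E3, ℂ)) : imS (dC i K) = dS i (imS K) := by
  ext x
  have h : HasFDerivAt (imS K) _ x := Complex.imCLM.hasFDerivAt.comp x (K.hasFDerivAt x)
  rw [dS_apply, h.fderiv]
  rfl

/-- The pairing of `w` with a dilated and translated complex kernel. -/
def dilC (K : 𝓢(E3, ℂ)) (w : E3 → ℝ) (r : ℝ) (x : E3) : ℂ :=
  dil (reS K) w r x + dil (imS K) w r x * Complex.I

theorem Tempered.integrable_dilC {w : E3 → ℝ} (hw : Tempered w) (K : 𝓢(E3, ℂ)) {r : ℝ}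
    (hr : 0 < r) (x : E3) : Integrable fun y => (w y : ℂ) * K (r • (y - x)) := by
  have h1 : Integrable fun y => ((w y * reS K (r • (y - x)) : ℝ) : ℂ) :=
    (hw.integrable_dil (reS K) hr x).ofReal
  have h2 : Integrable fun y => ((w y * imS K (r • (y - x)) : ℝ) : ℂ) :=
    (hw.integrable_dil (imS K) hr x).ofReal
  refine (h1.add (h2.mul_const Complex.I)).congr (ae_of_all _ fun y => ?_)
  simp only [Pi.add_apply, reS_apply, imS_apply]
  push_cast
  conv_rhs => rw [← Complex.re_add_im (K (r • (y - x)))]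
  ring

theorem Tempered.dilC_eq {w : E3 → ℝ} (hw : Tempered w) (K : 𝓢(E3, ℂ)) {r : ℝ}
    (hr : 0 < r) (x : E3) : dilC K w r x = ∫ y, (w y : ℂ) * K (r • (y - x)) := by
  have h1 : Integrable fun y => ((w y * reS K (r • (y - x)) : ℝ) : ℂ) :=
    (hw.integrable_dil (reS K) hr x).ofReal
  have h2 : Integrable fun y => ((w y * imS K (r • (y - x)) : ℝ) : ℂ) :=
    (hw.integrable_dil (imS K) hr x).ofReal
  rw [dilC, dil, dil, ← integral_complex_ofReal, ← integral_complex_ofReal, ← integral_mul_const,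
    ← integral_add h1 (h2.mul_const Complex.I)]
  refine integral_congr_ae (ae_of_all _ fun y => ?_)
  simp only [reS_apply, imS_apply]
  push_cast
  conv_rhs => rw [← Complex.re_add_im (K (r • (y - x)))]
  ring

theorem Tempered.contDiff_dilC {w : E3 → ℝ} (hw : Tempered w) (K : 𝓢(E3, ℂ)) {r : ℝ}
    (hr : 0 < r) : ContDiff ℝ ∞ (dilC K w r) := by
  have h1 := hw.contDiff_dil (reS K) hr
  have h2 := hw.contDiff_dil (imS K) hr
  exact (Complex.ofRealCLM.contDiff.comp h1).add
    ((Complex.ofRealCLM.contDiff.comp h2).mul contDiff_const)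

theorem Tempered.fderiv_dilC {w : E3 → ℝ} (hw : Tempered w) (K : 𝓢(E3, ℂ)) {r : ℝ}
    (hr : 0 < r) (x : E3) (i : Fin 3) :
    fderiv ℝ (dilC K w r) x (e3 i) = -(r * dilC (dC i K) w r x) := by
  have h1 := ((hw.contDiff_dil (reS K) hr).differentiable (by simp) x).hasFDerivAt
  have h2 := ((hw.contDiff_dil (imS K) hr).differentiable (by simp) x).hasFDerivAt
  have h3 : HasFDerivAt (dilC K w r) _ x := (Complex.ofRealCLM.hasFDerivAt.comp x h1).add
    ((Complex.ofRealCLM.hasFDerivAt.comp x h2).mul_const Complex.I)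
  rw [h3.fderiv]
  simp only [_root_.add_apply, _root_.smul_apply, ContinuousLinearMap.comp_apply,
    hw.fderiv_dil _ hr, Complex.ofRealCLM_apply, dilC, reS_dC, imS_dC, smul_eq_mul]
  push_cast
  ring

end

section

/-! ### Littlewood-Paley projections of tempered functions -/

section Proj

open FourierTransform

variable {φ : E3 → ℝ} {N : ℝ}

/-- `g = P_N f` for scalar functions. -/
def ScalarProj (φ : E3 → ℝ) (N : ℝ) (f : E3 → ℝ) (g : E3 → ℂ) : Prop :=
  ∃ S : 𝓢(E3, ℂ) →L[ℂ] ℂ, (∀ ψ : 𝓢(E3, ℂ), HasCompactSupport ψ → S ψ = ∫ x, ψ x * (f x : ℂ)) ∧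
    ∀ ψ : 𝓢(E3, ℂ), HasCompactSupport ψ →
      S (𝓕 (SchwartzMap.smulLeftCLM ℂ (lpSymbol φ N) (𝓕⁻ ψ))) = ∫ x, ψ x * g x

theorem exists_decay_complex : ∃ C : ℝ, ∃ s : Finset (ℕ × ℕ), 0 ≤ C ∧
    ∀ g : 𝓢(E3, ℂ), ∀ z, ‖g z‖ ≤ C * s.sup (schwartzSeminormFamily ℂ E3 ℂ) g / (1 + ‖z‖) ^ 4 := by
  refine ⟨2 ^ 4, Finset.Iic (4, 0), by positivity, fun g z => ?_⟩
  have h := SchwartzMap.one_add_le_sup_seminorm_apply (𝕜 := ℂ) (m := (4, 0)) le_rfl le_rfl g z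
  rw [norm_iteratedFDeriv_zero] at h
  rw [le_div_iff₀ (by positivity), mul_comm]
  exact h

theorem Tempered.integrable_mul_complex {w : E3 → ℝ} (hw : Tempered w) (g : 𝓢(E3, ℂ)) :
    Integrable fun y => g y * (w y : ℂ) := by
  have h := hw.integrable_dilC g one_pos 0
  simpa [mul_comm] using h

/-- Integration against a tempered function as a distribution. -/
def Tempered.toDistribution {w : E3 → ℝ} (hw : Tempered w) : 𝓢(E3, ℂ) →L[ℂ] ℂ :=
  SchwartzMap.mkCLMtoNormedSpace (fun ψ => ∫ x, ψ x * (w x : ℂ))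
    (fun f g => by
      rw [← integral_add (hw.integrable_mul_complex f) (hw.integrable_mul_complex g)]
      exact integral_congr_ae (ae_of_all _ fun y => by simp [add_mul]))
    (fun a f => by
      rw [RingHom.id_apply, ← integral_smul]
      exact integral_congr_ae (ae_of_all _ fun y => by simp [mul_assoc]))
    (by
      obtain ⟨C, s, hC, h⟩ := exists_decay_complex
      refine ⟨s, C * ∫ y, |w y| / (1 + ‖y‖) ^ 4, by positivity, fun f => ?_⟩
      have hI : Integrable fun y => |w y| / (1 + ‖y‖) ^ 4 := by
        refine hw.int.norm.congr (ae_of_all _ fun y => ?_)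
        simp only [norm_div, Real.norm_eq_abs]
        rw [abs_of_nonneg (by positivity : (0 : ℝ) ≤ (1 + ‖y‖) ^ 4)]
      refine (norm_integral_le_of_norm_le (hI.const_mul
        (C * s.sup (schwartzSeminormFamily ℂ E3 ℂ) f)) (ae_of_all _ fun y => ?_)).trans
        (le_of_eq ?_)
      · rw [norm_mul, Complex.norm_real, Real.norm_eq_abs]
        refine (mul_le_mul_of_nonneg_right (h f y) (abs_nonneg _)).trans (le_of_eq (by ring))
      · rw [integral_const_mul]; ring)

theorem Tempered.toDistribution_apply {w : E3 → ℝ} (hw : Tempered w) (ψ : 𝓢(E3, ℂ)) :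
    hw.toDistribution ψ = ∫ x, ψ x * (w x : ℂ) := rfl

/-- Fubini against the convolution kernel. The test function has compact support, so the translates
of the kernel are dominated uniformly by a multiple of `(1 + |x|)⁻⁴`. -/
theorem Tempered.scalarProj {w : E3 → ℝ} (hw : Tempered w) (hφ : IsLPBump φ) (hN : 0 < N) :
    ScalarProj φ N w fun x => (N : ℂ) ^ 3 * dilC (lpKernel hφ) w N x := by
  refine ⟨hw.toDistribution, fun ψ _ => rfl, fun ψ hψ => ?_⟩
  rw [hw.toDistribution_apply]
  simp only [fourierMultiplier_lp_apply hφ hN, hw.dilC_eq _ hN, ← integral_const_mul,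
    ← integral_mul_const]
  set K := lpKernel hφ
  have hswap := integral_integral_swap (μ := volume) (ν := volume)
    (f := fun x z : E3 => ψ z * ((N : ℂ) ^ 3 * K (N • (x - z))) * (w x : ℂ)) ?_
  · rw [hswap]
    refine integral_congr_ae (ae_of_all _ fun z => ?_)
    exact integral_congr_ae (ae_of_all _ fun x => by ring)
  obtain ⟨X, hX⟩ := hψ.isCompact.isBounded.subset_closedBall (0 : E3)
  obtain ⟨C₁, hC₁, h₁⟩ := exists_dil_decay (reS K) 4 hN (X := X)
  obtain ⟨C₂, hC₂, h₂⟩ := exists_dil_decay (imS K) 4 hN (X := X)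
  have hcw := hw.cont
  have hmaj : Integrable (fun q : E3 × E3 => (N ^ 3 * (C₁ + C₂)) * (‖w q.1 / (1 + ‖q.1‖) ^ 4‖ *
      ‖ψ q.2‖)) (volume.prod volume) :=
    (Integrable.mul_prod (f := fun x => ‖w x / (1 + ‖x‖) ^ 4‖) (g := fun z => ‖ψ z‖) hw.int.norm
      ψ.integrable.norm).const_mul _
  refine hmaj.mono ?_ (ae_of_all _ fun q => ?_)
  · exact (by fun_prop : Continuous fun q : E3 × E3 =>
      ψ q.2 * ((N : ℂ) ^ 3 * K (N • (q.1 - q.2))) * (w q.1 : ℂ)).aestronglyMeasurable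
  · simp only [Function.uncurry]
    by_cases hq : ψ q.2 = 0
    · simp only [hq, zero_mul, norm_zero]; positivity
    have hq2 : ‖q.2‖ ≤ X := by
      simpa using hX (subset_tsupport _ hq)
    have hK : ‖K (N • (q.1 - q.2))‖ ≤ (C₁ + C₂) / (1 + ‖q.1‖) ^ 4 := by
      refine (Complex.norm_le_abs_re_add_abs_im _).trans ?_
      rw [add_div]
      exact add_le_add (h₁ N le_rfl _ hq2 _) (h₂ N le_rfl _ hq2 _)
    have hN3 : ‖(N : ℂ) ^ 3‖ = N ^ 3 := by
      rw [norm_pow, Complex.norm_real, Real.norm_of_nonneg hN.le]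
    simp only [norm_mul, hN3, norm_norm, norm_div, Complex.norm_real]
    rw [Real.norm_of_nonneg (by positivity : (0 : ℝ) ≤ (1 + ‖q.1‖) ^ 4),
      Real.norm_of_nonneg (by positivity : (0 : ℝ) ≤ N ^ 3),
      Real.norm_of_nonneg (by positivity : (0 : ℝ) ≤ C₁ + C₂)]
    calc ‖ψ q.2‖ * (N ^ 3 * ‖K (N • (q.1 - q.2))‖) * ‖w q.1‖
        ≤ ‖ψ q.2‖ * (N ^ 3 * ((C₁ + C₂) / (1 + ‖q.1‖) ^ 4)) * ‖w q.1‖ := by gcongr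
      _ = _ := by ring

theorem integral_dC_mul {f : E3 → ℂ} (hf : ContDiff ℝ 1 f) {ψ : 𝓢(E3, ℂ)}
    (hψ : HasCompactSupport ψ) (i : Fin 3) :
    ∫ x, dC i ψ x * f x = -∫ x, ψ x * fderiv ℝ f x (e3 i) := by
  have hd : HasCompactSupport (dC i ψ) := hψ.fderiv_apply ℝ (e3 i)
  have h1 : Continuous fun x => fderiv ℝ f x (e3 i) :=
    (hf.continuous_fderiv one_ne_zero).clm_apply continuous_const
  rw [eq_comm, neg_eq_iff_eq_neg]
  exact integral_mul_fderiv_eq_neg_fderiv_mul_of_integrable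
    (((dC i ψ).continuous.mul hf.continuous).integrable_of_hasCompactSupport hd.mul_right)
    ((ψ.continuous.mul h1).integrable_of_hasCompactSupport hψ.mul_right)
    ((ψ.continuous.mul hf.continuous).integrable_of_hasCompactSupport hψ.mul_right)
    (fun x _ => ψ.differentiableAt) (fun x _ => hf.differentiable one_ne_zero x)

/-- The distributional derivative of the distribution of `f` represents `∂ᵢ f`, with no growth
condition on `∂ᵢ f`, and it commutes with the multiplier. This is how the vorticity, for which no
bound is known, is handled. -/
theorem ScalarProj.pd {f : E3 → ℝ} {g : E3 → ℂ} (h : ScalarProj φ N f g) (hφ : IsLPBump φ)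
    (hN : 0 < N) (hf : ContDiff ℝ 1 f)
    (hg : ContDiff ℝ 1 g) (i : Fin 3) :
    ScalarProj φ N (pd i f) fun x => fderiv ℝ g x (e3 i) := by
  obtain ⟨S, h1, h2⟩ := h
  refine ⟨-(S.comp (LineDeriv.lineDerivOpCLM ℂ 𝓢(E3, ℂ) (e3 i))), fun ψ hψ => ?_, fun ψ hψ => ?_⟩
  · have hd : HasCompactSupport (dC i ψ) := hψ.fderiv_apply ℝ (e3 i)
    have h3 := h1 (dC i ψ) hd
    have hfc : ContDiff ℝ 1 fun x => (f x : ℂ) := Complex.ofRealCLM.contDiff.comp hf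
    rw [integral_dC_mul hfc hψ] at h3
    change -S (dC i ψ) = _
    rw [h3, neg_neg]
    refine integral_congr_ae (ae_of_all _ fun x => ?_)
    have h4 : HasFDerivAt (fun x => (f x : ℂ)) _ x := Complex.ofRealCLM.hasFDerivAt.comp x
      (hf.differentiable one_ne_zero x).hasFDerivAt
    simp only [h4.fderiv]
    rfl
  · have hd : HasCompactSupport (dC i ψ) := hψ.fderiv_apply ℝ (e3 i)
    change -S (dC i (𝓕 (SchwartzMap.smulLeftCLM ℂ (lpSymbol φ N) (𝓕⁻ ψ)))) = _
    have h5 := dC_fourier_smulLeft_fourierInv (lpSchwartz hφ hN) ψ i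
    have h6 : (lpSchwartz hφ hN : E3 → ℂ) = lpSymbol φ N := rfl
    rw [h6] at h5
    rw [h5, h2 _ hd, integral_dC_mul hg hψ, neg_neg]

theorem ScalarProj.sub {f₁ f₂ : E3 → ℝ} {g₁ g₂ : E3 → ℂ} (h₁ : ScalarProj φ N f₁ g₁)
    (h₂ : ScalarProj φ N f₂ g₂) (hf₁ : Continuous f₁) (hf₂ : Continuous f₂)
    (hg₁ : Continuous g₁) (hg₂ : Continuous g₂) :
    ScalarProj φ N (fun x => f₁ x - f₂ x) fun x => g₁ x - g₂ x := by
  obtain ⟨S₁, h11, h12⟩ := h₁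
  obtain ⟨S₂, h21, h22⟩ := h₂
  have key : ∀ (ψ : 𝓢(E3, ℂ)), HasCompactSupport ψ → ∀ {a b : E3 → ℂ}, Continuous a →
      Continuous b → (∫ x, ψ x * a x) - ∫ x, ψ x * b x = ∫ x, ψ x * (a x - b x) := by
    intro ψ hψ a b ha hb
    have hI : ∀ {a : E3 → ℂ}, Continuous a → Integrable fun x => ψ x * a x := fun ha =>
      (ψ.continuous.mul ha).integrable_of_hasCompactSupport hψ.mul_right
    rw [← integral_sub (hI ha) (hI hb)]
    exact integral_congr_ae (ae_of_all _ fun x => (mul_sub _ _ _).symm)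
  refine ⟨S₁ - S₂, fun ψ hψ => ?_, fun ψ hψ => ?_⟩
  · rw [_root_.sub_apply, h11 ψ hψ, h21 ψ hψ, key ψ hψ (by fun_prop) (by fun_prop)]
    simp
  · rw [_root_.sub_apply, h12 ψ hψ, h22 ψ hψ, key ψ hψ hg₁ hg₂]

theorem isLPProjection_of_scalar {f : E3 → E3} {g : Fin 3 → E3 → ℂ} (hf : Continuous f)
    (hg : ∀ k, Continuous (g k)) (h : ∀ k, ScalarProj φ N (fun x => f x k) (g k)) :
    IsLPProjection φ N f fun x => WithLp.toLp 2 fun k => g k x := by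
  choose S h1 h2 using h
  have hc : Continuous fun x => (WithLp.toLp 2 fun k => g k x : C3) :=
    (PiLp.continuous_toLp 2 _).comp (continuous_pi hg)
  have hc' : Continuous fun x => toC3 (f x) := by
    unfold toC3
    exact (PiLp.continuous_toLp 2 _).comp (by fun_prop)
  let T : 𝓢(E3, ℂ) →L[ℂ] C3 :=
    ((PiLp.continuousLinearEquiv 2 ℂ fun _ : Fin 3 => ℂ).symm : (Fin 3 → ℂ) →L[ℂ] C3).comp
      (ContinuousLinearMap.pi S)
  have hT : ∀ ψ, T ψ = WithLp.toLp 2 fun k => S k ψ := fun ψ => rfl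
  have key : ∀ (ψ : 𝓢(E3, ℂ)), HasCompactSupport ψ → ∀ {a : Fin 3 → E3 → ℂ},
      Continuous (fun x => (WithLp.toLp 2 fun k => a k x : C3)) →
      (WithLp.toLp 2 fun k => ∫ x, ψ x * a k x : C3) =
        ∫ x, ψ x • (WithLp.toLp 2 fun k => a k x : C3) := by
    intro ψ hψ a ha
    ext k
    have hI : Integrable fun x => ψ x • (WithLp.toLp 2 fun k => a k x : C3) :=
      (ψ.continuous.smul ha).integrable_of_hasCompactSupport hψ.smul_right
    have := (EuclideanSpace.proj k : C3 →L[ℂ] ℂ).integral_comp_comm hI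
    simpa using this
  refine ⟨hc, ContinuousLinearMap.toPointwiseConvergenceCLM _ _ _ _ T,
    ⟨hc'.locallyIntegrable, fun ψ hψ => ?_⟩, ⟨hc.locallyIntegrable, fun ψ hψ => ?_⟩⟩
  · change T ψ = _
    rw [hT]
    simp only [h1 _ ψ hψ]
    exact key ψ hψ hc'
  · rw [TemperedDistribution.fourierMultiplierCLM_apply_apply]
    change T _ = _
    rw [hT]
    simp only [h2 _ ψ hψ]
    exact key ψ hψ hc

end Proj

end

section

/-! ### Pointwise estimates for the projections of a flow -/

/-- The Laplacian on complex-valued Schwartz functions. -/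
def lapC (g : 𝓢(E3, ℂ)) : 𝓢(E3, ℂ) := ∑ i, dC i (dC i g)

theorem reS_lapC (g : 𝓢(E3, ℂ)) : reS (lapC g) = lapS (reS g) := by
  simp only [lapS, lapC, ← reS_dC]
  exact map_sum (SchwartzMap.postcompCLM (𝕜 := ℝ) (E := E3) Complex.reCLM) _ _

theorem imS_lapC (g : 𝓢(E3, ℂ)) : imS (lapC g) = lapS (imS g) := by
  simp only [lapS, lapC, ← imS_dC]
  exact map_sum (SchwartzMap.postcompCLM (𝕜 := ℝ) (E := E3) Complex.imCLM) _ _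

theorem dC_lapC (i : Fin 3) (g : 𝓢(E3, ℂ)) : dC i (lapC g) = lapC (dC i g) := by
  have h1 : reS (dC i (lapC g)) = reS (lapC (dC i g)) := by
    rw [reS_dC, reS_lapC, reS_lapC, reS_dC, dS_lapS]
  have h2 : imS (dC i (lapC g)) = imS (lapC (dC i g)) := by
    rw [imS_dC, imS_lapC, imS_lapC, imS_dC, dS_lapS]
  ext x
  exact Complex.ext (DFunLike.congr_fun h1 x) (DFunLike.congr_fun h2 x)

/-- The two parts of the time derivative are `r² · M / r²` and `r · M² / r`: the scale drops out,
and `M ≤ M²` because `1 ≤ M`. -/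
theorem exists_dil_bounds (κ : 𝓢(E3, ℝ)) : ∃ C : ℝ, 0 < C ∧ ∀ {a b M : ℝ} {u : ℝ → E3 → E3}
    {p : ℝ → E3 → ℝ}, NSFlow a b M u p → ∀ (k : Fin 3) (t : ℝ) {r : ℝ}, 0 < r → ∀ x,
    |dil (lapS κ) (fun y => u t y k) r x| ≤ C * (M / r ^ 2) ∧ (t ∈ Icc a b → ∃ D : ℝ,
      HasDerivWithinAt (fun t => dil (lapS κ) (fun y => u t y k) r x) D (Icc a b) t ∧
        |D| ≤ C * M ^ 2) := by
  obtain ⟨C₁, hC₁, h₁⟩ := NSFlow.exists_abs_dil_comp_le (lapS κ)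
  obtain ⟨C₂, hC₂, h₂⟩ := NSFlow.exists_abs_dil_comp_le (lapS (lapS κ))
  obtain ⟨C₃, hC₃, h₃⟩ := NSFlow.exists_abs_nonlinDil_le κ
  refine ⟨C₁ + C₂ + C₃, by positivity, fun {a b M u p} h k t r hr x => ⟨?_, fun ht =>
    ⟨_, h.hasDerivWithinAt_dil κ k hr x ht, ?_⟩⟩⟩
  · refine (h₁ h k t hr x).trans ?_
    have := h.M_pos
    gcongr
    linarith
  · have hM := h.M_pos
    have h1 := h.one_le
    refine (abs_add_le _ _).trans ?_
    rw [abs_mul, abs_mul, abs_of_pos hr, abs_of_pos (pow_pos hr 2)]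
    calc r ^ 2 * |dil (lapS (lapS κ)) (fun y => u t y k) r x| + r * |nonlinDil u κ k r x t|
        ≤ r ^ 2 * (C₂ * (M / r ^ 2)) + r * (C₃ * (M ^ 2 / r)) := by
          gcongr
          · exact h₂ h k t hr x
          · exact h₃ h k t hr x
      _ = C₂ * M + C₃ * M ^ 2 := by field_simp
      _ ≤ C₂ * M ^ 2 + C₃ * M ^ 2 := by gcongr; nlinarith
      _ ≤ _ := by nlinarith [sq_nonneg M]

theorem exists_dilC_bounds (κ : 𝓢(E3, ℂ)) : ∃ C : ℝ, 0 < C ∧ ∀ {a b M : ℝ} {u : ℝ → E3 → E3}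
    {p : ℝ → E3 → ℝ}, NSFlow a b M u p → ∀ (k : Fin 3) (t : ℝ) {r : ℝ}, 0 < r → ∀ x,
    ‖dilC (lapC κ) (fun y => u t y k) r x‖ ≤ C * (M / r ^ 2) ∧ (t ∈ Icc a b → ∃ D : ℂ,
      HasDerivWithinAt (fun t => dilC (lapC κ) (fun y => u t y k) r x) D (Icc a b) t ∧
        ‖D‖ ≤ C * M ^ 2) := by
  obtain ⟨C₁, hC₁, h₁⟩ := exists_dil_bounds (reS κ)
  obtain ⟨C₂, hC₂, h₂⟩ := exists_dil_bounds (imS κ)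
  have hn : ∀ a b : ℝ, ‖(a : ℂ) + b * Complex.I‖ ≤ |a| + |b| := fun a b => by
    refine (norm_add_le _ _).trans ?_
    simp
  refine ⟨C₁ + C₂, by positivity, fun {a b M u p} h k t r hr x => ⟨?_, fun ht => ?_⟩⟩
  · rw [dilC, reS_lapC, imS_lapC, add_mul]
    exact (hn _ _).trans (add_le_add (h₁ h k t hr x).1 (h₂ h k t hr x).1)
  · obtain ⟨D₁, hd₁, hD₁⟩ := (h₁ h k t hr x).2 ht
    obtain ⟨D₂, hd₂, hD₂⟩ := (h₂ h k t hr x).2 ht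
    refine ⟨D₁ + D₂ * Complex.I, ?_, ?_⟩
    · simp only [dilC, reS_lapC, imS_lapC]
      exact hd₁.ofReal_comp.add (hd₂.ofReal_comp.mul_const _)
    · rw [add_mul]
      exact (hn _ _).trans (add_le_add hD₁ hD₂)

theorem norm_toLp_le {v : Fin 3 → ℂ} {B : ℝ} (h : ∀ k, ‖v k‖ ≤ B) :
    ‖(WithLp.toLp 2 v : C3)‖ ≤ 3 * B := by
  have hB : 0 ≤ B := (norm_nonneg _).trans (h 0)
  rw [EuclideanSpace.norm_eq, Fin.sum_univ_three]
  refine Real.sqrt_le_iff.2 ⟨by positivity, ?_⟩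
  have := fun k => pow_le_pow_left₀ (norm_nonneg _) (h k) 2
  have h0 := this 0
  have h1 := this 1
  have h2 := this 2
  nlinarith [sq_nonneg B]

theorem hasFDerivAt_toLp {g : Fin 3 → E3 → ℂ} {x : E3} (hg : ∀ k, DifferentiableAt ℝ (g k) x)
    {B : ℝ} (h : ∀ k i, ‖fderiv ℝ (g k) x (e3 i)‖ ≤ B) :
    DifferentiableAt ℝ (fun x => (WithLp.toLp 2 fun k => g k x : C3)) x ∧
      ‖fderiv ℝ (fun x => (WithLp.toLp 2 fun k => g k x : C3)) x‖ ≤ 9 * B := by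
  have hB : 0 ≤ B := (norm_nonneg _).trans (h 0 0)
  let L : (Fin 3 → ℂ) →L[ℝ] C3 := (PiLp.continuousLinearEquiv 2 ℝ fun _ : Fin 3 => ℂ).symm
  have h1 : HasFDerivAt (fun x => (WithLp.toLp 2 fun k => g k x : C3))
      (L.comp (ContinuousLinearMap.pi fun k => fderiv ℝ (g k) x)) x :=
    L.hasFDerivAt.comp x (hasFDerivAt_pi.2 fun k => (hg k).hasFDerivAt)
  refine ⟨h1.differentiableAt, ?_⟩
  rw [h1.fderiv]
  refine ContinuousLinearMap.opNorm_le_bound _ (by positivity) fun v => ?_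
  have h2 : ∀ k, ‖fderiv ℝ (g k) x v‖ ≤ 3 * B * ‖v‖ := fun k => by
    conv_lhs => rw [← sum_coord_smul_e3 v]
    rw [map_sum]
    refine (norm_sum_le _ _).trans ?_
    have h3 : ∀ i ∈ Finset.univ, ‖fderiv ℝ (g k) x (v i • e3 i)‖ ≤ ‖v‖ * B := fun i _ => by
      rw [map_smul, norm_smul, Real.norm_eq_abs]
      exact mul_le_mul (abs_coord_le v i) (h k i) (norm_nonneg _) (norm_nonneg _)
    refine (Finset.sum_le_sum h3).trans (le_of_eq ?_)
    simp
    ring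
  exact (norm_toLp_le h2).trans (le_of_eq (by ring))

theorem hasDerivWithinAt_toLp {g : Fin 3 → ℝ → ℂ} {a b t : ℝ} (hab : a < b) (ht : t ∈ Icc a b)
    {B : ℝ} (h : ∀ k, ∃ D, HasDerivWithinAt (g k) D (Icc a b) t ∧ ‖D‖ ≤ B) :
    DifferentiableWithinAt ℝ (fun s => (WithLp.toLp 2 fun k => g k s : C3)) (Icc a b) t ∧
      ‖derivWithin (fun s => (WithLp.toLp 2 fun k => g k s : C3)) (Icc a b) t‖ ≤ 3 * B := by
  choose D hD hB using h
  let L : (Fin 3 → ℂ) →L[ℝ] C3 := (PiLp.continuousLinearEquiv 2 ℝ fun _ : Fin 3 => ℂ).symm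
  have h1 : HasDerivWithinAt (fun s => (WithLp.toLp 2 fun k => g k s : C3))
      (WithLp.toLp 2 D) (Icc a b) t :=
    L.hasFDerivAt.comp_hasDerivWithinAt t (hasDerivWithinAt_pi.2 hD)
  refine ⟨h1.differentiableWithinAt, ?_⟩
  rw [h1.derivWithin (uniqueDiffOn_Icc hab t ht)]
  exact norm_toLp_le hB

theorem curl_apply (v : E3 → E3) (x : E3) (c : Fin 3) :
    curl v x c = pderiv (c + 1) (c + 2) v x - pderiv (c + 2) (c + 1) v x := by
  fin_cases c <;> simp [curl]

variable {φ : E3 → ℝ} {a b M : ℝ} {u : ℝ → E3 → E3} {p : ℝ → E3 → ℝ}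

/-- Components of `P_N u`. -/
def lpComp (hφ : IsLPBump φ) (N : ℝ) (u : E3 → E3) (k : Fin 3) (x : E3) : ℂ :=
  (N : ℂ) ^ 3 * dilC (lapC (invLapKernel hφ)) (fun y => u y k) N x

/-- Components of `P_N ω`. -/
def lpCurl (hφ : IsLPBump φ) (N : ℝ) (u : E3 → E3) (c : Fin 3) (x : E3) : ℂ :=
  (N : ℂ) ^ 4 * (dilC (lapC (dC (c + 2) (invLapKernel hφ))) (fun y => u y (c + 1)) N x -
    dilC (lapC (dC (c + 1) (invLapKernel hφ))) (fun y => u y (c + 2)) N x)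

theorem Tempered.fderiv_const_mul_dilC {w : E3 → ℝ} (hw : Tempered w) (c : ℂ) (κ : 𝓢(E3, ℂ))
    {r : ℝ} (hr : 0 < r) (x : E3) (i : Fin 3) :
    fderiv ℝ (fun x => c * dilC (lapC κ) w r x) x (e3 i) =
      c * -(r * dilC (lapC (dC i κ)) w r x) := by
  have h := ((hw.contDiff_dilC (lapC κ) hr).differentiable (by simp) x).hasFDerivAt.const_mul c
  rw [h.fderiv, _root_.smul_apply, hw.fderiv_dilC _ hr, dC_lapC, smul_eq_mul]

namespace NSFlow

theorem isLPProjection (h : NSFlow a b M u p) (hφ : IsLPBump φ) {N : ℝ} (hN : 0 < N) (t : ℝ) :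
    IsLPProjection φ N (u t) fun x => WithLp.toLp 2 fun k => lpComp hφ N (u t) k x := by
  refine isLPProjection_of_scalar (h.cont_slice t) (fun k => ?_) fun k => ?_
  · exact continuous_const.mul (((h.tempered_comp k).tempered t).contDiff_dilC _ hN).continuous
  · have := ((h.tempered_comp k).tempered t).scalarProj hφ hN
    rwa [lpKernel_eq] at this

/-- The curl is never integrated against a kernel directly; its projection is obtained by
differentiating those of the components of `u`. -/
theorem isLPProjection_curl (h : NSFlow a b M u p) (hφ : IsLPBump φ) {N : ℝ} (hN : 0 < N) {t : ℝ}
    (ht : t ∈ Icc a b) :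
    IsLPProjection φ N (curl (u t)) fun x => WithLp.toLp 2 fun c => lpCurl hφ N (u t) c x := by
  have hT := fun k => (h.tempered_comp k).tempered t
  have hu1 : ∀ j, ContDiff ℝ 1 fun y => u t y j := fun j =>
    (h.contDiff_comp ht j).of_le one_le_infty
  have hpd : ∀ i j, Continuous (pd i fun y => u t y j) := fun i j =>
    (contDiff_pd (m := 0) (hu1 j) (by norm_num) i).continuous
  have hcurl : ∀ c, (fun x => curl (u t) x c) = fun x => pd (c + 1) (fun y => u t y (c + 2)) x -
      pd (c + 2) (fun y => u t y (c + 1)) x := fun c => by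
    ext x
    rw [curl_apply, h.pderiv_eq ht, h.pderiv_eq ht]
  have hg : ∀ j, ContDiff ℝ 1 (lpComp hφ N (u t) j) := fun j =>
    contDiff_const.mul (((hT j).contDiff_dilC _ hN).of_le one_le_infty)
  have hgd : ∀ i j, Continuous fun x => fderiv ℝ (lpComp hφ N (u t) j) x (e3 i) := fun i j =>
    ((hg j).continuous_fderiv one_ne_zero).clm_apply continuous_const
  have hP : ∀ i j, ScalarProj φ N (pd i fun y => u t y j)
      fun x => fderiv ℝ (lpComp hφ N (u t) j) x (e3 i) := fun i j => by
    have := (hT j).scalarProj hφ hN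
    rw [lpKernel_eq] at this
    exact this.pd hφ hN (hu1 j) (hg j) i
  -- Differentiating in the centre of the kernel gives a minus sign, which explains the order of the
  -- two terms in `lpCurl`.
  have hE : ∀ c, lpCurl hφ N (u t) c = fun x =>
      fderiv ℝ (lpComp hφ N (u t) (c + 2)) x (e3 (c + 1)) -
      fderiv ℝ (lpComp hφ N (u t) (c + 1)) x (e3 (c + 2)) := fun c => by
    ext x
    unfold lpComp
    rw [(hT _).fderiv_const_mul_dilC _ _ hN, (hT _).fderiv_const_mul_dilC _ _ hN, lpCurl]
    ring
  refine isLPProjection_of_scalar ?_ (fun c => ?_) fun c => ?_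
  · have h1 : Continuous fun x => WithLp.toLp 2 fun c => curl (u t) x c := by
      refine (PiLp.continuous_toLp 2 _).comp (continuous_pi fun c => ?_)
      have := (hpd (c + 1) (c + 2)).sub (hpd (c + 2) (c + 1))
      exact (this.congr fun x => (congrFun (hcurl c) x).symm)
    exact h1
  · rw [hE]
    exact (hgd _ _).sub (hgd _ _)
  · rw [hcurl, hE]
    exact (hP _ _).sub (hP _ _) (hpd _ _) (hpd _ _) (hgd _ _) (hgd _ _)

/-- Bernstein-type bounds for the Littlewood-Paley projections of a flow. -/
theorem exists_lp_bounds (hφ : IsLPBump φ) : ∃ C : ℝ, 0 < C ∧ ∀ {a b M : ℝ} {u : ℝ → E3 → E3}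
    {p : ℝ → E3 → ℝ}, NSFlow a b M u p → ∀ {N : ℝ}, 0 < N → ∀ t ∈ Icc a b, ∀ x : E3,
      ‖lpProj φ N (u t) x‖ ≤ C * (M * N) ∧
      (DifferentiableAt ℝ (lpProj φ N (u t)) x ∧
        ‖fderiv ℝ (lpProj φ N (u t)) x‖ ≤ C * (M * N ^ 2)) ∧
      (DifferentiableWithinAt ℝ (fun s => lpProj φ N (u s) x) (Icc a b) t ∧
        ‖derivWithin (fun s => lpProj φ N (u s) x) (Icc a b) t‖ ≤ C * (M ^ 2 * N ^ 3)) ∧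
      ‖lpProj φ N (curl (u t)) x‖ ≤ C * (M * N ^ 2) ∧
      (DifferentiableAt ℝ (lpProj φ N (curl (u t))) x ∧
        ‖fderiv ℝ (lpProj φ N (curl (u t))) x‖ ≤ C * (M * N ^ 3)) ∧
      (DifferentiableWithinAt ℝ (fun s => lpProj φ N (curl (u s)) x) (Icc a b) t ∧
        ‖derivWithin (fun s => lpProj φ N (curl (u s)) x) (Icc a b) t‖ ≤
          C * (M ^ 2 * N ^ 4)) := by
  set κ := invLapKernel hφ with hκ
  obtain ⟨C₀, hC₀, h₀⟩ := exists_dilC_bounds κ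
  choose C₁ hC₁ h₁ using fun i => exists_dilC_bounds (dC i κ)
  choose C₂ hC₂ h₂ using fun i j => exists_dilC_bounds (dC i (dC j κ))
  set A := C₀ + ∑ i, C₁ i + ∑ i, ∑ j, C₂ i j with hA
  have hs1 : ∀ i, C₁ i ≤ ∑ i, C₁ i := fun i =>
    Finset.single_le_sum (fun j _ => (hC₁ j).le) (Finset.mem_univ i)
  have hs2 : ∀ i j, C₂ i j ≤ ∑ i, ∑ j, C₂ i j := fun i j =>
    (Finset.single_le_sum (f := fun j => C₂ i j) (fun j _ => (hC₂ i j).le)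
      (Finset.mem_univ j)).trans (Finset.single_le_sum (f := fun i => ∑ j, C₂ i j)
      (fun i _ => Finset.sum_nonneg fun j _ => (hC₂ i j).le) (Finset.mem_univ i))
  have hp1 : 0 ≤ ∑ i, C₁ i := Finset.sum_nonneg fun i _ => (hC₁ i).le
  have hp2 : 0 ≤ ∑ i, ∑ j, C₂ i j :=
    Finset.sum_nonneg fun i _ => Finset.sum_nonneg fun j _ => (hC₂ i j).le
  have hA0 : C₀ ≤ A := by linarith
  have hA1 : ∀ i, C₁ i ≤ A := fun i => by linarith [hs1 i]
  have hA2 : ∀ i j, C₂ i j ≤ A := fun i j => by linarith [hs2 i j]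
  have hApos : 0 < A := hC₀.trans_le hA0
  -- A factor 9 passes from the entries of the derivative to its operator norm, a factor 2 from the
  -- two terms in each component of the curl.
  refine ⟨18 * A, by positivity, fun {a b M u p} h N hN t ht x => ?_⟩
  have hM := h.M_pos
  have hT := fun k s => (h.tempered_comp k).tempered s
  have hNn : ∀ n : ℕ, ‖(N : ℂ) ^ n‖ = N ^ n := fun n => by
    rw [norm_pow, Complex.norm_real, Real.norm_of_nonneg hN.le]
  have hNr : ‖(N : ℂ)‖ = N := by rw [Complex.norm_real, Real.norm_of_nonneg hN.le]
  have hu : ∀ s, lpProj φ N (u s) = fun x => WithLp.toLp 2 fun k => lpComp hφ N (u s) k x :=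
    fun s => lpProj_eq (h.isLPProjection hφ hN s)
  have hω : ∀ s ∈ Icc a b, lpProj φ N (curl (u s)) =
      fun x => WithLp.toLp 2 fun k => lpCurl hφ N (u s) k x :=
    fun s hs => lpProj_eq (h.isLPProjection_curl hφ hN hs)
  have b0 : ∀ k x, ‖dilC (lapC κ) (fun y => u t y k) N x‖ ≤ A * (M / N ^ 2) := fun k x =>
    ((h₀ h k t hN x).1).trans (by gcongr)
  have b1 : ∀ i k x, ‖dilC (lapC (dC i κ)) (fun y => u t y k) N x‖ ≤ A * (M / N ^ 2) :=
    fun i k x => ((h₁ i h k t hN x).1).trans (by gcongr; exact hA1 i)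
  have b2 : ∀ i j k x, ‖dilC (lapC (dC i (dC j κ))) (fun y => u t y k) N x‖ ≤ A * (M / N ^ 2) :=
    fun i j k x => ((h₂ i j h k t hN x).1).trans (by gcongr; exact hA2 i j)
  have hdiff : ∀ (κ : 𝓢(E3, ℂ)) (k : Fin 3) x,
      DifferentiableAt ℝ (dilC (lapC κ) (fun y => u t y k) N) x := fun κ k x =>
    ((hT k t).contDiff_dilC _ hN).differentiable (by simp) x
  have hprod : 0 ≤ A * (M * N) ∧ 0 ≤ A * (M * N ^ 2) ∧ 0 ≤ A * (M * N ^ 3) ∧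
    0 ≤ A * (M ^ 2 * N ^ 3) ∧ 0 ≤ A * (M ^ 2 * N ^ 4) := by
    refine ⟨?_, ?_, ?_, ?_, ?_⟩ <;> positivity
  obtain ⟨q1, q2, q3, q4, q5⟩ := hprod
  refine ⟨?_, ?_, ?_, ?_, ?_, ?_⟩
  · rw [hu]
    refine (norm_toLp_le (B := A * (M * N)) fun k => ?_).trans (by linarith)
    rw [lpComp, norm_mul, hNn]
    calc N ^ 3 * _ ≤ N ^ 3 * (A * (M / N ^ 2)) := by gcongr; exact b0 k x
      _ = _ := by field_simp
  · rw [hu]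
    have := hasFDerivAt_toLp (g := fun k => lpComp hφ N (u t) k) (x := x) (B := A * (M * N ^ 2))
      (fun k => (hdiff κ k x).const_mul _) fun k i => ?_
    · exact ⟨this.1, this.2.trans (by linarith)⟩
    unfold lpComp
    rw [(hT k t).fderiv_const_mul_dilC _ _ hN, norm_mul, norm_neg, norm_mul, hNn, hNr]
    calc N ^ 3 * (N * _) ≤ N ^ 3 * (N * (A * (M / N ^ 2))) := by gcongr; exact b1 i k x
      _ = _ := by field_simp
  · have := hasDerivWithinAt_toLp (g := fun k s => lpComp hφ N (u s) k x) h.lt ht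
      (B := A * (M ^ 2 * N ^ 3)) fun k => ?_
    · simp only [hu]
      exact ⟨this.1, this.2.trans (by linarith)⟩
    obtain ⟨D, hD, hB⟩ := (h₀ h k t hN x).2 ht
    refine ⟨_, hD.const_mul _, ?_⟩
    rw [norm_mul, hNn]
    calc N ^ 3 * ‖D‖ ≤ N ^ 3 * (A * M ^ 2) := by
          gcongr
          exact hB.trans (by gcongr)
      _ = _ := by ring
  · rw [hω t ht]
    refine (norm_toLp_le (B := 2 * (A * (M * N ^ 2))) fun k => ?_).trans (by linarith)
    rw [lpCurl, norm_mul, hNn]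
    calc N ^ 4 * _ ≤ N ^ 4 * (A * (M / N ^ 2) + A * (M / N ^ 2)) := by
          gcongr
          exact (norm_sub_le _ _).trans (add_le_add (b1 _ _ x) (b1 _ _ x))
      _ = _ := by field_simp; ring
  · rw [hω t ht]
    have hd := fun k => ((hdiff (dC (k + 2) κ) (k + 1) x).const_mul ((N : ℂ) ^ 4)).sub
      ((hdiff (dC (k + 1) κ) (k + 2) x).const_mul ((N : ℂ) ^ 4))
    have heq : ∀ k, lpCurl hφ N (u t) k =
        (fun x => (N : ℂ) ^ 4 * dilC (lapC (dC (k + 2) κ)) (fun y => u t y (k + 1)) N x) -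
        fun x => (N : ℂ) ^ 4 * dilC (lapC (dC (k + 1) κ)) (fun y => u t y (k + 2)) N x :=
      fun k => by
        ext x
        rw [lpCurl, Pi.sub_apply]
        ring
    have := hasFDerivAt_toLp (g := fun k => lpCurl hφ N (u t) k) (x := x)
      (B := 2 * (A * (M * N ^ 3))) (fun k => by rw [heq]; exact hd k) fun k i => ?_
    · exact ⟨this.1, this.2.trans (by linarith)⟩
    rw [heq, fderiv_sub ((hdiff (dC (k + 2) κ) (k + 1) x).const_mul _)
      ((hdiff (dC (k + 1) κ) (k + 2) x).const_mul _), _root_.sub_apply,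
      (hT _ t).fderiv_const_mul_dilC _ _ hN, (hT _ t).fderiv_const_mul_dilC _ _ hN]
    refine (norm_sub_le _ _).trans ?_
    rw [norm_mul, norm_neg, norm_mul, norm_mul, norm_neg, norm_mul, hNn, hNr]
    calc N ^ 4 * (N * _) + N ^ 4 * (N * _) ≤ N ^ 4 * (N * (A * (M / N ^ 2))) +
          N ^ 4 * (N * (A * (M / N ^ 2))) := by
          gcongr
          · exact b2 _ _ _ x
          · exact b2 _ _ _ x
      _ = _ := by field_simp; ring
  · have := hasDerivWithinAt_toLp (g := fun k s => lpCurl hφ N (u s) k x) h.lt ht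
      (B := 2 * (A * (M ^ 2 * N ^ 4))) fun k => ?_
    · have hcongr : EqOn (fun s => lpProj φ N (curl (u s)) x)
          (fun s => WithLp.toLp 2 fun k => lpCurl hφ N (u s) k x) (Icc a b) := fun s hs => by
        simp only [hω s hs]
      rw [derivWithin_congr hcongr (hcongr ht)]
      exact ⟨this.1.congr hcongr (hcongr ht), this.2.trans (by linarith)⟩
    obtain ⟨D, hD, hB⟩ := (h₁ (k + 2) h (k + 1) t hN x).2 ht
    obtain ⟨D', hD', hB'⟩ := (h₁ (k + 1) h (k + 2) t hN x).2 ht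
    refine ⟨_, (hD.sub hD').const_mul ((N : ℂ) ^ 4), ?_⟩
    rw [norm_mul, hNn]
    calc N ^ 4 * ‖D - D'‖ ≤ N ^ 4 * (A * M ^ 2 + A * M ^ 2) := by
          gcongr
          refine (norm_sub_le _ _).trans (add_le_add (hB.trans ?_) (hB'.trans ?_))
          · gcongr; exact hA1 _
          · gcongr; exact hA1 _
      _ = _ := by ring

end NSFlow

end

section

/-! ### The heat kernel as a Schwartz function -/

/-- A single Taylor term gives `(1 + s)^m ≤ m! e^{1+s}`, and `1 + s - s²/4 ≤ 2`. -/
theorem one_add_pow_le_exp (m : ℕ) {s : ℝ} (hs : 0 ≤ s) :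
    (1 + s) ^ m * Real.exp (-(s ^ 2 / 4)) ≤ m.factorial * Real.exp 2 := by
  have h1 := Real.pow_div_factorial_le_exp (1 + s) (by linarith) m
  rw [div_le_iff₀ (by positivity)] at h1
  calc (1 + s) ^ m * Real.exp (-(s ^ 2 / 4))
      ≤ (Real.exp (1 + s) * m.factorial) * Real.exp (-(s ^ 2 / 4)) := by gcongr
    _ = m.factorial * Real.exp (1 + s + -(s ^ 2 / 4)) := by rw [Real.exp_add (1 + s)]; ring
    _ ≤ m.factorial * Real.exp 2 := by
      gcongr
      nlinarith [sq_nonneg (s - 2)]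

/-- The Gaussian `exp(-|z|²/4)`. -/
def gaussS : 𝓢(E3, ℝ) where
  toFun z := Real.exp (-(‖z‖ ^ 2 / 4))
  smooth' := Real.contDiff_exp.comp ((contDiff_norm_sq ℝ).div_const 4).neg
  decay' := by
    intro k n
    have hf : Function.HasTemperateGrowth fun z : E3 => -(‖z‖ ^ 2 / 4) := by
      have := Function.hasTemperateGrowth_norm_sq E3
      have h2 : (fun z : E3 => -(‖z‖ ^ 2 / 4)) = fun z => (-1 / 4 : ℝ) * ‖z‖ ^ 2 := by
        ext z; ring
      rw [h2]
      exact (Function.HasTemperateGrowth.const _).mul this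
    obtain ⟨l, C, hC, h⟩ := hf.norm_iteratedFDeriv_le_uniform n
    refine ⟨n.factorial * (C + 1) ^ n * ((k + l * n).factorial * Real.exp 2), fun z => ?_⟩
    -- In the bound for derivatives of a composition the outer derivatives all equal the Gaussian,
    -- and the inner ones grow polynomially.
    have h1 := norm_iteratedFDeriv_comp_le (𝕜 := ℝ) (n := n) (N := ∞) (g := Real.exp)
      (f := fun z : E3 => -(‖z‖ ^ 2 / 4)) Real.contDiff_exp
      ((contDiff_norm_sq ℝ).div_const 4).neg (mod_cast le_top) z
      (C := Real.exp (-(‖z‖ ^ 2 / 4))) (D := (C + 1) * (1 + ‖z‖) ^ l) (fun i _ => by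
        rw [norm_iteratedFDeriv_eq_norm_iteratedDeriv, iteratedDeriv_eq_iterate,
          Real.iter_deriv_exp, Real.norm_of_nonneg (Real.exp_pos _).le])
      (fun i hi hin => by
        have hD : 1 ≤ (C + 1) * (1 + ‖z‖) ^ l := by
          have : 1 ≤ (1 + ‖z‖) ^ l := one_le_pow₀ (by linarith [norm_nonneg z])
          nlinarith
        refine ((h i hin z).trans ?_).trans (le_self_pow₀ hD (by lia))
        gcongr
        linarith)
    calc ‖z‖ ^ k * ‖iteratedFDeriv ℝ n (Real.exp ∘ fun z : E3 => -(‖z‖ ^ 2 / 4)) z‖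
        ≤ (1 + ‖z‖) ^ k * (n.factorial * Real.exp (-(‖z‖ ^ 2 / 4)) *
          ((C + 1) * (1 + ‖z‖) ^ l) ^ n) := by gcongr; linarith
      _ = n.factorial * (C + 1) ^ n * ((1 + ‖z‖) ^ (k + l * n) * Real.exp (-(‖z‖ ^ 2 / 4))) := by
        rw [mul_pow, ← pow_mul, pow_add]; ring
      _ ≤ _ := mul_le_mul_of_nonneg_left (one_add_pow_le_exp _ (norm_nonneg z)) (by positivity)

theorem integral_gaussS_pos : 0 < ∫ z, gaussS z :=
  integral_pos_of_integrable_nonneg_nonzero (x := 0) gaussS.continuous gaussS.integrable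
    (fun _ => (Real.exp_pos _).le) (Real.exp_pos _).ne'

/-- The heat kernel at time one. -/
def heatS : 𝓢(E3, ℝ) := (∫ z, gaussS z)⁻¹ • gaussS

theorem integral_heatS : ∫ z, heatS z = 1 := by
  have : ∀ z, heatS z = (∫ z, gaussS z)⁻¹ * gaussS z := fun z => rfl
  simp only [this]
  rw [integral_const_mul, inv_mul_cancel₀ integral_gaussS_pos.ne']

theorem dS_gaussS (i : Fin 3) (z : E3) : dS i gaussS z = -(z i / 2) * gaussS z := by
  have h1 : HasFDerivAt (fun z : E3 => -(‖z‖ ^ 2 / 4)) (-((4 : ℝ)⁻¹ • (2 • innerSL ℝ z))) z := by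
    have := ((hasStrictFDerivAt_norm_sq z).hasFDerivAt.const_mul (4 : ℝ)⁻¹).fun_neg
    simp only [div_eq_inv_mul]
    exact this
  have h2 := (Real.hasDerivAt_exp (-(‖z‖ ^ 2 / 4))).comp_hasFDerivAt z h1
  have h3 : (gaussS : E3 → ℝ) = Real.exp ∘ fun z => -(‖z‖ ^ 2 / 4) := rfl
  rw [dS_apply, h3, h2.fderiv]
  simp [e3, EuclideanSpace.inner_single_right]
  ring

theorem pd_coord (i j : Fin 3) (z : E3) : pd i (fun z => z j) z = if i = j then 1 else 0 := by
  have h : HasFDerivAt (fun z : E3 => z j) (EuclideanSpace.proj j : E3 →L[ℝ] ℝ) z :=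
    (EuclideanSpace.proj j : E3 →L[ℝ] ℝ).hasFDerivAt
  rw [pd, h.fderiv]
  simp [e3, eq_comm]

theorem contDiff_coord (j : Fin 3) : ContDiff ℝ 1 fun z : E3 => z j :=
  (EuclideanSpace.proj j : E3 →L[ℝ] ℝ).contDiff

/-- The commutator `[∂ᵢ, z · ∇] = ∂ᵢ`. -/
theorem dS_eulerS (i : Fin 3) (g : 𝓢(E3, ℝ)) : dS i (eulerS g) = dS i g + eulerS (dS i g) := by
  ext z
  have h1 : eulerS g = ∑ j, SchwartzMap.smulLeftCLM ℝ (fun z : E3 => z j) (dS j g) := rfl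
  have h2 : ∀ j, dS i (SchwartzMap.smulLeftCLM ℝ (fun z : E3 => z j) (dS j g)) z =
      (if i = j then 1 else 0) * dS j g z + z j * dS i (dS j g) z := by
    intro j
    have h3 := pd_mul (contDiff_coord j) ((dS j g).smooth 1) i z
    rw [pd_coord] at h3
    rw [← pd_schwartz, ← pd_schwartz i (dS j g), ← h3]
    congr 1
    ext y
    rw [SchwartzMap.smulLeftCLM_apply_apply (hasTemperateGrowth_coord j), smul_eq_mul]
  rw [h1, dS_sum, _root_.sum_apply, _root_.add_apply, eulerS_apply, fderiv_apply_eq_sum]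
  simp only [h2, Finset.sum_add_distrib, dS_comm i]
  simp

theorem lapS_eulerS (g : 𝓢(E3, ℝ)) : lapS (eulerS g) = (2 : ℝ) • lapS g + eulerS (lapS g) := by
  have hadd : ∀ (i : Fin 3) (f g : 𝓢(E3, ℝ)), dS i (f + g) = dS i f + dS i g := fun i f g =>
    map_add (LineDeriv.lineDerivOpCLM ℝ 𝓢(E3, ℝ) (e3 i)) f g
  have heul : eulerS (lapS g) = ∑ i, eulerS (dS i (dS i g)) := by
    ext z
    simp only [eulerS_apply, lapS, _root_.sum_apply, fderiv_apply_eq_sum, dS_sum, Finset.mul_sum]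
    exact Finset.sum_comm
  rw [heul]
  simp only [lapS, dS_eulerS, hadd, Finset.sum_add_distrib]
  module

/-- The self-similar form of the heat equation at time one. It is linear, so the value of the
normalizing Gaussian integral is irrelevant. -/
theorem lapS_heatS : lapS heatS = (-(1 / 2) : ℝ) • ((3 : ℝ) • heatS + eulerS heatS) := by
  have hE : ∀ (c : ℝ) (g : 𝓢(E3, ℝ)), eulerS (c • g) = c • eulerS g := fun c g => by
    ext z
    rw [eulerS_apply, _root_.smul_apply, eulerS_apply]
    have : (⇑(c • g) : E3 → ℝ) = c • ⇑g := rfl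
    rw [this, fderiv_const_smul g.differentiableAt]
    rfl
  have hg : lapS gaussS = (-(1 / 2) : ℝ) • ((3 : ℝ) • gaussS + eulerS gaussS) := by
    ext z
    have h2 : ∀ i, dS i (dS i gaussS) z = (-(1 / 2) + z i ^ 2 / 4) * gaussS z := fun i => by
      have h3 : dS i gaussS = SchwartzMap.smulLeftCLM ℝ (fun z : E3 => z i) ((-(1/2) : ℝ) • gaussS) := by
        ext y
        rw [SchwartzMap.smulLeftCLM_apply_apply (hasTemperateGrowth_coord i), dS_gaussS,
          _root_.smul_apply, smul_eq_mul, smul_eq_mul]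
        ring
      have h4 := pd_mul (contDiff_coord i) (((-(1/2) : ℝ) • gaussS).smooth 1) i z
      have h5 : (fun y : E3 => y i * ((-(1/2) : ℝ) • gaussS) y) = dS i gaussS := by
        rw [h3]
        ext y
        rw [SchwartzMap.smulLeftCLM_apply_apply (hasTemperateGrowth_coord i), smul_eq_mul]
      rw [h5, pd_coord, pd_schwartz, pd_schwartz, dS_smul, _root_.smul_apply, _root_.smul_apply,
        dS_gaussS] at h4
      rw [h4]
      simp only [smul_eq_mul, if_true]
      ring
    have h6 : eulerS gaussS z = ∑ i, -(z i ^ 2 / 2) * gaussS z := by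
      rw [eulerS_apply, fderiv_apply_eq_sum]
      refine Finset.sum_congr rfl fun i _ => ?_
      rw [dS_gaussS]
      ring
    rw [lapS, _root_.sum_apply, _root_.smul_apply, _root_.add_apply, _root_.smul_apply, h6]
    simp only [h2, Fin.sum_univ_three, smul_eq_mul]
    ring
  rw [heatS, lapS_smul, hg, hE]
  module

/-! ### Approximate identities -/

theorem one_add_norm_le_mul (x y : E3) : 1 + ‖y‖ ≤ (1 + ‖x‖) * (1 + ‖y - x‖) := by
  have h1 : ‖y‖ ≤ ‖y - x‖ + ‖x‖ := by
    calc ‖y‖ = ‖(y - x) + x‖ := by simp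
      _ ≤ _ := norm_add_le _ _
  nlinarith [norm_nonneg x, norm_nonneg (y - x)]

theorem Tempered.integrable_abs {w : E3 → ℝ} (hw : Tempered w) :
    Integrable fun y => |w y| / (1 + ‖y‖) ^ 4 := by
  refine hw.int.norm.congr (ae_of_all _ fun y => ?_)
  simp only [norm_div, Real.norm_eq_abs]
  rw [abs_of_nonneg (by positivity : (0 : ℝ) ≤ (1 + ‖y‖) ^ 4)]

theorem integral_abs_comp_dil (g : 𝓢(E3, ℝ)) {r : ℝ} (hr : 0 < r) (x : E3) :
    ∫ y, |g (r • (y - x))| = (∫ z, |g z|) / r ^ 3 := by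
  have h3 := integral_sub_right_eq_self (μ := volume) (fun y : E3 => |g (r • y)|) x
  have h4 := Measure.integral_comp_smul volume (fun y : E3 => |g y|) r
  rw [h3, h4]
  simp only [finrank_euclideanSpace, Fintype.card_fin, smul_eq_mul]
  rw [abs_of_pos (by positivity)]
  ring

theorem integral_comp_dil (g : 𝓢(E3, ℝ)) {r : ℝ} (hr : 0 < r) (x : E3) :
    ∫ y, g (r • (y - x)) = (∫ z, g z) / r ^ 3 := by
  have h3 := integral_sub_right_eq_self (μ := volume) (fun y : E3 => g (r • y)) x
  have h4 := Measure.integral_comp_smul volume (fun y : E3 => g y) r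
  rw [h3, h4]
  simp only [finrank_euclideanSpace, Fintype.card_fin, smul_eq_mul]
  rw [abs_of_pos (by positivity)]
  ring

/-- Near `x` the kernel contributes its `L¹` mass. Away from it, of the eight powers of decay four
give `(r δ)⁻⁴` and four supply the weight, so that after the factor `r³` the far part is `O(1/r)`.
-/
theorem exists_abs_dil_le_near_far (g : 𝓢(E3, ℝ)) : ∃ C : ℝ, 0 < C ∧ ∀ {w : E3 → ℝ},
    Tempered w → ∀ (x : E3) {δ r B : ℝ}, 0 < δ → 1 ≤ r → 0 ≤ B →
    (∀ y, ‖y - x‖ < δ → |w y| ≤ B) →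
    |r ^ 3 * dil g w r x| ≤ C * B +
      C / (r * δ ^ 4) * ((1 + ‖x‖) ^ 4 * ∫ y, |w y| / (1 + ‖y‖) ^ 4) := by
  obtain ⟨C, hC, hg⟩ := exists_decay g 8
  have hI0 : 0 ≤ ∫ z, |g z| := integral_nonneg fun z => abs_nonneg _
  refine ⟨C + ∫ z, |g z|, by positivity, fun {w} hw x δ r B hδ hr hB h => ?_⟩
  have hr0 : 0 < r := one_pos.trans_le hr
  have hI := hw.integrable_abs
  have hgi : Integrable fun y => |g (r • (y - x))| :=
    ((g.integrable.comp_smul hr0.ne').comp_sub_right x).abs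
  have hpt : ∀ y, ‖w y * g (r • (y - x))‖ ≤ B * |g (r • (y - x))| +
      C / (r ^ 4 * δ ^ 4) * (1 + ‖x‖) ^ 4 * (|w y| / (1 + ‖y‖) ^ 4) := by
    intro y
    rw [norm_mul, Real.norm_eq_abs, Real.norm_eq_abs]
    by_cases hy : ‖y - x‖ < δ
    · exact le_add_of_le_of_nonneg (mul_le_mul_of_nonneg_right (h y hy) (abs_nonneg _))
        (by positivity)
    · refine le_add_of_nonneg_of_le (by positivity) ?_
      have hyx : δ ≤ ‖y - x‖ := not_lt.1 hy
      have h2 : ‖r • (y - x)‖ = r * ‖y - x‖ := by rw [norm_smul, Real.norm_of_nonneg hr0.le]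
      have h3 : r ^ 4 * δ ^ 4 * (1 + ‖y‖) ^ 4 ≤ (1 + ‖x‖) ^ 4 * (1 + ‖r • (y - x)‖) ^ 8 := by
        have ha : r * δ ≤ 1 + ‖r • (y - x)‖ := by
          rw [h2]; nlinarith
        have hb : 1 + ‖y‖ ≤ (1 + ‖x‖) * (1 + ‖r • (y - x)‖) := by
          refine (one_add_norm_le_mul x y).trans ?_
          rw [h2]
          gcongr
          nlinarith [norm_nonneg (y - x)]
        calc r ^ 4 * δ ^ 4 * (1 + ‖y‖) ^ 4 = (r * δ) ^ 4 * (1 + ‖y‖) ^ 4 := by ring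
          _ ≤ (1 + ‖r • (y - x)‖) ^ 4 * ((1 + ‖x‖) * (1 + ‖r • (y - x)‖)) ^ 4 := by gcongr
          _ = _ := by ring
      have h4 : C / (1 + ‖r • (y - x)‖) ^ 8 ≤
          C / (r ^ 4 * δ ^ 4) * (1 + ‖x‖) ^ 4 / (1 + ‖y‖) ^ 4 := by
        rw [div_mul_eq_mul_div, div_div, div_le_div_iff₀ (by positivity) (by positivity)]
        calc C * (r ^ 4 * δ ^ 4 * (1 + ‖y‖) ^ 4) ≤
            C * ((1 + ‖x‖) ^ 4 * (1 + ‖r • (y - x)‖) ^ 8) := by gcongr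
          _ = _ := by ring
      calc |w y| * |g (r • (y - x))| ≤
          |w y| * (C / (r ^ 4 * δ ^ 4) * (1 + ‖x‖) ^ 4 / (1 + ‖y‖) ^ 4) := by
            gcongr
            exact (hg _).trans h4
        _ = _ := by ring
  have hfin := norm_integral_le_of_norm_le ((hgi.const_mul B).add (hI.const_mul
    (C / (r ^ 4 * δ ^ 4) * (1 + ‖x‖) ^ 4))) (ae_of_all _ hpt)
  have hadd := integral_add (hgi.const_mul B) (hI.const_mul (C / (r ^ 4 * δ ^ 4) * (1 + ‖x‖) ^ 4))
  have hfin' : |dil g w r x| ≤ B * ((∫ z, |g z|) / r ^ 3) +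
      C / (r ^ 4 * δ ^ 4) * (1 + ‖x‖) ^ 4 * ∫ y, |w y| / (1 + ‖y‖) ^ 4 := by
    rw [← integral_abs_comp_dil g hr0 x, ← integral_const_mul, ← integral_const_mul, ← hadd]
    exact hfin
  rw [abs_mul, abs_of_pos (pow_pos hr0 3)]
  have hJ : 0 ≤ ∫ y, |w y| / (1 + ‖y‖) ^ 4 := integral_nonneg fun y => by positivity
  calc r ^ 3 * |dil g w r x| ≤ r ^ 3 * (B * ((∫ z, |g z|) / r ^ 3) +
      C / (r ^ 4 * δ ^ 4) * (1 + ‖x‖) ^ 4 * ∫ y, |w y| / (1 + ‖y‖) ^ 4) := by gcongr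
    _ = (∫ z, |g z|) * B + C / (r * δ ^ 4) * ((1 + ‖x‖) ^ 4 * ∫ y, |w y| / (1 + ‖y‖) ^ 4) := by
      field_simp
    _ ≤ _ := by
      gcongr <;> linarith

theorem tempered_const (c : ℝ) : Tempered fun _ => c :=
  ⟨continuous_const, ((integrable_one_add_norm_pow_inv (k := 4) le_rfl).const_mul c).congr
    (ae_of_all _ fun y => by simp [div_eq_mul_inv])⟩

theorem Tempered.sub {v w : E3 → ℝ} (hv : Tempered v) (hw : Tempered w) :
    Tempered fun y => v y - w y :=
  ⟨hv.cont.sub hw.cont, (hv.int.sub hw.int).congr (ae_of_all _ fun y => by simp [sub_div])⟩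

/-- Constants are tempered, so `w x` may be subtracted from `w`; continuity at `x` then handles the
near part and `r → ∞` the far part. -/
theorem Tempered.tendsto_dil {w : E3 → ℝ} (hw : Tempered w) (g : 𝓢(E3, ℝ)) (x : E3) :
    Tendsto (fun r => r ^ 3 * dil g w r x) atTop (𝓝 (w x * ∫ z, g z)) := by
  obtain ⟨C, hC, h⟩ := exists_abs_dil_le_near_far g
  have hw' := hw.sub (tempered_const (w x))
  have hid : ∀ r : ℝ, 0 < r → r ^ 3 * dil g w r x - w x * ∫ z, g z =
      r ^ 3 * dil g (fun y => w y - w x) r x := fun r hr => by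
    simp only [dil, sub_mul]
    rw [integral_sub (hw.integrable_dil g hr x) ((tempered_const (w x)).integrable_dil g hr x),
      integral_const_mul, integral_comp_dil g hr]
    field_simp
  rw [Metric.tendsto_atTop]
  intro ε hε
  obtain ⟨δ, hδ, hδw⟩ := Metric.continuous_iff.1 hw.cont x (ε / (2 * C)) (by positivity)
  set J := (1 + ‖x‖) ^ 4 * ∫ y, |w y - w x| / (1 + ‖y‖) ^ 4
  have hlim : Tendsto (fun r : ℝ => C / (r * δ ^ 4) * J) atTop (𝓝 0) := by
    have h1 : Tendsto (fun r : ℝ => r⁻¹ * (C / δ ^ 4 * J)) atTop (𝓝 0) := by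
      simpa using tendsto_inv_atTop_zero.mul_const (C / δ ^ 4 * J)
    refine h1.congr fun r => ?_
    field_simp
  obtain ⟨R, hR⟩ := eventually_atTop.1 (hlim.eventually (gt_mem_nhds (half_pos hε)))
  refine ⟨max R 1, fun r hr => ?_⟩
  have hr1 : 1 ≤ r := (le_max_right _ _).trans hr
  rw [Real.dist_eq, hid r (by linarith)]
  refine (h hw' x hδ hr1 (B := ε / (2 * C)) (by positivity) fun y hy => ?_).trans_lt ?_
  · exact (hδw y (by rwa [dist_eq_norm])).le
  · have h1 := hR r ((le_max_left _ _).trans hr)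
    have h2 : C * (ε / (2 * C)) = ε / 2 := by field_simp
    linarith

end

section

/-! ### The heat extension and Duhamel's formula -/

theorem Tempered.dil_add {w : E3 → ℝ} (hw : Tempered w) (f g : 𝓢(E3, ℝ)) {r : ℝ} (hr : 0 < r)
    (x : E3) : dil (f + g) w r x = dil f w r x + dil g w r x := by
  rw [dil, dil, dil, ← integral_add (hw.integrable_dil f hr x) (hw.integrable_dil g hr x)]
  exact integral_congr_ae (ae_of_all _ fun y => by simp [mul_add])

theorem dil_smul (c : ℝ) (g : 𝓢(E3, ℝ)) (w : E3 → ℝ) (r : ℝ) (x : E3) :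
    dil (c • g) w r x = c * dil g w r x := by
  rw [dil, dil, ← integral_const_mul]
  exact integral_congr_ae (ae_of_all _ fun y => by simp; ring)

/-- The heat extension `e^{σΔ} w`. -/
def heat (w : E3 → ℝ) (σ : ℝ) (x : E3) : ℝ := (√σ)⁻¹ ^ 3 * dil heatS w (√σ)⁻¹ x

/-- The Laplacian of the heat extension. -/
def heatLap (w : E3 → ℝ) (σ : ℝ) (x : E3) : ℝ := (√σ)⁻¹ ^ 5 * dil (lapS heatS) w (√σ)⁻¹ x

theorem hasDerivAt_inv_sqrt {σ : ℝ} (hσ : 0 < σ) :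
    HasDerivAt (fun σ => (√σ)⁻¹) (-(1 / 2) * (√σ)⁻¹ ^ 3) σ := by
  refine ((Real.hasDerivAt_sqrt hσ.ne').inv (Real.sqrt_pos.2 hσ).ne').congr_deriv ?_
  have := (Real.sqrt_pos.2 hσ).ne'
  field_simp

/-- With `r = σ^{-1/2}` one has `dr/dσ = -r³/2`, and `r ∂_r` acts as the Euler operator on the
kernel. For `heatS` with `n = 3`, and for its Laplacian with `n = 5`, the resulting kernel is again
a Laplacian, which is the heat equation. -/
theorem Tempered.hasDerivAt_dil_sqrt {w : E3 → ℝ} (hw : Tempered w) (g : 𝓢(E3, ℝ)) (n : ℕ)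
    {σ : ℝ} (hσ : 0 < σ) (x : E3) :
    HasDerivAt (fun σ => (√σ)⁻¹ ^ n * dil g w (√σ)⁻¹ x)
      ((√σ)⁻¹ ^ (n + 2) * dil ((-(1 / 2) : ℝ) • ((n : ℝ) • g + eulerS g)) w (√σ)⁻¹ x) σ := by
  have hq : 0 < (√σ)⁻¹ := inv_pos.2 (Real.sqrt_pos.2 hσ)
  have h1 := hasDerivAt_inv_sqrt hσ
  refine ((h1.pow n).mul ((hw.hasDerivAt_dil_left g hq x).comp σ h1)).congr_deriv ?_
  rw [dil_smul, hw.dil_add _ _ hq, dil_smul]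
  simp only [Function.comp_apply, Pi.pow_apply]
  generalize (√σ)⁻¹ = q at *
  rcases n with _ | n
  · field_simp; simp
  · simp only [Nat.add_sub_cancel]; field_simp; ring

theorem Tempered.hasDerivAt_heat {w : E3 → ℝ} (hw : Tempered w) {σ : ℝ} (hσ : 0 < σ) (x : E3) :
    HasDerivAt (fun σ => heat w σ x) (heatLap w σ x) σ := by
  have h := hw.hasDerivAt_dil_sqrt heatS 3 hσ x
  rw [Nat.cast_ofNat, ← lapS_heatS] at h
  exact h

/-- Apply the Laplacian to `lapS_heatS`; the commutator with the Euler operator raises 3 to 5. -/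
theorem lapS_lapS_heatS :
    lapS (lapS heatS) = (-(1 / 2) : ℝ) • ((5 : ℝ) • lapS heatS + eulerS (lapS heatS)) := by
  have hadd : ∀ f g : 𝓢(E3, ℝ), lapS (f + g) = lapS f + lapS g := fun f g => by
    have h : ∀ (i : Fin 3) (f g : 𝓢(E3, ℝ)), dS i (f + g) = dS i f + dS i g := fun i f g =>
      map_add (LineDeriv.lineDerivOpCLM ℝ 𝓢(E3, ℝ) (e3 i)) f g
    simp only [lapS, h, Finset.sum_add_distrib]
  conv_lhs => rw [lapS_heatS]
  rw [lapS_smul, hadd, lapS_smul, lapS_eulerS]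
  module

theorem Tempered.hasDerivAt_heatLap {w : E3 → ℝ} (hw : Tempered w) {σ : ℝ} (hσ : 0 < σ) (x : E3) :
    HasDerivAt (fun σ => heatLap w σ x) ((√σ)⁻¹ ^ 7 * dil (lapS (lapS heatS)) w (√σ)⁻¹ x) σ := by
  have h := hw.hasDerivAt_dil_sqrt (lapS heatS) 5 hσ x
  rw [Nat.cast_ofNat, ← lapS_lapS_heatS] at h
  exact h

variable {a b M : ℝ} {u : ℝ → E3 → E3} {p : ℝ → E3 → ℝ}

/-- The Duhamel integrand at time `t` and heat time `σ`. -/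
def duh (u : ℝ → E3 → E3) (k : Fin 3) (x : E3) (t σ : ℝ) : ℝ :=
  (√σ)⁻¹ ^ 6 * nonlinDil u heatS k (√σ)⁻¹ x t

theorem continuousOn_sqrt_inv {X : Type*} [TopologicalSpace X] {f : X → ℝ} {s : Set X}
    (hf : ContinuousOn f s) (h : ∀ x ∈ s, 0 < f x) : ContinuousOn (fun x => (√(f x))⁻¹) s :=
  (Real.continuous_sqrt.comp_continuousOn hf).inv₀ fun x hx => (Real.sqrt_pos.2 (h x hx)).ne'

namespace NSFlow

theorem continuousOn_dil_sqrt (h : NSFlow a b M u p) (g : 𝓢(E3, ℝ)) (k : Fin 3) (x : E3) :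
    ContinuousOn (fun q : ℝ × ℝ => dil g (fun y => u q.1 y k) (√q.2)⁻¹ x) {q | 0 < q.2} :=
  (h.continuousOn_dil_comp g k).comp (f := fun q : ℝ × ℝ => (q.1, (√q.2)⁻¹, x))
    (continuousOn_fst.prodMk ((continuousOn_sqrt_inv continuousOn_snd fun _ hq => hq).prodMk
      continuousOn_const)) fun _ hq => inv_pos.2 (Real.sqrt_pos.2 hq)

theorem continuousOn_duh (h : NSFlow a b M u p) (k : Fin 3) (x : E3) :
    ContinuousOn (fun q : ℝ × ℝ => duh u k x q.1 q.2) {q | 0 < q.2} := by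
  have h0 : ContinuousOn (fun q : ℝ × ℝ => (√q.2)⁻¹) {q | 0 < q.2} :=
    continuousOn_sqrt_inv continuousOn_snd fun _ hq => hq
  exact (h0.pow 6).mul ((h.continuousOn_nonlinDil heatS k).comp
    (f := fun q : ℝ × ℝ => (q.1, (√q.2)⁻¹, x))
    (continuousOn_fst.prodMk (h0.prodMk continuousOn_const))
    fun q hq => inv_pos.2 (Real.sqrt_pos.2 hq))

/-- Along the path the time derivative contributes `Δ²` of the heat extension plus the nonlinear
term, and the decreasing heat time contributes minus the same `Δ²`. The Laplacian of the heat
extension is followed, not the extension itself, because only pairings with Laplacians evolve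
without pressure. -/
theorem hasDerivAt_heatLap_path (h : NSFlow a b M u p) (k : Fin 3) (x : E3) {c s : ℝ}
    (hs : s ∈ Ioo a b) (hc : s < c) :
    HasDerivAt (fun s => heatLap (fun y => u s y k) (c - s) x) (duh u k x s (c - s)) s := by
  let F₂ : ℝ → ℝ → ℝ := fun t σ => (√σ)⁻¹ ^ 7 * dil (lapS (lapS heatS)) (fun y => u t y k) (√σ)⁻¹ x
  let F₁ : ℝ → ℝ → ℝ := fun t σ => F₂ t σ + duh u k x t σ
  have ho : {q : ℝ × ℝ | q.1 ∈ Ioo a b ∧ 0 < q.2} ∈ 𝓝 (s, c - s) :=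
    ((isOpen_Ioo.preimage continuous_fst).inter (isOpen_Ioi.preimage continuous_snd)).mem_nhds
      ⟨hs, sub_pos.2 hc⟩
  have ho2 : {q : ℝ × ℝ | 0 < q.2} ∈ 𝓝 (s, c - s) := by
    filter_upwards [ho] with q hq using hq.2
  have h0 : ContinuousOn (fun q : ℝ × ℝ => (√q.2)⁻¹) {q | 0 < q.2} :=
    continuousOn_sqrt_inv continuousOn_snd fun _ hq => hq
  have hcF₂ : ContinuousOn (fun q : ℝ × ℝ => F₂ q.1 q.2) {q | 0 < q.2} :=
    (h0.pow 7).mul (h.continuousOn_dil_sqrt _ k x)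
  have hcF₁ : ContinuousOn (fun q : ℝ × ℝ => F₁ q.1 q.2) {q | 0 < q.2} :=
    hcF₂.add (h.continuousOn_duh k x)
  let L : ℝ → ℝ →L[ℝ] ℝ := fun c => ContinuousLinearMap.toSpanSingleton ℝ c
  have hL : Continuous L := by
    have : L = fun c => c • ContinuousLinearMap.id ℝ ℝ := by
      ext c; simp [L]
    rw [this]
    fun_prop
  -- Continuity of both partial derivatives gives joint differentiability, hence the chain rule
  -- along the path.
  have key := hasStrictFDerivAt_uncurry_coprod (𝕜 := ℝ) (u := (s, c - s))
    (f := fun t σ => heatLap (fun y => u t y k) σ x) (f₁ := fun t σ => L (F₁ t σ))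
    (f₂ := fun t σ => L (F₂ t σ)) ?_ ?_ ?_ ?_
  · have h2 := key.hasFDerivAt.comp_hasDerivAt s (f := fun s => (s, c - s))
      ((hasDerivAt_id s).prodMk ((hasDerivAt_id s).const_sub c))
    refine h2.congr_deriv ?_
    simp [Function.HasUncurry.uncurry, L, F₁]
  · filter_upwards [ho] with q hq
    have hq0 : 0 < (√q.2)⁻¹ := inv_pos.2 (Real.sqrt_pos.2 hq.2)
    have h3 := ((h.hasDerivWithinAt_dil heatS k hq0 x (Ioo_subset_Icc_self hq.1)).hasDerivAt
      (Icc_mem_nhds hq.1.1 hq.1.2)).const_mul ((√q.2)⁻¹ ^ 5)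
    refine (h3.congr_deriv ?_).hasFDerivAt
    simp only [F₁, F₂, duh]
    ring
  · filter_upwards [ho] with q hq
    exact (((h.tempered_comp k).tempered q.1).hasDerivAt_heatLap hq.2 x).hasFDerivAt
  · exact hL.continuousAt.comp (hcF₁.continuousAt ho2)
  · exact hL.continuousAt.comp (hcF₂.continuousAt ho2)

theorem heatLap_sub (h : NSFlow a b M u p) (k : Fin 3) (x : E3) {t₁ t₂ ε : ℝ}
    (h₁ : a ≤ t₁) (h₁₂ : t₁ ≤ t₂) (h₂ : t₂ ≤ b) (hε : 0 < ε) :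
    heatLap (fun y => u t₂ y k) ε x - heatLap (fun y => u t₁ y k) (ε + (t₂ - t₁)) x =
      ∫ s in t₁..t₂, duh u k x s (ε + t₂ - s) := by
  have hmap : ∀ s ∈ Icc t₁ t₂, (s, ε + t₂ - s) ∈ {q : ℝ × ℝ | 0 < q.2} := fun s hs => by
    have := hs.2
    simp only [mem_ofPred_eq]
    linarith
  have hpath : ContinuousOn (fun s : ℝ => (s, ε + t₂ - s)) (Icc t₁ t₂) := by fun_prop
  have h0 : ContinuousOn (fun q : ℝ × ℝ => (√q.2)⁻¹) {q | 0 < q.2} :=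
    continuousOn_sqrt_inv continuousOn_snd fun _ hq => hq
  have hz : ContinuousOn (fun q : ℝ × ℝ => heatLap (fun y => u q.1 y k) q.2 x) {q | 0 < q.2} :=
    (h0.pow 5).mul (h.continuousOn_dil_sqrt (lapS heatS) k x)
  have hd : ContinuousOn (fun s => duh u k x s (ε + t₂ - s)) (Icc t₁ t₂) :=
    (h.continuousOn_duh k x).comp (f := fun s => (s, ε + t₂ - s)) hpath hmap
  rw [intervalIntegral.integral_eq_sub_of_hasDerivAt_of_le h₁₂
    (f := fun s => heatLap (fun y => u s y k) (ε + t₂ - s) x)]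
  · simp only
    congr 2 <;> ring
  · exact hz.comp (f := fun s => (s, ε + t₂ - s)) hpath hmap
  · exact fun s hs => h.hasDerivAt_heatLap_path k x ⟨h₁.trans_lt hs.1, hs.2.trans_le h₂⟩
      (by linarith [hs.2])
  · exact hd.intervalIntegrable_of_Icc h₁₂

theorem integral_heatLap (h : NSFlow a b M u p) (k : Fin 3) (x : E3) (t : ℝ) {τ ε L : ℝ}
    (hτ : 0 ≤ τ) (hε : 0 < ε) (hL : ε ≤ L) :
    IntervalIntegrable (fun σ => heatLap (fun y => u t y k) (σ + τ) x) volume ε L ∧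
    ∫ σ in ε..L, heatLap (fun y => u t y k) (σ + τ) x =
      heat (fun y => u t y k) (L + τ) x - heat (fun y => u t y k) (ε + τ) x := by
  have hT := (h.tempered_comp k).tempered t
  have hd : ∀ σ ∈ Icc ε L, HasDerivAt (fun σ => heat (fun y => u t y k) (σ + τ) x)
      (heatLap (fun y => u t y k) (σ + τ) x) σ := fun σ hσ =>
    (hT.hasDerivAt_heat (by linarith [hσ.1]) x).comp_add_const σ τ
  have hc : ContinuousOn (fun σ => heatLap (fun y => u t y k) (σ + τ) x) (Icc ε L) := fun σ hσ =>
    ((hT.hasDerivAt_heatLap (by linarith [hσ.1] : 0 < σ + τ) x).comp_add_const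
      σ τ).continuousAt.continuousWithinAt
  have hi := hc.intervalIntegrable_of_Icc hL (μ := volume)
  refine ⟨hi, ?_⟩
  exact intervalIntegral.integral_eq_sub_of_hasDerivAt (fun σ hσ => hd σ (by rwa [uIcc_of_le hL] at hσ)) hi

/-- The weak `L³` bound makes the heat extension `O(M σ^{-1/2})`. -/
theorem tendsto_heat_atTop (h : NSFlow a b M u p) (k : Fin 3) (x : E3) (t : ℝ) :
    Tendsto (fun σ => heat (fun y => u t y k) σ x) atTop (𝓝 0) := by
  obtain ⟨C, hC, hb⟩ := exists_abs_dil_comp_le heatS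
  have hq : Tendsto (fun σ : ℝ => C * M * (√σ)⁻¹) atTop (𝓝 0) := by
    simpa using (Real.tendsto_sqrt_atTop.inv_tendsto_atTop).const_mul (C * M)
  refine squeeze_zero_norm' ?_ hq
  filter_upwards [eventually_gt_atTop 0] with σ hσ
  have hq0 : 0 < (√σ)⁻¹ := inv_pos.2 (Real.sqrt_pos.2 hσ)
  rw [heat, norm_mul, Real.norm_eq_abs, Real.norm_eq_abs, abs_of_pos (pow_pos hq0 3)]
  generalize (√σ)⁻¹ = q at *
  calc q ^ 3 * _ ≤ q ^ 3 * (C * (M / q ^ 2)) := by gcongr; exact hb h k t hq0 x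
    _ = C * M * q := by field_simp

theorem tendsto_heat_zero (h : NSFlow a b M u p) (k : Fin 3) (x : E3) (t : ℝ) :
    Tendsto (fun σ => heat (fun y => u t y k) σ x) (𝓝[>] 0) (𝓝 (u t x k)) := by
  have h1 := ((h.tempered_comp k).tempered t).tendsto_dil heatS x
  rw [integral_heatS, mul_one] at h1
  have h2 : Tendsto (fun σ : ℝ => (√σ)⁻¹) (𝓝[>] 0) atTop := by
    refine Tendsto.inv_tendsto_nhdsGT_zero ?_
    refine tendsto_nhdsWithin_iff.2 ⟨?_, ?_⟩
    · have := (Real.continuous_sqrt.tendsto 0).mono_left (nhdsWithin_le_nhds (s := Ioi (0 : ℝ)))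
      simpa using this
    · filter_upwards [self_mem_nhdsWithin] with σ hσ using Real.sqrt_pos.2 hσ
  exact h1.comp h2

end NSFlow

/-! ### Averages at parabolic scale -/

/-- The average of `F` at heat time `σ`. -/
def hav (F : E3 → ℝ≥0∞) (σ : ℝ) (x : E3) : ℝ≥0∞ :=
  ENNReal.ofReal ((√σ)⁻¹ ^ 3) * av F (√σ)⁻¹ x

/-- The square of the speed. -/
def sq (v : E3 → E3) (y : E3) : ℝ≥0∞ := ENNReal.ofReal (‖v y‖ ^ 2)

theorem measurable_hav {F : ℝ → E3 → ℝ≥0∞} (hF : Measurable fun z : ℝ × E3 => F z.1 z.2) :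
    Measurable fun q : ℝ × ℝ × E3 => hav (F q.1) q.2.1 q.2.2 := by
  have h1 : Measurable fun z : (ℝ × ℝ × E3) × E3 =>
      F z.1.1 z.2 * ENNReal.ofReal (bk (√z.1.2.1)⁻¹ z.1.2.2 z.2) := by
    refine (hF.comp (by fun_prop : Measurable fun z : (ℝ × ℝ × E3) × E3 => (z.1.1, z.2))).mul ?_
    exact (continuous_bk.measurable.comp (by fun_prop :
      Measurable fun z : (ℝ × ℝ × E3) × E3 => ((√z.1.2.1)⁻¹, z.1.2.2, z.2))).ennreal_ofReal
  exact (by fun_prop : Measurable fun q : ℝ × ℝ × E3 => ENNReal.ofReal ((√q.2.1)⁻¹ ^ 3)).mul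
    h1.lintegral_prod_right'

theorem NSFlow.measurable_sq (h : NSFlow a b M u p) :
    Measurable fun z : ℝ × E3 => sq (u z.1) z.2 :=
  (h.cont.norm.pow 2).measurable.ennreal_ofReal

theorem exists_ofReal_abs_nonlinDil_le (κ : 𝓢(E3, ℝ)) : ∃ C : ℝ, 0 < C ∧
    ∀ (u : ℝ → E3 → E3) (k : Fin 3) (r : ℝ) (x : E3) (t : ℝ),
    ENNReal.ofReal |nonlinDil u κ k r x t| ≤ ENNReal.ofReal C * av (sq (u t)) r x := by
  choose C hC H using fun i => exists_ofReal_abs_dil_le (dS i (lapS κ))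
  choose D hD H' using fun i j k => exists_ofReal_abs_dil_le (dS i (dS j (dS k κ)))
  have hprod : ∀ (v : E3) (i j : Fin 3), |v i * v j| ≤ ‖v‖ ^ 2 := fun v i j => by
    rw [abs_mul, pow_two]
    exact mul_le_mul (abs_coord_le v i) (abs_coord_le v j) (abs_nonneg _) (norm_nonneg _)
  have hs : ∀ {f : Fin 3 → ℝ}, ENNReal.ofReal |∑ i, f i| ≤ ∑ i, ENNReal.ofReal |f i| :=
    fun {f} => (ENNReal.ofReal_le_ofReal (Finset.abs_sum_le_sum_abs _ _)).trans
      (ENNReal.ofReal_sum_of_nonneg fun i _ => abs_nonneg _).le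
  refine ⟨∑ i, C i + ∑ k, ∑ i, ∑ j, D i j k, ?_, fun u k r x t => ?_⟩
  · exact add_pos (Finset.sum_pos (fun i _ => hC i) Finset.univ_nonempty)
      (Finset.sum_pos (fun k _ => Finset.sum_pos (fun i _ => Finset.sum_pos (fun j _ => hD i j k)
        Finset.univ_nonempty) Finset.univ_nonempty) Finset.univ_nonempty)
  have hD0 : ∀ k, 0 ≤ ∑ i, ∑ j, D i j k := fun k =>
    Finset.sum_nonneg fun i _ => Finset.sum_nonneg fun j _ => (hD i j k).le
  have hDk : ∑ i, ∑ j, D i j k ≤ ∑ k, ∑ i, ∑ j, D i j k :=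
    Finset.single_le_sum (f := fun k => ∑ i, ∑ j, D i j k) (fun k _ => hD0 k) (Finset.mem_univ k)
  have hav' : ∀ i j, av (fun y => ENNReal.ofReal |u t y i * u t y j|) r x ≤ av (sq (u t)) r x :=
    fun i j => av_mono (fun y => ENNReal.ofReal_le_ofReal (hprod _ _ _)) r x
  refine le_trans ?_ (mul_le_mul_left (ENNReal.ofReal_le_ofReal (add_le_add_right hDk _)) _)
  rw [ENNReal.ofReal_add (Finset.sum_nonneg fun i _ => (hC i).le) (hD0 k), add_mul]
  refine (ENNReal.ofReal_le_ofReal (abs_sub _ _)).trans ?_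
  rw [ENNReal.ofReal_add (abs_nonneg _) (abs_nonneg _)]
  refine add_le_add (hs.trans ?_) (hs.trans ?_)
  · rw [ENNReal.ofReal_sum_of_nonneg fun i _ => (hC i).le, Finset.sum_mul]
    exact Finset.sum_le_sum fun i _ => (H i _ r x).trans (mul_le_mul_right (hav' i k) _)
  · rw [ENNReal.ofReal_sum_of_nonneg fun i _ => Finset.sum_nonneg fun j _ => (hD i j k).le,
      Finset.sum_mul]
    refine Finset.sum_le_sum fun i _ => hs.trans ?_
    rw [ENNReal.ofReal_sum_of_nonneg fun j _ => (hD i j k).le, Finset.sum_mul]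
    exact Finset.sum_le_sum fun j _ => (H' i j k _ r x).trans (mul_le_mul_right (hav' i j) _)

end

/-! ### Duhamel's formula as an inequality, and averages of weak `L³` fields -/

section

variable {a b M : ℝ} {u : ℝ → E3 → E3} {p : ℝ → E3 → ℝ}

theorem inv_sqrt_pow_three {σ : ℝ} (hσ : 0 < σ) : (√σ)⁻¹ ^ 3 = σ ^ (-(3 / 2) : ℝ) := by
  rw [Real.sqrt_eq_rpow, ← Real.rpow_neg hσ.le, ← Real.rpow_natCast, ← Real.rpow_mul hσ.le]
  norm_num

theorem setLIntegral_Ioi_comp_add (f : ℝ → ℝ≥0∞) (c : ℝ) :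
    ∫⁻ ε in Ioi 0, f (ε + c) = ∫⁻ σ in Ioi c, f σ := by
  rw [← (measurePreserving_add_right volume c).setLIntegral_comp_preimage_emb
    (measurableEmbedding_addRight c) f (Ioi c)]
  simp

theorem NSFlow.measurable_hav_sq (h : NSFlow a b M u p) :
    Measurable fun q : ℝ × ℝ × E3 => hav (sq (u q.1)) q.2.1 q.2.2 :=
  measurable_hav (F := fun s => sq (u s)) h.measurable_sq

theorem NSFlow.measurable_duhMaj_integrand (h : NSFlow a b M u p) :
    Measurable fun q : ℝ × ℝ × E3 =>
      ENNReal.ofReal (q.2.1 ^ (-(3 / 2) : ℝ)) * hav (sq (u q.1)) q.2.1 q.2.2 := by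
  have h2 : Measurable fun q : ℝ × ℝ × E3 => ENNReal.ofReal (q.2.1 ^ (-(3 / 2) : ℝ)) := by
    fun_prop
  exact h2.mul h.measurable_hav_sq

/-- The majorant in Duhamel's formula. -/
def duhMaj (u : ℝ → E3 → E3) (t₁ t₂ : ℝ) (x : E3) : ℝ≥0∞ :=
  ∫⁻ s in Ioc t₁ t₂, ∫⁻ σ in Ioi (t₂ - s), ENNReal.ofReal (σ ^ (-(3 / 2) : ℝ)) * hav (sq (u s)) σ x

/-- The identity is known only after applying the Laplacian. Integrating in heat time from zero to
infinity undoes it, because the heat extension vanishes at infinite heat time and returns the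
function at heat time zero. -/
theorem NSFlow.exists_duhamel_comp : ∃ C : ℝ, 0 < C ∧ ∀ {a b M : ℝ} {u : ℝ → E3 → E3}
    {p : ℝ → E3 → ℝ}, NSFlow a b M u p → ∀ (k : Fin 3) (x : E3) {t₁ t₂ : ℝ}, a ≤ t₁ → t₁ < t₂ →
    t₂ ≤ b → ENNReal.ofReal |u t₂ x k - heat (fun y => u t₁ y k) (t₂ - t₁) x| ≤
      ENNReal.ofReal C * duhMaj u t₁ t₂ x := by
  obtain ⟨C, hC, hN⟩ := exists_ofReal_abs_nonlinDil_le heatS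
  refine ⟨C, hC, fun {a b M u p} h k x t₁ t₂ h₁ h₁₂ h₂ => ?_⟩
  set τ := t₂ - t₁ with hτ
  have hτ0 : 0 < τ := sub_pos.2 h₁₂
  set R := ∫⁻ ε in Ioi 0, ∫⁻ s in Ioc t₁ t₂, ‖duh u k x s (ε + t₂ - s)‖ₑ with hR
  have hA : ∀ e L : ℝ, 0 < e → e ≤ L →
      ENNReal.ofReal |(heat (fun y => u t₂ y k) L x - heat (fun y => u t₂ y k) e x) -
        (heat (fun y => u t₁ y k) (L + τ) x - heat (fun y => u t₁ y k) (e + τ) x)| ≤ R := by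
    intro e L he hL
    obtain ⟨i1, e1⟩ := h.integral_heatLap k x t₂ le_rfl he hL
    obtain ⟨i2, e2⟩ := h.integral_heatLap k x t₁ hτ0.le he hL
    simp only [add_zero] at i1 e1
    rw [← e1, ← e2, ← intervalIntegral.integral_sub i1 i2, intervalIntegral.integral_of_le hL,
      ← Real.norm_eq_abs, ofReal_norm]
    refine (enorm_integral_le_lintegral_enorm _).trans ?_
    rw [hR]
    refine (setLIntegral_mono' measurableSet_Ioc fun ε hε => ?_).trans
      (lintegral_mono_set (fun ε hε => he.trans hε.1 : Ioc e L ⊆ Ioi 0))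
    rw [h.heatLap_sub k x h₁ h₁₂.le h₂ (he.trans hε.1), intervalIntegral.integral_of_le h₁₂.le]
    exact enorm_integral_le_lintegral_enorm _
  have hB : ENNReal.ofReal |u t₂ x k - heat (fun y => u t₁ y k) τ x| ≤ R := by
    -- Heat times run from `1 / (n + 1)` to `n + 1`; the values at the upper end vanish in the
    -- limit.
    have hL : Tendsto (fun n : ℕ => (n : ℝ) + 1) atTop atTop :=
      tendsto_atTop_add_const_right _ _ tendsto_natCast_atTop_atTop
    have he : Tendsto (fun n : ℕ => 1 / ((n : ℝ) + 1)) atTop (𝓝[>] 0) :=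
      tendsto_nhdsWithin_iff.2 ⟨tendsto_one_div_add_atTop_nhds_zero_nat,
        Eventually.of_forall fun n => by
          have : (0 : ℝ) < 1 / ((n : ℝ) + 1) := by positivity
          exact this⟩
    have c1 := (h.tendsto_heat_atTop k x t₂).comp hL
    have c2 := (h.tendsto_heat_zero k x t₂).comp he
    have c3 := (h.tendsto_heat_atTop k x t₁).comp
      (tendsto_atTop_add_const_right _ τ hL)
    have c4 : Tendsto (fun n : ℕ => heat (fun y => u t₁ y k) (1 / ((n : ℝ) + 1) + τ) x) atTop
        (𝓝 (heat (fun y => u t₁ y k) τ x)) := by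
      have hc := (((h.tempered_comp k).tempered t₁).hasDerivAt_heat hτ0 x).continuousAt.tendsto
      refine hc.comp ?_
      simpa using (tendsto_one_div_add_atTop_nhds_zero_nat (𝕜 := ℝ)).add_const τ
    have c5 := ENNReal.tendsto_ofReal ((c1.sub c2).sub (c3.sub c4)).abs
    have hval : |(0 - u t₂ x k) - (0 - heat (fun y => u t₁ y k) τ x)| =
        |u t₂ x k - heat (fun y => u t₁ y k) τ x| := by
      rw [← abs_neg]; congr 1; ring
    rw [hval] at c5
    refine le_of_tendsto' c5 fun n => ?_
    have hn : (1 : ℝ) ≤ n + 1 := by linarith [n.cast_nonneg (α := ℝ)]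
    exact hA _ _ (by positivity) ((div_le_one (by positivity)).2 hn |>.trans hn)
  refine hB.trans ?_
  set G : ℝ → ℝ → ℝ≥0∞ := fun s σ =>
    ENNReal.ofReal (σ ^ (-(3 / 2) : ℝ)) * hav (sq (u s)) σ x with hG
  have hGm : Measurable fun q : ℝ × ℝ => G (q.2) (q.1 + t₂ - q.2) := by
    have h1 := h.measurable_duhMaj_integrand
    have h2 : Measurable fun q : ℝ × ℝ => (q.2, q.1 + t₂ - q.2, x) := by fun_prop
    exact Measurable.comp (g := fun q : ℝ × ℝ × E3 =>
      ENNReal.ofReal (q.2.1 ^ (-(3 / 2) : ℝ)) * hav (sq (u q.1)) q.2.1 q.2.2)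
      (f := fun q : ℝ × ℝ => (q.2, q.1 + t₂ - q.2, x)) h1 h2
  have hle : R ≤ ∫⁻ ε in Ioi 0, ∫⁻ s in Ioc t₁ t₂, ENNReal.ofReal C * G s (ε + t₂ - s) := by
    refine setLIntegral_mono' measurableSet_Ioi fun ε hε =>
      setLIntegral_mono' measurableSet_Ioc fun s hs => ?_
    have hσ : 0 < ε + t₂ - s := by
      have h1 : 0 < ε := hε
      linarith [hs.2]
    -- Of the factor `σ⁻³` in `duh`, half is absorbed by the normalization of `hav` and `σ^{-3/2}`
    -- remains.
    rw [hG]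
    simp only
    rw [← ofReal_norm, Real.norm_eq_abs, duh, abs_mul, abs_of_nonneg (by positivity),
      hav, ← inv_sqrt_pow_three hσ, ← mul_assoc (ENNReal.ofReal
      ((√(ε + t₂ - s))⁻¹ ^ 3)), ← ENNReal.ofReal_mul (by positivity), ← pow_add, mul_left_comm (ENNReal.ofReal C),
      ENNReal.ofReal_mul (by positivity)]
    exact mul_le_mul_right (hN u k _ x s) _
  refine hle.trans ?_
  -- Tonelli; for fixed `s` the shift `σ = ε + t₂ - s` turns `ε > 0` into `σ > t₂ - s`.
  rw [lintegral_lintegral_swap, duhMaj, ← lintegral_const_mul' _ _ ENNReal.ofReal_ne_top]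
  · refine setLIntegral_mono' measurableSet_Ioc fun s hs => ?_
    rw [lintegral_const_mul' _ _ ENNReal.ofReal_ne_top]
    refine mul_le_mul_right (le_of_eq ?_) _
    rw [← setLIntegral_Ioi_comp_add fun σ =>
      ENNReal.ofReal (σ ^ (-(3 / 2) : ℝ)) * hav (sq (u s)) σ x]
    simp only [add_sub_assoc, hG]
  · exact (hGm.const_mul _).aemeasurable

/-- The heat extension of a vector field. -/
def heatV (v : E3 → E3) (σ : ℝ) (x : E3) : E3 := WithLp.toLp 2 fun k => heat (fun y => v y k) σ x

theorem norm_le_sum_abs (v : E3) : ‖v‖ ≤ ∑ k, |v k| := by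
  rw [EuclideanSpace.norm_eq]
  refine Real.sqrt_le_iff.2 ⟨Finset.sum_nonneg fun k _ => abs_nonneg _, ?_⟩
  simp only [Fin.sum_univ_three, Real.norm_eq_abs]
  nlinarith [mul_nonneg (abs_nonneg (v 0)) (abs_nonneg (v 1)),
    mul_nonneg (abs_nonneg (v 0)) (abs_nonneg (v 2)), mul_nonneg (abs_nonneg (v 1)) (abs_nonneg (v 2))]

theorem NSFlow.exists_duhamel : ∃ C : ℝ, 0 < C ∧ ∀ {a b M : ℝ} {u : ℝ → E3 → E3}
    {p : ℝ → E3 → ℝ}, NSFlow a b M u p → ∀ (x : E3) {t₁ t₂ : ℝ}, a ≤ t₁ → t₁ < t₂ →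
    t₂ ≤ b → ENNReal.ofReal ‖u t₂ x - heatV (u t₁) (t₂ - t₁) x‖ ≤
      ENNReal.ofReal C * duhMaj u t₁ t₂ x := by
  obtain ⟨C, hC, h⟩ := NSFlow.exists_duhamel_comp
  refine ⟨3 * C, by positivity, fun {a b M u p} hf x t₁ t₂ h₁ h₁₂ h₂ => ?_⟩
  refine (ENNReal.ofReal_le_ofReal (norm_le_sum_abs _)).trans ?_
  rw [ENNReal.ofReal_sum_of_nonneg fun k _ => abs_nonneg _]
  refine (Finset.sum_le_sum fun k _ => h hf k x h₁ h₁₂ h₂).trans (le_of_eq ?_)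
  rw [ENNReal.ofReal_mul (by norm_num), mul_assoc]
  simp

theorem NSFlow.exists_norm_heatV_le : ∃ C : ℝ, 0 < C ∧ ∀ {a b M : ℝ} {u : ℝ → E3 → E3}
    {p : ℝ → E3 → ℝ}, NSFlow a b M u p → ∀ (t : ℝ) {σ : ℝ}, 0 < σ → ∀ x,
    ‖heatV (u t) σ x‖ ≤ C * (M * (√σ)⁻¹) := by
  obtain ⟨C, hC, hb⟩ := NSFlow.exists_abs_dil_comp_le heatS
  refine ⟨3 * C, by positivity, fun {a b M u p} h t σ hσ x => ?_⟩
  have hq0 : 0 < (√σ)⁻¹ := inv_pos.2 (Real.sqrt_pos.2 hσ)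
  have h1 : ∀ k, |heatV (u t) σ x k| ≤ C * (M * (√σ)⁻¹) := fun k => by
    change |heat (fun y => u t y k) σ x| ≤ _
    rw [heat, abs_mul, abs_of_pos (pow_pos hq0 3)]
    generalize (√σ)⁻¹ = q at *
    calc q ^ 3 * _ ≤ q ^ 3 * (C * (M / q ^ 2)) := by gcongr; exact hb h k t hq0 x
      _ = C * (M * q) := by field_simp
  refine (norm_le_sum_abs _).trans ((Finset.sum_le_sum fun k _ => h1 k).trans (le_of_eq ?_))
  simp
  ring

/-! ### Quadratic estimates -/

/-- Cauchy-Schwarz against the constant one for the measure with density `w`. -/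
theorem sq_lintegral_mul_le {α : Type*} [MeasurableSpace α] {μ : Measure α} {f w : α → ℝ≥0∞}
    (hf : Measurable f) (hw : Measurable w) :
    (∫⁻ z, w z * f z ∂μ) ^ 2 ≤ (∫⁻ z, w z ∂μ) * ∫⁻ z, w z * f z ^ 2 ∂μ := by
  have h := ENNReal.lintegral_mul_le_Lp_mul_Lq (μ.withDensity w) Real.HolderConjugate.two_two
    hf.aemeasurable (g := 1) aemeasurable_one
  have h1 := lintegral_withDensity_eq_lintegral_mul μ hw hf
  have h2 := lintegral_withDensity_eq_lintegral_mul μ hw (hf.pow_const 2)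
  simp only [Pi.mul_apply] at h1 h2
  simp only [Pi.mul_apply, mul_one, Pi.one_apply, one_pow, lintegral_one,
    withDensity_apply _ MeasurableSet.univ, Measure.restrict_univ, ENNReal.rpow_ofNat] at h
  rw [h1, h2] at h
  calc _ ≤ ((∫⁻ z, w z * f z ^ 2 ∂μ) ^ (1 / 2 : ℝ) * (∫⁻ z, w z ∂μ) ^ (1 / 2 : ℝ)) ^ 2 := by
        gcongr
    _ = _ := by
      rw [mul_pow, ← ENNReal.rpow_natCast, ← ENNReal.rpow_natCast, ← ENNReal.rpow_mul,
        ← ENNReal.rpow_mul]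
      norm_num
      rw [mul_comm]

theorem sq_av_le {F : E3 → ℝ≥0∞} (hF : Measurable F) {r : ℝ} (hr : 0 < r) (x : E3) :
    av F r x ^ 2 ≤ ENNReal.ofReal (K0 / r ^ 3) * av (fun y => F y ^ 2) r x := by
  have h := sq_lintegral_mul_le (μ := volume) hF (measurable_bk r x).ennreal_ofReal
  rw [lintegral_bk hr] at h
  simpa only [av, mul_comm] using h

theorem sq_hav_le {F : E3 → ℝ≥0∞} (hF : Measurable F) {σ : ℝ} (hσ : 0 < σ) (x : E3) :
    hav F σ x ^ 2 ≤ ENNReal.ofReal K0 * hav (fun y => F y ^ 2) σ x := by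
  have hq0 : 0 < (√σ)⁻¹ := inv_pos.2 (Real.sqrt_pos.2 hσ)
  rw [hav, hav, mul_pow]
  generalize (√σ)⁻¹ = q at *
  refine (mul_le_mul_right (sq_av_le hF hq0 x) _).trans (le_of_eq ?_)
  rw [← mul_assoc, ← mul_assoc, ← ENNReal.ofReal_pow (by positivity),
    ← ENNReal.ofReal_mul (by positivity), ← ENNReal.ofReal_mul K0_nonneg]
  congr 2
  field_simp

theorem measurable_av {F : E3 → ℝ≥0∞} (hF : Measurable F) (r : ℝ) : Measurable (av F r) := by
  have h1 : Measurable fun z : E3 × E3 => F z.2 * ENNReal.ofReal (bk r z.1 z.2) :=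
    (hF.comp measurable_snd).mul (continuous_bk.measurable.comp (by fun_prop :
      Measurable fun z : E3 × E3 => (r, z.1, z.2))).ennreal_ofReal
  exact h1.lintegral_prod_right'

theorem measurable_hav_right {F : E3 → ℝ≥0∞} (hF : Measurable F) (σ : ℝ) :
    Measurable (hav F σ) := (measurable_av hF _).const_mul _

/-- Tonelli, together with the symmetry of the kernel in its two points and its mass `K0` at every
heat time. -/
theorem lintegral_hav {F : E3 → ℝ≥0∞} (hF : Measurable F) {σ : ℝ} (hσ : 0 < σ) :
    ∫⁻ x, hav F σ x = ENNReal.ofReal K0 * ∫⁻ y, F y := by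
  have hq0 : 0 < (√σ)⁻¹ := inv_pos.2 (Real.sqrt_pos.2 hσ)
  have h1 : Measurable fun z : E3 × E3 => F z.2 * ENNReal.ofReal (bk (√σ)⁻¹ z.1 z.2) :=
    (hF.comp measurable_snd).mul (continuous_bk.measurable.comp (by fun_prop :
      Measurable fun z : E3 × E3 => ((√σ)⁻¹, z.1, z.2))).ennreal_ofReal
  simp only [hav]
  rw [lintegral_const_mul _ (measurable_av hF _)]
  simp only [av]
  rw [lintegral_lintegral_swap h1.aemeasurable]
  generalize (√σ)⁻¹ = q at *
  have h2 : ∀ y, ∫⁻ x, F y * ENNReal.ofReal (bk q x y) = F y * ENNReal.ofReal (K0 / q ^ 3) := by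
    intro y
    simp only [bk_comm q _ y]
    rw [lintegral_const_mul _ (measurable_bk q y).ennreal_ofReal, lintegral_bk hq0]
  simp only [h2]
  rw [lintegral_mul_const _ hF, mul_left_comm, ← ENNReal.ofReal_mul (by positivity), mul_comm]
  congr 2
  field_simp

theorem hav_le_lintegral (F : E3 → ℝ≥0∞) (σ : ℝ) (x : E3) :
    hav F σ x ≤ ENNReal.ofReal ((√σ)⁻¹ ^ 3) * ∫⁻ y, F y :=
  mul_le_mul_right (lintegral_mono fun _ => mul_le_of_le_one_right (zero_le)
    (ENNReal.ofReal_le_one.2 (bk_le_one _ _ _))) _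

theorem hav_add {F : E3 → ℝ≥0∞} (hF : Measurable F) (G : E3 → ℝ≥0∞) (σ : ℝ) (x : E3) :
    hav (fun y => F y + G y) σ x = hav F σ x + hav G σ x := by
  rw [hav, av_add hF, mul_add]; rfl

theorem hav_mono {F G : E3 → ℝ≥0∞} (h : ∀ y, F y ≤ G y) (σ : ℝ) (x : E3) :
    hav F σ x ≤ hav G σ x := mul_le_mul_right (av_mono h _ x) _

theorem ENNReal_sq_add_le (x y : ℝ≥0∞) : (x + y) ^ 2 ≤ 2 * x ^ 2 + 2 * y ^ 2 := by
  rw [← mul_add]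
  rcases eq_or_ne x ⊤ with hx | hx
  · simp [hx]
  rcases eq_or_ne y ⊤ with hy | hy
  · simp [hy]
  lift x to NNReal using hx
  lift y to NNReal using hy
  norm_cast
  rw [← NNReal.coe_le_coe]
  push_cast
  nlinarith [sq_nonneg ((x : ℝ) - y)]

/-- Split `|f|²` at the natural height `M q`, with `q = σ^{-1/2}`. The low part is square integrable
and averaging preserves this; the high part is integrable, so its average is both bounded and
integrable. -/
theorem WeakL3.lintegral_sq_hav_le {f : E3 → E3} (hf : WeakL3 M f) (hM : 0 < M)
    (hm : Measurable f) {σ : ℝ} (hσ : 0 < σ) :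
    ∫⁻ x, hav (sq f) σ x ^ 2 ≤ ENNReal.ofReal ((8 * K0 ^ 2 + 18 * K0) * (M ^ 4 * (√σ)⁻¹)) := by
  have hq0 : 0 < (√σ)⁻¹ := inv_pos.2 (Real.sqrt_pos.2 hσ)
  have hK := K0_nonneg
  set q := (√σ)⁻¹ with hq
  set F₁ : E3 → ℝ≥0∞ := fun y => ENNReal.ofReal (min ‖f y‖ (M * q) ^ 2) with hF₁
  set F₂ : E3 → ℝ≥0∞ := {y | M * q < ‖f y‖}.indicator fun y => ENNReal.ofReal (‖f y‖ ^ 2) with hF₂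
  have hS : MeasurableSet {y | M * q < ‖f y‖} := measurableSet_lt measurable_const hm.norm
  have m₁ : Measurable F₁ := ((hm.norm.min measurable_const).pow_const 2).ennreal_ofReal
  have m₂ : Measurable F₂ := ((hm.norm.pow_const 2).ennreal_ofReal).indicator hS
  have hI₂ : ∫⁻ y, F₂ y ≤ ENNReal.ofReal (3 * M ^ 2 / q) := by
    rw [hF₂, lintegral_indicator hS]
    refine (hf.setLIntegral_sq_le hM.le hm (by positivity)).trans
      (ENNReal.ofReal_le_ofReal (le_of_eq ?_))
    field_simp
  have h1 : ∫⁻ x, hav F₁ σ x ^ 2 ≤ ENNReal.ofReal (4 * K0 ^ 2 * (M ^ 4 * q)) := by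
    refine (lintegral_mono fun x => sq_hav_le m₁ hσ x).trans ?_
    rw [lintegral_const_mul _ (measurable_hav_right (m₁.pow_const 2) _),
      lintegral_hav (m₁.pow_const 2) hσ]
    have h2 : ∀ y, F₁ y ^ 2 = ENNReal.ofReal (min ‖f y‖ (M * q) ^ 4) := fun y => by
      rw [hF₁, ← ENNReal.ofReal_pow (by positivity)]
      congr 1
      ring
    simp only [h2]
    refine (mul_le_mul_right (mul_le_mul_right
      (hf.lintegral_min_pow_le hM.le hm (by positivity : 0 < M * q)) _) _).trans (le_of_eq ?_)
    rw [← ENNReal.ofReal_mul hK, ← ENNReal.ofReal_mul hK]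
    congr 1
    ring
  have h3 : ∫⁻ x, hav F₂ σ x ^ 2 ≤ ENNReal.ofReal (9 * K0 * (M ^ 4 * q)) := by
    have h4 : ∀ x, hav F₂ σ x ^ 2 ≤ ENNReal.ofReal (q ^ 3 * (3 * M ^ 2 / q)) * hav F₂ σ x :=
      fun x => by
        rw [pow_two]
        refine mul_le_mul_left ((hav_le_lintegral F₂ σ x).trans ?_) _
        rw [ENNReal.ofReal_mul (by positivity)]
        exact mul_le_mul_right hI₂ _
    refine (lintegral_mono h4).trans ?_
    rw [lintegral_const_mul _ (measurable_hav_right m₂ _), lintegral_hav m₂ hσ]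
    refine (mul_le_mul_right (mul_le_mul_right hI₂ _) _).trans (le_of_eq ?_)
    rw [← ENNReal.ofReal_mul hK, ← ENNReal.ofReal_mul (by positivity)]
    congr 1
    field_simp
    ring
  calc ∫⁻ x, hav (sq f) σ x ^ 2 ≤ ∫⁻ x, (2 * hav F₁ σ x ^ 2 + 2 * hav F₂ σ x ^ 2) := by
        refine lintegral_mono fun x => le_trans ?_ (ENNReal_sq_add_le _ _)
        rw [← hav_add m₁]
        gcongr
        exact hav_mono (fun y => ofReal_sq_le_min_add f (M * q) y) σ x
    _ ≤ 2 * ENNReal.ofReal (4 * K0 ^ 2 * (M ^ 4 * q)) + 2 * ENNReal.ofReal (9 * K0 * (M ^ 4 * q)) := by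
        rw [lintegral_add_left (((measurable_hav_right m₁ _).pow_const 2).const_mul _),
          lintegral_const_mul _ ((measurable_hav_right m₁ _).pow_const 2),
          lintegral_const_mul _ ((measurable_hav_right m₂ _).pow_const 2)]
        gcongr
    _ = _ := by
        rw [show (2 : ℝ≥0∞) = ENNReal.ofReal 2 by simp, ← ENNReal.ofReal_mul (by norm_num),
          ← ENNReal.ofReal_mul (by norm_num), ← ENNReal.ofReal_add (by positivity) (by positivity)]
        congr 1
        ring

end

/-! ### Square-integral bounds for the deviation and for the source term -/

section

variable {a b M : ℝ} {u : ℝ → E3 → E3} {p : ℝ → E3 → ℝ}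

theorem setLIntegral_Ioc_sub_rpow {q t₁ t₂ : ℝ} (hq : 0 < q) (h : t₁ ≤ t₂) :
    ∫⁻ s in Ioc t₁ t₂, ENNReal.ofReal ((t₂ - s) ^ (q - 1)) =
      ENNReal.ofReal ((t₂ - t₁) ^ q / q) := by
  rw [← lintegral_Ioc_rpow hq (sub_nonneg.2 h),
    ← setLIntegral_congr (Ioo_ae_eq_Ioc (μ := volume) (a := t₁) (b := t₂)),
    ← setLIntegral_congr (Ioo_ae_eq_Ioc (μ := volume) (a := 0) (b := t₂ - t₁)),
    ← (Measure.measurePreserving_sub_left volume t₂).setLIntegral_comp_preimage_emb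
      (MeasurableEquiv.subLeft t₂).measurableEmbedding _ (Ioo 0 (t₂ - t₁))]
  congr 2
  ext s
  simp only [mem_Ioo, mem_preimage]
  constructor <;> rintro ⟨h1, h2⟩ <;> constructor <;> linarith

/-- The weight in the Cauchy-Schwarz inequality for `duhMaj`. -/
def duhWeight (t₂ : ℝ) (z : ℝ × ℝ) : ℝ≥0∞ :=
  {z : ℝ × ℝ | t₂ - z.1 < z.2}.indicator (fun z => ENNReal.ofReal (z.2 ^ (-(7 / 4) : ℝ))) z

theorem measurable_duhWeight (t₂ : ℝ) : Measurable (duhWeight t₂) := by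
  have h : Measurable fun z : ℝ × ℝ => ENNReal.ofReal (z.2 ^ (-(7 / 4) : ℝ)) := by fun_prop
  exact h.indicator (measurableSet_lt (by fun_prop) (by fun_prop))

theorem lintegral_duhWeight {t₁ t₂ : ℝ} (h : t₁ ≤ t₂) :
    ∫⁻ z, duhWeight t₂ z ∂((volume.restrict (Ioc t₁ t₂)).prod volume) =
      ENNReal.ofReal (16 / 3 * (t₂ - t₁) ^ (1 / 4 : ℝ)) := by
  rw [lintegral_prod _ (measurable_duhWeight t₂).aemeasurable,
    ← setLIntegral_congr (Ioo_ae_eq_Ioc (μ := volume) (a := t₁) (b := t₂))]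
  have h1 : ∀ s ∈ Ioo t₁ t₂, ∫⁻ σ, duhWeight t₂ (s, σ) =
      ENNReal.ofReal (4 / 3) * ENNReal.ofReal ((t₂ - s) ^ ((1 / 4 : ℝ) - 1)) := fun s hs => by
    have h2 : ∀ σ, duhWeight t₂ (s, σ) = (Ioi (t₂ - s)).indicator
        (fun σ => ENNReal.ofReal (σ ^ ((-(3 / 4) : ℝ) - 1))) σ := fun σ => by
      simp only [duhWeight, indicator, mem_Ioi]
      norm_num
    simp only [h2]
    rw [lintegral_indicator measurableSet_Ioi,
      lintegral_Ioi_rpow (by norm_num) (sub_pos.2 hs.2), ← ENNReal.ofReal_mul (by norm_num)]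
    congr 1
    norm_num
    ring
  rw [setLIntegral_congr_fun measurableSet_Ioo h1,
    lintegral_const_mul' _ _ ENNReal.ofReal_ne_top,
    setLIntegral_congr (Ioo_ae_eq_Ioc (μ := volume) (a := t₁) (b := t₂)),
    setLIntegral_Ioc_sub_rpow (by norm_num) h, ← ENNReal.ofReal_mul (by norm_num)]
  congr 1
  ring

theorem NSFlow.measurable_weighted (h : NSFlow a b M u p) :
    Measurable fun z : E3 × ℝ × ℝ =>
      ENNReal.ofReal (z.2.2 ^ (1 / 4 : ℝ)) * hav (sq (u z.2.1)) z.2.2 z.1 := by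
  have h1 : Measurable fun z : E3 × ℝ × ℝ => ENNReal.ofReal (z.2.2 ^ (1 / 4 : ℝ)) := by fun_prop
  have h2 : Measurable fun z : E3 × ℝ × ℝ => (z.2.1, z.2.2, z.1) := by fun_prop
  exact h1.mul (Measurable.comp (g := fun q : ℝ × ℝ × E3 => hav (sq (u q.1)) q.2.1 q.2.2)
    (f := fun z : E3 × ℝ × ℝ => (z.2.1, z.2.2, z.1)) h.measurable_hav_sq h2)

theorem NSFlow.duhMaj_eq (h : NSFlow a b M u p) (t₁ t₂ : ℝ) (x : E3) :
    duhMaj u t₁ t₂ x = ∫⁻ z, duhWeight t₂ z *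
      (ENNReal.ofReal (z.2 ^ (1 / 4 : ℝ)) * hav (sq (u z.1)) z.2 x)
        ∂((volume.restrict (Ioc t₁ t₂)).prod volume) := by
  have hm : Measurable fun z : ℝ × ℝ =>
      ENNReal.ofReal (z.2 ^ (1 / 4 : ℝ)) * hav (sq (u z.1)) z.2 x :=
    h.measurable_weighted.comp (measurable_prodMk_left (x := x))
  have hm' : Measurable fun z : ℝ × ℝ => duhWeight t₂ z *
      (ENNReal.ofReal (z.2 ^ (1 / 4 : ℝ)) * hav (sq (u z.1)) z.2 x) :=
    (measurable_duhWeight t₂).mul hm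
  rw [lintegral_prod _ hm'.aemeasurable, duhMaj]
  refine setLIntegral_congr_fun measurableSet_Ioc fun s hs => ?_
  rw [← lintegral_indicator measurableSet_Ioi]
  refine lintegral_congr fun σ => ?_
  by_cases hσ : t₂ - s < σ
  · have hσ0 : 0 < σ := by linarith [hs.2]
    rw [indicator_of_mem (by exact hσ), duhWeight, indicator_of_mem (by exact hσ), ← mul_assoc,
      ← ENNReal.ofReal_mul (by positivity), ← Real.rpow_add hσ0]
    norm_num
  · rw [indicator_of_notMem (by exact hσ), duhWeight, indicator_of_notMem (by exact hσ), zero_mul]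

/-- Cauchy-Schwarz with `σ^{-3/2} = σ^{-7/4} σ^{1/4}`. The squared factor `σ^{1/2}` cancels the
`σ^{-1/2}` in the square integral of the averages, and the weight `σ^{-7/4}` on `σ > t₂ - s` has
mass of order `(t₂ - t₁)^{1/4}`, which occurs twice. -/
theorem NSFlow.exists_lintegral_duhMaj_sq_le : ∃ C : ℝ, 0 < C ∧ ∀ {a b M : ℝ} {u : ℝ → E3 → E3}
    {p : ℝ → E3 → ℝ}, NSFlow a b M u p → ∀ {t₁ t₂ : ℝ}, t₁ ≤ t₂ →
    ∫⁻ x, duhMaj u t₁ t₂ x ^ 2 ≤ ENNReal.ofReal (C * (M ^ 4 * √(t₂ - t₁))) := by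
  have hK := K0_nonneg
  refine ⟨(16 / 3) ^ 2 * (8 * K0 ^ 2 + 18 * K0) + 1, by positivity,
    fun {a b M u p} h t₁ t₂ h₁₂ => ?_⟩
  have hM := h.M_pos
  set A := 8 * K0 ^ 2 + 18 * K0 with hA
  set μ := (volume.restrict (Ioc t₁ t₂)).prod (volume : Measure ℝ) with hμ
  set W := ENNReal.ofReal (16 / 3 * (t₂ - t₁) ^ (1 / 4 : ℝ)) with hW
  have hW' : ∫⁻ z, duhWeight t₂ z ∂μ = W := lintegral_duhWeight h₁₂
  have hm := h.measurable_weighted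
  have h1 : ∀ x, duhMaj u t₁ t₂ x ^ 2 ≤ W * ∫⁻ z, duhWeight t₂ z *
      (ENNReal.ofReal (z.2 ^ (1 / 4 : ℝ)) * hav (sq (u z.1)) z.2 x) ^ 2 ∂μ := fun x => by
    rw [h.duhMaj_eq, ← hW']
    exact sq_lintegral_mul_le (hm.comp (measurable_prodMk_left (x := x)))
      (measurable_duhWeight t₂)
  have h2 : ∀ᵐ z ∂μ, ∫⁻ x, duhWeight t₂ z *
      (ENNReal.ofReal (z.2 ^ (1 / 4 : ℝ)) * hav (sq (u z.1)) z.2 x) ^ 2 ≤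
      duhWeight t₂ z * ENNReal.ofReal (A * M ^ 4) := by
    have h3 : ∀ᵐ z ∂μ, z.1 ∈ Ioc t₁ t₂ :=
      Measure.quasiMeasurePreserving_fst.ae (ae_restrict_mem measurableSet_Ioc)
    filter_upwards [h3] with z hz
    by_cases hσ : t₂ - z.1 < z.2
    · have hσ0 : 0 < z.2 := by linarith [hz.2]
      have hh : Measurable (hav (sq (u z.1)) z.2) :=
        measurable_hav_right (h.measurable_sq.comp measurable_prodMk_left) _
      rw [lintegral_const_mul _ ((hh.const_mul _).pow_const 2)]
      refine mul_le_mul_right ?_ _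
      simp only [mul_pow]
      rw [lintegral_const_mul _ (hh.pow_const 2)]
      refine (mul_le_mul_right ((h.weak z.1).lintegral_sq_hav_le hM (h.cont_slice z.1).measurable
        hσ0) _).trans (le_of_eq ?_)
      rw [← ENNReal.ofReal_pow (by positivity), ← ENNReal.ofReal_mul (by positivity)]
      congr 1
      have h4 : (z.2 ^ (1 / 4 : ℝ)) ^ 2 = √z.2 := by
        rw [Real.sqrt_eq_rpow, ← Real.rpow_natCast, ← Real.rpow_mul hσ0.le]
        norm_num
      have h5 : √z.2 ≠ 0 := (Real.sqrt_pos.2 hσ0).ne'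
      rw [h4]
      field_simp
      rw [hA]
      ring
    · simp only [duhWeight, indicator_of_notMem (show z ∉ {z : ℝ × ℝ | t₂ - z.1 < z.2} from hσ),
        zero_mul, lintegral_zero, le_refl]
  have hm2 : Measurable fun q : E3 × ℝ × ℝ => duhWeight t₂ q.2 *
      (ENNReal.ofReal (q.2.2 ^ (1 / 4 : ℝ)) * hav (sq (u q.2.1)) q.2.2 q.1) ^ 2 :=
    ((measurable_duhWeight t₂).comp measurable_snd).mul (hm.pow_const 2)
  calc ∫⁻ x, duhMaj u t₁ t₂ x ^ 2 ≤ ∫⁻ x, W * ∫⁻ z, duhWeight t₂ z *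
      (ENNReal.ofReal (z.2 ^ (1 / 4 : ℝ)) * hav (sq (u z.1)) z.2 x) ^ 2 ∂μ := lintegral_mono h1
    _ = W * ∫⁻ z, (∫⁻ x, duhWeight t₂ z *
      (ENNReal.ofReal (z.2 ^ (1 / 4 : ℝ)) * hav (sq (u z.1)) z.2 x) ^ 2) ∂μ := by
        rw [lintegral_const_mul' _ _ ENNReal.ofReal_ne_top,
          lintegral_lintegral_swap hm2.aemeasurable]
    _ ≤ W * (W * ENNReal.ofReal (A * M ^ 4)) := by
        refine mul_le_mul_right ((lintegral_mono_ae h2).trans (le_of_eq ?_)) _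
        rw [lintegral_mul_const _ (measurable_duhWeight t₂), hW']
    _ ≤ _ := by
        have h0 : 0 ≤ t₂ - t₁ := sub_nonneg.2 h₁₂
        rw [hW, ← ENNReal.ofReal_mul (by positivity), ← ENNReal.ofReal_mul (by positivity)]
        refine ENNReal.ofReal_le_ofReal ?_
        have h4 : (t₂ - t₁) ^ (1 / 4 : ℝ) * (t₂ - t₁) ^ (1 / 4 : ℝ) = √(t₂ - t₁) := by
          rw [Real.sqrt_eq_rpow, ← Real.rpow_add' h0 (by norm_num)]
          norm_num
        rw [← h4]
        have h5 : 0 ≤ M ^ 4 * ((t₂ - t₁) ^ (1 / 4 : ℝ) * (t₂ - t₁) ^ (1 / 4 : ℝ)) := by positivity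
        linarith

theorem NSFlow.exists_lintegral_sub_heatV_sq_le : ∃ C : ℝ, 0 < C ∧ ∀ {a b M : ℝ}
    {u : ℝ → E3 → E3} {p : ℝ → E3 → ℝ}, NSFlow a b M u p → ∀ {t₁ t₂ : ℝ}, a ≤ t₁ → t₁ < t₂ →
    t₂ ≤ b → ∫⁻ x, ENNReal.ofReal (‖u t₂ x - heatV (u t₁) (t₂ - t₁) x‖ ^ 2) ≤
      ENNReal.ofReal (C * (M ^ 4 * √(t₂ - t₁))) := by
  obtain ⟨C₁, hC₁, h1⟩ := NSFlow.exists_duhamel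
  obtain ⟨C₂, hC₂, h2⟩ := NSFlow.exists_lintegral_duhMaj_sq_le
  refine ⟨C₁ ^ 2 * C₂, by positivity, fun {a b M u p} h t₁ t₂ ha hab hb => ?_⟩
  calc _ ≤ ∫⁻ x, ENNReal.ofReal C₁ ^ 2 * duhMaj u t₁ t₂ x ^ 2 := lintegral_mono fun x => by
        rw [ENNReal.ofReal_pow (norm_nonneg _), ← mul_pow]
        gcongr
        exact h1 h x ha hab hb
    _ ≤ ENNReal.ofReal C₁ ^ 2 * ENNReal.ofReal (C₂ * (M ^ 4 * √(t₂ - t₁))) := by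
        rw [lintegral_const_mul' _ _ (ENNReal.pow_ne_top ENNReal.ofReal_ne_top)]
        exact mul_le_mul_right (h2 h hab.le) _
    _ = _ := by
        rw [← ENNReal.ofReal_pow hC₁.le, ← ENNReal.ofReal_mul (by positivity)]
        congr 1
        ring

/-- Jensen's inequality for averages, after bounding the heat kernel by the averaging kernel. -/
theorem exists_ofReal_norm_heatV_sq_le : ∃ C : ℝ, 0 < C ∧ ∀ {v : E3 → E3}, Measurable v →
    ∀ {σ : ℝ}, 0 < σ → ∀ x,
    ENNReal.ofReal (‖heatV v σ x‖ ^ 2) ≤ ENNReal.ofReal C * hav (sq v) σ x := by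
  obtain ⟨C, hC, h⟩ := exists_ofReal_abs_dil_le heatS
  have hK := K0_nonneg
  refine ⟨(3 * C) ^ 2 * K0 + 1, by positivity, fun {v} hv σ hσ x => ?_⟩
  have hm : Measurable fun y => ENNReal.ofReal ‖v y‖ := hv.norm.ennreal_ofReal
  have h1 : ENNReal.ofReal ‖heatV v σ x‖ ≤
      ENNReal.ofReal (3 * C) * hav (fun y => ENNReal.ofReal ‖v y‖) σ x := by
    refine (ENNReal.ofReal_le_ofReal (norm_le_sum_abs _)).trans ?_
    rw [ENNReal.ofReal_sum_of_nonneg fun k _ => abs_nonneg _]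
    have h2 : ∀ k, ENNReal.ofReal |heatV v σ x k| ≤
        ENNReal.ofReal C * hav (fun y => ENNReal.ofReal ‖v y‖) σ x := fun k => by
      change ENNReal.ofReal |heat (fun y => v y k) σ x| ≤ _
      rw [heat, abs_mul, abs_of_nonneg (by positivity), ENNReal.ofReal_mul (by positivity), hav,
        mul_left_comm]
      refine mul_le_mul_right ((h _ _ x).trans (mul_le_mul_right (av_mono (fun y => ?_) _ x) _)) _
      exact ENNReal.ofReal_le_ofReal (abs_coord_le _ k)
    refine (Finset.sum_le_sum fun k _ => h2 k).trans (le_of_eq ?_)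
    rw [ENNReal.ofReal_mul (by norm_num), mul_assoc]
    simp
  have h3 : (fun y => ENNReal.ofReal ‖v y‖ ^ 2) = sq v := by
    ext y
    rw [sq, ENNReal.ofReal_pow (norm_nonneg _)]
  rw [ENNReal.ofReal_pow (norm_nonneg _)]
  calc _ ≤ (ENNReal.ofReal (3 * C) * hav (fun y => ENNReal.ofReal ‖v y‖) σ x) ^ 2 := by gcongr
    _ ≤ ENNReal.ofReal (3 * C) ^ 2 * (ENNReal.ofReal K0 * hav (sq v) σ x) := by
        rw [mul_pow, ← h3]
        gcongr
        exact sq_hav_le hm hσ x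
    _ ≤ _ := by
        rw [← mul_assoc, ← ENNReal.ofReal_pow (by positivity), ← ENNReal.ofReal_mul (by positivity)]
        gcongr
        linarith

/-- Split `|u|²` at height `M q`, with `q = τ^{-1/2}`. Below, Young's inequality reduces to fourth
powers of the truncated field and of the heat extension; above, the heat extension is bounded by a
multiple of `M q` and `|u|²` is integrable. -/
theorem NSFlow.exists_lintegral_sq_mul_heatV_sq_le : ∃ C : ℝ, 0 < C ∧ ∀ {a b M : ℝ}
    {u : ℝ → E3 → E3} {p : ℝ → E3 → ℝ}, NSFlow a b M u p → ∀ (t s : ℝ) {τ : ℝ}, 0 < τ →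
    ∫⁻ x, ENNReal.ofReal (‖u t x‖ ^ 2 * ‖heatV (u s) τ x‖ ^ 2) ≤
      ENNReal.ofReal (C * (M ^ 4 * (√τ)⁻¹)) := by
  obtain ⟨C₁, hC₁, h1⟩ := NSFlow.exists_norm_heatV_le
  obtain ⟨C₂, hC₂, h2⟩ := exists_ofReal_norm_heatV_sq_le
  have hK := K0_nonneg
  refine ⟨4 + C₂ ^ 2 * (8 * K0 ^ 2 + 18 * K0) + 3 * C₁ ^ 2, by positivity,
    fun {a b M u p} h t s τ hτ => ?_⟩
  have hM := h.M_pos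
  have hq0 : 0 < (√τ)⁻¹ := inv_pos.2 (Real.sqrt_pos.2 hτ)
  have hmt := (h.cont_slice t).measurable
  have hms := (h.cont_slice s).measurable
  have hsq := (h.weak s).lintegral_sq_hav_le hM hms hτ
  have hle1 := h1 h s hτ
  have hle2 := fun x => h2 hms hτ x
  have hmh : Measurable (hav (sq (u s)) τ) :=
    measurable_hav_right (h.measurable_sq.comp measurable_prodMk_left) _
  generalize (√τ)⁻¹ = q at *
  set l := heatV (u s) τ
  have hS : MeasurableSet {y | M * q < ‖u t y‖} := measurableSet_lt measurable_const hmt.norm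
  have hpt : ∀ x, ENNReal.ofReal (‖u t x‖ ^ 2 * ‖l x‖ ^ 2) ≤
      ENNReal.ofReal (min ‖u t x‖ (M * q) ^ 4) +
        ENNReal.ofReal C₂ ^ 2 * hav (sq (u s)) τ x ^ 2 +
      ENNReal.ofReal ((C₁ * (M * q)) ^ 2) *
        {y | M * q < ‖u t y‖}.indicator (fun y => ENNReal.ofReal (‖u t y‖ ^ 2)) x := fun x => by
    rw [ENNReal.ofReal_mul (by positivity)]
    refine (mul_le_mul_left (ofReal_sq_le_min_add (u t) (M * q) x) _).trans ?_
    rw [add_mul]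
    refine add_le_add ?_ ?_
    · have h3 : ENNReal.ofReal (min ‖u t x‖ (M * q) ^ 2) * ENNReal.ofReal (‖l x‖ ^ 2) ≤
          ENNReal.ofReal (min ‖u t x‖ (M * q) ^ 2) ^ 2 + ENNReal.ofReal (‖l x‖ ^ 2) ^ 2 := by
        rw [← ENNReal.ofReal_mul (by positivity), ← ENNReal.ofReal_pow (by positivity),
          ← ENNReal.ofReal_pow (by positivity), ← ENNReal.ofReal_add (by positivity) (by positivity)]
        refine ENNReal.ofReal_le_ofReal ?_
        nlinarith [sq_nonneg (min ‖u t x‖ (M * q) ^ 2 - ‖l x‖ ^ 2),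
          sq_nonneg (min ‖u t x‖ (M * q) ^ 2), sq_nonneg (‖l x‖ ^ 2)]
      refine h3.trans (add_le_add (le_of_eq ?_) ?_)
      · rw [← ENNReal.ofReal_pow (by positivity)]
        congr 1
        ring
      · rw [← mul_pow]
        gcongr
        exact hle2 x
    · rw [mul_comm]
      gcongr
      exact hle1 x
  refine (lintegral_mono hpt).trans ?_
  rw [lintegral_add_right _ ((hmt.norm.pow_const 2).ennreal_ofReal.indicator hS |>.const_mul _),
    lintegral_add_right _ ((hmh.pow_const 2).const_mul _),
    lintegral_const_mul _ (hmh.pow_const 2),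
    lintegral_const_mul _ ((hmt.norm.pow_const 2).ennreal_ofReal.indicator hS),
    lintegral_indicator hS]
  refine (add_le_add (add_le_add ((h.weak t).lintegral_min_pow_le hM.le hmt (by positivity))
    (mul_le_mul_right hsq _)) (mul_le_mul_right
    ((h.weak t).setLIntegral_sq_le hM.le hmt (by positivity)) _)).trans (le_of_eq ?_)
  rw [← ENNReal.ofReal_pow hC₂.le, ← ENNReal.ofReal_mul (by positivity),
    ← ENNReal.ofReal_mul (by positivity), ← ENNReal.ofReal_add (by positivity) (by positivity),
    ← ENNReal.ofReal_add (by positivity) (by positivity)]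
  congr 1
  field_simp

end

section

/-! ### A Lorentz-Sobolev inequality -/

/-- The quantity `∫₀^∞ |{|w|² > α}|^{1/3} dα`, equivalent to the square of the `L^{6,2}` norm. -/
def lorS (w : E3 → E3) : ℝ≥0∞ := ∫⁻ α in Ioi (0 : ℝ), volume {x | α < ‖w x‖ ^ 2} ^ (1 / 3 : ℝ)

theorem exists_deriv_smoothTransition_le : ∃ D : ℝ, 0 < D ∧
    ∀ s, |deriv Real.smoothTransition s| ≤ (Icc (0 : ℝ) 1).indicator (fun _ => D) s := by
  have hc : Continuous (deriv Real.smoothTransition) :=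
    (Real.smoothTransition.contDiff (n := 1)).continuous_deriv (by simp)
  obtain ⟨D, hD⟩ := (isCompact_Icc (a := (0 : ℝ)) (b := 1)).exists_bound_of_continuousOn
    hc.continuousOn
  refine ⟨|D| + 1, by positivity, fun s => ?_⟩
  by_cases hs : s ∈ Icc (0 : ℝ) 1
  · rw [indicator_of_mem hs]
    exact (hD s hs).trans ((le_abs_self D).trans (by linarith))
  · rw [indicator_of_notMem hs]
    have : deriv Real.smoothTransition s = 0 := by
      rcases lt_or_ge s 0 with h0 | h0
      · have : Real.smoothTransition =ᶠ[𝓝 s] fun _ => 0 := by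
          filter_upwards [gt_mem_nhds h0] with y hy
          exact Real.smoothTransition.zero_of_nonpos hy.le
        rw [this.deriv_eq, deriv_const]
      · have h1 : 1 < s := by
          by_contra h1
          exact hs ⟨h0, not_lt.1 h1⟩
        have : Real.smoothTransition =ᶠ[𝓝 s] fun _ => 1 := by
          filter_upwards [lt_mem_nhds h1] with y hy
          exact Real.smoothTransition.one_of_one_le hy.le
        rw [this.deriv_eq, deriv_const]
    rw [this, abs_zero]

/-- The embedding of `Ḣ¹` in `L⁶` in dimension three, squared. -/
theorem exists_gagliardo_nirenberg : ∃ C : ℝ, 0 < C ∧ ∀ g : E3 → ℝ, ContDiff ℝ 1 g →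
    HasCompactSupport g → (∫⁻ x, ‖g x‖ₑ ^ 6) ^ (1 / 3 : ℝ) ≤
      ENNReal.ofReal C * ∫⁻ x, ‖fderiv ℝ g x‖ₑ ^ 2 := by
  set K := SNormLESNormFDerivOfEqConst ℝ (volume : Measure E3) ((2 : NNReal) : ℝ) with hK
  refine ⟨(K : ℝ) ^ 2 + 1, by positivity, fun g hg hs => ?_⟩
  have h := eLpNorm_le_eLpNorm_fderiv_of_eq (volume : Measure E3) hg hs (p := 2) (p' := 6)
    (by norm_num) (by simp) (by simp; norm_num)
  have h6 := eLpNorm_nnreal_pow_eq_lintegral (μ := (volume : Measure E3)) (f := g)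
    (p := 6) (by norm_num)
  have h2 := eLpNorm_nnreal_pow_eq_lintegral (μ := (volume : Measure E3)) (f := fderiv ℝ g)
    (p := 2) (by norm_num)
  have e6 : ∫⁻ x, ‖g x‖ₑ ^ 6 = eLpNorm g ((6 : NNReal) : ℝ≥0∞) volume ^ (6 : ℝ) := by
    rw [show (6 : ℝ) = ((6 : NNReal) : ℝ) by norm_num, h6]
    simp only [NNReal.coe_ofNat, ENNReal.rpow_ofNat]
  have e2 : ∫⁻ x, ‖fderiv ℝ g x‖ₑ ^ 2 =
      eLpNorm (fderiv ℝ g) ((2 : NNReal) : ℝ≥0∞) volume ^ (2 : ℝ) := by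
    rw [show (2 : ℝ) = ((2 : NNReal) : ℝ) by norm_num, h2]
    simp only [NNReal.coe_ofNat, ENNReal.rpow_ofNat]
  rw [e6, e2, ← ENNReal.rpow_mul]
  norm_num only [ENNReal.rpow_ofNat]
  calc eLpNorm g ((6 : NNReal) : ℝ≥0∞) volume ^ 2 ≤
      ((K : ℝ≥0∞) * eLpNorm (fderiv ℝ g) ((2 : NNReal) : ℝ≥0∞) volume) ^ 2 := by gcongr
    _ ≤ _ := by
      rw [mul_pow]
      gcongr
      rw [← ENNReal.ofReal_coe_nnreal, ← ENNReal.ofReal_pow (by positivity)]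
      exact ENNReal.ofReal_le_ofReal (by linarith)

/-- Sobolev's inequality is applied to a smooth step of `|w|²/α`. The gradient of the step lives
where `|w|²` is comparable to `α`, so the gradient of `w` is charged only near its own level. -/
theorem exists_volume_level_le : ∃ C : ℝ, 0 < C ∧ ∀ w : E3 → E3, ContDiff ℝ 1 w →
    HasCompactSupport w → ∀ α : ℝ, 0 < α → volume {x | α < ‖w x‖ ^ 2} ^ (1 / 3 : ℝ) ≤
      ENNReal.ofReal C * ∫⁻ x, {x : E3 | α ≤ 2 * ‖w x‖ ^ 2 ∧ ‖w x‖ ^ 2 ≤ α}.indicator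
        (fun x => ENNReal.ofReal (α⁻¹ * ‖fderiv ℝ w x‖ ^ 2)) x := by
  obtain ⟨D, hD, hder⟩ := exists_deriv_smoothTransition_le
  obtain ⟨C, hC, hGN⟩ := exists_gagliardo_nirenberg
  refine ⟨C * (16 * D ^ 2), by positivity, fun w hw hs α hα => ?_⟩
  -- The step is one where `|w|² ≥ α` and zero where `2|w|² ≤ α`.
  set g : E3 → ℝ := fun x => Real.smoothTransition (2 / α * ‖w x‖ ^ 2 - 1) with hg
  have hgd : ContDiff ℝ 1 g := (Real.smoothTransition.contDiff (n := 1)).comp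
    ((contDiff_const.mul (hw.norm_sq ℝ)).sub contDiff_const)
  have hgs : HasCompactSupport g := hs.comp_left (g := fun v : E3 =>
    Real.smoothTransition (2 / α * ‖v‖ ^ 2 - 1)) (by simp)
  have h1 : volume {x | α < ‖w x‖ ^ 2} ≤ ∫⁻ x, ‖g x‖ₑ ^ 6 := by
    have hS : MeasurableSet {x | α < ‖w x‖ ^ 2} :=
      measurableSet_lt measurable_const (hw.continuous.norm.pow 2).measurable
    rw [← lintegral_indicator_one hS]
    refine lintegral_mono fun x => ?_
    by_cases hx : α < ‖w x‖ ^ 2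
    · have : g x = 1 := Real.smoothTransition.one_of_one_le (by
        have : 2 ≤ 2 / α * ‖w x‖ ^ 2 := by
          rw [div_mul_eq_mul_div, le_div_iff₀ hα]
          linarith
        linarith)
      simp [this, indicator_of_mem (show x ∈ {x | α < ‖w x‖ ^ 2} from hx)]
    · simp [indicator_of_notMem (show x ∉ {x | α < ‖w x‖ ^ 2} from hx)]
  have h2 : ∀ x, ‖fderiv ℝ g x‖ₑ ^ 2 ≤ ENNReal.ofReal (16 * D ^ 2) *
      {x : E3 | α ≤ 2 * ‖w x‖ ^ 2 ∧ ‖w x‖ ^ 2 ≤ α}.indicator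
        (fun x => ENNReal.ofReal (α⁻¹ * ‖fderiv ℝ w x‖ ^ 2)) x := fun x => by
    set s := 2 / α * ‖w x‖ ^ 2 - 1 with hs
    have hwx := ((hw.differentiable one_ne_zero) x).hasFDerivAt
    have hφ : HasDerivAt Real.smoothTransition (deriv Real.smoothTransition s) s :=
      ((Real.smoothTransition.contDiff (n := 1)).differentiable (by simp) s).hasDerivAt
    have hd := hφ.comp_hasFDerivAt (f := fun x => 2 / α * ‖w x‖ ^ 2 - 1) x
      ((hwx.norm_sq.const_mul (2 / α)).sub_const 1)
    have hval : fderiv ℝ g x = _ := hd.fderiv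
    have hnorm : ‖fderiv ℝ g x‖ ≤
        |deriv Real.smoothTransition s| * (4 / α * (‖w x‖ * ‖fderiv ℝ w x‖)) := by
      rw [hval, norm_smul, Real.norm_eq_abs]
      gcongr
      rw [norm_smul, Real.norm_of_nonneg (by positivity), two_smul]
      have h3 : ‖(innerSL ℝ (w x)).comp (fderiv ℝ w x)‖ ≤ ‖w x‖ * ‖fderiv ℝ w x‖ := by
        refine (ContinuousLinearMap.opNorm_comp_le _ _).trans (le_of_eq ?_)
        rw [innerSL_apply_norm]
      calc _ ≤ 2 / α * (‖w x‖ * ‖fderiv ℝ w x‖ + ‖w x‖ * ‖fderiv ℝ w x‖) := by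
            gcongr
            exact (norm_add_le _ _).trans (add_le_add h3 h3)
        _ = _ := by ring
    rw [← ofReal_norm, ← ENNReal.ofReal_pow (norm_nonneg _)]
    have hds := hder s
    by_cases hx : x ∈ {x : E3 | α ≤ 2 * ‖w x‖ ^ 2 ∧ ‖w x‖ ^ 2 ≤ α}
    · rw [indicator_of_mem hx, ← ENNReal.ofReal_mul (by positivity)]
      refine ENNReal.ofReal_le_ofReal ?_
      have hds' : |deriv Real.smoothTransition s| ≤ D := by
        refine hds.trans ?_
        rw [indicator]
        split_ifs
        exacts [le_rfl, hD.le]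
      calc ‖fderiv ℝ g x‖ ^ 2 ≤ (D * (4 / α * (‖w x‖ * ‖fderiv ℝ w x‖))) ^ 2 := by
            gcongr
            exact hnorm.trans (by gcongr)
        _ = 16 * D ^ 2 / α ^ 2 * ‖fderiv ℝ w x‖ ^ 2 * ‖w x‖ ^ 2 := by ring
        _ ≤ 16 * D ^ 2 / α ^ 2 * ‖fderiv ℝ w x‖ ^ 2 * α := by gcongr; exact hx.2
        _ = _ := by field_simp
    · have hs' : s ∉ Icc (0 : ℝ) 1 := fun h => hx (by
        have e : α * (s + 1) = 2 * ‖w x‖ ^ 2 := by rw [hs]; field_simp; ring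
        constructor
        · nlinarith [h.1]
        · nlinarith [h.2])
      rw [indicator_of_notMem hs'] at hds
      rw [abs_nonpos_iff.1 hds, abs_zero, zero_mul] at hnorm
      simp [le_antisymm hnorm (norm_nonneg _)]
  calc _ ≤ (∫⁻ x, ‖g x‖ₑ ^ 6) ^ (1 / 3 : ℝ) := by gcongr
    _ ≤ ENNReal.ofReal C * ∫⁻ x, ‖fderiv ℝ g x‖ₑ ^ 2 := hGN g hgd hgs
    _ ≤ ENNReal.ofReal C * (ENNReal.ofReal (16 * D ^ 2) *
        ∫⁻ x, {x : E3 | α ≤ 2 * ‖w x‖ ^ 2 ∧ ‖w x‖ ^ 2 ≤ α}.indicator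
        (fun x => ENNReal.ofReal (α⁻¹ * ‖fderiv ℝ w x‖ ^ 2)) x) := by
        rw [← lintegral_const_mul' (ENNReal.ofReal (16 * D ^ 2)) _ ENNReal.ofReal_ne_top]
        exact mul_le_mul_right (lintegral_mono h2) _
    _ = _ := by rw [← mul_assoc, ← ENNReal.ofReal_mul hC.le]

/-- The measure `dα/α` gives an interval `[r, 2r]` bounded mass, whatever `r`. -/
theorem setLIntegral_Icc_inv_le {r : ℝ} (hr : 0 ≤ r) :
    ∫⁻ α in Ioi (0 : ℝ), (Icc r (2 * r)).indicator (fun α => ENNReal.ofReal α⁻¹) α ≤ 1 := by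
  rcases hr.eq_or_lt with rfl | hr
  · simp only [mul_zero, Icc_self]
    rw [setLIntegral_congr_fun measurableSet_Ioi (g := fun _ => 0) fun α hα =>
      indicator_of_notMem (by simpa using (ne_of_gt hα)) _]
    simp
  calc _ ≤ ∫⁻ α, (Icc r (2 * r)).indicator (fun α => ENNReal.ofReal α⁻¹) α :=
        setLIntegral_le_lintegral _ _
    _ = ∫⁻ α in Icc r (2 * r), ENNReal.ofReal α⁻¹ := lintegral_indicator measurableSet_Icc _
    _ ≤ ∫⁻ α in Icc r (2 * r), ENNReal.ofReal r⁻¹ :=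
        setLIntegral_mono' measurableSet_Icc fun α hα =>
          ENNReal.ofReal_le_ofReal (inv_anti₀ hr hα.1)
    _ = 1 := by
        rw [setLIntegral_const, Real.volume_Icc, ← ENNReal.ofReal_mul (by positivity)]
        rw [show r⁻¹ * (2 * r - r) = 1 by field_simp; ring, ENNReal.ofReal_one]

/-- Integrate the level inequality over `α`. By Tonelli each point `x` counts only for `α` between
`|w x|²` and `2|w x|²`, with total weight at most one, so the levels add up to a single Dirichlet
integral. -/
theorem exists_lorS_le : ∃ C : ℝ, 0 < C ∧ ∀ w : E3 → E3, ContDiff ℝ 1 w →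
    HasCompactSupport w → lorS w ≤ ENNReal.ofReal C * ∫⁻ x, ENNReal.ofReal (‖fderiv ℝ w x‖ ^ 2) := by
  obtain ⟨C, hC, h⟩ := exists_volume_level_le
  refine ⟨C, hC, fun w hw hs => ?_⟩
  have hn : Continuous fun x => ‖w x‖ ^ 2 := hw.continuous.norm.pow 2
  have hf : Continuous fun x => ‖fderiv ℝ w x‖ ^ 2 :=
    ((hw.continuous_fderiv one_ne_zero).norm.pow 2)
  have hm : Measurable fun z : ℝ × E3 => (Icc (‖w z.2‖ ^ 2) (2 * ‖w z.2‖ ^ 2)).indicator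
      (fun α => ENNReal.ofReal α⁻¹) z.1 * ENNReal.ofReal (‖fderiv ℝ w z.2‖ ^ 2) := by
    have hS : MeasurableSet {z : ℝ × E3 | ‖w z.2‖ ^ 2 ≤ z.1 ∧ z.1 ≤ 2 * ‖w z.2‖ ^ 2} :=
      (measurableSet_le (hn.measurable.comp measurable_snd) measurable_fst).inter
        (measurableSet_le measurable_fst ((hn.measurable.comp measurable_snd).const_mul 2))
    have h1 : Measurable fun z : ℝ × E3 => ENNReal.ofReal z.1⁻¹ := by fun_prop
    exact (h1.indicator hS).mul (hf.measurable.comp measurable_snd).ennreal_ofReal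
  calc lorS w ≤ ∫⁻ α in Ioi (0 : ℝ), ENNReal.ofReal C * ∫⁻ x,
        (Icc (‖w x‖ ^ 2) (2 * ‖w x‖ ^ 2)).indicator (fun α => ENNReal.ofReal α⁻¹) α *
          ENNReal.ofReal (‖fderiv ℝ w x‖ ^ 2) :=
        setLIntegral_mono' measurableSet_Ioi fun α hα => by
          refine (h w hw hs α hα).trans (mul_le_mul_right (lintegral_mono fun x => ?_) _)
          have hα' : 0 < α := hα
          by_cases hx : x ∈ {x : E3 | α ≤ 2 * ‖w x‖ ^ 2 ∧ ‖w x‖ ^ 2 ≤ α}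
          · rw [indicator_of_mem hx, indicator_of_mem (show α ∈ Icc _ _ from ⟨hx.2, hx.1⟩),
              ENNReal.ofReal_mul (by positivity)]
          · rw [indicator_of_notMem hx]
            exact zero_le
    _ = ENNReal.ofReal C * ∫⁻ x, (∫⁻ α in Ioi (0 : ℝ),
        (Icc (‖w x‖ ^ 2) (2 * ‖w x‖ ^ 2)).indicator (fun α => ENNReal.ofReal α⁻¹) α) *
          ENNReal.ofReal (‖fderiv ℝ w x‖ ^ 2) := by
        rw [lintegral_const_mul' _ _ ENNReal.ofReal_ne_top,
          lintegral_lintegral_swap hm.aemeasurable]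
        simp only [lintegral_mul_const' _ _ ENNReal.ofReal_ne_top]
    _ ≤ _ := mul_le_mul_right (lintegral_mono fun x =>
        mul_le_of_le_one_left zero_le (setLIntegral_Icc_inv_le (by positivity))) _

theorem lintegral_level_mul (w : E3 → E3) (x : E3) (c : ℝ≥0∞) :
    ∫⁻ α in Ioi (0 : ℝ), {x | α < ‖w x‖ ^ 2}.indicator (fun _ => c) x =
      c * ENNReal.ofReal (‖w x‖ ^ 2) := by
  have h : ∀ α : ℝ, {x | α < ‖w x‖ ^ 2}.indicator (fun _ => c) x =
      (Iio (‖w x‖ ^ 2)).indicator (fun _ => c) α := fun α => by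
    simp only [indicator, mem_Iio]
    rfl
  simp only [h]
  rw [setLIntegral_indicator measurableSet_Iio, setLIntegral_const, inter_comm, Ioi_inter_Iio,
    Real.volume_Ioo, sub_zero]

theorem measurable_level {w : E3 → E3} (hw : Measurable w) {f : E3 → ℝ≥0∞} (hf : Measurable f) :
    Measurable fun z : E3 × ℝ => {x | z.2 < ‖w x‖ ^ 2}.indicator f z.1 := by
  have hS : MeasurableSet {z : E3 × ℝ | z.2 < ‖w z.1‖ ^ 2} :=
    measurableSet_lt measurable_snd ((hw.norm.pow_const 2).comp measurable_fst)
  exact (hf.comp measurable_fst).indicator hS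

theorem lintegral_mul_sq_eq {w : E3 → E3} (hw : Measurable w) {f : E3 → ℝ≥0∞} (hf : Measurable f) :
    ∫⁻ x, f x * ENNReal.ofReal (‖w x‖ ^ 2) =
      ∫⁻ α in Ioi (0 : ℝ), ∫⁻ x in {x | α < ‖w x‖ ^ 2}, f x := by
  have h : ∀ x, f x * ENNReal.ofReal (‖w x‖ ^ 2) =
      ∫⁻ α in Ioi (0 : ℝ), {x | α < ‖w x‖ ^ 2}.indicator f x := fun x => by
    rw [← lintegral_level_mul w x (f x)]
    rfl
  simp only [h]
  rw [lintegral_lintegral_swap (measurable_level hw hf).aemeasurable]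
  refine lintegral_congr fun α => lintegral_indicator ?_ _
  exact measurableSet_lt measurable_const (hw.norm.pow_const 2)

/-- Hölder's inequality in Lorentz form, weak `L³` times `L^{6,2}` in `L²`: a layer cake in `w`
reduces it to integrals of `|f|²` over sets. -/
theorem WeakL3.lintegral_sq_mul_sq_le {M : ℝ} {f w : E3 → E3} (hf : WeakL3 M f) (hM : 0 < M)
    (hm : Measurable f) (hw : Measurable w) :
    ∫⁻ x, ENNReal.ofReal (‖f x‖ ^ 2) * ENNReal.ofReal (‖w x‖ ^ 2) ≤
      ENNReal.ofReal (4 * M ^ 2) * lorS w := by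
  rw [lintegral_mul_sq_eq hw (hm.norm.pow_const 2).ennreal_ofReal, lorS,
    ← lintegral_const_mul' _ _ ENNReal.ofReal_ne_top]
  exact lintegral_mono fun α => hf.setLIntegral_sq_le_measure hM hm _

/-- An upper bound for `sup_x hav (sq v) σ x`. -/
def havSup (v : E3 → E3) (σ : ℝ) : ℝ≥0∞ := ∫⁻ α in Ioi (0 : ℝ),
  min (ENNReal.ofReal K0) (ENNReal.ofReal (σ ^ (-(3 / 2) : ℝ)) * volume {x | α < ‖v x‖ ^ 2})

/-- Layer cake in `v`; at each level the kernel is bounded either by its total mass or by its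
maximum. -/
theorem hav_sq_le_havSup {v : E3 → E3} (hv : Measurable v) {σ : ℝ} (hσ : 0 < σ) (x : E3) :
    hav (sq v) σ x ≤ havSup v σ := by
  have hq0 : 0 < (√σ)⁻¹ := inv_pos.2 (Real.sqrt_pos.2 hσ)
  have h1 : av (sq v) (√σ)⁻¹ x = ∫⁻ α in Ioi (0 : ℝ), ∫⁻ y in {y | α < ‖v y‖ ^ 2},
      ENNReal.ofReal (bk (√σ)⁻¹ x y) := by
    rw [← lintegral_mul_sq_eq hv (measurable_bk _ x).ennreal_ofReal]
    simp only [av, sq, mul_comm]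
  rw [hav, h1, ← lintegral_const_mul' _ _ ENNReal.ofReal_ne_top, havSup]
  refine lintegral_mono fun α => le_min ?_ ?_
  · refine (mul_le_mul_right (setLIntegral_le_lintegral _ _) _).trans (le_of_eq ?_)
    rw [lintegral_bk hq0, ← ENNReal.ofReal_mul (by positivity)]
    congr 1
    field_simp
  · rw [inv_sqrt_pow_three hσ]
    refine mul_le_mul_right ?_ _
    refine (lintegral_mono (g := fun _ => 1) fun y =>
      ENNReal.ofReal_le_one.2 (bk_le_one _ _ _)).trans (le_of_eq ?_)
    simp

/-- The power `1/3` of the measure emerges here, level by level, which is why the Lorentz exponent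
of `lorS` is exactly what the sup bound needs. -/
theorem lintegral_min_le {K : ℝ} (hK : 0 ≤ K) (m : ℝ≥0∞) :
    ∫⁻ σ in Ioi (0 : ℝ), ENNReal.ofReal (σ ^ (-(1 / 2) : ℝ)) *
      min (ENNReal.ofReal K) (ENNReal.ofReal (σ ^ (-(3 / 2) : ℝ)) * m) ≤
      ENNReal.ofReal (2 * K + 1) * m ^ (1 / 3 : ℝ) := by
  rcases eq_or_ne m ⊤ with rfl | hm
  · rw [ENNReal.top_rpow_of_pos (by norm_num), ENNReal.mul_top]
    · exact le_top
    · simp; positivity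
  obtain ⟨r, hr, rfl⟩ : ∃ r : ℝ, 0 ≤ r ∧ ENNReal.ofReal r = m :=
    ⟨m.toReal, ENNReal.toReal_nonneg, ENNReal.ofReal_toReal hm⟩
  rcases hr.eq_or_lt with rfl | hr
  · simp
  -- The heat time at which the two entries of the minimum are comparable.
  set L := r ^ (2 / 3 : ℝ) with hL
  have hL0 : 0 < L := Real.rpow_pos_of_pos hr _
  rw [← Ioc_union_Ioi_eq_Ioi hL0.le, lintegral_union measurableSet_Ioi
    (disjoint_left.2 fun x hx hx' => not_lt.2 hx.2 hx')]
  have e1 : L ^ (1 / 2 : ℝ) = r ^ (1 / 3 : ℝ) := by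
    rw [hL, ← Real.rpow_mul hr.le]; norm_num
  have e2 : L ^ (-1 : ℝ) * r = r ^ (1 / 3 : ℝ) := by
    rw [hL, ← Real.rpow_mul hr.le, ← Real.rpow_add_one hr.ne']; norm_num
  have h1 : ∫⁻ σ in Ioc 0 L, ENNReal.ofReal (σ ^ (-(1 / 2) : ℝ)) *
      min (ENNReal.ofReal K) (ENNReal.ofReal (σ ^ (-(3 / 2) : ℝ)) * ENNReal.ofReal r) ≤
      ENNReal.ofReal (2 * K * r ^ (1 / 3 : ℝ)) := by
    calc _ ≤ ∫⁻ σ in Ioc 0 L, ENNReal.ofReal (σ ^ ((1 / 2 : ℝ) - 1)) * ENNReal.ofReal K :=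
          lintegral_mono fun σ => by
            norm_num
            gcongr
            exact min_le_left _ _
      _ = _ := by
          rw [lintegral_mul_const' _ _ ENNReal.ofReal_ne_top,
            lintegral_Ioc_rpow (by norm_num) hL0.le, ← ENNReal.ofReal_mul (by positivity), e1]
          congr 1
          ring
  have h2 : ∫⁻ σ in Ioi L, ENNReal.ofReal (σ ^ (-(1 / 2) : ℝ)) *
      min (ENNReal.ofReal K) (ENNReal.ofReal (σ ^ (-(3 / 2) : ℝ)) * ENNReal.ofReal r) ≤
      ENNReal.ofReal (r ^ (1 / 3 : ℝ)) := by
    calc _ ≤ ∫⁻ σ in Ioi L, ENNReal.ofReal (σ ^ ((-1 : ℝ) - 1)) * ENNReal.ofReal r :=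
          setLIntegral_mono' measurableSet_Ioi fun σ hσ => by
            have hσ0 : 0 < σ := hL0.trans hσ
            refine (mul_le_mul_right (min_le_right _ _) _).trans (le_of_eq ?_)
            rw [← mul_assoc, ← ENNReal.ofReal_mul (by positivity), ← Real.rpow_add hσ0]
            norm_num
      _ = _ := by
          rw [lintegral_mul_const' _ _ ENNReal.ofReal_ne_top,
            lintegral_Ioi_rpow (by norm_num) hL0, ← ENNReal.ofReal_mul (by positivity), ← e2]
          congr 1
          ring
  refine (add_le_add h1 h2).trans (le_of_eq ?_)
  rw [← ENNReal.ofReal_add (by positivity) (by positivity), ENNReal.ofReal_rpow_of_pos hr,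
    ← ENNReal.ofReal_mul (by positivity)]
  congr 1
  ring

theorem measurable_volume_level {w : ℝ → E3 → E3}
    (hw : Measurable fun z : ℝ × E3 => w z.1 z.2) :
    Measurable fun q : ℝ × ℝ => volume {x | q.2 < ‖w q.1 x‖ ^ 2} := by
  have hS : MeasurableSet {z : (ℝ × ℝ) × E3 | z.1.2 < ‖w z.1.1 z.2‖ ^ 2} :=
    measurableSet_lt (by fun_prop) ((hw.comp (by fun_prop :
      Measurable fun z : (ℝ × ℝ) × E3 => (z.1.1, z.2))).norm.pow_const 2)
  exact measurable_measure_prodMk_left hS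

/-- Exchange the order of integration and treat each level set with `lintegral_min_le`. -/
theorem lintegral_havSup_le {v : E3 → E3} (hv : Measurable v) :
    ∫⁻ σ in Ioi (0 : ℝ), ENNReal.ofReal (σ ^ (-(1 / 2) : ℝ)) * havSup v σ ≤
      ENNReal.ofReal (2 * K0 + 1) * lorS v := by
  have h1 : Measurable fun q : ℝ × ℝ => volume {x | q.2 < ‖v x‖ ^ 2} :=
    measurable_volume_level (w := fun _ => v) (hv.comp measurable_snd)
  have h2 : Measurable fun q : ℝ × ℝ => ENNReal.ofReal (q.1 ^ (-(1 / 2) : ℝ)) *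
      min (ENNReal.ofReal K0)
        (ENNReal.ofReal (q.1 ^ (-(3 / 2) : ℝ)) * volume {x | q.2 < ‖v x‖ ^ 2}) := by
    have h3 : Measurable fun q : ℝ × ℝ => ENNReal.ofReal (q.1 ^ (-(1 / 2) : ℝ)) := by fun_prop
    have h4 : Measurable fun q : ℝ × ℝ => ENNReal.ofReal (q.1 ^ (-(3 / 2) : ℝ)) := by fun_prop
    exact h3.mul (measurable_const.min (h4.mul h1))
  simp only [havSup, ← lintegral_const_mul' _ _ ENNReal.ofReal_ne_top]
  rw [lintegral_lintegral_swap h2.aemeasurable, lorS, ← lintegral_const_mul' _ _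
    ENNReal.ofReal_ne_top]
  exact lintegral_mono fun α => lintegral_min_le K0_nonneg _

end

section

open scoped FourierTransform

variable {a b M : ℝ} {u : ℝ → E3 → E3} {p : ℝ → E3 → ℝ}

/-! ### A dyadic resolution of the identity -/

theorem exists_isLPBump : ∃ φ : E3 → ℝ, IsLPBump φ := by
  let f : ContDiffBump (0 : E3) := ⟨1 / 2, 1, by norm_num, by norm_num⟩
  refine ⟨f, f.contDiff, ?_, fun ξ hξ => f.one_of_mem_closedBall (Metric.ball_subset_closedBall hξ)⟩
  rw [f.support_eq]
  exact Metric.ball_subset_closedBall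

/-- Take for `θ` the real part of the transform of a bump. Its integral is the value of the bump at
the origin, and the difference of two dyadic dilates is the kernel of `P_1`, hence a Laplacian. -/
theorem exists_dyadic_kernel : ∃ θ κ : 𝓢(E3, ℝ), ∫ z, θ z = 1 ∧
    ∀ z, lapS κ z = θ z - 1 / 8 * θ ((1 / 2 : ℝ) • z) := by
  obtain ⟨φ, hφ⟩ := exists_isLPBump
  have hc : HasCompactSupport φ := HasCompactSupport.of_support_subset_isCompact
    (isCompact_closedBall 0 1) hφ.support_subset
  have hC : HasCompactSupport fun ξ => (φ ξ : ℂ) :=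
    hc.comp_left (g := fun r : ℝ => (r : ℂ)) Complex.ofReal_zero
  have hd : ContDiff ℝ ∞ fun ξ => (φ ξ : ℂ) := Complex.ofRealCLM.contDiff.comp hφ.smooth
  have hC2 : HasCompactSupport fun ξ => (φ ((1 / 2 : ℝ)⁻¹ • ξ) : ℂ) :=
    hC.comp_smul (by norm_num)
  have hd2 : ContDiff ℝ ∞ fun ξ => (φ ((1 / 2 : ℝ)⁻¹ • ξ) : ℂ) :=
    hd.comp (contDiff_const_smul _)
  set f₁ : 𝓢(E3, ℂ) := hC.toSchwartzMap hd with hf₁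
  set f₂ : 𝓢(E3, ℂ) := hC2.toSchwartzMap hd2 with hf₂
  have e : lpSchwartz hφ one_pos = f₁ - f₂ := by
    ext ξ
    change lpSymbol φ 1 ξ = (φ ξ : ℂ) - (φ ((1 / 2 : ℝ)⁻¹ • ξ) : ℂ)
    simp [lpSymbol]
  have e2 : ∀ z, 𝓕 f₂ z = ((1 / 2 : ℝ) : ℂ) ^ 3 * 𝓕 f₁ ((1 / 2 : ℝ) • z) :=
    fourier_comp_smul (by norm_num) fun ξ => rfl
  refine ⟨reS (𝓕 f₁), reS (invLapKernel hφ), ?_, fun z => ?_⟩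
  · have h1 : 𝓕 (𝓕 f₁) 0 = 1 := by
      rw [fourier_fourier_apply, neg_zero]
      change (φ 0 : ℂ) = 1
      rw [hφ.eq_one 0 (by simp), Complex.ofReal_one]
    have h2 : 𝓕 (𝓕 f₁) 0 = ∫ z, 𝓕 f₁ z := by
      rw [SchwartzMap.fourier_coe, Real.fourier_eq]
      simp
    simp only [reS_apply]
    have h3 := Complex.reCLM.integral_comp_comm (𝓕 f₁).integrable (μ := volume)
    simp only [Complex.reCLM_apply] at h3
    rw [h3, ← h2, h1, Complex.one_re]
  · rw [← reS_lapC, reS_apply, reS_apply, reS_apply]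
    have h1 : lapC (invLapKernel hφ) = 𝓕 f₁ - 𝓕 f₂ := by
      rw [lapC, ← lpKernel_eq, lpKernel, e]
      exact map_sub (SchwartzMap.fourierTransformCLM ℂ) f₁ f₂
    rw [h1]
    change (𝓕 f₁ z - 𝓕 f₂ z).re = _
    rw [e2, Complex.sub_re]
    congr 1
    rw [← Complex.ofReal_pow, Complex.re_ofReal_mul]
    norm_num

theorem Tempered.dil_dyadic {w : E3 → ℝ} (hw : Tempered w) {θ g : 𝓢(E3, ℝ)}
    (h : ∀ z, g z = θ z - 1 / 8 * θ ((1 / 2 : ℝ) • z)) {r : ℝ} (hr : 0 < r) (x : E3) :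
    r ^ 3 * dil g w r x = r ^ 3 * dil θ w r x - (r / 2) ^ 3 * dil θ w (r / 2) x := by
  have i1 := hw.integrable_dil θ hr x
  have i2 := hw.integrable_dil θ (half_pos hr) x
  have h1 : dil g w r x = dil θ w r x - 1 / 8 * dil θ w (r / 2) x := by
    have i3 : Integrable fun y => 1 / 8 * (w y * θ ((r / 2) • (y - x))) := i2.const_mul _
    rw [dil, dil, dil, ← integral_const_mul, ← integral_sub i1 i3]
    refine integral_congr_ae (ae_of_all _ fun y => ?_)
    simp only [h, smul_smul]
    rw [show (1 / 2 : ℝ) * r = r / 2 by ring]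
    ring
  rw [h1]
  ring

/-! ### Pairing averages with test functions -/

/-- The integral of `h` against the average of `w` with kernel `g` at scale `r⁻¹`. -/
def pr (g : 𝓢(E3, ℝ)) (r : ℝ) (w : E3 → ℝ) (h : 𝓢(E3, ℝ)) : ℝ :=
  ∫ x, h x * (r ^ 3 * dil g w r x)

theorem Tempered.continuous_dil {w : E3 → ℝ} (hw : Tempered w) (g : 𝓢(E3, ℝ)) {r : ℝ}
    (hr : 0 < r) : Continuous (dil g w r) := (hw.contDiff_dil g hr).continuous

theorem Tempered.integrable_pr {w : E3 → ℝ} (hw : Tempered w) (g : 𝓢(E3, ℝ)) {r : ℝ}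
    (hr : 0 < r) {h : 𝓢(E3, ℝ)} (hh : HasCompactSupport h) :
    Integrable fun x => h x * (r ^ 3 * dil g w r x) :=
  (h.continuous.mul (continuous_const.mul (hw.continuous_dil g hr))).integrable_of_hasCompactSupport
    hh.mul_right

/-- Integration by parts trades a derivative on the kernel, worth a factor `r`, for one on the test
function. -/
theorem Tempered.pr_dS {w : E3 → ℝ} (hw : Tempered w) (g : 𝓢(E3, ℝ)) {r : ℝ}
    (hr : 0 < r) {h : 𝓢(E3, ℝ)} (hh : HasCompactSupport h) (i : Fin 3) :
    r * pr (dS i g) r w h = pr g r w (dS i h) := by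
  have h1 := integral_pd_mul ((hw.contDiff_dil g hr).of_le one_le_infty)
    ((h.smooth ⊤).of_le one_le_infty) hh i
  simp only [pd_schwartz] at h1
  have h2 : ∀ x, pd i (dil g w r) x = -(r * dil (dS i g) w r x) := fun x => hw.fderiv_dil g hr x i
  simp only [h2] at h1
  have e1 : r * pr (dS i g) r w h = -(r ^ 3 * ∫ x, -(r * dil (dS i g) w r x) * h x) := by
    rw [pr, ← integral_const_mul, ← integral_const_mul, ← integral_neg]
    exact integral_congr_ae (ae_of_all _ fun x => by ring)
  rw [e1, h1, mul_neg, neg_neg, pr, ← integral_const_mul]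
  exact integral_congr_ae (ae_of_all _ fun x => by ring)

theorem Tempered.pr_dyadic {w : E3 → ℝ} (hw : Tempered w) {θ g : 𝓢(E3, ℝ)}
    (h : ∀ z, g z = θ z - 1 / 8 * θ ((1 / 2 : ℝ) • z)) {r : ℝ} (hr : 0 < r) {f : 𝓢(E3, ℝ)}
    (hf : HasCompactSupport f) : pr g r w f = pr θ r w f - pr θ (r / 2) w f := by
  rw [pr, pr, pr, ← integral_sub (hw.integrable_pr θ hr hf) (hw.integrable_pr θ (half_pos hr) hf)]
  refine integral_congr_ae (ae_of_all _ fun x => ?_)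
  simp only [hw.dil_dyadic h hr, mul_sub]

theorem Tempered.pr_sum {w : E3 → ℝ} (hw : Tempered w) (g : 𝓢(E3, ℝ)) {r : ℝ} (hr : 0 < r)
    {f : Fin 3 → 𝓢(E3, ℝ)} (hf : ∀ k, HasCompactSupport (f k)) :
    pr g r w (∑ k, f k) = ∑ k, pr g r w (f k) := by
  simp only [pr]
  have hi : ∀ k ∈ Finset.univ, Integrable fun x => f k x * (r ^ 3 * dil g w r x) :=
    fun k _ => hw.integrable_pr g hr (hf k)
  rw [← integral_finsetSum _ hi]
  refine integral_congr_ae (ae_of_all _ fun x => ?_)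
  simp only [_root_.sum_apply, Finset.sum_mul]

theorem Tempered.pr_lapS {w : E3 → ℝ} (hw : Tempered w) (g : 𝓢(E3, ℝ)) {r : ℝ}
    (hr : 0 < r) {h : 𝓢(E3, ℝ)} (hh : HasCompactSupport h) :
    r ^ 2 * pr (lapS g) r w h = pr g r w (lapS h) := by
  have hi : ∀ k ∈ Finset.univ, Integrable fun x => h x * (r ^ 3 * dil (dS k (dS k g)) w r x) :=
    fun k _ => hw.integrable_pr _ hr hh
  have h1 : pr (lapS g) r w h = ∑ k, pr (dS k (dS k g)) r w h := by
    simp only [pr]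
    rw [← integral_finsetSum _ hi]
    refine integral_congr_ae (ae_of_all _ fun x => ?_)
    simp only
    rw [← Finset.mul_sum, ← Finset.mul_sum]
    congr 2
    have hj : ∀ k ∈ Finset.univ, Integrable fun y => w y * dS k (dS k g) (r • (y - x)) :=
      fun k _ => hw.integrable_dil _ hr x
    simp only [dil]
    rw [← integral_finsetSum _ hj]
    refine integral_congr_ae (ae_of_all _ fun y => ?_)
    simp only [lapS, _root_.sum_apply, Finset.mul_sum]
  rw [h1, lapS, hw.pr_sum g hr fun k => hasCompactSupport_dS (hasCompactSupport_dS hh k) k,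
    Finset.mul_sum]
  refine Finset.sum_congr rfl fun k _ => ?_
  rw [← hw.pr_dS g hr (hasCompactSupport_dS hh k), ← hw.pr_dS _ hr hh]
  ring

theorem UnifTempered.continuous_pr {w : ℝ → E3 → ℝ} (hw : UnifTempered w) (g : 𝓢(E3, ℝ)) {r : ℝ}
    (hr : 0 < r) {h : 𝓢(E3, ℝ)} (hh : HasCompactSupport h) :
    Continuous fun t => pr g r (w t) h := by
  have hz : ContinuousOn (fun q : ℝ × ℝ × E3 => dil g (w q.1) q.2.1 q.2.2) {q | 0 < q.2.1} :=
    hw.continuousOn_dil g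
  have h1 : Continuous fun q : ℝ × E3 => dil g (w q.1) r q.2 := by
    rw [← continuousOn_univ]
    exact ContinuousOn.comp (g := fun q : ℝ × ℝ × E3 => dil g (w q.1) q.2.1 q.2.2)
      (f := fun q : ℝ × E3 => (q.1, r, q.2)) hz (by fun_prop) fun q _ => hr
  have h2 : Continuous (Function.uncurry fun (t : ℝ) (x : E3) => h x * (r ^ 3 * dil g (w t) r x)) :=
    (h.continuous.comp continuous_snd).mul (continuous_const.mul h1)
  have h3 := continuous_parametric_integral_of_continuous (μ := volume) h2 hh.isCompact
  refine h3.congr fun t => ?_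
  rw [pr, setIntegral_eq_integral_of_forall_compl_eq_zero]
  intro x hx
  rw [image_eq_zero_of_notMem_tsupport hx, zero_mul]

/-- A bound uniform in `r ≥ 1` on compact space-time sets: the domination needed as the averaging
scale shrinks to zero. -/
theorem UnifTempered.exists_abs_dil_le {w : ℝ → E3 → ℝ} (hw : UnifTempered w) (g : 𝓢(E3, ℝ))
    (t₁ t₂ X : ℝ) : ∃ B : ℝ, 0 ≤ B ∧ ∀ t ∈ Icc t₁ t₂, ∀ x : E3, ‖x‖ ≤ X → ∀ r, 1 ≤ r →
      |r ^ 3 * dil g (w t) r x| ≤ B := by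
  obtain ⟨C, hC, h⟩ := exists_abs_dil_le_near_far g
  obtain ⟨B₁, hB₁⟩ := hw.bound
  obtain ⟨B₂, hB₂⟩ := ((isCompact_Icc (a := t₁) (b := t₂)).prod
    (isCompact_closedBall (0 : E3) (X + 1))).exists_bound_of_continuousOn hw.cont.continuousOn
  refine ⟨C * |B₂| + C * ((1 + |X|) ^ 4 * |B₁|), by positivity, fun t ht x hx r hr => ?_⟩
  have h1 := h (hw.tempered t) x one_pos hr (abs_nonneg B₂) fun y hy => by
    refine (hB₂ (t, y) ⟨ht, ?_⟩).trans (le_abs_self _)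
    rw [mem_closedBall_zero_iff]
    have : ‖y‖ ≤ ‖y - x‖ + ‖x‖ := by simpa using norm_add_le (y - x) x
    linarith
  refine h1.trans ?_
  gcongr
  · exact div_le_self hC.le (by rw [one_pow, mul_one]; exact hr)
  · exact hx.trans (le_abs_self X)
  · exact (hB₁ t).2.trans (le_abs_self _)

theorem UnifTempered.exists_abs_pr_le {w : ℝ → E3 → ℝ} (hw : UnifTempered w) (g : 𝓢(E3, ℝ))
    (t₁ t₂ : ℝ) {h : 𝓢(E3, ℝ)} (hh : HasCompactSupport h) :
    ∃ B : ℝ, ∀ t ∈ Icc t₁ t₂, ∀ r, 1 ≤ r → |pr g r (w t) h| ≤ B := by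
  obtain ⟨X, hX⟩ := hh.isCompact.isBounded.subset_closedBall 0
  obtain ⟨B, hB0, hB⟩ := hw.exists_abs_dil_le g t₁ t₂ X
  refine ⟨∫ x, |h x| * B, fun t ht r hr => ?_⟩
  rw [← Real.norm_eq_abs]
  refine norm_integral_le_of_norm_le (h.integrable.norm.mul_const B) (ae_of_all _ fun x => ?_)
  rw [norm_mul, Real.norm_eq_abs]
  by_cases hx : x ∈ tsupport h
  · exact mul_le_mul_of_nonneg_left (hB t ht x (mem_closedBall_zero_iff.1 (hX hx)) r hr)
      (abs_nonneg _)
  · rw [image_eq_zero_of_notMem_tsupport hx]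
    simp

theorem UnifTempered.tendsto_pr {w : ℝ → E3 → ℝ} (hw : UnifTempered w) {θ : 𝓢(E3, ℝ)}
    (hθ : ∫ z, θ z = 1) {h : 𝓢(E3, ℝ)} (hh : HasCompactSupport h) {r : ℕ → ℝ}
    (hr1 : ∀ n, 1 ≤ r n) (hr : Tendsto r atTop atTop) (t : ℝ) :
    Tendsto (fun n => pr θ (r n) (w t) h) atTop (𝓝 (pair (w t) h)) := by
  obtain ⟨X, hX⟩ := hh.isCompact.isBounded.subset_closedBall 0
  obtain ⟨B, hB0, hB⟩ := hw.exists_abs_dil_le θ t t X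
  have e : pair (w t) h = ∫ x, h x * w t x := by
    simp only [pair, mul_comm]
  rw [e]
  refine tendsto_integral_of_dominated_convergence (fun x => |h x| * B)
    (fun n => ((hw.tempered t).integrable_pr θ (one_pos.trans_le (hr1 n)) hh).aestronglyMeasurable)
    (h.integrable.norm.mul_const B) (fun n => ae_of_all _ fun x => ?_) (ae_of_all _ fun x => ?_)
  · rw [norm_mul, Real.norm_eq_abs]
    by_cases hx : x ∈ tsupport h
    · exact mul_le_mul_of_nonneg_left (hB t ⟨le_rfl, le_rfl⟩ x (mem_closedBall_zero_iff.1 (hX hx))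
        _ (hr1 n)) (abs_nonneg _)
    · rw [image_eq_zero_of_notMem_tsupport hx]
      simp
  · have := ((hw.tempered t).tendsto_dil θ x).comp hr
    rw [hθ, mul_one] at this
    exact this.const_mul _

/-- The `L²` norm of a test function. -/
def l2 (f : E3 → ℝ) : ℝ := √(∫ x, f x ^ 2)

/-- Cauchy-Schwarz, with the square integral of averages of `|v|²` at heat time `σ = r⁻²`, which is
`O(M⁴ r)`. -/
theorem exists_abs_pr_le_l2 (g : 𝓢(E3, ℝ)) : ∃ C : ℝ, 0 < C ∧ ∀ {M : ℝ} {v : E3 → E3},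
    WeakL3 M v → 0 < M → Measurable v → ∀ {w : E3 → ℝ}, Tempered w → (∀ y, |w y| ≤ ‖v y‖ ^ 2) →
    ∀ {r : ℝ}, 0 < r → ∀ h : 𝓢(E3, ℝ), |pr g r w h| ≤ C * (M ^ 2 * √r * l2 h) := by
  obtain ⟨C, hC, hd⟩ := exists_ofReal_abs_dil_le g
  have hK := K0_nonneg
  set A := 8 * K0 ^ 2 + 18 * K0 + 1 with hA
  refine ⟨C * √A, by positivity, fun {M v} hv hM hm {w} hw hwv {r} hr h => ?_⟩
  have hr2 : (√(r⁻¹ ^ 2))⁻¹ = r := by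
    rw [Real.sqrt_sq (by positivity), inv_inv]
  have hσ : 0 < r⁻¹ ^ 2 := by positivity
  have h1 : ∀ x, ENNReal.ofReal |r ^ 3 * dil g w r x| ≤
      ENNReal.ofReal C * hav (sq v) (r⁻¹ ^ 2) x := fun x => by
    rw [hav, hr2, abs_mul, abs_of_pos (by positivity : 0 < r ^ 3), ENNReal.ofReal_mul
      (by positivity), mul_left_comm]
    refine mul_le_mul_right ((hd w r x).trans (mul_le_mul_right (av_mono (fun y => ?_) r x) _)) _
    exact ENNReal.ofReal_le_ofReal (hwv y)
  have hsq : Measurable (sq v) := (hm.norm.pow_const 2).ennreal_ofReal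
  have hhav := measurable_hav_right hsq (r⁻¹ ^ 2)
  have h2 := hv.lintegral_sq_hav_le hM hm hσ
  rw [hr2] at h2
  have hH := ENNReal.lintegral_mul_le_Lp_mul_Lq volume Real.HolderConjugate.two_two
    (h.continuous.norm.measurable.ennreal_ofReal.aemeasurable (μ := volume)) hhav.aemeasurable
  simp only [Pi.mul_apply, ENNReal.rpow_ofNat] at hH
  have i2 : Integrable fun x => h x ^ 2 := by
    have hb := (h.memLp 2 volume).integrable_sq
    exact hb
  have hh2 : ∫⁻ x, ENNReal.ofReal ‖h x‖ ^ 2 = ENNReal.ofReal (∫ x, h x ^ 2) := by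
    rw [ofReal_integral_eq_lintegral_ofReal i2 (ae_of_all _ fun x => sq_nonneg _)]
    refine lintegral_congr fun x => ?_
    rw [← ENNReal.ofReal_pow (norm_nonneg _), Real.norm_eq_abs, sq_abs]
  have hAr : 8 * K0 ^ 2 + 18 * K0 ≤ A := by linarith
  have h3 : ENNReal.ofReal |pr g r w h| ≤
      ENNReal.ofReal (C * (l2 h * √(A * (M ^ 4 * r)))) := by
    rw [pr, ← Real.norm_eq_abs, ofReal_norm]
    refine (enorm_integral_le_lintegral_enorm _).trans ?_
    calc _ ≤ ∫⁻ x, ENNReal.ofReal C * (ENNReal.ofReal ‖h x‖ * hav (sq v) (r⁻¹ ^ 2) x) :=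
          lintegral_mono fun x => by
            rw [enorm_mul, ← ofReal_norm, ← ofReal_norm, mul_left_comm]
            exact mul_le_mul_right (h1 x) _
      _ ≤ ENNReal.ofReal C * (ENNReal.ofReal (∫ x, h x ^ 2) ^ (1 / 2 : ℝ) *
          ENNReal.ofReal (A * (M ^ 4 * r)) ^ (1 / 2 : ℝ)) := by
          rw [lintegral_const_mul' _ _ ENNReal.ofReal_ne_top, ← hh2]
          refine mul_le_mul_right (hH.trans (mul_le_mul_right ?_ _)) _
          gcongr
          exact h2.trans (ENNReal.ofReal_le_ofReal (by gcongr))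
      _ = _ := by
          rw [ENNReal.ofReal_rpow_of_nonneg (integral_nonneg fun x => sq_nonneg _) (by norm_num),
            ENNReal.ofReal_rpow_of_nonneg (by positivity) (by norm_num),
            ← Real.sqrt_eq_rpow, ← Real.sqrt_eq_rpow, ← ENNReal.ofReal_mul (by positivity),
            ← ENNReal.ofReal_mul hC.le, l2]
  have h4 := (ENNReal.ofReal_le_ofReal_iff (by unfold l2; positivity)).1 h3
  refine h4.trans (le_of_eq ?_)
  rw [Real.sqrt_mul (by positivity), Real.sqrt_mul (by positivity),
    show M ^ 4 = (M ^ 2) ^ 2 by ring, Real.sqrt_sq (by positivity)]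
  ring

end

section

variable {a b M : ℝ} {u : ℝ → E3 → E3} {p : ℝ → E3 → ℝ}

/-! ### The pressure -/

/-- The divergence of a test field. -/
def divS (h : Fin 3 → 𝓢(E3, ℝ)) : 𝓢(E3, ℝ) := ∑ k, dS k (h k)

/-- The averaged velocity against a test field. -/
def avgU (u : ℝ → E3 → E3) (h : Fin 3 → 𝓢(E3, ℝ)) (g : 𝓢(E3, ℝ)) (r t : ℝ) : ℝ :=
  ∑ k, pr g r (fun y => u t y k) (h k)

/-- The averages of the linear and convective terms against a test field. -/
def avgG (u : ℝ → E3 → E3) (h : Fin 3 → 𝓢(E3, ℝ)) (g : 𝓢(E3, ℝ)) (r t : ℝ) : ℝ :=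
  ∑ k, (pr g r (fun y => u t y k) (lapS (h k)) +
    ∑ i, pr g r (fun y => u t y i * u t y k) (dS i (h k)))

/-- A frequency-localized piece of the pressure against a test function. -/
def avgP (u : ℝ → E3 → E3) (f κ : 𝓢(E3, ℝ)) (r t : ℝ) : ℝ :=
  ∑ i, ∑ j, pr (dS i (dS j κ)) r (fun y => u t y i * u t y j) f

theorem hasCompactSupport_lapS {g : 𝓢(E3, ℝ)} (hg : HasCompactSupport g) :
    HasCompactSupport (lapS g) := by
  have h1 : (lapS g : E3 → ℝ) = fun x => dS 0 (dS 0 g) x + dS 1 (dS 1 g) x + dS 2 (dS 2 g) x := by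
    ext x
    simp [lapS, Fin.sum_univ_three]
  rw [h1]
  have h2 := fun k => hasCompactSupport_dS (hasCompactSupport_dS hg k) k
  exact ((h2 0).add (h2 1)).add (h2 2)

theorem hasCompactSupport_divS {h : Fin 3 → 𝓢(E3, ℝ)} (hh : ∀ k, HasCompactSupport (h k)) :
    HasCompactSupport (divS h) := by
  have h1 : (divS h : E3 → ℝ) = fun x => dS 0 (h 0) x + dS 1 (h 1) x + dS 2 (h 2) x := by
    ext x
    simp [divS, Fin.sum_univ_three]
  rw [h1]
  have h2 := fun k => hasCompactSupport_dS (hh k) k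
  exact ((h2 0).add (h2 1)).add (h2 2)

namespace NSFlow

/-- Derivatives are moved from the kernel to the test function until the powers of `r` are used up.
In the last sum two stay on the kernel: that term represents the pressure, and only the divergence
of the test field will appear in it. -/
theorem hasDerivAt_pr (h : NSFlow a b M u p) (κ : 𝓢(E3, ℝ)) (k : Fin 3) {f : 𝓢(E3, ℝ)}
    (hf : HasCompactSupport f) {r : ℝ} (hr : 0 < r) {t : ℝ} (ht : t ∈ Ioo a b) :
    HasDerivAt (fun t => pr (lapS κ) r (fun y => u t y k) f)
      (pr (lapS κ) r (fun y => u t y k) (lapS f) +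
        ∑ i, pr (lapS κ) r (fun y => u t y i * u t y k) (dS i f) -
        ∑ i, ∑ j, pr (dS i (dS j κ)) r (fun y => u t y i * u t y j) (dS k f)) t := by
  have hw := (h.tempered_comp k).tempered t
  have hww := fun i j => (h.tempered_prod i j).tempered t
  have c1 : ∀ g, Continuous fun q : ℝ × E3 => dil g (fun y => u q.1 y k) r q.2 := fun g => by
    have hz : ContinuousOn (fun q : ℝ × ℝ × E3 => dil g (fun y => u q.1 y k) q.2.1 q.2.2)
      {q | 0 < q.2.1} := h.continuousOn_dil_comp g k
    rw [← continuousOn_univ]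
    exact ContinuousOn.comp (g := fun q : ℝ × ℝ × E3 => dil g (fun y => u q.1 y k) q.2.1 q.2.2)
      (f := fun q : ℝ × E3 => (q.1, r, q.2)) hz (by fun_prop) fun q _ => hr
  have c2 : Continuous fun q : ℝ × E3 => nonlinDil u κ k r q.2 q.1 := by
    have hz : ContinuousOn (fun q : ℝ × ℝ × E3 => nonlinDil u κ k q.2.1 q.2.2 q.1)
      {q | 0 < q.2.1} := h.continuousOn_nonlinDil κ k
    rw [← continuousOn_univ]
    exact ContinuousOn.comp (g := fun q : ℝ × ℝ × E3 => nonlinDil u κ k q.2.1 q.2.2 q.1)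
      (f := fun q : ℝ × E3 => (q.1, r, q.2)) hz (by fun_prop) fun q _ => hr
  have hfc : Continuous fun q : ℝ × E3 => f q.2 := f.continuous.comp continuous_snd
  have hd := hasDerivAt_integral_of_compact (a := a) (b := b) hf.isCompact
    (F := fun t x => f x * (r ^ 3 * dil (lapS κ) (fun y => u t y k) r x))
    (F' := fun t x => f x * (r ^ 3 * (r ^ 2 * dil (lapS (lapS κ)) (fun y => u t y k) r x +
        r * nonlinDil u κ k r x t)))
    (hfc.mul (continuous_const.mul (c1 _))).continuousOn
    (hfc.mul (continuous_const.mul ((continuous_const.mul (c1 _)).add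
      (continuous_const.mul c2)))).continuousOn
    (fun t _ y hy => by simp [image_eq_zero_of_notMem_tsupport hy])
    (fun t _ y hy => by simp [image_eq_zero_of_notMem_tsupport hy])
    (fun t ht y => (((h.hasDerivWithinAt_dil κ k hr y (Ioo_subset_Icc_self ht)).hasDerivAt
      (Icc_mem_nhds ht.1 ht.2)).const_mul _).const_mul _) ht
  refine hd.congr_deriv ?_
  have i1 := hw.integrable_pr (lapS (lapS κ)) hr hf
  have i2 : ∀ i ∈ Finset.univ, Integrable fun x => f x * (r ^ 3 *
    dil (dS i (lapS κ)) (fun y => u t y i * u t y k) r x) := fun i _ =>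
    (hww i k).integrable_pr _ hr hf
  have i3 : ∀ i j, Integrable fun x => f x * (r ^ 3 *
    dil (dS i (dS j (dS k κ))) (fun y => u t y i * u t y j) r x) := fun i j =>
    (hww i j).integrable_pr _ hr hf
  have i3' : ∀ i ∈ Finset.univ, Integrable fun x => ∑ j, f x * (r ^ 3 *
    dil (dS i (dS j (dS k κ))) (fun y => u t y i * u t y j) r x) := fun i _ =>
    integrable_finsetSum _ fun j _ => i3 i j
  have j1 : Integrable fun x => r ^ 2 * (f x * (r ^ 3 * dil (lapS (lapS κ)) (fun y => u t y k) r x)) :=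
    i1.const_mul _
  have j2 : Integrable fun x => r * ∑ i, f x * (r ^ 3 *
    dil (dS i (lapS κ)) (fun y => u t y i * u t y k) r x) :=
    (integrable_finsetSum _ i2).const_mul _
  have j3 : Integrable fun x => r * ∑ i, ∑ j, f x * (r ^ 3 *
    dil (dS i (dS j (dS k κ))) (fun y => u t y i * u t y j) r x) :=
    (integrable_finsetSum _ i3').const_mul _
  have j12 : Integrable fun x => r ^ 2 * (f x * (r ^ 3 * dil (lapS (lapS κ)) (fun y => u t y k) r x)) +
    r * ∑ i, f x * (r ^ 3 * dil (dS i (lapS κ)) (fun y => u t y i * u t y k) r x) := j1.add j2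
  calc _ = ∫ x, (r ^ 2 * (f x * (r ^ 3 * dil (lapS (lapS κ)) (fun y => u t y k) r x)) +
        r * ∑ i, f x * (r ^ 3 * dil (dS i (lapS κ)) (fun y => u t y i * u t y k) r x) -
        r * ∑ i, ∑ j, f x * (r ^ 3 *
          dil (dS i (dS j (dS k κ))) (fun y => u t y i * u t y j) r x)) := by
        refine integral_congr_ae (ae_of_all _ fun x => ?_)
        simp only [nonlinDil, ← Finset.mul_sum]
        ring
    _ = r ^ 2 * pr (lapS (lapS κ)) r (fun y => u t y k) f +
        r * ∑ i, pr (dS i (lapS κ)) r (fun y => u t y i * u t y k) f -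
        r * ∑ i, ∑ j, pr (dS i (dS j (dS k κ))) r (fun y => u t y i * u t y j) f := by
        rw [integral_sub j12 j3, integral_add j1 j2, integral_const_mul, integral_const_mul,
          integral_const_mul, integral_finsetSum _ i2, integral_finsetSum _ i3']
        simp only [pr, integral_finsetSum _ fun j _ => i3 _ j]
    _ = _ := by
        rw [hw.pr_lapS _ hr hf, Finset.mul_sum, Finset.mul_sum]
        simp only [Finset.mul_sum]
        congr 1
        · congr 1
          exact Finset.sum_congr rfl fun i _ => (hww i k).pr_dS _ hr hf i
        · refine Finset.sum_congr rfl fun i _ => Finset.sum_congr rfl fun j _ => ?_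
          rw [dS_comm j k, dS_comm i k]
          exact (hww i j).pr_dS _ hr hf k

theorem hasDerivAt_avgU (h : NSFlow a b M u p) (κ : 𝓢(E3, ℝ)) {f : Fin 3 → 𝓢(E3, ℝ)}
    (hf : ∀ k, HasCompactSupport (f k)) {r : ℝ} (hr : 0 < r) {t : ℝ} (ht : t ∈ Ioo a b) :
    HasDerivAt (avgU u f (lapS κ) r) (avgG u f (lapS κ) r t - avgP u (divS f) κ r t) t := by
  refine (HasDerivAt.fun_sum (u := Finset.univ) fun k _ => h.hasDerivAt_pr κ k (hf k) hr ht).congr_deriv ?_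
  rw [Finset.sum_sub_distrib, avgG, avgP]
  congr 1
  rw [Finset.sum_comm]
  refine Finset.sum_congr rfl fun i _ => ?_
  rw [Finset.sum_comm]
  refine Finset.sum_congr rfl fun j _ => ?_
  rw [divS, ((h.tempered_prod i j).tempered t).pr_sum _ hr fun k => hasCompactSupport_dS (hf k) k]

theorem continuous_avgG (h : NSFlow a b M u p) (g : 𝓢(E3, ℝ)) {f : Fin 3 → 𝓢(E3, ℝ)}
    (hf : ∀ k, HasCompactSupport (f k)) {r : ℝ} (hr : 0 < r) : Continuous (avgG u f g r) :=
  continuous_finsetSum _ fun k _ => ((h.tempered_comp k).continuous_pr g hr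
    (hasCompactSupport_lapS (hf k))).add (continuous_finsetSum _ fun i _ =>
      (h.tempered_prod i k).continuous_pr g hr (hasCompactSupport_dS (hf k) i))

theorem continuous_avgP (h : NSFlow a b M u p) (κ : 𝓢(E3, ℝ)) {f : 𝓢(E3, ℝ)}
    (hf : HasCompactSupport f) {r : ℝ} (hr : 0 < r) : Continuous (avgP u f κ r) :=
  continuous_finsetSum _ fun i _ => continuous_finsetSum _ fun j _ =>
    (h.tempered_prod i j).continuous_pr _ hr hf

theorem avgU_sub (h : NSFlow a b M u p) (κ : 𝓢(E3, ℝ)) {f : Fin 3 → 𝓢(E3, ℝ)}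
    (hf : ∀ k, HasCompactSupport (f k)) {r : ℝ} (hr : 0 < r) {t₁ t₂ : ℝ} (h₁ : a < t₁)
    (h₁₂ : t₁ ≤ t₂) (h₂ : t₂ < b) :
    avgU u f (lapS κ) r t₂ - avgU u f (lapS κ) r t₁ =
      (∫ t in t₁..t₂, avgG u f (lapS κ) r t) - ∫ t in t₁..t₂, avgP u (divS f) κ r t := by
  have c1 := h.continuous_avgG (lapS κ) hf hr
  have c2 := h.continuous_avgP κ (hasCompactSupport_divS hf) hr
  rw [← intervalIntegral.integral_sub (c1.intervalIntegrable _ _) (c2.intervalIntegrable _ _)]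
  refine (intervalIntegral.integral_eq_sub_of_hasDerivAt (fun t ht => ?_)
    ((c1.sub c2).intervalIntegrable _ _)).symm
  rw [uIcc_of_le h₁₂] at ht
  exact h.hasDerivAt_avgU κ hf hr ⟨h₁.trans_le ht.1, ht.2.trans_lt h₂⟩

/-- The residual of the momentum equation, averaged at scale `r⁻¹`. -/
def _root_.LorentzNS.resid (u : ℝ → E3 → E3) (f : Fin 3 → 𝓢(E3, ℝ)) (θ : 𝓢(E3, ℝ))
    (t₁ t₂ r : ℝ) : ℝ :=
  avgU u f θ r t₂ - avgU u f θ r t₁ - ∫ t in t₁..t₂, avgG u f θ r t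

/-- The kernel `lapS κ` is a dyadic difference of `θ`, so the averaged momentum equation for `κ`
computes the increment of the residual. -/
theorem resid_sub (h : NSFlow a b M u p) {θ κ : 𝓢(E3, ℝ)}
    (hθ : ∀ z, lapS κ z = θ z - 1 / 8 * θ ((1 / 2 : ℝ) • z)) {f : Fin 3 → 𝓢(E3, ℝ)}
    (hf : ∀ k, HasCompactSupport (f k)) {r : ℝ} (hr : 0 < r) {t₁ t₂ : ℝ} (h₁ : a < t₁)
    (h₁₂ : t₁ ≤ t₂) (h₂ : t₂ < b) :
    resid u f θ t₁ t₂ r - resid u f θ t₁ t₂ (r / 2) = -∫ t in t₁..t₂, avgP u (divS f) κ r t := by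
  have hU : ∀ t, avgU u f (lapS κ) r t = avgU u f θ r t - avgU u f θ (r / 2) t := fun t => by
    simp only [avgU, ← Finset.sum_sub_distrib]
    exact Finset.sum_congr rfl fun k _ =>
      ((h.tempered_comp k).tempered t).pr_dyadic hθ hr (hf k)
  have hG : ∀ t, avgG u f (lapS κ) r t = avgG u f θ r t - avgG u f θ (r / 2) t := fun t => by
    simp only [avgG, ← Finset.sum_sub_distrib]
    refine Finset.sum_congr rfl fun k _ => ?_
    rw [((h.tempered_comp k).tempered t).pr_dyadic hθ hr (hasCompactSupport_lapS (hf k)),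
      add_sub_add_comm, ← Finset.sum_sub_distrib]
    congr 1
    exact Finset.sum_congr rfl fun i _ => ((h.tempered_prod i k).tempered t).pr_dyadic hθ hr
      (hasCompactSupport_dS (hf k) i)
  have e := h.avgU_sub κ hf hr h₁ h₁₂ h₂
  have c1 := h.continuous_avgG θ hf hr
  have c2 := h.continuous_avgG θ hf (half_pos hr)
  simp only [hU, hG] at e
  rw [intervalIntegral.integral_sub (c1.intervalIntegrable _ _) (c2.intervalIntegrable _ _)] at e
  rw [resid, resid]
  linarith

end NSFlow

theorem exists_abs_pr_prod_le (g : 𝓢(E3, ℝ)) : ∃ C : ℝ, 0 < C ∧ ∀ {a b M : ℝ} {u : ℝ → E3 → E3}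
    {p : ℝ → E3 → ℝ}, NSFlow a b M u p → ∀ (t : ℝ) (i j : Fin 3) {r : ℝ}, 0 < r →
    ∀ f : 𝓢(E3, ℝ), |pr g r (fun y => u t y i * u t y j) f| ≤ C * (M ^ 2 * √r * l2 f) := by
  obtain ⟨C, hC, h⟩ := exists_abs_pr_le_l2 g
  refine ⟨C, hC, fun {a b M u p} hu t i j r hr f => h (hu.weak t) hu.M_pos
    (hu.cont_slice t).measurable ((hu.tempered_prod i j).tempered t) (fun y => ?_) hr f⟩
  rw [abs_mul, pow_two]
  exact mul_le_mul (abs_coord_le _ i) (abs_coord_le _ j) (abs_nonneg _) (norm_nonneg _)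

theorem l2_nonneg (f : E3 → ℝ) : 0 ≤ l2 f := Real.sqrt_nonneg _

/-- The first bound decays as `r → 0`. For the second, which decays as `r → ∞`, one derivative is
moved to the test function, gaining a factor `1/r`. -/
theorem exists_abs_avgP_le (κ : 𝓢(E3, ℝ)) : ∃ C : ℝ, 0 < C ∧ ∀ {a b M : ℝ} {u : ℝ → E3 → E3}
    {p : ℝ → E3 → ℝ}, NSFlow a b M u p → ∀ (t : ℝ) {r : ℝ}, 0 < r →
    ∀ f : 𝓢(E3, ℝ), HasCompactSupport f → |avgP u f κ r t| ≤ C * (M ^ 2 * √r * l2 f) ∧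
      |avgP u f κ r t| ≤ C * (M ^ 2 * (√r)⁻¹ * ∑ i, l2 (dS i f)) := by
  choose C₁ hC₁ h1 using fun i j => exists_abs_pr_prod_le (dS i (dS j κ))
  choose C₂ hC₂ h2 using fun j => exists_abs_pr_prod_le (dS j κ)
  refine ⟨∑ i, ∑ j, C₁ i j + ∑ j, C₂ j, add_pos
    (Finset.sum_pos (fun i _ => Finset.sum_pos (fun j _ => hC₁ i j) Finset.univ_nonempty)
      Finset.univ_nonempty) (Finset.sum_pos (fun j _ => hC₂ j) Finset.univ_nonempty),
    fun {a b M u p} hu t r hr f hf => ?_⟩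
  have hs1 : 0 ≤ ∑ i, ∑ j, C₁ i j := Finset.sum_nonneg fun i _ => Finset.sum_nonneg fun j _ =>
    (hC₁ i j).le
  have hs2 : 0 ≤ ∑ j, C₂ j := Finset.sum_nonneg fun j _ => (hC₂ j).le
  have hM := hu.M_pos
  have hl := l2_nonneg f
  have hsr : 0 < √r := Real.sqrt_pos.2 hr
  have hsum : ∀ X : Fin 3 → Fin 3 → ℝ, (∀ i j, |pr (dS i (dS j κ)) r
      (fun y => u t y i * u t y j) f| ≤ X i j) → |avgP u f κ r t| ≤ ∑ i, ∑ j, X i j :=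
    fun X hX => (Finset.abs_sum_le_sum_abs _ _).trans (Finset.sum_le_sum fun i _ =>
      (Finset.abs_sum_le_sum_abs _ _).trans (Finset.sum_le_sum fun j _ => hX i j))
  constructor
  · refine (hsum _ fun i j => h1 i j hu t i j hr f).trans ?_
    simp only [← Finset.sum_mul]
    have h0 : 0 ≤ M ^ 2 * √r * l2 f := by positivity
    gcongr
    linarith
  · have h3 : ∀ i j, |pr (dS i (dS j κ)) r (fun y => u t y i * u t y j) f| ≤
        l2 (dS i f) * (C₂ j * (M ^ 2 * (√r)⁻¹)) := fun i j => by
      have e := ((hu.tempered_prod i j).tempered t).pr_dS (dS j κ) hr hf i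
      have e2 := h2 j hu t i j hr (dS i f)
      rw [← e, abs_mul, abs_of_pos hr] at e2
      have e3 : √r * √r = r := Real.mul_self_sqrt hr.le
      rw [← mul_le_mul_iff_right₀ hr]
      refine e2.trans (le_of_eq ?_)
      nth_rewrite 2 [← e3]
      field_simp
    refine (hsum _ h3).trans ?_
    simp only [← Finset.mul_sum, ← Finset.sum_mul]
    have h0 : 0 ≤ M ^ 2 * (√r)⁻¹ * ∑ i, l2 (dS i f) :=
      mul_nonneg (by positivity) (Finset.sum_nonneg fun i _ => l2_nonneg _)
    calc _ = (∑ j, C₂ j) * (M ^ 2 * (√r)⁻¹ * ∑ i, l2 (dS i f)) := by ring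
      _ ≤ _ := by gcongr; linarith

end

/-! ### The pressure as a limit of averaged residuals -/

section

variable {a b M : ℝ} {u : ℝ → E3 → E3} {p : ℝ → E3 → ℝ}

theorem abs_pr_le {g : 𝓢(E3, ℝ)} {w : E3 → ℝ} {r D : ℝ} (hr : 0 < r)
    (h : ∀ x, |dil g w r x| ≤ D) (f : 𝓢(E3, ℝ)) : |pr g r w f| ≤ (∫ x, |f x|) * (r ^ 3 * D) := by
  rw [← Real.norm_eq_abs, ← integral_mul_const]
  refine norm_integral_le_of_norm_le (f.integrable.norm.mul_const _) (ae_of_all _ fun x => ?_)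
  rw [norm_mul, Real.norm_eq_abs, Real.norm_eq_abs, abs_mul, abs_of_pos (by positivity : 0 < r ^ 3)]
  gcongr
  exact h x

theorem exists_abs_dil_prod_le (g : 𝓢(E3, ℝ)) : ∃ C : ℝ, 0 < C ∧ ∀ {a b M : ℝ} {u : ℝ → E3 → E3}
    {p : ℝ → E3 → ℝ}, NSFlow a b M u p → ∀ (i j : Fin 3) (t : ℝ) {r : ℝ}, 0 < r → ∀ x,
    |dil g (fun y => u t y i * u t y j) r x| ≤ C * (M ^ 2 / r) := by
  obtain ⟨C, hC, h⟩ := exists_abs_dil_le_of_sq g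
  refine ⟨C, hC, fun {a b M u p} hu i j t r hr x => h (hu.weak t) hu.M_pos
    (hu.cont_slice t).measurable (fun y => ?_) hr x⟩
  rw [abs_mul, pow_two]
  exact mul_le_mul (abs_coord_le _ i) (abs_coord_le _ j) (abs_nonneg _) (norm_nonneg _)

/-- The linear and convective terms against a test field. -/
def flux (u : ℝ → E3 → E3) (f : Fin 3 → 𝓢(E3, ℝ)) (t : ℝ) : ℝ :=
  ∑ k, (pair (fun y => u t y k) (lapS (f k)) +
    ∑ i, pair (fun y => u t y i * u t y k) (dS i (f k)))

namespace NSFlow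

/-- At large length scales the `L¹` norm of the test function meets averages of size `r³ · M / r²`
or `r³ · M² / r`, both `O(r)` for `r ≤ 1`. -/
theorem exists_abs_avg_le (h : NSFlow a b M u p) (θ : 𝓢(E3, ℝ)) (f : Fin 3 → 𝓢(E3, ℝ)) :
    ∃ B : ℝ, 0 ≤ B ∧ ∀ t r, 0 < r → r ≤ 1 → |avgU u f θ r t| ≤ B * r ∧ |avgG u f θ r t| ≤ B * r := by
  obtain ⟨C₁, hC₁, h1⟩ := NSFlow.exists_abs_dil_comp_le θ
  obtain ⟨C₂, hC₂, h2⟩ := exists_abs_dil_prod_le θ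
  have hM := h.M_pos
  have hI : ∀ g : 𝓢(E3, ℝ), 0 ≤ ∫ x, |g x| := fun g => integral_nonneg fun x => abs_nonneg _
  have b1 : ∀ (k : Fin 3) (g : 𝓢(E3, ℝ)) (t r : ℝ), 0 < r → r ≤ 1 →
      |pr θ r (fun y => u t y k) g| ≤ (∫ x, |g x|) * (C₁ * M) * r := fun k g t r hr hr1 => by
    refine (abs_pr_le hr (h1 h k t hr) g).trans (le_of_eq ?_)
    field_simp
  have b2 : ∀ (i k : Fin 3) (g : 𝓢(E3, ℝ)) (t r : ℝ), 0 < r → r ≤ 1 →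
      |pr θ r (fun y => u t y i * u t y k) g| ≤ (∫ x, |g x|) * (C₂ * M ^ 2) * r :=
    fun i k g t r hr hr1 => by
      refine (abs_pr_le hr (h2 h i k t hr) g).trans ?_
      have hg := hI g
      calc _ = (∫ x, |g x|) * (C₂ * M ^ 2) * (r * r) := by field_simp
        _ ≤ _ := by
          refine mul_le_mul_of_nonneg_left (by nlinarith) (by positivity)
  set B₁ := ∑ k, (∫ x, |f k x|) * (C₁ * M) with hB₁
  set B₂ := ∑ k, ((∫ x, |lapS (f k) x|) * (C₁ * M) +
    ∑ i, (∫ x, |dS i (f k) x|) * (C₂ * M ^ 2)) with hB₂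
  have p1 : 0 ≤ B₁ := Finset.sum_nonneg fun k _ => mul_nonneg (hI _) (by positivity)
  have p2 : 0 ≤ B₂ := Finset.sum_nonneg fun k _ => add_nonneg (mul_nonneg (hI _) (by positivity))
    (Finset.sum_nonneg fun i _ => mul_nonneg (hI _) (by positivity))
  refine ⟨B₁ + B₂, by positivity, fun t r hr hr1 => ⟨?_, ?_⟩⟩
  · refine ((Finset.abs_sum_le_sum_abs _ _).trans
      (Finset.sum_le_sum fun k _ => b1 k (f k) t r hr hr1)).trans ?_
    rw [← Finset.sum_mul]
    gcongr
    linarith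
  · refine ((Finset.abs_sum_le_sum_abs _ _).trans (Finset.sum_le_sum fun k _ =>
      (abs_add_le _ _).trans (add_le_add (b1 k _ t r hr hr1) ((Finset.abs_sum_le_sum_abs _ _).trans
        (Finset.sum_le_sum fun i _ => b2 i k _ t r hr hr1))))).trans ?_
    simp only [← Finset.sum_mul, ← add_mul]
    simp only [hB₂]
    simp only [← Finset.sum_mul] at p1 ⊢
    gcongr
    linarith

theorem tendsto_resid_zero (h : NSFlow a b M u p) (θ : 𝓢(E3, ℝ)) (f : Fin 3 → 𝓢(E3, ℝ))
    (t₁ t₂ : ℝ) {r : ℕ → ℝ} (hr0 : ∀ n, 0 < r n) (hr1 : ∀ n, r n ≤ 1)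
    (hr : Tendsto r atTop (𝓝 0)) : Tendsto (fun n => resid u f θ t₁ t₂ (r n)) atTop (𝓝 0) := by
  obtain ⟨B, hB, hb⟩ := h.exists_abs_avg_le θ f
  have hlim : Tendsto (fun n => (2 * B + B * |t₂ - t₁|) * r n) atTop (𝓝 0) := by
    simpa using hr.const_mul (2 * B + B * |t₂ - t₁|)
  refine squeeze_zero_norm (fun n => ?_) hlim
  have e1 := (hb t₁ (r n) (hr0 n) (hr1 n)).1
  have e2 := (hb t₂ (r n) (hr0 n) (hr1 n)).1
  have e3 := intervalIntegral.norm_integral_le_of_norm_le_const (a := t₁) (b := t₂)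
    (f := fun t => avgG u f θ (r n) t) fun t _ => (hb t (r n) (hr0 n) (hr1 n)).2
  rw [resid, Real.norm_eq_abs]
  refine (abs_sub _ _).trans ?_
  rw [Real.norm_eq_abs] at e3
  have e4 := abs_sub (avgU u f θ (r n) t₂) (avgU u f θ (r n) t₁)
  linarith

theorem continuousOn_pair_p (h : NSFlow a b M u p) {g : 𝓢(E3, ℝ)} (hg : HasCompactSupport g) :
    ContinuousOn (fun t => pair (p t) g) (Icc a b) := by
  refine continuousOn_integral_of_compact_support (f := fun t y => p t y * g y) hg.isCompact ?_
    fun t y _ hy => by simp [image_eq_zero_of_notMem_tsupport hy]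
  exact h.sol.smooth_p.continuousOn.mul (g.continuous.comp continuous_snd).continuousOn

theorem continuous_flux (h : NSFlow a b M u p) (f : Fin 3 → 𝓢(E3, ℝ)) : Continuous (flux u f) :=
  continuous_finsetSum _ fun k _ => ((h.tempered_comp k).continuous_pair _).add
    (continuous_finsetSum _ fun i _ => (h.tempered_prod i k).continuous_pair _)

theorem integral_pair_p (h : NSFlow a b M u p) {f : Fin 3 → 𝓢(E3, ℝ)}
    (hf : ∀ k, HasCompactSupport (f k)) {t₁ t₂ : ℝ} (h₁ : a < t₁) (h₁₂ : t₁ ≤ t₂) (h₂ : t₂ < b) :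
    ∫ t in t₁..t₂, pair (p t) (divS f) =
      ∑ k, pair (fun y => u t₂ y k) (f k) - ∑ k, pair (fun y => u t₁ y k) (f k) -
        ∫ t in t₁..t₂, flux u f t := by
  have hsub : uIcc t₁ t₂ ⊆ Ioo a b := by
    rw [uIcc_of_le h₁₂]
    exact fun t ht => ⟨h₁.trans_le ht.1, ht.2.trans_lt h₂⟩
  have c1 : IntervalIntegrable (flux u f) volume t₁ t₂ := (h.continuous_flux f).intervalIntegrable _ _
  have c2 : IntervalIntegrable (fun t => pair (p t) (divS f)) volume t₁ t₂ :=
    ((h.continuousOn_pair_p (hasCompactSupport_divS hf)).mono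
      (hsub.trans Ioo_subset_Icc_self)).intervalIntegrable
  have hd : ∀ t ∈ uIcc t₁ t₂, HasDerivAt (fun t => ∑ k, pair (fun y => u t y k) (f k))
      (flux u f t + pair (p t) (divS f)) t := fun t ht => by
    refine (HasDerivAt.fun_sum (u := Finset.univ) fun k _ =>
      h.hasDerivAt_pair (hf k) k (hsub ht)).congr_deriv ?_
    rw [Finset.sum_add_distrib, flux]
    congr 1
    simp only [pair, divS]
    have hi : ∀ k ∈ Finset.univ, Integrable fun y => p t y * dS k (f k) y := fun k _ =>
      ((h.contDiff_p (Ioo_subset_Icc_self (hsub ht))).continuous.mul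
        (dS k (f k)).continuous).integrable_of_hasCompactSupport
        (hasCompactSupport_dS (hf k) k).mul_left
    rw [← integral_finsetSum _ hi]
    refine integral_congr_ae (ae_of_all _ fun y => ?_)
    simp only [_root_.sum_apply, Finset.mul_sum]
  have e := intervalIntegral.integral_eq_sub_of_hasDerivAt hd (c1.add c2)
  rw [intervalIntegral.integral_add c1 c2] at e
  linarith

/-- The averages form an approximate identity, so the residual tends to the unaveraged balance of
momentum, whose missing term is the pressure. -/
theorem tendsto_resid_atTop (h : NSFlow a b M u p) {θ : 𝓢(E3, ℝ)} (hθ : ∫ z, θ z = 1)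
    {f : Fin 3 → 𝓢(E3, ℝ)} (hf : ∀ k, HasCompactSupport (f k)) {t₁ t₂ : ℝ} (h₁ : a < t₁)
    (h₁₂ : t₁ ≤ t₂) (h₂ : t₂ < b) {r : ℕ → ℝ} (hr1 : ∀ n, 1 ≤ r n) (hr : Tendsto r atTop atTop) :
    Tendsto (fun n => resid u f θ t₁ t₂ (r n)) atTop
      (𝓝 (∫ t in t₁..t₂, pair (p t) (divS f))) := by
  rw [h.integral_pair_p hf h₁ h₁₂ h₂]
  have hU : ∀ t, Tendsto (fun n => avgU u f θ (r n) t) atTop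
      (𝓝 (∑ k, pair (fun y => u t y k) (f k))) := fun t =>
    tendsto_finsetSum _ fun k _ => (h.tempered_comp k).tendsto_pr hθ (hf k) hr1 hr t
  have hG : ∀ t, Tendsto (fun n => avgG u f θ (r n) t) atTop (𝓝 (flux u f t)) := fun t =>
    tendsto_finsetSum _ fun k _ =>
      ((h.tempered_comp k).tendsto_pr hθ (hasCompactSupport_lapS (hf k)) hr1 hr t).add
      (tendsto_finsetSum _ fun i _ =>
        (h.tempered_prod i k).tendsto_pr hθ (hasCompactSupport_dS (hf k) i) hr1 hr t)
  choose B₁ hB₁ using fun k => (h.tempered_comp k).exists_abs_pr_le θ t₁ t₂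
    (hasCompactSupport_lapS (hf k))
  choose B₂ hB₂ using fun k i => (h.tempered_prod i k).exists_abs_pr_le θ t₁ t₂
    (hasCompactSupport_dS (hf k) i)
  refine ((hU t₂).sub (hU t₁)).sub ?_
  refine intervalIntegral.tendsto_integral_filter_of_dominated_convergence
    (fun _ => ∑ k, (B₁ k + ∑ i, B₂ k i))
    (Eventually.of_forall fun n =>
      (h.continuous_avgG θ hf (one_pos.trans_le (hr1 n))).aestronglyMeasurable)
    (Eventually.of_forall fun n => ae_of_all _ fun t ht => ?_)
    intervalIntegrable_const (ae_of_all _ fun t _ => hG t)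
  rw [uIoc_of_le h₁₂] at ht
  have ht' : t ∈ Icc t₁ t₂ := Ioc_subset_Icc_self ht
  exact (Finset.abs_sum_le_sum_abs _ _).trans (Finset.sum_le_sum fun k _ =>
    (abs_add_le _ _).trans (add_le_add (hB₁ k t ht' _ (hr1 n))
      ((Finset.abs_sum_le_sum_abs _ _).trans (Finset.sum_le_sum fun i _ =>
        hB₂ k i t ht' _ (hr1 n)))))

/-- Telescoping over dyadic scales from the residual at `r = 1`: upwards to the pressure pairing,
downwards to zero. No normalization of the pressure is needed, since only divergences are paired
with it. -/
theorem exists_abs_integral_pair_p_le : ∃ C : ℝ, 0 < C ∧ ∀ {a b M : ℝ} {u : ℝ → E3 → E3}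
    {p : ℝ → E3 → ℝ}, NSFlow a b M u p → ∀ {f : Fin 3 → 𝓢(E3, ℝ)},
    (∀ k, HasCompactSupport (f k)) → ∀ {t₁ t₂ : ℝ}, a < t₁ → t₁ ≤ t₂ → t₂ < b →
    |∫ t in t₁..t₂, pair (p t) (divS f)| ≤
      C * (M ^ 2 * (l2 (divS f) + ∑ i, l2 (dS i (divS f)))) * (t₂ - t₁) := by
  obtain ⟨θ, κ, hθ, hκ⟩ := exists_dyadic_kernel
  obtain ⟨C, hC, hP⟩ := exists_abs_avgP_le κ
  -- Doubling or halving `r` changes the relevant bound on `avgP` by this factor, the ratio of both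
  -- geometric series.
  set q := (√2)⁻¹ with hq
  have h2 : 1 < √2 := by rw [Real.lt_sqrt] <;> norm_num
  have hq0 : 0 < q := by positivity
  have hq1 : q < 1 := inv_lt_one_of_one_lt₀ h2
  have h1q : 0 < 1 - q := sub_pos.2 hq1
  refine ⟨C / (1 - q), by positivity, fun {a b M u p} h f hf t₁ t₂ h₁ h₁₂ hb => ?_⟩
  have hM := h.M_pos
  have ht : 0 ≤ t₂ - t₁ := sub_nonneg.2 h₁₂
  set S₀ := l2 (divS f)
  set S₁ := ∑ i, l2 (dS i (divS f))
  have hpow : ∀ n : ℕ, √((2 : ℝ) ^ n) = (√2) ^ n := fun n => by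
    rw [Real.sqrt_eq_iff_mul_self_eq (by positivity) (by positivity), ← mul_pow,
      Real.mul_self_sqrt (by norm_num)]
  have hpow' : ∀ n : ℕ, √(((2 : ℝ) ^ n)⁻¹) = q ^ n := fun n => by
    rw [Real.sqrt_inv, hpow, hq, inv_pow]
  have hS₁ : 0 ≤ S₁ := Finset.sum_nonneg fun i _ => l2_nonneg _
  have up := dist_le_of_le_geometric_of_tendsto₀ q (C * (M ^ 2 * S₁) * (t₂ - t₁)) hq1
    (f := fun n : ℕ => resid u f θ t₁ t₂ (2 ^ n)) (fun n => by
      have e := h.resid_sub hκ hf (r := 2 ^ (n + 1)) (by positivity) h₁ h₁₂ hb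
      rw [show (2 : ℝ) ^ (n + 1) / 2 = 2 ^ n by rw [pow_succ]; ring] at e
      rw [dist_comm, Real.dist_eq, e, abs_neg]
      have e3 := intervalIntegral.norm_integral_le_of_norm_le_const (a := t₁) (b := t₂)
        (f := fun t => avgP u (divS f) κ (2 ^ (n + 1)) t) fun t _ =>
          (hP h t (by positivity : (0 : ℝ) < 2 ^ (n + 1)) _ (hasCompactSupport_divS hf)).2
      rw [Real.norm_eq_abs, abs_of_nonneg ht, hpow, ← inv_pow, ← hq] at e3
      refine e3.trans ?_
      have : q ^ (n + 1) ≤ q ^ n := pow_le_pow_of_le_one hq0.le hq1.le (Nat.le_succ n)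
      calc C * (M ^ 2 * q ^ (n + 1) * S₁) * (t₂ - t₁) ≤ C * (M ^ 2 * q ^ n * S₁) * (t₂ - t₁) := by
            gcongr
        _ = _ := by ring)
    (h.tendsto_resid_atTop hθ hf h₁ h₁₂ hb (fun n => one_le_pow₀ (by norm_num))
      (tendsto_pow_atTop_atTop_of_one_lt (by norm_num)))
  have down := dist_le_of_le_geometric_of_tendsto₀ q (C * (M ^ 2 * S₀) * (t₂ - t₁)) hq1
    (f := fun n : ℕ => resid u f θ t₁ t₂ ((2 ^ n)⁻¹)) (fun n => by
      have e := h.resid_sub hκ hf (r := (2 ^ n)⁻¹) (by positivity) h₁ h₁₂ hb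
      rw [show ((2 : ℝ) ^ n)⁻¹ / 2 = (2 ^ (n + 1))⁻¹ by rw [pow_succ, mul_inv]; ring] at e
      rw [Real.dist_eq, e, abs_neg]
      have e3 := intervalIntegral.norm_integral_le_of_norm_le_const (a := t₁) (b := t₂)
        (f := fun t => avgP u (divS f) κ ((2 ^ n)⁻¹) t) fun t _ =>
          (hP h t (by positivity : (0 : ℝ) < (2 ^ n)⁻¹) _ (hasCompactSupport_divS hf)).1
      rw [Real.norm_eq_abs, abs_of_nonneg ht, hpow'] at e3
      exact e3.trans (le_of_eq (by ring)))
    (h.tendsto_resid_zero θ f t₁ t₂ (fun n => by positivity)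
      (fun n => inv_le_one_of_one_le₀ (one_le_pow₀ (by norm_num)))
      (tendsto_inv_atTop_zero.comp (tendsto_pow_atTop_atTop_of_one_lt (by norm_num))))
  simp only [pow_zero, inv_one, Real.dist_eq, sub_zero] at up down
  have e := abs_sub_abs_le_abs_sub (∫ t in t₁..t₂, pair (p t) (divS f)) (resid u f θ t₁ t₂ 1)
  rw [abs_sub_comm] at up
  calc _ ≤ C * (M ^ 2 * S₁) * (t₂ - t₁) / (1 - q) + C * (M ^ 2 * S₀) * (t₂ - t₁) / (1 - q) := by
        linarith
    _ = _ := by field_simp; ring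

/-- The time integral of a continuous function is Lipschitz with the constant just found, and its
derivative inherits that constant. -/
theorem exists_abs_pair_p_le : ∃ C : ℝ, 0 < C ∧ ∀ {a b M : ℝ} {u : ℝ → E3 → E3}
    {p : ℝ → E3 → ℝ}, NSFlow a b M u p → ∀ {f : Fin 3 → 𝓢(E3, ℝ)},
    (∀ k, HasCompactSupport (f k)) → ∀ {t : ℝ}, t ∈ Ioo a b →
    |pair (p t) (divS f)| ≤ C * (M ^ 2 * (l2 (divS f) + ∑ i, l2 (dS i (divS f)))) := by
  obtain ⟨C, hC, hI⟩ := exists_abs_integral_pair_p_le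
  refine ⟨C, hC, fun {a b M u p} h f hf t ht => ?_⟩
  have hM := h.M_pos
  have hc := (h.continuousOn_pair_p (hasCompactSupport_divS hf)).mono
    (Ioo_subset_Icc_self (a := a) (b := b))
  have hca := hc.continuousAt (Ioo_mem_nhds ht.1 ht.2)
  have hd : HasDerivAt (fun s => ∫ τ in t..s, pair (p τ) (divS f)) (pair (p t) (divS f)) t :=
    intervalIntegral.integral_hasDerivAt_right (by simp)
      (hc.stronglyMeasurableAtFilter isOpen_Ioo t ht) hca
  rw [← Real.norm_eq_abs]
  have h0 : 0 ≤ l2 (divS f) + ∑ i, l2 (dS i (divS f)) :=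
    add_nonneg (l2_nonneg _) (Finset.sum_nonneg fun i _ => l2_nonneg _)
  refine hd.le_of_lip' (by positivity) ?_
  filter_upwards [Ioo_mem_nhds ht.1 ht.2] with s hs
  rw [intervalIntegral.integral_same, sub_zero, Real.norm_eq_abs, Real.norm_eq_abs]
  rcases le_total t s with hts | hts
  · rw [abs_of_nonneg (sub_nonneg.2 hts)]
    exact hI h hf ht.1 hts hs.2
  · rw [intervalIntegral.integral_symm, abs_neg, abs_sub_comm, abs_of_nonneg (sub_nonneg.2 hts)]
    exact hI h hf hs.1 hts ht.2

end NSFlow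

end

section

/-! ### Cut-off functions -/

/-- A fixed bump function. -/
def bump : ContDiffBump (0 : E3) := ⟨1, 2, one_pos, one_lt_two⟩

/-- A cut-off function at scale `R`. -/
def cut (R : ℝ) (x : E3) : ℝ := bump (R⁻¹ • x)

theorem contDiff_cut (R : ℝ) : ContDiff ℝ ∞ (cut R) := bump.contDiff.comp (contDiff_const_smul _)

theorem hasCompactSupport_cut {R : ℝ} (hR : 0 < R) : HasCompactSupport (cut R) :=
  bump.hasCompactSupport.comp_smul (inv_pos.2 hR).ne'

theorem cut_nonneg (R : ℝ) (x : E3) : 0 ≤ cut R x := bump.nonneg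

theorem cut_le_one (R : ℝ) (x : E3) : cut R x ≤ 1 := bump.le_one

theorem cut_eq_one {R : ℝ} (hR : 0 < R) {x : E3} (hx : ‖x‖ ≤ R) : cut R x = 1 := by
  refine bump.one_of_mem_closedBall ?_
  rw [mem_closedBall_zero_iff, norm_smul, Real.norm_of_nonneg (inv_pos.2 hR).le]
  change R⁻¹ * ‖x‖ ≤ 1
  rwa [inv_mul_le_iff₀ hR, mul_one]

theorem pd_comp_smul {f : E3 → ℝ} (hf : ContDiff ℝ 1 f) (c : ℝ) (i : Fin 3) (x : E3) :
    pd i (fun x => f (c • x)) x = c * pd i f (c • x) := by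
  have h1 : HasFDerivAt (fun x : E3 => c • x) (c • ContinuousLinearMap.id ℝ E3) x :=
    (hasFDerivAt_id x).const_smul c
  have h2 := ((hf.differentiable one_ne_zero) (c • x)).hasFDerivAt.comp x h1
  change fderiv ℝ (fun x => f (c • x)) x (e3 i) = c * fderiv ℝ f (c • x) (e3 i)
  rw [show fderiv ℝ (fun x => f (c • x)) x = _ from h2.fderiv]
  simp

/-- Second derivatives are `O(R⁻²)`; the weaker common bound is enough because `R ≥ 1` and only
decay matters. -/
theorem exists_abs_pd_cut_le : ∃ K : ℝ, 0 < K ∧ ∀ R : ℝ, 1 ≤ R → ∀ x,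
    (∀ i, |pd i (cut R) x| ≤ K / R) ∧ ∀ i j, |pd i (pd j (cut R)) x| ≤ K / R := by
  have hb : ContDiff ℝ ∞ (bump : E3 → ℝ) := bump.contDiff
  have h1 : ∀ i, ContDiff ℝ 1 (pd i bump) := fun i => contDiff_pd hb (by norm_cast) i
  have bd : ∀ f : E3 → ℝ, Continuous f → HasCompactSupport f → ∃ K : ℝ, ∀ x, |f x| ≤ K :=
    fun f hf hs => by
      obtain ⟨K, hK⟩ := hs.exists_bound_of_continuous hf
      exact ⟨K, hK⟩
  choose K₁ hK₁ using fun i => bd (pd i bump) (h1 i).continuous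
    (hasCompactSupport_pd bump.hasCompactSupport i)
  choose K₂ hK₂ using fun i j => bd (pd i (pd j bump))
    (contDiff_pd (m := 0) (h1 j) (by norm_num) i).continuous
    (hasCompactSupport_pd (hasCompactSupport_pd bump.hasCompactSupport j) i)
  refine ⟨∑ i, |K₁ i| + ∑ i, ∑ j, |K₂ i j| + 1, by positivity, fun R hR x => ?_⟩
  have hR0 : 0 < R := one_pos.trans_le hR
  have hp : ∀ j, pd j (cut R) = fun x => R⁻¹ * pd j bump (R⁻¹ • x) := fun j =>
    funext fun x => pd_comp_smul (hb.of_le one_le_infty) _ _ _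
  have s1 : ∀ i, K₁ i ≤ ∑ i, |K₁ i| := fun i => (le_abs_self _).trans
    (Finset.single_le_sum (f := fun i => |K₁ i|) (fun i _ => abs_nonneg _) (Finset.mem_univ i))
  have s2 : ∀ i j, K₂ i j ≤ ∑ i, ∑ j, |K₂ i j| := fun i j => (le_abs_self _).trans
    ((Finset.single_le_sum (f := fun j => |K₂ i j|) (fun i _ => abs_nonneg _)
      (Finset.mem_univ j)).trans (Finset.single_le_sum (f := fun i => ∑ j, |K₂ i j|)
      (fun i _ => Finset.sum_nonneg fun j _ => abs_nonneg _) (Finset.mem_univ i)))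
  have p1 : 0 ≤ ∑ i, |K₁ i| := by positivity
  have p2 : 0 ≤ ∑ i, ∑ j, |K₂ i j| := by positivity
  constructor
  · intro i
    rw [hp, abs_mul, abs_of_pos (inv_pos.2 hR0), div_eq_inv_mul]
    gcongr
    exact (hK₁ i _).trans (by linarith [s1 i])
  · intro i j
    have e : pd i (pd j (cut R)) x = R⁻¹ * (R⁻¹ * pd i (pd j bump) (R⁻¹ • x)) := by
      rw [hp, ← pd_comp_smul (h1 j)]
      have hd : DifferentiableAt ℝ (fun x => pd j bump (R⁻¹ • x)) x :=
        (((h1 j).comp (contDiff_const_smul R⁻¹)).differentiable one_ne_zero) x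
      change fderiv ℝ (fun x => R⁻¹ * pd j bump (R⁻¹ • x)) x (e3 i) = R⁻¹ * fderiv ℝ _ x (e3 i)
      rw [fderiv_const_mul hd]
      simp
    rw [e, abs_mul, abs_mul, abs_of_pos (inv_pos.2 hR0), div_eq_inv_mul]
    gcongr
    refine (mul_le_of_le_one_left (abs_nonneg _) (inv_le_one_of_one_le₀ hR)).trans ?_
    exact (hK₂ i j _).trans (by linarith [s2 i j])

/-! ### The local energy identity -/

/-- Reduces product rules for partial derivatives to one variable. -/
theorem hasDerivAt_line {f : E3 → ℝ} (hf : ContDiff ℝ 1 f) (i : Fin 3) (x : E3) :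
    HasDerivAt (fun s : ℝ => f (x + s • e3 i)) (pd i f x) 0 := by
  have h1 : HasDerivAt (fun s : ℝ => x + s • e3 i) ((1 : ℝ) • e3 i) 0 :=
    ((hasDerivAt_id (0 : ℝ)).smul_const (e3 i)).const_add x
  have h2 : HasFDerivAt f (fderiv ℝ f x) (x + (0 : ℝ) • e3 i) := by
    rw [zero_smul, add_zero]
    exact ((hf.differentiable one_ne_zero) x).hasFDerivAt
  have h3 := h2.comp_hasDerivAt (0 : ℝ) h1
  rw [one_smul] at h3
  exact h3

theorem integral_pd_eq_zero {f : E3 → ℝ} (hf : ContDiff ℝ 1 f) (hs : HasCompactSupport f)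
    (i : Fin 3) : ∫ x, pd i f x = 0 := by
  have h := integral_pd_mul (contDiff_const (c := (1 : ℝ))) hf hs i
  have e : ∀ x : E3, pd i (fun _ => (1 : ℝ)) x = 0 := fun x => by simp [pd]
  simp only [e, zero_mul, integral_zero, one_mul] at h
  linarith

/-- The components of a vector field. -/
def comp (v : E3 → E3) (k : Fin 3) (x : E3) : ℝ := v x k

theorem contDiff_comp {n : ℕ∞ω} {v : E3 → E3} (hv : ContDiff ℝ n v) (k : Fin 3) :
    ContDiff ℝ n (comp v k) :=
  (contDiff_piLp 2).1 hv k

/-- The integrand in the time derivative of the local energy. -/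
def enIn (η : E3 → ℝ) (u v : E3 → E3) (p : E3 → ℝ) (x : E3) : ℝ :=
  ∑ k, η x ^ 2 * (v x k * (∑ i, pd i (pd i (comp v k)) x - ∑ i, u x i * pd i (comp u k) x - pd k p x))

/-- The energy density dissipated and transported. -/
def enOut (η : E3 → ℝ) (u v l : E3 → E3) (x : E3) : ℝ :=
  ∑ k, ∑ i, (-(pd i (comp v k) x * (2 * η x * pd i η x * v x k + η x ^ 2 * pd i (comp v k) x)) +
    u x i * v x k ^ 2 * (η x * pd i η x) + 2 * u x i * l x k * η x * pd i η x * v x k +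
    u x i * l x k * η x ^ 2 * pd i (comp v k) x)

/-- The divergence of `η² v` for divergence free `v`. -/
def divCut (η : E3 → ℝ) (v : E3 → E3) (x : E3) : ℝ := ∑ k, 2 * η x * pd k η x * v x k

/-- The energy flux. -/
def enFlux (η : E3 → ℝ) (u v : E3 → E3) (p : E3 → ℝ) (i : Fin 3) (x : E3) : ℝ :=
  η x * η x * (∑ k, (comp v k x * pd i (comp v k) x - comp v k x * (comp u i x * comp u k x) +
    1 / 2 * (comp u i x * (comp v k x * comp v k x))) - comp v i x * p x)

theorem contDiff_enFlux {η : E3 → ℝ} {u v : E3 → E3} {p : E3 → ℝ} (hη : ContDiff ℝ ∞ η)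
    (hu : ContDiff ℝ ∞ u) (hv : ContDiff ℝ ∞ v) (hp : ContDiff ℝ ∞ p) (i : Fin 3) :
    ContDiff ℝ 1 (enFlux η u v p i) := by
  have hη1 := hη.of_le one_le_infty
  have cu := fun k => contDiff_comp (hu.of_le one_le_infty) k
  have cv := fun k => contDiff_comp (hv.of_le one_le_infty) k
  have cdv : ∀ k, ContDiff ℝ 1 (pd i (comp v k)) := fun k =>
    contDiff_pd (contDiff_comp hv k) (by norm_cast) i
  refine (hη1.mul hη1).mul ((ContDiff.sum fun k _ => ?_).sub ((cv i).mul (hp.of_le one_le_infty)))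
  exact (((cv k).mul (cdv k)).sub ((cv k).mul ((cu i).mul (cu k)))).add
    (contDiff_const.mul ((cu i).mul ((cv k).mul (cv k))))

/-- With `u = v + l`, the part of the convective term cubic in `u, v, v` is a divergence, since `u`
is divergence free. What is left is the dissipation, terms containing a derivative of the cut-off,
and the source `u_i l_k ∂_i v_k`. -/
theorem sum_pd_enFlux {η : E3 → ℝ} {u v l : E3 → E3} {p : E3 → ℝ} (hη : ContDiff ℝ ∞ η)
    (hu : ContDiff ℝ ∞ u) (hv : ContDiff ℝ ∞ v) (hp : ContDiff ℝ ∞ p)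
    (hl : ∀ x k, u x k = v x k + l x k) (du : ∀ x, ∑ i, pd i (comp u i) x = 0)
    (dv : ∀ x, ∑ i, pd i (comp v i) x = 0) (x : E3) :
    ∑ i, pd i (enFlux η u v p i) x =
      enIn η u v p x - enOut η u v l x - p x * divCut η v x := by
  have hη1 := hη.of_le one_le_infty
  have cu := fun k => contDiff_comp (hu.of_le one_le_infty) k
  have cv := fun k => contDiff_comp (hv.of_le one_le_infty) k
  have cdv : ∀ i k, ContDiff ℝ 1 (pd i (comp v k)) := fun i k =>
    contDiff_pd (contDiff_comp hv k) (by norm_cast) i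
  have key : ∀ i, pd i (enFlux η u v p i) x =
      2 * η x * pd i η x * (∑ k, (v x k * pd i (comp v k) x - v x k * (u x i * u x k) +
        1 / 2 * (u x i * (v x k * v x k))) - v x i * p x) +
      η x ^ 2 * (∑ k, (pd i (comp v k) x ^ 2 + v x k * pd i (pd i (comp v k)) x -
        (pd i (comp v k) x * (u x i * u x k) + v x k * (pd i (comp u i) x * u x k +
          u x i * pd i (comp u k) x)) + 1 / 2 * (pd i (comp u i) x * (v x k * v x k) +
          u x i * (2 * v x k * pd i (comp v k) x))) -
        (pd i (comp v i) x * p x + v x i * pd i p x)) := fun i => by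
    have h1 := hasDerivAt_line (contDiff_enFlux hη hu hv hp i) i x
    have dη := hasDerivAt_line hη1 i x
    have dp := hasDerivAt_line (hp.of_le one_le_infty) i x
    have dU := fun k => hasDerivAt_line (cu k) i x
    have dV := fun k => hasDerivAt_line (cv k) i x
    have dD := fun k => hasDerivAt_line (cdv i k) i x
    have h2 := (dη.mul dη).mul ((HasDerivAt.fun_sum (u := Finset.univ) fun k _ =>
      (((dV k).mul (dD k)).sub ((dV k).mul ((dU i).mul (dU k)))).add
        (((dU i).mul ((dV k).mul (dV k))).const_mul (1 / 2))).sub ((dV i).mul dp))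
    rw [h1.unique h2]
    simp only [Pi.mul_apply, Pi.sub_apply, Pi.add_apply, zero_smul, add_zero, comp,
      Fin.sum_univ_three]
    ring
  simp only [key, enIn, enOut, divCut]
  have e1 := du x
  have e2 := dv x
  simp only [Fin.sum_univ_three, hl] at e1 e2 ⊢
  -- The two sides differ by multiples of `∇ · u` and `∇ · v`; these are the coefficients.
  linear_combination (η x ^ 2 * (-(v x 0 * (v x 0 + l x 0) + v x 1 * (v x 1 + l x 1) +
    v x 2 * (v x 2 + l x 2)) + 1 / 2 * (v x 0 ^ 2 + v x 1 ^ 2 + v x 2 ^ 2))) * e1 -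
    (η x ^ 2 * p x) * e2

theorem continuous_enOut {η : E3 → ℝ} {u v l : E3 → E3} (hη : ContDiff ℝ ∞ η)
    (hu : Continuous u) (hv : ContDiff ℝ ∞ v) (hl : Continuous l) :
    Continuous (enOut η u v l) := by
  have c0 := hη.continuous
  have c1 : ∀ i, Continuous (pd i η) := fun i =>
    (contDiff_pd (m := 0) hη (by norm_cast) i).continuous
  have c2 : ∀ i k, Continuous (pd i (comp v k)) := fun i k =>
    (contDiff_pd (m := 0) (contDiff_comp hv k) (by norm_cast) i).continuous
  have c3 := hv.continuous
  unfold enOut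
  fun_prop

theorem continuous_divCut {η : E3 → ℝ} {v : E3 → E3} (hη : ContDiff ℝ ∞ η) (hv : Continuous v) :
    Continuous (divCut η v) := by
  have c0 := hη.continuous
  have c1 : ∀ i, Continuous (pd i η) := fun i =>
    (contDiff_pd (m := 0) hη (by norm_cast) i).continuous
  unfold divCut
  fun_prop

theorem integral_enIn {η : E3 → ℝ} {u v l : E3 → E3} {p : E3 → ℝ} (hη : ContDiff ℝ ∞ η)
    (hs : HasCompactSupport η) (hu : ContDiff ℝ ∞ u) (hv : ContDiff ℝ ∞ v) (hlc : Continuous l)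
    (hp : ContDiff ℝ ∞ p) (hl : ∀ x k, u x k = v x k + l x k)
    (du : ∀ x, ∑ i, pd i (comp u i) x = 0) (dv : ∀ x, ∑ i, pd i (comp v i) x = 0) :
    Integrable (enOut η u v l) ∧
    ∫ x, enIn η u v p x = (∫ x, enOut η u v l x) + ∫ x, p x * divCut η v x := by
  have s0 : ∀ x, x ∉ tsupport η → η x = 0 := fun x hx => image_eq_zero_of_notMem_tsupport hx
  have i1 : Integrable (enOut η u v l) :=
    (continuous_enOut hη hu.continuous hv hlc).integrable_of_hasCompactSupport
      (HasCompactSupport.intro hs.isCompact fun x hx => by simp [enOut, s0 x hx])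
  have i2 : Integrable fun x => p x * divCut η v x :=
    (hp.continuous.mul (continuous_divCut hη hv.continuous)).integrable_of_hasCompactSupport
      (HasCompactSupport.intro hs.isCompact fun x hx => by simp [divCut, s0 x hx])
  have hz : ∀ i, HasCompactSupport (enFlux η u v p i) := fun i =>
    HasCompactSupport.intro hs.isCompact fun x hx => by simp [enFlux, s0 x hx]
  have i3 : ∀ i ∈ Finset.univ, Integrable (pd i (enFlux η u v p i)) := fun i _ =>
    (contDiff_pd (m := 0) (contDiff_enFlux hη hu hv hp i) (by norm_num)
      i).continuous.integrable_of_hasCompactSupport (hasCompactSupport_pd (hz i) i)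
  have i4 : Integrable fun x => ∑ i, pd i (enFlux η u v p i) x := integrable_finsetSum _ i3
  have i5 : Integrable fun x => enOut η u v l x + p x * divCut η v x := i1.add i2
  refine ⟨i1, ?_⟩
  calc ∫ x, enIn η u v p x = ∫ x, (∑ i, pd i (enFlux η u v p i) x +
        (enOut η u v l x + p x * divCut η v x)) := by
        refine integral_congr_ae (ae_of_all _ fun x => ?_)
        simp only [sum_pd_enFlux hη hu hv hp hl du dv x]
        ring
    _ = _ := by
        rw [integral_add i4 i5, integral_add i1 i2, integral_finsetSum _ i3]
        simp only [integral_pd_eq_zero (contDiff_enFlux hη hu hv hp _) (hz _),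
          Finset.sum_const_zero, zero_add]

end

/-! ### Bounds for the terms of the local energy identity -/

section

/-- The squared Hilbert-Schmidt norm of the gradient. -/
def gradSq (v : E3 → E3) (x : E3) : ℝ := ∑ i, ∑ k, pd i (comp v k) x ^ 2

theorem gradSq_nonneg (v : E3 → E3) (x : E3) : 0 ≤ gradSq v x := by
  unfold gradSq; positivity

theorem continuous_gradSq {v : E3 → E3} (hv : ContDiff ℝ 1 v) : Continuous (gradSq v) := by
  have c2 : ∀ i k, Continuous (pd i (comp v k)) := fun i k =>
    (contDiff_pd (m := 0) (contDiff_comp hv k) (by norm_num) i).continuous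
  unfold gradSq
  fun_prop

theorem norm_sq_eq (v : E3) : ‖v‖ ^ 2 = ∑ k, v k ^ 2 := by
  rw [EuclideanSpace.real_norm_sq_eq]

theorem fderiv_apply_comp {v : E3 → E3} (hv : ContDiff ℝ 1 v) (x y : E3) (k : Fin 3) :
    (fderiv ℝ v x y) k = fderiv ℝ (comp v k) x y := by
  have h1 : HasFDerivAt (comp v k) _ x := (EuclideanSpace.proj k : E3 →L[ℝ] ℝ).hasFDerivAt.comp x
    ((hv.differentiable one_ne_zero) x).hasFDerivAt
  rw [h1.fderiv]
  rfl

theorem norm_fderiv_sq_le {v : E3 → E3} (hv : ContDiff ℝ 1 v) (x : E3) :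
    ‖fderiv ℝ v x‖ ^ 2 ≤ 3 * gradSq v x := by
  set A := fderiv ℝ v x
  have h1 : ∀ i, ‖A (e3 i)‖ ^ 2 = ∑ k, pd i (comp v k) x ^ 2 := fun i => by
    rw [norm_sq_eq]
    exact Finset.sum_congr rfl fun k _ => by rw [fderiv_apply_comp hv]; rfl
  have h2 : ‖A‖ ≤ ∑ i, ‖A (e3 i)‖ := by
    refine A.opNorm_le_bound (Finset.sum_nonneg fun i _ => norm_nonneg _) fun y => ?_
    conv_lhs => rw [← sum_coord_smul_e3 y]
    rw [map_sum, Finset.sum_mul]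
    refine (norm_sum_le _ _).trans (Finset.sum_le_sum fun i _ => ?_)
    rw [map_smul, norm_smul, mul_comm, Real.norm_eq_abs]
    gcongr
    exact abs_coord_le y i
  have h3 : (∑ i, ‖A (e3 i)‖) ^ 2 ≤ 3 * ∑ i, ‖A (e3 i)‖ ^ 2 := by
    simp only [Fin.sum_univ_three]
    nlinarith [sq_nonneg (‖A (e3 0)‖ - ‖A (e3 1)‖), sq_nonneg (‖A (e3 0)‖ - ‖A (e3 2)‖),
      sq_nonneg (‖A (e3 1)‖ - ‖A (e3 2)‖)]
  calc ‖A‖ ^ 2 ≤ (∑ i, ‖A (e3 i)‖) ^ 2 := by gcongr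
    _ ≤ _ := h3
    _ = _ := by simp only [h1, gradSq]

theorem contDiff_cut_smul {n : ℕ∞} {v : E3 → E3} (hv : ContDiff ℝ n v) (R : ℝ) :
    ContDiff ℝ n fun x => cut R x • v x :=
  ((contDiff_cut R).of_le (by exact_mod_cast le_top)).smul hv

theorem sum_abs_mul_sq_le {e : ℝ} {f g : Fin 3 → ℝ} (hf : ∀ i, |f i| ≤ e) :
    ∑ i, ∑ k, (f i * g k) ^ 2 ≤ 3 * e ^ 2 * ∑ k, g k ^ 2 := by
  have h : ∀ i, f i ^ 2 ≤ e ^ 2 := fun i => sq_le_sq' (neg_le_of_abs_le (hf i)) (le_of_abs_le (hf i))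
  have h1 : ∀ i ∈ Finset.univ, ∑ k, (f i * g k) ^ 2 ≤ e ^ 2 * ∑ k, g k ^ 2 := fun i _ => by
    rw [Finset.mul_sum]
    refine Finset.sum_le_sum fun k _ => ?_
    rw [mul_pow]
    exact mul_le_mul_of_nonneg_right (h i) (sq_nonneg _)
  refine (Finset.sum_le_sum h1).trans (le_of_eq ?_)
  simp
  ring

theorem gradSq_cut_smul_le {v : E3 → E3} (hv : ContDiff ℝ 1 v) {R e : ℝ} {x : E3}
    (he : ∀ i, |pd i (cut R) x| ≤ e) :
    gradSq (fun x => cut R x • v x) x ≤ 2 * (cut R x ^ 2 * gradSq v x) + 6 * e ^ 2 * ‖v x‖ ^ 2 := by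
  have h1 : ∀ i k, pd i (comp (fun x => cut R x • v x) k) x =
      pd i (cut R) x * v x k + cut R x * pd i (comp v k) x := fun i k =>
    pd_mul ((contDiff_cut R).of_le one_le_infty) (contDiff_comp hv k) i x
  have h2 : ∀ i k, pd i (comp (fun x => cut R x • v x) k) x ^ 2 ≤
      2 * (pd i (cut R) x * v x k) ^ 2 + 2 * (cut R x ^ 2 * pd i (comp v k) x ^ 2) := fun i k => by
    rw [h1]
    nlinarith [sq_nonneg (pd i (cut R) x * v x k - cut R x * pd i (comp v k) x)]
  have h3 := sum_abs_mul_sq_le (g := fun k => v x k) he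
  calc _ ≤ ∑ i, ∑ k, (2 * (pd i (cut R) x * v x k) ^ 2 +
        2 * (cut R x ^ 2 * pd i (comp v k) x ^ 2)) :=
        Finset.sum_le_sum fun i _ => Finset.sum_le_sum fun k _ => h2 i k
    _ = 2 * ∑ i, ∑ k, (pd i (cut R) x * v x k) ^ 2 + 2 * (cut R x ^ 2 * gradSq v x) := by
        simp only [Finset.sum_add_distrib, ← Finset.mul_sum, gradSq]
    _ ≤ _ := by
        rw [norm_sq_eq]
        linarith

/-- The localized dissipation. -/
def diss (R : ℝ) (v : E3 → E3) : ℝ := ∫ x, cut R x ^ 2 * gradSq v x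

theorem integrable_diss {v : E3 → E3} (hv : ContDiff ℝ 1 v) {R : ℝ} (hR : 0 < R) :
    Integrable fun x => cut R x ^ 2 * gradSq v x :=
  (((contDiff_cut R).continuous.pow 2).mul (continuous_gradSq hv)).integrable_of_hasCompactSupport
    (HasCompactSupport.intro (hasCompactSupport_cut hR).isCompact fun x hx => by
      simp [image_eq_zero_of_notMem_tsupport hx])

theorem diss_nonneg (R : ℝ) (v : E3 → E3) : 0 ≤ diss R v :=
  integral_nonneg fun x => mul_nonneg (sq_nonneg _) (gradSq_nonneg v x)

/-- Lorentz-Sobolev for the truncated field; where the derivative hits the cut-off only the `L²`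
norm is needed, with a factor decaying in `R`. -/
theorem exists_lorS_cut_le : ∃ C : ℝ, 0 < C ∧ ∀ v : E3 → E3, ContDiff ℝ 1 v →
    Integrable (fun x => ‖v x‖ ^ 2) → ∀ R : ℝ, 1 ≤ R →
    lorS (fun x => cut R x • v x) ≤ ENNReal.ofReal (C * (diss R v + (∫ x, ‖v x‖ ^ 2) / R)) := by
  obtain ⟨C, hC, h⟩ := exists_lorS_le
  obtain ⟨K, hK, hcut⟩ := exists_abs_pd_cut_le
  refine ⟨C * (6 + 18 * K ^ 2), by positivity, fun v hv hi R hR => ?_⟩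
  have hR0 : 0 < R := one_pos.trans_le hR
  have hw : ContDiff ℝ 1 fun x => cut R x • v x := contDiff_cut_smul (n := 1) hv R
  have hs : HasCompactSupport fun x => cut R x • v x := (hasCompactSupport_cut hR0).smul_right
  have i1 := (integrable_diss hv hR0).const_mul 6
  have i2 := hi.const_mul (18 * (K / R) ^ 2)
  have hV : 0 ≤ ∫ x, ‖v x‖ ^ 2 := integral_nonneg fun x => sq_nonneg _
  have hD := diss_nonneg R v
  calc _ ≤ ENNReal.ofReal C * ∫⁻ x, ENNReal.ofReal (‖fderiv ℝ (fun x => cut R x • v x) x‖ ^ 2) :=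
        h _ hw hs
    _ ≤ ENNReal.ofReal C * ∫⁻ x, ENNReal.ofReal (6 * (cut R x ^ 2 * gradSq v x) +
        18 * (K / R) ^ 2 * ‖v x‖ ^ 2) := by
        refine mul_le_mul_right (lintegral_mono fun x => ENNReal.ofReal_le_ofReal ?_) _
        have e1 := norm_fderiv_sq_le hw x
        have e2 := gradSq_cut_smul_le hv (hcut R hR x).1
        linarith
    _ = ENNReal.ofReal C * ENNReal.ofReal (6 * diss R v + 18 * (K / R) ^ 2 * ∫ x, ‖v x‖ ^ 2) := by
        have i3 : Integrable fun x => 6 * (cut R x ^ 2 * gradSq v x) +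
          18 * (K / R) ^ 2 * ‖v x‖ ^ 2 := i1.add i2
        rw [diss, ← integral_const_mul, ← integral_const_mul, ← integral_add i1 i2,
          ofReal_integral_eq_lintegral_ofReal i3 (ae_of_all _ fun x => ?_)]
        · have := gradSq_nonneg v x
          change 0 ≤ 6 * (cut R x ^ 2 * gradSq v x) + 18 * (K / R) ^ 2 * ‖v x‖ ^ 2
          positivity
    _ ≤ _ := by
        rw [← ENNReal.ofReal_mul hC.le]
        refine ENNReal.ofReal_le_ofReal ?_
        rw [mul_assoc C (6 + 18 * K ^ 2)]
        refine mul_le_mul_of_nonneg_left ?_ hC.le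
        have e1 : (K / R) ^ 2 * ∫ x, ‖v x‖ ^ 2 ≤ K ^ 2 * ((∫ x, ‖v x‖ ^ 2) / R) := by
          rw [div_pow, div_mul_eq_mul_div, mul_div_assoc]
          gcongr
          nlinarith
        have e2 : 0 ≤ (∫ x, ‖v x‖ ^ 2) / R := by positivity
        nlinarith [mul_nonneg (sq_nonneg K) hD]

/-- Young's inequality entry by entry. The source term is absorbed at the cost of a quarter of the
dissipation, and every term with a derivative of the cut-off carries the small factor `e`. -/
theorem enOut_le {η : E3 → ℝ} {u v l : E3 → E3} {e : ℝ} {x : E3} (he0 : 0 ≤ e)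
    (h0 : 0 ≤ η x) (h1 : η x ≤ 1) (he : ∀ i, |pd i η x| ≤ e) :
    enOut η u v l x ≤ -(3 / 4 - e) * (η x ^ 2 * gradSq v x) + (1 + e) * (‖u x‖ ^ 2 * ‖l x‖ ^ 2) +
      e * (9 * ‖v x‖ ^ 2 + ‖u x‖ ^ 2 * ‖η x • v x‖ ^ 2) := by
  have key : ∀ k i, -(pd i (comp v k) x * (2 * η x * pd i η x * v x k +
      η x ^ 2 * pd i (comp v k) x)) + u x i * v x k ^ 2 * (η x * pd i η x) +
      2 * u x i * l x k * η x * pd i η x * v x k + u x i * l x k * η x ^ 2 * pd i (comp v k) x ≤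
      -(3 / 4 - e) * (η x ^ 2 * pd i (comp v k) x ^ 2) + (1 + e) * (u x i ^ 2 * l x k ^ 2) +
      e * (3 * v x k ^ 2 + u x i ^ 2 * (η x ^ 2 * v x k ^ 2)) := fun k i => by
    have hh := he i
    generalize pd i (comp v k) x = d
    generalize pd i η x = h at *
    generalize η x = n at *
    generalize v x k = w
    generalize l x k = m
    generalize u x i = U
    obtain ⟨hh1, hh2⟩ := abs_le.1 hh
    have aux : ∀ X Y : ℝ, 2 * (h * (X * Y)) ≤ e * (X ^ 2 + Y ^ 2) := fun X Y => by
      nlinarith [mul_nonneg (sub_nonneg.2 hh2) (sq_nonneg (X + Y)),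
        mul_nonneg (neg_le_iff_add_nonneg.1 hh1) (sq_nonneg (X - Y))]
    have a1 := aux (-(n * d)) w
    have a2 := aux (U * (n * w)) w
    have a3 := aux (U * m * n) w
    have a4 : n ^ 2 ≤ 1 := by nlinarith
    have a5 : (U * m * n) ^ 2 ≤ (U * m) ^ 2 := by
      rw [mul_pow]
      exact mul_le_of_le_one_right (sq_nonneg _) a4
    have a6 : U * m * n ^ 2 * d ≤ (U * m * n) ^ 2 + 1 / 4 * (n * d) ^ 2 := by
      nlinarith [sq_nonneg (U * m * n - 1 / 2 * (n * d))]
    have a7 : 0 ≤ e * ((U * m) ^ 2 - (U * m * n) ^ 2) := mul_nonneg he0 (sub_nonneg.2 a5)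
    have a8 : 0 ≤ e * (U * (n * w)) ^ 2 := by positivity
    have a9 : 0 ≤ e * w ^ 2 := by positivity
    nlinarith
  refine (Finset.sum_le_sum fun k _ => Finset.sum_le_sum fun i _ => key k i).trans (le_of_eq ?_)
  rw [norm_smul, mul_pow, Real.norm_eq_abs, sq_abs]
  simp only [norm_sq_eq, gradSq, Fin.sum_univ_three]
  ring

theorem divCut_sq_le {η : E3 → ℝ} {v : E3 → E3} {e : ℝ} {x : E3}
    (h0 : 0 ≤ η x) (h1 : η x ≤ 1) (he : ∀ i, |pd i η x| ≤ e) :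
    divCut η v x ^ 2 ≤ 12 * e ^ 2 * ‖v x‖ ^ 2 := by
  have h2 : ∀ k, (2 * η x * pd k η x * v x k) ^ 2 ≤ 4 * e ^ 2 * v x k ^ 2 := fun k => by
    have a1 : pd k η x ^ 2 ≤ e ^ 2 := sq_le_sq' (neg_le_of_abs_le (he k)) (le_of_abs_le (he k))
    have a2 : η x ^ 2 ≤ 1 := by nlinarith
    have a3 : η x ^ 2 * pd k η x ^ 2 ≤ 1 * e ^ 2 := mul_le_mul a2 a1 (sq_nonneg _) zero_le_one
    nlinarith [mul_le_mul_of_nonneg_right a3 (sq_nonneg (v x k))]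
  have h3 : divCut η v x ^ 2 ≤ 3 * ∑ k, (2 * η x * pd k η x * v x k) ^ 2 := by
    simpa [divCut] using sq_sum_le_card_mul_sum_sq (s := Finset.univ)
      (f := fun k => 2 * η x * pd k η x * v x k)
  refine h3.trans ?_
  rw [norm_sq_eq]
  have h4 := Finset.sum_le_sum fun k (_ : k ∈ Finset.univ) => h2 k
  rw [← Finset.mul_sum] at h4
  linarith

theorem pd_divCut {η : E3 → ℝ} {v : E3 → E3} (hη : ContDiff ℝ ∞ η) (hv : ContDiff ℝ 1 v)
    (i : Fin 3) (x : E3) : pd i (divCut η v) x = ∑ k, (2 * (pd i η x * pd k η x) * v x k +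
      2 * (η x * pd i (pd k η) x) * v x k + 2 * (η x * pd k η x) * pd i (comp v k) x) := by
  have hη1 := hη.of_le one_le_infty
  have hd : ∀ k, ContDiff ℝ 1 (pd k η) := fun k => contDiff_pd hη (by norm_cast) k
  have h1 : ContDiff ℝ 1 (divCut η v) := ContDiff.sum fun k _ =>
    ((contDiff_const.mul hη1).mul (hd k)).mul (contDiff_comp hv k)
  have dη := hasDerivAt_line hη1 i x
  have dd := fun k => hasDerivAt_line (hd k) i x
  have dV := fun k => hasDerivAt_line (contDiff_comp hv k) i x
  have h2 := HasDerivAt.fun_sum (u := Finset.univ) fun k _ =>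
    ((dη.const_mul 2).mul (dd k)).mul (dV k)
  rw [(hasDerivAt_line h1 i x).unique h2]
  simp only [Pi.mul_apply, zero_smul, add_zero, comp]
  exact Finset.sum_congr rfl fun k _ => by ring

/-- Each term of the derivative contains at least one derivative of the cut-off and so a factor `e`;
a second one is bounded by `K`. -/
theorem pd_divCut_sq_le {η : E3 → ℝ} {v : E3 → E3} (hη : ContDiff ℝ ∞ η) (hv : ContDiff ℝ 1 v)
    {e K : ℝ} {x : E3} (he0 : 0 ≤ e) (heK : e ≤ K)
    (h0 : 0 ≤ η x) (h1 : η x ≤ 1) (he : ∀ i, |pd i η x| ≤ e) (he' : ∀ i j, |pd i (pd j η) x| ≤ e)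
    (i : Fin 3) : pd i (divCut η v) x ^ 2 ≤
      24 * (K + 1) ^ 2 * e ^ 2 * (‖v x‖ ^ 2 + η x ^ 2 * gradSq v x) := by
  have hK : 0 ≤ K := he0.trans heK
  have h2 : ∀ k, (2 * (pd i η x * pd k η x) * v x k + 2 * (η x * pd i (pd k η) x) * v x k +
      2 * (η x * pd k η x) * pd i (comp v k) x) ^ 2 ≤
      8 * (K + 1) ^ 2 * e ^ 2 * (v x k ^ 2 + η x ^ 2 * pd i (comp v k) x ^ 2) := fun k => by
    have b1 : |pd i η x * pd k η x| ≤ e * K := by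
      rw [abs_mul]
      exact mul_le_mul (he i) ((he k).trans heK) (abs_nonneg _) he0
    have b2 : |η x * pd i (pd k η) x| ≤ e := by
      rw [abs_mul, abs_of_nonneg h0]
      exact (mul_le_of_le_one_left (abs_nonneg _) h1).trans (he' i k)
    have b3 : |2 * (pd i η x * pd k η x) * v x k + 2 * (η x * pd i (pd k η) x) * v x k +
        2 * (η x * pd k η x) * pd i (comp v k) x| ≤
        2 * e * (K + 1) * (|v x k| + |η x * pd i (comp v k) x|) := by
      have t1 : |2 * (pd i η x * pd k η x) * v x k| ≤ 2 * (e * K) * |v x k| := by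
        rw [abs_mul, abs_mul, abs_two]; gcongr
      have t2 : |2 * (η x * pd i (pd k η) x) * v x k| ≤ 2 * e * |v x k| := by
        rw [abs_mul, abs_mul, abs_two]; gcongr
      have t3 : |2 * (η x * pd k η x) * pd i (comp v k) x| ≤ 2 * e * |η x * pd i (comp v k) x| := by
        rw [show 2 * (η x * pd k η x) * pd i (comp v k) x =
          2 * pd k η x * (η x * pd i (comp v k) x) by ring, abs_mul, abs_mul, abs_two]
        gcongr
        exact he k
      have t4 := abs_add_le (2 * (pd i η x * pd k η x) * v x k + 2 * (η x * pd i (pd k η) x) * v x k)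
        (2 * (η x * pd k η x) * pd i (comp v k) x)
      have t5 := abs_add_le (2 * (pd i η x * pd k η x) * v x k) (2 * (η x * pd i (pd k η) x) * v x k)
      have t6 : 0 ≤ 2 * e * K * |η x * pd i (comp v k) x| := by positivity
      nlinarith
    have b4 := pow_le_pow_left₀ (abs_nonneg _) b3 2
    rw [sq_abs] at b4
    refine b4.trans ?_
    have b5 : (|v x k| + |η x * pd i (comp v k) x|) ^ 2 ≤
        2 * (v x k ^ 2 + η x ^ 2 * pd i (comp v k) x ^ 2) := by
      rw [← sq_abs (v x k), ← mul_pow (η x), ← sq_abs (η x * _)]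
      nlinarith [sq_nonneg (|v x k| - |η x * pd i (comp v k) x|)]
    rw [mul_pow]
    calc _ ≤ (2 * e * (K + 1)) ^ 2 * (2 * (v x k ^ 2 + η x ^ 2 * pd i (comp v k) x ^ 2)) := by
          gcongr
      _ = _ := by ring
  rw [pd_divCut hη hv]
  refine (sq_sum_le_card_mul_sum_sq (s := Finset.univ)).trans ?_
  have h4 := Finset.sum_le_sum fun k (_ : k ∈ Finset.univ) => h2 k
  rw [← Finset.mul_sum, Finset.sum_add_distrib, ← norm_sq_eq, ← Finset.mul_sum] at h4
  have h5 : ∑ k, pd i (comp v k) x ^ 2 ≤ gradSq v x :=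
    Finset.single_le_sum (f := fun i => ∑ k, pd i (comp v k) x ^ 2)
      (fun i _ => Finset.sum_nonneg fun k _ => sq_nonneg _) (Finset.mem_univ i)
  have h6 : ‖v x‖ ^ 2 + η x ^ 2 * ∑ k, pd i (comp v k) x ^ 2 ≤ ‖v x‖ ^ 2 + η x ^ 2 * gradSq v x := by
    gcongr
  have h7 : 0 ≤ 8 * (K + 1) ^ 2 * e ^ 2 := by positivity
  have h8 := mul_le_mul_of_nonneg_left h6 h7
  simp only [Finset.card_univ, Fintype.card_fin, Nat.cast_ofNat]
  linarith

/-- The crude `√y ≤ 1 + y` for `y ≥ 0`, making the bound linear in energy and dissipation so that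
the latter can be absorbed. -/
theorem l2_le {g F : E3 → ℝ} {A : ℝ} (hA : 0 ≤ A) (hg : Continuous g) (hF : Integrable F)
    (h : ∀ x, g x ^ 2 ≤ A ^ 2 * F x) (hF0 : 0 ≤ ∫ x, F x) : l2 g ≤ A * (1 + ∫ x, F x) := by
  have hi := hF.const_mul (A ^ 2)
  have hgi : Integrable fun x => g x ^ 2 := hi.mono' (hg.pow 2).aestronglyMeasurable
    (ae_of_all _ fun x => by rw [Real.norm_of_nonneg (sq_nonneg _)]; exact h x)
  rw [l2]
  refine Real.sqrt_le_iff.2 ⟨by positivity, ?_⟩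
  refine (integral_mono hgi hi h).trans ?_
  rw [integral_const_mul, mul_pow]
  gcongr
  nlinarith

end

/-! ### The local energy inequality -/

section

variable {a b M : ℝ} {u : ℝ → E3 → E3} {p : ℝ → E3 → ℝ}

/-- The test field `η² v`. -/
def cutField (R : ℝ) (hR : 0 < R) {v : E3 → E3} (hv : ContDiff ℝ ∞ v) (k : Fin 3) : 𝓢(E3, ℝ) :=
  ((((hasCompactSupport_cut hR).mul_right (f' := cut R)).mul_right (f' := comp v k))).toSchwartzMap
    (((contDiff_cut R).mul (contDiff_cut R)).mul (contDiff_comp hv k))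

theorem hasCompactSupport_cutField (R : ℝ) (hR : 0 < R) {v : E3 → E3} (hv : ContDiff ℝ ∞ v)
    (k : Fin 3) : HasCompactSupport (cutField R hR hv k) :=
  (((hasCompactSupport_cut hR).mul_right (f' := cut R)).mul_right (f' := comp v k))

theorem divS_cutField (R : ℝ) (hR : 0 < R) {v : E3 → E3} (hv : ContDiff ℝ ∞ v)
    (dv : ∀ x, ∑ i, pd i (comp v i) x = 0) : (divS (cutField R hR hv) : E3 → ℝ) = divCut (cut R) v := by
  ext x
  have hc := (contDiff_cut R).of_le one_le_infty
  have hcv := fun k => (contDiff_comp hv k).of_le one_le_infty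
  have h1 : ∀ k, dS k (cutField R hR hv k) x =
      2 * cut R x * pd k (cut R) x * v x k + cut R x * cut R x * pd k (comp v k) x := fun k => by
    have e := pd_mul (hc.mul hc) (hcv k) k x
    rw [pd_mul hc hc] at e
    rw [← pd_schwartz]
    refine Eq.trans (e : pd k (cutField R hR hv k) x = _) ?_
    simp only [comp]
    ring
  simp only [divS, _root_.sum_apply, h1, divCut, Finset.sum_add_distrib, ← Finset.mul_sum, dv,
    mul_zero, add_zero]

/-- For `R` large the error terms contain at most a quarter of the dissipation, which leaves half of
it on the other side of the energy inequality. -/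
theorem local_energy_arith {K CS CP M R V Q D C : ℝ} (hK : 0 < K) (hCS : 0 < CS) (hCP : 0 < CP)
    (hR0 : 0 < R) (hV0 : 0 ≤ V) (hQ0 : 0 ≤ Q) (hD0 : 0 ≤ D)
    (hC : C = K * (9 + 4 * CS + 20 * CP * (K + 1)) + 1) (hR : 4 * (C * (1 + M ^ 2)) ≤ R) :
    K / R * (D + Q + 9 * V + 4 * M ^ 2 * (CS * (D + V)) +
      20 * CP * (K + 1) * M ^ 2 * (1 + (V + D))) ≤
      C * (1 + M ^ 2) / R * (1 + V + Q) + 1 / 4 * D := by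
  set e := K / R with he
  have he0 : 0 < e := by positivity
  set W := (1 + M ^ 2) * (1 + V + Q + D) with hW
  have hM2 : 0 ≤ M ^ 2 := sq_nonneg M
  have hA4 : C * (1 + M ^ 2) / R ≤ 1 / 4 := by
    rw [div_le_iff₀ hR0]
    linarith
  have m1 := mul_nonneg hM2 hV0
  have m2 := mul_nonneg hM2 hQ0
  have m3 := mul_nonneg hM2 hD0
  have hWe : W = 1 + V + Q + D + M ^ 2 + M ^ 2 * V + M ^ 2 * Q + M ^ 2 * D := by rw [hW]; ring
  have h1 : C * (1 + M ^ 2) / R * (1 + V + Q + D) =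
      (e * (9 + 4 * CS + 20 * CP * (K + 1)) + 1 / R) * W := by
    rw [hC, he]
    field_simp
    exact hW.symm
  have h2 : 0 ≤ 1 / R * W := by positivity
  have z1 : D + Q + 9 * V ≤ 9 * W := by linarith
  have z2 : 4 * M ^ 2 * (CS * (D + V)) ≤ 4 * CS * W := by
    have : M ^ 2 * (D + V) ≤ W := by linarith
    calc _ = 4 * CS * (M ^ 2 * (D + V)) := by ring
      _ ≤ _ := by gcongr
  have z3 : 20 * CP * (K + 1) * M ^ 2 * (1 + (V + D)) ≤ 20 * CP * (K + 1) * W := by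
    rw [mul_assoc]
    refine mul_le_mul_of_nonneg_left ?_ (by positivity)
    linarith
  have z4 := mul_le_mul_of_nonneg_left (add_le_add (add_le_add z1 z2) z3) he0.le
  have z5 : C * (1 + M ^ 2) / R * (1 + V + Q + D) ≤
      C * (1 + M ^ 2) / R * (1 + V + Q) + 1 / 4 * D := by
    rw [mul_add]
    gcongr
  rw [h1, add_mul, mul_assoc] at z5
  linarith

/-- In the integrated identity the transport across the cut-off is controlled by weak `L³` times the
Lorentz-Sobolev bound, and the pressure term by `NSFlow.exists_abs_pair_p_le` applied to the field
`η² v`. Both are `O(1/R)` times energy and dissipation. -/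
theorem NSFlow.exists_local_energy : ∃ C : ℝ, 1 ≤ C ∧ ∀ {a b M : ℝ} {u : ℝ → E3 → E3}
    {p : ℝ → E3 → ℝ}, NSFlow a b M u p → ∀ {t : ℝ}, t ∈ Ioo a b → ∀ {v l : E3 → E3},
    ContDiff ℝ ∞ v → Continuous l → (∀ x k, u t x k = v x k + l x k) →
    (∀ x, ∑ i, pd i (comp v i) x = 0) → Integrable (fun x => ‖v x‖ ^ 2) →
    Integrable (fun x => ‖u t x‖ ^ 2 * ‖l x‖ ^ 2) → ∀ R, 4 * (C * (1 + M ^ 2)) ≤ R →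
    (∫ x, enIn (cut R) (u t) v (p t) x) + 1 / 2 * diss R v ≤
      (∫ x, ‖u t x‖ ^ 2 * ‖l x‖ ^ 2) + C * (1 + M ^ 2) / R *
        (1 + (∫ x, ‖v x‖ ^ 2) + ∫ x, ‖u t x‖ ^ 2 * ‖l x‖ ^ 2) := by
  obtain ⟨CS, hCS, hS⟩ := exists_lorS_cut_le
  obtain ⟨CP, hCP, hP⟩ := NSFlow.exists_abs_pair_p_le
  obtain ⟨K, hK, hcut⟩ := exists_abs_pd_cut_le
  refine ⟨K * (9 + 4 * CS + 20 * CP * (K + 1)) + 1, by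
    have : 0 ≤ K * (9 + 4 * CS + 20 * CP * (K + 1)) := by positivity
    linarith, fun {a b M u p} h t ht v l hv hlc hl dv iV iQ R hR => ?_⟩
  have hM := h.M_pos
  set C := K * (9 + 4 * CS + 20 * CP * (K + 1)) + 1 with hC
  have hC1 : 1 ≤ C := by
    have : 0 ≤ K * (9 + 4 * CS + 20 * CP * (K + 1)) := by positivity
    linarith
  have hR1 : 1 ≤ R := by nlinarith [sq_nonneg M]
  have hR0 : 0 < R := one_pos.trans_le hR1
  have ht' := Ioo_subset_Icc_self ht
  have hu := h.contDiff_slice ht'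
  have hp := h.contDiff_p ht'
  have hv1 := hv.of_le one_le_infty
  set e := K / R with he
  have he0 : 0 < e := by positivity
  have heK : e ≤ K := div_le_self hK.le hR1
  set V := ∫ x, ‖v x‖ ^ 2 with hV
  set Q := ∫ x, ‖u t x‖ ^ 2 * ‖l x‖ ^ 2 with hQ
  set D := diss R v with hD
  have hV0 : 0 ≤ V := integral_nonneg fun x => sq_nonneg _
  have hQ0 : 0 ≤ Q := integral_nonneg fun x => by positivity
  have hD0 : 0 ≤ D := diss_nonneg R v
  have iD := integrable_diss hv1 hR0
  have cw : Continuous fun x => cut R x • v x := (contDiff_cut_smul (n := ⊤) hv R).continuous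
  have iY : Integrable fun x => ‖u t x‖ ^ 2 * ‖cut R x • v x‖ ^ 2 :=
    ((hu.continuous.norm.pow 2).mul (cw.norm.pow 2)).integrable_of_hasCompactSupport
      (HasCompactSupport.intro (hasCompactSupport_cut hR0).isCompact fun x hx => by
        simp [image_eq_zero_of_notMem_tsupport hx])
  set Y := ∫ x, ‖u t x‖ ^ 2 * ‖cut R x • v x‖ ^ 2 with hY
  have hYle : Y ≤ 4 * M ^ 2 * (CS * (D + V)) := by
    have h1 := (h.weak t).lintegral_sq_mul_sq_le hM hu.continuous.measurable cw.measurable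
    have h2 := h1.trans (mul_le_mul_right (hS v hv1 iV R hR1) _)
    have h3 : ∫⁻ x, ENNReal.ofReal (‖u t x‖ ^ 2) * ENNReal.ofReal (‖cut R x • v x‖ ^ 2) =
        ENNReal.ofReal Y := by
      rw [hY, ofReal_integral_eq_lintegral_ofReal iY (ae_of_all _ fun x => by positivity)]
      exact lintegral_congr fun x => (ENNReal.ofReal_mul (by positivity)).symm
    rw [h3, ← ENNReal.ofReal_mul (by positivity), ENNReal.ofReal_le_ofReal_iff (by positivity)] at h2
    refine h2.trans ?_
    gcongr
    exact div_le_self hV0 hR1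
  obtain ⟨iO, hX⟩ := integral_enIn (contDiff_cut R) (hasCompactSupport_cut hR0) hu hv hlc hp hl
    (h.sum_pd_eq_zero ht') dv
  have hO : ∫ x, enOut (cut R) (u t) v l x ≤ -(3 / 4 - e) * D + (1 + e) * Q + e * (9 * V + Y) := by
    have j1 : Integrable fun x => -(3 / 4 - e) * (cut R x ^ 2 * gradSq v x) := iD.const_mul _
    have j2 : Integrable fun x => (1 + e) * (‖u t x‖ ^ 2 * ‖l x‖ ^ 2) := iQ.const_mul _
    have j3 : Integrable fun x => 9 * ‖v x‖ ^ 2 := iV.const_mul _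
    have j4 : Integrable fun x => 9 * ‖v x‖ ^ 2 + ‖u t x‖ ^ 2 * ‖cut R x • v x‖ ^ 2 := j3.add iY
    have j5 : Integrable fun x => e * (9 * ‖v x‖ ^ 2 + ‖u t x‖ ^ 2 * ‖cut R x • v x‖ ^ 2) :=
      j4.const_mul _
    have j6 : Integrable fun x => -(3 / 4 - e) * (cut R x ^ 2 * gradSq v x) +
      (1 + e) * (‖u t x‖ ^ 2 * ‖l x‖ ^ 2) := j1.add j2
    have j7 : Integrable fun x => -(3 / 4 - e) * (cut R x ^ 2 * gradSq v x) +
      (1 + e) * (‖u t x‖ ^ 2 * ‖l x‖ ^ 2) +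
      e * (9 * ‖v x‖ ^ 2 + ‖u t x‖ ^ 2 * ‖cut R x • v x‖ ^ 2) := j6.add j5
    refine (integral_mono iO j7 fun x => enOut_le he0.le (cut_nonneg R x) (cut_le_one R x)
      (hcut R hR1 x).1).trans (le_of_eq ?_)
    rw [integral_add j6 j5, integral_add j1 j2, integral_const_mul, integral_const_mul,
      integral_const_mul, integral_add j3 iY, integral_const_mul]
    rfl
  have hπ : ∫ x, p t x * divCut (cut R) v x ≤ CP * (M ^ 2 * (20 * (K + 1) * e * (1 + (V + D)))) := by
    have h1 := hP h (f := cutField R hR0 hv) (hasCompactSupport_cutField R hR0 hv) ht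
    have h2 : pair (p t) (divS (cutField R hR0 hv)) = ∫ x, p t x * divCut (cut R) v x := by
      rw [pair, divS_cutField R hR0 hv dv]
    have h3 : ∀ i, dS i (divS (cutField R hR0 hv)) = pd i (divCut (cut R) v) := fun i => by
      rw [← pd_schwartz, divS_cutField R hR0 hv dv]
    rw [h2] at h1
    simp only [h3, divS_cutField R hR0 hv dv] at h1
    have iF : Integrable fun x => ‖v x‖ ^ 2 + cut R x ^ 2 * gradSq v x := iV.add iD
    have eF : ∫ x, (‖v x‖ ^ 2 + cut R x ^ 2 * gradSq v x) = V + D := integral_add iV iD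
    -- The square of 5 exceeds the constants 12 and 24 of the two pointwise bounds.
    have hA : 0 ≤ 5 * (K + 1) * e := by positivity
    have g0 : ∀ x, 0 ≤ cut R x ^ 2 * gradSq v x := fun x =>
      mul_nonneg (sq_nonneg _) (gradSq_nonneg v x)
    have a1 : l2 (divCut (cut R) v) ≤ 5 * (K + 1) * e * (1 + (V + D)) := by
      rw [← eF]
      refine l2_le hA (continuous_divCut (contDiff_cut R) hv.continuous) iF (fun x => ?_)
        (by rw [eF]; positivity)
      refine (divCut_sq_le (cut_nonneg R x) (cut_le_one R x) (hcut R hR1 x).1).trans ?_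
      have b1 : 12 * e ^ 2 ≤ (5 * (K + 1) * e) ^ 2 := by
        have : 12 * e ^ 2 ≤ 25 * (K + 1) ^ 2 * e ^ 2 := by
          gcongr
          nlinarith
        linarith [this, show (5 * (K + 1) * e) ^ 2 = 25 * (K + 1) ^ 2 * e ^ 2 by ring]
      exact mul_le_mul b1 (le_add_of_nonneg_right (g0 x)) (by positivity) (by positivity)
    have a2 : ∀ i, l2 (pd i (divCut (cut R) v)) ≤ 5 * (K + 1) * e * (1 + (V + D)) := fun i => by
      rw [← eF]
      refine l2_le hA ?_ iF (fun x => ?_) (by rw [eF]; positivity)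
      · rw [← h3 i]
        exact (dS i (divS (cutField R hR0 hv))).continuous
      · refine (pd_divCut_sq_le (contDiff_cut R) hv1 he0.le heK (cut_nonneg R x) (cut_le_one R x)
          (hcut R hR1 x).1 (hcut R hR1 x).2 i).trans ?_
        have := g0 x
        gcongr
        nlinarith [sq_nonneg ((K + 1) * e)]
    refine (le_abs_self _).trans (h1.trans ?_)
    gcongr
    -- Four `L²` norms in total, that of the divergence and those of its three derivatives, turn 5
    -- into 20.
    have a3 := Finset.sum_le_sum fun i (_ : i ∈ Finset.univ) => a2 i
    simp only [Finset.sum_const, Finset.card_univ, Fintype.card_fin, nsmul_eq_mul,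
      Nat.cast_ofNat] at a3
    linarith
  have hfin := local_energy_arith hK hCS hCP hR0 hV0 hQ0 hD0 hC hR
  have hYe := mul_le_mul_of_nonneg_left hYle he0.le
  rw [hX]
  linarith

end

/-! ### The deviation from the heat flow and its energy -/

section

variable {a b M : ℝ} {u : ℝ → E3 → E3} {p : ℝ → E3 → ℝ}

theorem Tempered.contDiff_heat {w : E3 → ℝ} (hw : Tempered w) {σ : ℝ} (hσ : 0 < σ) :
    ContDiff ℝ ∞ (heat w σ) :=
  contDiff_const.mul (hw.contDiff_dil heatS (inv_pos.2 (Real.sqrt_pos.2 hσ)))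

theorem Tempered.pd_const_mul_dil {w : E3 → ℝ} (hw : Tempered w) (g : 𝓢(E3, ℝ)) {r : ℝ}
    (hr : 0 < r) (n : ℕ) (i : Fin 3) :
    pd i (fun x => r ^ n * dil g w r x) = fun x => -(r ^ (n + 1) * dil (dS i g) w r x) := by
  ext x
  have hd : DifferentiableAt ℝ (dil g w r) x := (hw.contDiff_dil g hr).differentiable (by simp) x
  change fderiv ℝ (fun x => r ^ n * dil g w r x) x (e3 i) = _
  rw [fderiv_const_mul hd, _root_.smul_apply, hw.fderiv_dil g hr, smul_eq_mul]
  ring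

theorem Tempered.pd_heat {w : E3 → ℝ} (hw : Tempered w) {σ : ℝ} (hσ : 0 < σ) (i : Fin 3) :
    pd i (heat w σ) = fun x => -((√σ)⁻¹ ^ 4 * dil (dS i heatS) w (√σ)⁻¹ x) :=
  hw.pd_const_mul_dil heatS (inv_pos.2 (Real.sqrt_pos.2 hσ)) 3 i

theorem Tempered.sum_pd_pd_heat {w : E3 → ℝ} (hw : Tempered w) {σ : ℝ} (hσ : 0 < σ) (x : E3) :
    ∑ i, pd i (pd i (heat w σ)) x = heatLap w σ x := by
  have hr := inv_pos.2 (Real.sqrt_pos.2 hσ)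
  have h1 : ∀ i, pd i (pd i (heat w σ)) x = (√σ)⁻¹ ^ 5 * dil (dS i (dS i heatS)) w (√σ)⁻¹ x :=
    fun i => by
      rw [hw.pd_heat hσ]
      have e : (fun x => -((√σ)⁻¹ ^ 4 * dil (dS i heatS) w (√σ)⁻¹ x)) =
          -fun x => (√σ)⁻¹ ^ 4 * dil (dS i heatS) w (√σ)⁻¹ x := rfl
      have h2 := congrFun (hw.pd_const_mul_dil (dS i heatS) hr 4 i) x
      rw [pd] at h2 ⊢
      rw [e, fderiv_neg, _root_.neg_apply, h2, neg_neg]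
  simp only [h1, ← Finset.mul_sum, heatLap]
  congr 1
  simp only [← pair_dilS _ _ hr]
  rw [← hw.pair_sum, ← dilS_sum]
  rfl

namespace NSFlow

/-- The divergence passes to the heat kernel, and the translated and dilated kernel is an admissible
test function for `∇ · u = 0`. -/
theorem sum_pd_heat (h : NSFlow a b M u p) {t : ℝ} (ht : t ∈ Icc a b) {σ : ℝ} (hσ : 0 < σ)
    (x : E3) : ∑ i, pd i (heat (fun y => u t y i) σ) x = 0 := by
  have hr := inv_pos.2 (Real.sqrt_pos.2 hσ)
  have h1 := h.sum_pair_dS ht (dilS heatS hr x)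
  simp only [dS_dilS, pair_smul, pair_dilS] at h1
  simp only [fun i => ((h.tempered_comp i).tempered t).pd_heat hσ i]
  have h2 : ∀ i, -((√σ)⁻¹ ^ 4 * dil (dS i heatS) (fun y => u t y i) (√σ)⁻¹ x) =
      -((√σ)⁻¹ ^ 3) * ((√σ)⁻¹ * dil (dS i heatS) (fun y => u t y i) (√σ)⁻¹ x) := fun i => by ring
  rw [Finset.sum_congr rfl fun i _ => h2 i, ← Finset.mul_sum, h1, mul_zero]

/-- The deviation of the flow from the heat flow started at time `s`. -/
def _root_.LorentzNS.dev (u : ℝ → E3 → E3) (s t : ℝ) (x : E3) : E3 :=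
  u t x - heatV (u s) (t - s) x

theorem _root_.LorentzNS.dev_apply (u : ℝ → E3 → E3) (s t : ℝ) (x : E3) (k : Fin 3) :
    dev u s t x k = u t x k - heat (fun y => u s y k) (t - s) x := rfl

theorem contDiff_heatV (h : NSFlow a b M u p) (s : ℝ) {σ : ℝ} (hσ : 0 < σ) :
    ContDiff ℝ ∞ (heatV (u s) σ) :=
  (contDiff_piLp 2).2 fun k => ((h.tempered_comp k).tempered s).contDiff_heat hσ

theorem contDiff_dev (h : NSFlow a b M u p) {s t : ℝ} (ht : t ∈ Icc a b) (hst : s < t) :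
    ContDiff ℝ ∞ (dev u s t) :=
  (h.contDiff_slice ht).sub (h.contDiff_heatV s (sub_pos.2 hst))

theorem pd_dev (h : NSFlow a b M u p) {s t : ℝ} (ht : t ∈ Icc a b) (hst : s < t) (i k : Fin 3) :
    pd i (comp (dev u s t) k) = fun x =>
      pd i (fun y => u t y k) x - pd i (heat (fun y => u s y k) (t - s)) x := by
  ext x
  have d1 : DifferentiableAt ℝ (fun y => u t y k) x := (h.contDiff_comp ht k).differentiable (by simp) x
  have d2 : DifferentiableAt ℝ (heat (fun y => u s y k) (t - s)) x :=
    (((h.tempered_comp k).tempered s).contDiff_heat (sub_pos.2 hst)).differentiable (by simp) x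
  exact congrArg (fun A => A (e3 i)) (fderiv_fun_sub d1 d2)

theorem sum_pd_dev (h : NSFlow a b M u p) {s t : ℝ} (hs : s ∈ Icc a b) (ht : t ∈ Icc a b)
    (hst : s < t) (x : E3) : ∑ i, pd i (comp (dev u s t) i) x = 0 := by
  simp only [h.pd_dev ht hst, Finset.sum_sub_distrib, h.sum_pd_eq_zero ht,
    h.sum_pd_heat hs (sub_pos.2 hst), sub_zero]

theorem sum_pd_pd_dev (h : NSFlow a b M u p) {s t : ℝ} (ht : t ∈ Icc a b)
    (hst : s < t) (k : Fin 3) (x : E3) : ∑ i, pd i (pd i (comp (dev u s t) k)) x =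
      ∑ i, pd i (pd i (fun y => u t y k)) x - heatLap (fun y => u s y k) (t - s) x := by
  have hw := (h.tempered_comp k).tempered s
  rw [← hw.sum_pd_pd_heat (sub_pos.2 hst), ← Finset.sum_sub_distrib]
  refine Finset.sum_congr rfl fun i _ => ?_
  rw [h.pd_dev ht hst]
  have d1 : DifferentiableAt ℝ (pd i (fun y => u t y k)) x :=
    (contDiff_pd (m := 1) (h.contDiff_comp ht k) (by norm_cast) i).differentiable one_ne_zero x
  have d2 : DifferentiableAt ℝ (pd i (heat (fun y => u s y k) (t - s))) x :=
    (contDiff_pd (m := 1) (hw.contDiff_heat (sub_pos.2 hst)) (by norm_cast) i).differentiable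
      one_ne_zero x
  exact congrArg (fun A => A (e3 i)) (fderiv_fun_sub d1 d2)

/-- The time derivative of the deviation. -/
def _root_.LorentzNS.devDt (u : ℝ → E3 → E3) (s : ℝ) (k : Fin 3) (t : ℝ) (x : E3) : ℝ :=
  dt u k t x - heatLap (fun y => u s y k) (t - s) x

theorem hasDerivAt_dev (h : NSFlow a b M u p) {s t : ℝ} (ht : t ∈ Ioo a b) (hst : s < t)
    (k : Fin 3) (x : E3) : HasDerivAt (fun t => dev u s t x k) (devDt u s k t x) t := by
  have h1 := ((h.tempered_comp k).tempered s).hasDerivAt_heat (sub_pos.2 hst) x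
  have h2 : HasDerivAt (fun t => t - s) 1 t := (hasDerivAt_id t).sub_const s
  have h3 := h1.comp t h2
  rw [mul_one] at h3
  exact (h.hasDerivAt_comp k ht x).sub h3

/-- The heat extension solves the heat equation, so the deviation satisfies `∂_t v = Δv - u · ∇u -
∇p`. -/
theorem enIn_eq (h : NSFlow a b M u p) {s t : ℝ} (ht : t ∈ Ioo a b) (hst : s < t)
    (R : ℝ) (x : E3) : enIn (cut R) (u t) (dev u s t) (p t) x =
      ∑ k, cut R x ^ 2 * (dev u s t x k * devDt u s k t x) := by
  refine Finset.sum_congr rfl fun k _ => ?_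
  rw [devDt, h.momentum_comp ht, h.sum_pd_pd_dev (Ioo_subset_Icc_self ht) hst]
  have e : comp (u t) k = fun y => u t y k := rfl
  rw [e]
  ring

theorem continuousOn_dil_sqrt_sub (h : NSFlow a b M u p) (g : 𝓢(E3, ℝ)) (k : Fin 3) (s : ℝ) :
    ContinuousOn (fun z : ℝ × E3 => dil g (fun y => u s y k) (√(z.1 - s))⁻¹ z.2)
      (Ioi s ×ˢ univ) := by
  have hz : ContinuousOn (fun q : ℝ × E3 => dil g (fun y => u s y k) q.1 q.2) {q | 0 < q.1} :=
    (((h.tempered_comp k).tempered s).contDiffOn_dil g).continuousOn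
  have hr : ContinuousOn (fun z : ℝ × E3 => (√(z.1 - s))⁻¹) (Ioi s ×ˢ univ) :=
    continuousOn_sqrt_inv (by fun_prop) fun z hz => sub_pos.2 hz.1
  exact ContinuousOn.comp (g := fun q : ℝ × E3 => dil g (fun y => u s y k) q.1 q.2)
    (f := fun z : ℝ × E3 => ((√(z.1 - s))⁻¹, z.2)) hz (hr.prodMk continuousOn_snd)
    fun z hz => inv_pos.2 (Real.sqrt_pos.2 (sub_pos.2 hz.1))

theorem continuousOn_dev (h : NSFlow a b M u p) (s : ℝ) (k : Fin 3) :
    ContinuousOn (fun z : ℝ × E3 => dev u s z.1 z.2 k) (Ioi s ×ˢ univ) := by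
  have hr : ContinuousOn (fun z : ℝ × E3 => (√(z.1 - s))⁻¹) (Ioi s ×ˢ univ) :=
    continuousOn_sqrt_inv (by fun_prop) fun z hz => sub_pos.2 hz.1
  exact (h.cont_comp k).continuousOn.sub ((hr.pow 3).mul (h.continuousOn_dil_sqrt_sub heatS k s))

theorem continuousOn_devDt (h : NSFlow a b M u p) (s : ℝ) (k : Fin 3) :
    ContinuousOn (fun z : ℝ × E3 => devDt u s k z.1 z.2) ((Ioo a b ∩ Ioi s) ×ˢ univ) := by
  have hr : ContinuousOn (fun z : ℝ × E3 => (√(z.1 - s))⁻¹) (Ioi s ×ˢ univ) :=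
    continuousOn_sqrt_inv (by fun_prop) fun z hz => sub_pos.2 hz.1
  refine ((h.continuousOn_dt k).mono (prod_mono_left inter_subset_left)).sub
    (((hr.pow 5).mul (h.continuousOn_dil_sqrt_sub (lapS heatS) k s)).mono
      (prod_mono_left inter_subset_right))

/-- The localized energy of the deviation. -/
def _root_.LorentzNS.locEn (u : ℝ → E3 → E3) (s R t : ℝ) : ℝ :=
  ∫ x, 1 / 2 * (cut R x ^ 2 * ∑ k, dev u s t x k ^ 2)

theorem hasDerivAt_locEn (h : NSFlow a b M u p) {s t R : ℝ} (hR : 0 < R) (hs : a ≤ s)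
    (hst : s < t) (ht : t < b) :
    HasDerivAt (locEn u s R) (∫ x, enIn (cut R) (u t) (dev u s t) (p t) x) t := by
  have hsub : Ioo s b ⊆ Ioo a b ∩ Ioi s := fun t ht => ⟨⟨hs.trans_lt ht.1, ht.2⟩, ht.1⟩
  have hc : ContinuousOn (fun z : ℝ × E3 => cut R z.2 ^ 2) (Ioo s b ×ˢ univ) :=
    (((contDiff_cut R).continuous.comp continuous_snd).pow 2).continuousOn
  have c1 : ∀ k, ContinuousOn (fun z : ℝ × E3 => dev u s z.1 z.2 k) (Ioo s b ×ˢ univ) := fun k =>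
    (h.continuousOn_dev s k).mono (prod_mono_left (hsub.trans inter_subset_right))
  have c2 : ∀ k, ContinuousOn (fun z : ℝ × E3 => devDt u s k z.1 z.2) (Ioo s b ×ˢ univ) := fun k =>
    (h.continuousOn_devDt s k).mono (prod_mono_left hsub)
  have hd := hasDerivAt_integral_of_compact (a := s) (b := b) (hasCompactSupport_cut hR).isCompact
    (F := fun t x => 1 / 2 * (cut R x ^ 2 * ∑ k, dev u s t x k ^ 2))
    (F' := fun t x => ∑ k, cut R x ^ 2 * (dev u s t x k * devDt u s k t x))
    (continuousOn_const.mul (hc.mul (continuousOn_finsetSum _ fun k _ => (c1 k).pow 2)))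
    (continuousOn_finsetSum _ fun k _ => hc.mul ((c1 k).mul (c2 k)))
    (fun t _ y hy => by simp [image_eq_zero_of_notMem_tsupport hy])
    (fun t _ y hy => by simp [image_eq_zero_of_notMem_tsupport hy])
    (fun t ht y => by
      have h1 := HasDerivAt.fun_sum (u := Finset.univ) fun k _ =>
        (h.hasDerivAt_dev (hsub ht).1 ht.1 k y).pow 2
      refine ((h1.const_mul (cut R y ^ 2)).const_mul (1 / 2)).congr_deriv ?_
      simp only [Fin.sum_univ_three]
      ring) ⟨hst, ht⟩
  refine hd.congr_deriv (integral_congr_ae (ae_of_all _ fun x => ?_))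
  exact (h.enIn_eq (hsub ⟨hst, ht⟩).1 hst R x).symm

theorem continuousOn_integral_enIn (h : NSFlow a b M u p) {s R : ℝ} (hR : 0 < R) (hs : a ≤ s) :
    ContinuousOn (fun t => ∫ x, enIn (cut R) (u t) (dev u s t) (p t) x) (Ioo s b) := by
  have hsub : Ioo s b ⊆ Ioo a b ∩ Ioi s := fun t ht => ⟨⟨hs.trans_lt ht.1, ht.2⟩, ht.1⟩
  have hc : ContinuousOn (fun z : ℝ × E3 => cut R z.2 ^ 2) (Ioo s b ×ˢ univ) :=
    (((contDiff_cut R).continuous.comp continuous_snd).pow 2).continuousOn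
  have c1 : ∀ k, ContinuousOn (fun z : ℝ × E3 => dev u s z.1 z.2 k) (Ioo s b ×ˢ univ) := fun k =>
    (h.continuousOn_dev s k).mono (prod_mono_left (hsub.trans inter_subset_right))
  have c2 : ∀ k, ContinuousOn (fun z : ℝ × E3 => devDt u s k z.1 z.2) (Ioo s b ×ˢ univ) := fun k =>
    (h.continuousOn_devDt s k).mono (prod_mono_left hsub)
  have c3 : ContinuousOn (fun t => ∫ x, ∑ k, cut R x ^ 2 * (dev u s t x k * devDt u s k t x))
      (Ioo s b) :=
    continuousOn_integral_of_compact_support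
      (f := fun t x => ∑ k, cut R x ^ 2 * (dev u s t x k * devDt u s k t x))
      (hasCompactSupport_cut hR).isCompact
      (continuousOn_finsetSum _ fun k _ => hc.mul ((c1 k).mul (c2 k)))
      fun t y _ hy => by simp [image_eq_zero_of_notMem_tsupport hy]
  refine c3.congr fun t ht => integral_congr_ae (ae_of_all _ fun x => ?_)
  exact h.enIn_eq (hsub ht).1 ht.1 R x

/-- Bounds for the energy of the deviation and for the source term. -/
structure _root_.LorentzNS.DevBound (u : ℝ → E3 → E3) (s V Q t : ℝ) : Prop where
  intV : Integrable fun x => ‖dev u s t x‖ ^ 2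
  leV : ∫ x, ‖dev u s t x‖ ^ 2 ≤ V
  intQ : Integrable fun x => ‖u t x‖ ^ 2 * ‖heatV (u s) (t - s) x‖ ^ 2
  leQ : ∫ x, ‖u t x‖ ^ 2 * ‖heatV (u s) (t - s) x‖ ^ 2 ≤ Q

/-- The local energy inequality integrated in time; the final localized energy is nonnegative and
may be dropped. -/
theorem exists_lintegral_diss_le : ∃ C : ℝ, 1 ≤ C ∧ ∀ {a b M : ℝ} {u : ℝ → E3 → E3}
    {p : ℝ → E3 → ℝ}, NSFlow a b M u p → ∀ {s c d V Q : ℝ}, a ≤ s → s < c → c ≤ d → d < b →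
    (∀ t ∈ Icc c d, DevBound u s V Q t) → ∀ R, 4 * (C * (1 + M ^ 2)) ≤ R →
    ∫⁻ t in Ioc c d, ENNReal.ofReal (diss R (dev u s t)) ≤
      ENNReal.ofReal (V + 2 * (d - c) * (Q + C * (1 + M ^ 2) / R * (1 + V + Q))) := by
  obtain ⟨C, hC, hE⟩ := NSFlow.exists_local_energy
  refine ⟨C, hC, fun {a b M u p} h s c d V Q hs hsc hcd hd hb R hR => ?_⟩
  have hR0 : 0 < R := by nlinarith [sq_nonneg M]
  have hA : 0 ≤ C * (1 + M ^ 2) / R := by positivity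
  set B := Q + C * (1 + M ^ 2) / R * (1 + V + Q) with hB
  set E' : ℝ → ℝ := fun t => ∫ x, enIn (cut R) (u t) (dev u s t) (p t) x with hE'
  have hsub : ∀ t ∈ Icc c d, t ∈ Ioo s b := fun t ht => ⟨hsc.trans_le ht.1, ht.2.trans_lt hd⟩
  have hs' : s ∈ Icc a b := ⟨hs, by linarith⟩
  have hpt : ∀ t ∈ Icc c d, 1 / 2 * diss R (dev u s t) ≤ B - E' t := fun t ht => by
    have hst := hsub t ht
    have ht' : t ∈ Ioo a b := ⟨hs.trans_lt hst.1, hst.2⟩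
    have hbt := hb t ht
    have := hE h ht' (h.contDiff_dev (Ioo_subset_Icc_self ht') hst.1)
      (h.contDiff_heatV s (sub_pos.2 hst.1)).continuous (fun x k => by
        rw [dev_apply]; exact (sub_add_cancel _ _).symm)
      (h.sum_pd_dev hs' (Ioo_subset_Icc_self ht') hst.1) hbt.intV hbt.intQ R hR
    have h2 : C * (1 + M ^ 2) / R * (1 + (∫ x, ‖dev u s t x‖ ^ 2) +
        ∫ x, ‖u t x‖ ^ 2 * ‖heatV (u s) (t - s) x‖ ^ 2) ≤ C * (1 + M ^ 2) / R * (1 + V + Q) := by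
      have := hbt.leV
      have := hbt.leQ
      gcongr
    have := hbt.leQ
    simp only [hE', hB]
    linarith
  have hcE : ContinuousOn E' (Icc c d) := (h.continuousOn_integral_enIn hR0 hs).mono hsub
  have hiE : IntervalIntegrable E' volume c d := by
    apply ContinuousOn.intervalIntegrable
    rwa [uIcc_of_le hcd]
  have hFTC : ∫ t in c..d, E' t = locEn u s R d - locEn u s R c := by
    refine intervalIntegral.integral_eq_sub_of_hasDerivAt (fun t ht => ?_) hiE
    rw [uIcc_of_le hcd] at ht
    exact h.hasDerivAt_locEn hR0 hs (hsub t ht).1 (hsub t ht).2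
  have hEd : 0 ≤ locEn u s R d := integral_nonneg fun x => by positivity
  -- The energy argument starts at `c > s`, where the deviation is smooth, and its initial value is
  -- covered by the `L²` bound from Duhamel.
  have hEc : locEn u s R c ≤ 1 / 2 * V := by
    have hbc := hb c ⟨le_rfl, hcd⟩
    have hst := hsub c ⟨le_rfl, hcd⟩
    have cd := (h.contDiff_dev ⟨hs.trans hst.1.le, hst.2.le⟩ hst.1).continuous
    have i1 : Integrable fun x => 1 / 2 * ‖dev u s c x‖ ^ 2 := hbc.intV.const_mul _
    have hle : ∀ x, 1 / 2 * (cut R x ^ 2 * ∑ k, dev u s c x k ^ 2) ≤ 1 / 2 * ‖dev u s c x‖ ^ 2 :=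
      fun x => by
        rw [← norm_sq_eq]
        have h1 : cut R x ^ 2 ≤ 1 := by nlinarith [cut_nonneg R x, cut_le_one R x]
        have := mul_le_of_le_one_left (sq_nonneg ‖dev u s c x‖) h1
        linarith
    have i2 : Integrable fun x => 1 / 2 * (cut R x ^ 2 * ∑ k, dev u s c x k ^ 2) := by
      refine i1.mono' ?_ (ae_of_all _ fun x => ?_)
      · have : Continuous fun x => 1 / 2 * (cut R x ^ 2 * ∑ k, dev u s c x k ^ 2) := by
          have := (contDiff_cut R).continuous
          fun_prop
        exact this.aestronglyMeasurable
      · rw [Real.norm_of_nonneg (by positivity)]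
        exact hle x
    refine (integral_mono i2 i1 hle).trans ?_
    rw [integral_const_mul]
    have := hbc.leV
    linarith
  have hiB : IntervalIntegrable (fun t => B - E' t) volume c d := intervalIntegrable_const.sub hiE
  calc ∫⁻ t in Ioc c d, ENNReal.ofReal (diss R (dev u s t))
      ≤ ∫⁻ t in Ioc c d, ENNReal.ofReal 2 * ENNReal.ofReal (B - E' t) :=
        setLIntegral_mono' measurableSet_Ioc fun t ht => by
          rw [← ENNReal.ofReal_mul zero_le_two]
          refine ENNReal.ofReal_le_ofReal ?_
          have := hpt t (Ioc_subset_Icc_self ht)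
          linarith
    _ = ENNReal.ofReal 2 * ENNReal.ofReal (∫ t in c..d, (B - E' t)) := by
        rw [lintegral_const_mul' _ _ ENNReal.ofReal_ne_top, intervalIntegral.integral_of_le hcd,
          ofReal_integral_eq_lintegral_ofReal
            ((intervalIntegrable_iff_integrableOn_Ioc_of_le hcd).1 hiB)]
        filter_upwards [ae_restrict_mem measurableSet_Ioc] with t ht
        have h1 := hpt t (Ioc_subset_Icc_self ht)
        have h2 := diss_nonneg R (dev u s t)
        change 0 ≤ B - E' t
        linarith
    _ ≤ _ := by
        rw [← ENNReal.ofReal_mul zero_le_two,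
          intervalIntegral.integral_sub intervalIntegrable_const hiE,
          intervalIntegral.integral_const, hFTC, smul_eq_mul]
        refine ENNReal.ofReal_le_ofReal ?_
        linarith

end NSFlow

end

/-! ### Lorentz bound for the deviation over a time interval -/

section

variable {a b M : ℝ} {u : ℝ → E3 → E3} {p : ℝ → E3 → ℝ}

theorem measurable_lorS {w : ℝ → E3 → E3} (hw : Measurable fun z : ℝ × E3 => w z.1 z.2) :
    Measurable fun t => lorS (w t) :=
  ((measurable_volume_level hw).pow_const (1 / 3)).lintegral_prod_right'

/-- Level sets intersected with growing balls exhaust the level set, and Fatou's lemma in `α` does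
the rest. -/
theorem lorS_le_liminf_cut {v : E3 → E3} (hv : Measurable v) :
    lorS v ≤ liminf (fun n : ℕ => lorS fun x => cut n x • v x) atTop := by
  have hc : ∀ n : ℕ, Measurable fun x => cut n x • v x := fun n =>
    (contDiff_cut (n : ℝ)).continuous.measurable.smul hv
  have hm : ∀ n : ℕ, Measurable fun α : ℝ => volume {x | α < ‖cut n x • v x‖ ^ 2} ^ (1 / 3 : ℝ) :=
    fun n => ((measurable_volume_level (w := fun _ x => cut n x • v x)
      ((hc n).comp measurable_snd)).pow_const (1 / 3)).comp (measurable_prodMk_left (x := (0 : ℝ)))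
  refine le_trans (lintegral_mono fun α => ?_)
    (lintegral_liminf_le' fun n => (hm n).aemeasurable)
  set S : ℕ → Set E3 := fun n => {x | α < ‖v x‖ ^ 2 ∧ ‖x‖ ≤ n} with hS
  have hmono : Monotone S := fun m n hmn x hx =>
    ⟨hx.1, hx.2.trans (Nat.cast_le.2 hmn)⟩
  have hU : ⋃ n, S n = {x | α < ‖v x‖ ^ 2} := by
    ext x
    simp only [hS, mem_iUnion, mem_ofPred_eq, exists_and_left, and_iff_left_iff_imp]
    exact fun _ => exists_nat_ge _
  have ht := (ENNReal.continuous_rpow_const (y := 1 / 3)).continuousAt.tendsto.comp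
    (tendsto_measure_iUnion_atTop (μ := volume) hmono)
  rw [hU] at ht
  rw [← ht.liminf_eq]
  refine liminf_le_liminf ?_
  filter_upwards [eventually_gt_atTop 0] with n hn
  refine ENNReal.rpow_le_rpow (measure_mono fun x hx => ?_) (by norm_num)
  change α < ‖cut n x • v x‖ ^ 2
  rw [cut_eq_one (Nat.cast_pos.2 hn) hx.2, one_smul]
  exact hx.1

namespace NSFlow

/-- The deviation is continuous only after time `s`; extending it by zero gives a jointly measurable
field to integrate. -/
theorem exists_measurable_dev (h : NSFlow a b M u p) (s : ℝ) : ∃ W : ℝ → E3 → E3,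
    (Measurable fun z : ℝ × E3 => W z.1 z.2) ∧ ∀ t, s < t → W t = dev u s t := by
  classical
  set S : Set (ℝ × E3) := Ioi s ×ˢ univ with hS
  have hc : ContinuousOn (fun z : ℝ × E3 => dev u s z.1 z.2) S :=
    (PiLp.continuous_toLp 2 _).comp_continuousOn (continuousOn_pi.2 fun k => h.continuousOn_dev s k)
  have hm := hc.measurable_piecewise (g := fun _ => 0) continuousOn_const
    (measurableSet_Ioi.prod MeasurableSet.univ)
  exact ⟨fun t x => S.piecewise (fun z : ℝ × E3 => dev u s z.1 z.2) (fun _ => 0) (t, x), hm,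
    fun t ht => funext fun x => piecewise_eq_of_mem _ _ _ ⟨ht, mem_univ _⟩⟩

theorem aemeasurable_lorS_cut_dev (h : NSFlow a b M u p) {s c d : ℝ} (hsc : s ≤ c) (R : ℝ) :
    AEMeasurable (fun t => lorS fun x => cut R x • dev u s t x) (volume.restrict (Ioc c d)) := by
  obtain ⟨W, hW, hWe⟩ := h.exists_measurable_dev s
  have h1 : Measurable fun z : ℝ × E3 => cut R z.2 • W z.1 z.2 :=
    ((contDiff_cut R).continuous.measurable.comp measurable_snd).smul hW
  refine (measurable_lorS (w := fun t x => cut R x • W t x) h1).aemeasurable.congr ?_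
  filter_upwards [ae_restrict_mem measurableSet_Ioc] with t ht
  simp only [hWe t (hsc.trans_lt ht.1)]

/-- Fatou in time with cut-off radius `n → ∞`: all errors are `O(1/n)`, so the factor `1 + M²` in
them leaves no trace in the limit. -/
theorem exists_lintegral_lorS_dev_le : ∃ C : ℝ, 0 < C ∧ ∀ {a b M : ℝ} {u : ℝ → E3 → E3}
    {p : ℝ → E3 → ℝ}, NSFlow a b M u p → ∀ {s c d V Q : ℝ}, a ≤ s → s < c → c ≤ d → d < b →
    (∀ t ∈ Icc c d, DevBound u s V Q t) →
    ∫⁻ t in Ioc c d, lorS (dev u s t) ≤ ENNReal.ofReal (C * (V + 2 * (d - c) * Q)) := by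
  obtain ⟨C₁, hC₁, h1⟩ := exists_lorS_cut_le
  obtain ⟨C₂, hC₂, h2⟩ := NSFlow.exists_lintegral_diss_le
  refine ⟨C₁, hC₁, fun {a b M u p} h s c d V Q hs hsc hcd hd hb => ?_⟩
  have hV : 0 ≤ V := (integral_nonneg fun x => sq_nonneg _).trans (hb c ⟨le_rfl, hcd⟩).leV
  have hcd0 := sub_nonneg.2 hcd
  have hI : ∀ t ∈ Ioc c d, t ∈ Icc a b ∧ s < t := fun t ht =>
    ⟨⟨by linarith [ht.1], by linarith [ht.2]⟩, hsc.trans ht.1⟩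
  calc ∫⁻ t in Ioc c d, lorS (dev u s t)
      ≤ ∫⁻ t in Ioc c d, liminf (fun n : ℕ => lorS fun x => cut n x • dev u s t x) atTop :=
        setLIntegral_mono' measurableSet_Ioc fun t ht => lorS_le_liminf_cut
          (h.contDiff_dev (hI t ht).1 (hI t ht).2).continuous.measurable
    _ ≤ liminf (fun n : ℕ => ∫⁻ t in Ioc c d, lorS fun x => cut n x • dev u s t x) atTop :=
        lintegral_liminf_le' fun n => h.aemeasurable_lorS_cut_dev hsc.le n
    _ ≤ liminf (fun n : ℕ => ENNReal.ofReal (C₁ * ((V + 2 * (d - c) *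
          (Q + C₂ * (1 + M ^ 2) / n * (1 + V + Q))) + (d - c) * (V / n)))) atTop := by
        refine liminf_le_liminf ?_
        filter_upwards [eventually_ge_atTop ⌈4 * (C₂ * (1 + M ^ 2))⌉₊, eventually_ge_atTop 1]
          with n hn hn1
        have hR : 4 * (C₂ * (1 + M ^ 2)) ≤ n := (Nat.le_ceil _).trans (Nat.cast_le.2 hn)
        have hR1 : (1 : ℝ) ≤ n := Nat.one_le_cast.2 hn1
        have hVn : 0 ≤ V / n := div_nonneg hV (by positivity)
        have hb' := h2 h hs hsc hcd hd hb n hR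
        calc ∫⁻ t in Ioc c d, lorS (fun x => cut n x • dev u s t x)
            ≤ ∫⁻ t in Ioc c d, ENNReal.ofReal C₁ *
                (ENNReal.ofReal (diss n (dev u s t)) + ENNReal.ofReal (V / n)) :=
              setLIntegral_mono' measurableSet_Ioc fun t ht => by
                have hbt := hb t (Ioc_subset_Icc_self ht)
                refine (h1 _ ((h.contDiff_dev (hI t ht).1 (hI t ht).2).of_le (by norm_cast))
                  hbt.intV n hR1).trans ?_
                rw [← ENNReal.ofReal_add (diss_nonneg _ _) hVn, ← ENNReal.ofReal_mul hC₁.le]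
                refine ENNReal.ofReal_le_ofReal ?_
                have := hbt.leV
                gcongr
          _ = ENNReal.ofReal C₁ * ((∫⁻ t in Ioc c d, ENNReal.ofReal (diss n (dev u s t))) +
                ENNReal.ofReal ((d - c) * (V / n))) := by
              rw [lintegral_const_mul' _ _ ENNReal.ofReal_ne_top,
                lintegral_add_right _ measurable_const, setLIntegral_const, Real.volume_Ioc,
                ← ENNReal.ofReal_mul hVn, mul_comm (V / n)]
          _ ≤ ENNReal.ofReal C₁ * (ENNReal.ofReal (V + 2 * (d - c) *
                (Q + C₂ * (1 + M ^ 2) / n * (1 + V + Q))) + ENNReal.ofReal ((d - c) * (V / n))) := by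
              gcongr
          _ = _ := by
              have hQ : 0 ≤ Q := (integral_nonneg fun x => by positivity).trans
                (hb c ⟨le_rfl, hcd⟩).leQ
              rw [← ENNReal.ofReal_add (by positivity) (by positivity), ← ENNReal.ofReal_mul hC₁.le]
    _ = _ := by
        refine Tendsto.liminf_eq (ENNReal.tendsto_ofReal ?_)
        have e1 := tendsto_const_div_atTop_nhds_zero_nat (C₂ * (1 + M ^ 2))
        have e2 := tendsto_const_div_atTop_nhds_zero_nat V
        have e3 := ((((e1.mul_const (1 + V + Q)).const_add Q).const_mul (2 * (d - c))).const_add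
          V).add (e2.const_mul (d - c))
        have e4 := e3.const_mul C₁
        simpa using e4

/-- Conversion of the two basic energy bounds. -/
theorem exists_devBound : ∃ C : ℝ, 0 < C ∧ ∀ {a b M : ℝ} {u : ℝ → E3 → E3}
    {p : ℝ → E3 → ℝ}, NSFlow a b M u p → ∀ {s t ℓ : ℝ}, 0 < ℓ → a ≤ s → s + ℓ ≤ t → t ≤ s + 2 * ℓ →
    t ≤ b → DevBound u s (C * (M ^ 4 * √ℓ)) (C * (M ^ 4 * (√ℓ)⁻¹)) t := by
  obtain ⟨C₁, hC₁, h1⟩ := NSFlow.exists_lintegral_sub_heatV_sq_le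
  obtain ⟨C₂, hC₂, h2⟩ := NSFlow.exists_lintegral_sq_mul_heatV_sq_le
  refine ⟨2 * C₁ + C₂, by positivity, fun {a b M u p} h s t ℓ hℓ hs h₁ h₂ hb => ?_⟩
  have hst : s < t := by linarith
  have ht : t ∈ Icc a b := ⟨by linarith, hb⟩
  have hM := h.M_pos
  have hr : 0 < √ℓ := Real.sqrt_pos.2 hℓ
  have b1 := h1 h hs hst hb
  have b2 := h2 h t s (sub_pos.2 hst)
  have c1 : Continuous fun x => ‖dev u s t x‖ ^ 2 := (h.contDiff_dev ht hst).continuous.norm.pow 2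
  have c2 : Continuous fun x => ‖u t x‖ ^ 2 * ‖heatV (u s) (t - s) x‖ ^ 2 :=
    ((h.contDiff_slice ht).continuous.norm.pow 2).mul
      ((h.contDiff_heatV s (sub_pos.2 hst)).continuous.norm.pow 2)
  have key : ∀ {F : E3 → ℝ} {B : ℝ}, Continuous F → (∀ x, 0 ≤ F x) → 0 ≤ B →
      ∫⁻ x, ENNReal.ofReal (F x) ≤ ENNReal.ofReal B → Integrable F ∧ ∫ x, F x ≤ B :=
    fun {F B} hF h0 hB hle => by
      refine ⟨(lintegral_ofReal_ne_top_iff_integrable hF.aestronglyMeasurable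
        (ae_of_all _ h0)).1 (hle.trans_lt ENNReal.ofReal_lt_top).ne, ?_⟩
      rw [integral_eq_lintegral_of_nonneg_ae (ae_of_all _ h0) hF.aestronglyMeasurable]
      exact ENNReal.toReal_le_of_le_ofReal hB hle
  have k1 := key c1 (fun x => by positivity) (by positivity) b1
  have k2 := key c2 (fun x => by positivity) (by positivity) b2
  refine ⟨k1.1, k1.2.trans ?_, k2.1, k2.2.trans ?_⟩
  · have e1 : √(t - s) ≤ 2 * √ℓ := by
      rw [show (2 : ℝ) = √4 by rw [show (4 : ℝ) = 2 ^ 2 by norm_num, Real.sqrt_sq zero_le_two],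
        ← Real.sqrt_mul (by norm_num)]
      exact Real.sqrt_le_sqrt (by linarith)
    calc C₁ * (M ^ 4 * √(t - s)) ≤ C₁ * (M ^ 4 * (2 * √ℓ)) := by gcongr
      _ ≤ _ := by nlinarith [show 0 ≤ C₂ * (M ^ 4 * √ℓ) by positivity]
  · have e1 : √ℓ ≤ √(t - s) := Real.sqrt_le_sqrt (by linarith)
    calc C₂ * (M ^ 4 * (√(t - s))⁻¹) ≤ C₂ * (M ^ 4 * (√ℓ)⁻¹) := by gcongr
      _ ≤ _ := by nlinarith [show 0 ≤ C₁ * (M ^ 4 * (√ℓ)⁻¹) by positivity]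

/-- Starting the heat flow a full length `ℓ` earlier makes initial energy and integrated source both
`O(M⁴ √ℓ)`. The energy estimate needs an end time strictly before `b`, hence the exhaustion from
inside. -/
theorem exists_lintegral_lorS_le : ∃ C : ℝ, 0 < C ∧ ∀ {a b M : ℝ} {u : ℝ → E3 → E3}
    {p : ℝ → E3 → ℝ}, NSFlow a b M u p → ∀ {c ℓ : ℝ}, 0 < ℓ → a ≤ c - ℓ → c + ℓ ≤ b →
    ∫⁻ t in Ioo c (c + ℓ), lorS (dev u (c - ℓ) t) ≤ ENNReal.ofReal (C * (M ^ 4 * √ℓ)) := by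
  obtain ⟨C₁, hC₁, h1⟩ := NSFlow.exists_lintegral_lorS_dev_le
  obtain ⟨C₂, hC₂, h2⟩ := NSFlow.exists_devBound
  refine ⟨C₁ * (3 * C₂), by positivity, fun {a b M u p} h c ℓ hℓ ha hb => ?_⟩
  have hM := h.M_pos
  have hr : 0 < √ℓ := Real.sqrt_pos.2 hℓ
  have hrr : √ℓ * √ℓ = ℓ := Real.mul_self_sqrt hℓ.le
  set D : ℕ → ℝ := fun n => c + ℓ - ℓ / (n + 1) with hD
  have hDm : Monotone D := fun m n hmn => by
    have : (m : ℝ) ≤ n := Nat.cast_le.2 hmn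
    simp only [hD]
    gcongr
  have hD1 : ∀ n, D n < c + ℓ := fun n => by
    have : 0 < ℓ / ((n : ℝ) + 1) := by positivity
    simp only [hD]; linarith
  have hD0 : ∀ n, c ≤ D n := fun n => by
    have : ℓ / ((n : ℝ) + 1) ≤ ℓ := div_le_self hℓ.le (by linarith [n.cast_nonneg (α := ℝ)])
    simp only [hD]; linarith
  have hU : ⋃ n, Ioc c (D n) = Ioo c (c + ℓ) := by
    ext t
    simp only [mem_iUnion, mem_Ioc, mem_Ioo]
    refine ⟨fun ⟨n, hn⟩ => ⟨hn.1, hn.2.trans_lt (hD1 n)⟩, fun ht => ?_⟩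
    have hlim : Tendsto D atTop (𝓝 (c + ℓ)) := by
      have := (tendsto_one_div_add_atTop_nhds_zero_nat (𝕜 := ℝ)).const_mul ℓ
      have := this.const_sub (c + ℓ)
      simpa [hD, div_eq_mul_inv] using this
    obtain ⟨n, hn⟩ := (hlim.eventually (lt_mem_nhds ht.2)).exists
    exact ⟨n, ht.1, hn.le⟩
  rw [← hU, setLIntegral_iUnion_of_directed _
    (Monotone.directed_le fun m n hmn => Ioc_subset_Ioc_right (hDm hmn))]
  refine iSup_le fun n => ?_
  refine (h1 h ha (by linarith : c - ℓ < c) (hD0 n) (by linarith [hD1 n]) fun t ht =>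
    h2 h hℓ ha (by linarith [ht.1]) (by linarith [ht.2, hD1 n]) (by linarith [ht.2, hD1 n])).trans
    (ENNReal.ofReal_le_ofReal ?_)
  have e1 : D n - c ≤ √ℓ * √ℓ := by linarith [hD1 n]
  calc C₁ * (C₂ * (M ^ 4 * √ℓ) + 2 * (D n - c) * (C₂ * (M ^ 4 * (√ℓ)⁻¹)))
      ≤ C₁ * (C₂ * (M ^ 4 * √ℓ) + 2 * (√ℓ * √ℓ) * (C₂ * (M ^ 4 * (√ℓ)⁻¹))) := by gcongr
    _ = _ := by field_simp; ring

end NSFlow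

end

/-! ### The bound for the total speed on an interval -/

section

variable {a b M : ℝ} {u : ℝ → E3 → E3} {p : ℝ → E3 → ℝ}

theorem measurable_havSup {w : ℝ → E3 → E3} (hw : Measurable fun z : ℝ × E3 => w z.1 z.2) :
    Measurable fun z : ℝ × ℝ => havSup (w z.1) z.2 := by
  have h1 : Measurable fun q : (ℝ × ℝ) × ℝ => volume {x | q.2 < ‖w q.1.1 x‖ ^ 2} :=
    Measurable.comp (g := fun q : ℝ × ℝ => volume {x | q.2 < ‖w q.1 x‖ ^ 2})
      (f := fun q : (ℝ × ℝ) × ℝ => (q.1.1, q.2)) (measurable_volume_level hw) (by fun_prop)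
  have h2 : Measurable fun q : (ℝ × ℝ) × ℝ => ENNReal.ofReal (q.1.2 ^ (-(3 / 2) : ℝ)) := by fun_prop
  exact Measurable.lintegral_prod_right' (f := fun q : (ℝ × ℝ) × ℝ => min (ENNReal.ofReal K0)
    (ENNReal.ofReal (q.1.2 ^ (-(3 / 2) : ℝ)) * volume {x | q.2 < ‖w q.1.1 x‖ ^ 2}))
    (measurable_const.min (h2.mul h1))

theorem hav_const (c : ℝ≥0∞) {σ : ℝ} (hσ : 0 < σ) (x : E3) :
    hav (fun _ => c) σ x = c * ENNReal.ofReal K0 := by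
  have hq0 : 0 < (√σ)⁻¹ := inv_pos.2 (Real.sqrt_pos.2 hσ)
  rw [hav, av, lintegral_const_mul _ (measurable_bk _ x).ennreal_ofReal, lintegral_bk hq0,
    mul_left_comm, ← ENNReal.ofReal_mul (by positivity)]
  congr 2
  field_simp

theorem hav_sq_add_le {v w : E3 → E3} (hv : Measurable v) {A : ℝ} (hA : 0 ≤ A)
    (hw : ∀ y, ‖w y‖ ^ 2 ≤ A) {σ : ℝ} (hσ : 0 < σ) (x : E3) :
    hav (sq fun y => v y + w y) σ x ≤ ENNReal.ofReal (2 * A * K0) + 2 * havSup v σ := by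
  have h1 : ∀ y, sq (fun y => v y + w y) y ≤ ENNReal.ofReal (2 * A) + (sq v y + sq v y) := fun y => by
    rw [sq, sq, ← ENNReal.ofReal_add (by positivity) (by positivity),
      ← ENNReal.ofReal_add (by positivity) (by positivity)]
    refine ENNReal.ofReal_le_ofReal ?_
    have h2 := norm_add_le (v y) (w y)
    have h3 := hw y
    nlinarith [norm_nonneg (v y + w y), sq_nonneg (‖v y‖ - ‖w y‖)]
  have hm : Measurable (sq v) := (hv.norm.pow_const 2).ennreal_ofReal
  refine (hav_mono h1 σ x).trans ?_
  rw [hav_add measurable_const, hav_const _ hσ, hav_add hm, ← two_mul,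
    ← ENNReal.ofReal_mul (by positivity)]
  gcongr
  exact hav_sq_le_havSup hv hσ x

theorem lintegral_rpow_mul_min {ℓ : ℝ} (hℓ : 0 < ℓ) :
    ∫⁻ σ in Ioi (0 : ℝ), ENNReal.ofReal (σ ^ (-(3 / 2) : ℝ)) * ENNReal.ofReal (min σ ℓ) ≤
      ENNReal.ofReal (4 * √ℓ) := by
  rw [← Ioc_union_Ioi_eq_Ioi hℓ.le]
  refine (lintegral_union_le _ _ _).trans ?_
  have e1 : ∫⁻ σ in Ioc 0 ℓ, ENNReal.ofReal (σ ^ (-(3 / 2) : ℝ)) * ENNReal.ofReal (min σ ℓ) ≤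
      ENNReal.ofReal (2 * √ℓ) := by
    have := lintegral_Ioc_rpow (p := 1 / 2) (by norm_num) hℓ.le
    rw [← Real.sqrt_eq_rpow, show √ℓ / (1 / 2) = 2 * √ℓ by ring] at this
    rw [← this]
    refine setLIntegral_mono' measurableSet_Ioc fun σ hσ => ?_
    rw [min_eq_left hσ.2, ← ENNReal.ofReal_mul (Real.rpow_nonneg hσ.1.le _),
      ← Real.rpow_add_one hσ.1.ne']
    norm_num
  have e2 : ∫⁻ σ in Ioi ℓ, ENNReal.ofReal (σ ^ (-(3 / 2) : ℝ)) * ENNReal.ofReal (min σ ℓ) ≤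
      ENNReal.ofReal (2 * √ℓ) := by
    have := lintegral_Ioi_rpow (p := -(1 / 2)) (by norm_num) hℓ
    rw [show (-(1 / 2) - 1 : ℝ) = -(3 / 2) by norm_num] at this
    calc _ ≤ ∫⁻ σ in Ioi ℓ, ENNReal.ofReal (σ ^ (-(3 / 2) : ℝ)) * ENNReal.ofReal ℓ := by
          gcongr; exact min_le_right _ _
      _ = _ := by
          rw [lintegral_mul_const' _ _ ENNReal.ofReal_ne_top, this,
            ← ENNReal.ofReal_mul (by positivity), Real.rpow_neg hℓ.le, ← Real.sqrt_eq_rpow]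
          congr 1
          have := Real.mul_self_sqrt hℓ.le
          have h0 : √ℓ ≠ 0 := (Real.sqrt_pos.2 hℓ).ne'
          field_simp
          nlinarith
  refine (add_le_add e1 e2).trans ?_
  rw [← ENNReal.ofReal_add (by positivity) (by positivity)]
  exact ENNReal.ofReal_le_ofReal (by linarith)

theorem lintegral_rpow_mul_min_mul_havSup_le {v : E3 → E3} (hv : Measurable v) {ℓ : ℝ} :
    ∫⁻ σ in Ioi (0 : ℝ), ENNReal.ofReal (σ ^ (-(3 / 2) : ℝ)) * ENNReal.ofReal (min σ ℓ) *
      havSup v σ ≤ ENNReal.ofReal (2 * K0 + 1) * lorS v := by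
  refine (setLIntegral_mono' measurableSet_Ioi fun σ (hσ : 0 < σ) => ?_).trans
    (lintegral_havSup_le hv)
  gcongr
  rw [← ENNReal.ofReal_mul (Real.rpow_nonneg hσ.le _)]
  refine ENNReal.ofReal_le_ofReal ?_
  calc σ ^ (-(3 / 2) : ℝ) * min σ ℓ ≤ σ ^ (-(3 / 2) : ℝ) * σ := by
        gcongr; exact min_le_left _ _
    _ = _ := by rw [← Real.rpow_add_one hσ.ne']; norm_num

/-- Tonelli: for fixed `(s, σ)` the admissible times `t` lie in `[s, s + σ) ∩ (c, d)`, whose length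
is at most the minimum. -/
theorem lintegral_triangle_le {g : ℝ × ℝ → ℝ≥0∞} (hg : Measurable g) (c d : ℝ) :
    ∫⁻ t in Ioo c d, ∫⁻ s in Ioc c t, ∫⁻ σ in Ioi (t - s), g (s, σ) ≤
      ∫⁻ s in Ioo c d, ∫⁻ σ in Ioi 0, ENNReal.ofReal (min σ (d - c)) * g (s, σ) := by
  set ν := (volume.restrict (Ioo c d)).prod (volume.restrict (Ioi (0 : ℝ))) with hν
  set S : Set (ℝ × ℝ × ℝ) := {q | q.2.1 ≤ q.1 ∧ q.1 - q.2.1 < q.2.2} with hS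
  have hSm : MeasurableSet S := by
    have m1 : MeasurableSet {q : ℝ × ℝ × ℝ | q.2.1 ≤ q.1} :=
      measurableSet_le (by fun_prop) (by fun_prop)
    have m2 : MeasurableSet {q : ℝ × ℝ × ℝ | q.1 - q.2.1 < q.2.2} :=
      measurableSet_lt (by fun_prop) (by fun_prop)
    exact m1.inter m2
  have hm : Measurable fun q : ℝ × ℝ × ℝ => S.indicator (fun q => g q.2) q :=
    (hg.comp measurable_snd).indicator hSm
  have h1 : ∀ t ∈ Ioo c d, ∫⁻ s in Ioc c t, ∫⁻ σ in Ioi (t - s), g (s, σ) ≤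
      ∫⁻ z, S.indicator (fun q => g q.2) (t, z) ∂ν := fun t ht => by
    have hmt : Measurable fun z : ℝ × ℝ => S.indicator (fun q => g q.2) (t, z) :=
      hm.comp measurable_prodMk_left
    rw [hν, lintegral_prod _ hmt.aemeasurable]
    refine le_trans (setLIntegral_mono' measurableSet_Ioc fun s hs => ?_)
      (lintegral_mono_set (Ioc_subset_Ioo_right ht.2))
    refine (le_of_eq (setLIntegral_congr_fun measurableSet_Ioi fun σ hσ => ?_)).trans
      (lintegral_mono_set (show Ioi (t - s) ⊆ Ioi 0 from Ioi_subset_Ioi (sub_nonneg.2 hs.2)))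
    exact (indicator_of_mem (s := S) (f := fun q : ℝ × ℝ × ℝ => g q.2) (a := (t, s, σ))
      ⟨hs.2, hσ⟩).symm
  refine (setLIntegral_mono' measurableSet_Ioo h1).trans ?_
  rw [lintegral_lintegral_swap hm.aemeasurable]
  have hm' : Measurable fun z : ℝ × ℝ => ENNReal.ofReal (min z.2 (d - c)) * g z :=
    (by fun_prop : Measurable fun z : ℝ × ℝ => ENNReal.ofReal (min z.2 (d - c))).mul hg
  refine (lintegral_mono fun z => ?_).trans (lintegral_prod _ hm'.aemeasurable).le
  have h2 : ∀ t, S.indicator (fun q => g q.2) (t, z) ≤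
      (Ico z.1 (z.1 + z.2)).indicator (fun _ => g z) t := fun t => by
    by_cases ht : (t, z) ∈ S
    · rw [indicator_of_mem ht, indicator_of_mem]
      exact ⟨ht.1, by linarith [show t - z.1 < z.2 from ht.2]⟩
    · rw [indicator_of_notMem ht]
      exact zero_le
  refine (lintegral_mono h2).trans ?_
  rw [lintegral_indicator measurableSet_Ico, setLIntegral_const, mul_comm]
  gcongr
  rw [Measure.restrict_apply measurableSet_Ico, ENNReal.ofReal_min]
  refine le_min ((measure_mono inter_subset_left).trans ?_) ((measure_mono inter_subset_right).trans ?_)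
  · rw [Real.volume_Ico, add_sub_cancel_left]
  · rw [Real.volume_Ioo]

namespace NSFlow

/-- Duhamel from time `c`, with `u(s)` in the quadratic term written as the deviation plus the heat
extension started at `c - ℓ`. The latter has run for at least time `ℓ`, so its square is `O(M² /
ℓ)`. -/
theorem exists_eLpNorm_le : ∃ C : ℝ, 0 < C ∧ ∀ {a b M : ℝ} {u : ℝ → E3 → E3}
    {p : ℝ → E3 → ℝ}, NSFlow a b M u p → ∀ {c ℓ : ℝ}, 0 < ℓ → a ≤ c - ℓ → c + ℓ ≤ b →
    ∀ {W : ℝ → E3 → E3}, (Measurable fun z : ℝ × E3 => W z.1 z.2) →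
    (∀ t, c - ℓ < t → W t = dev u (c - ℓ) t) → ∀ t ∈ Ioo c (c + ℓ),
    eLpNorm (u t) ∞ volume ≤ ENNReal.ofReal (C * M) * ENNReal.ofReal ((t - c) ^ (1 / 2 - 1 : ℝ)) +
      ENNReal.ofReal C * ∫⁻ s in Ioc c t, ∫⁻ σ in Ioi (t - s), ENNReal.ofReal (σ ^ (-(3 / 2) : ℝ)) *
        (ENNReal.ofReal (C * (M ^ 2 / ℓ)) + 2 * havSup (W s) σ) := by
  obtain ⟨C₁, hC₁, h1⟩ := NSFlow.exists_duhamel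
  obtain ⟨C₂, hC₂, h2⟩ := NSFlow.exists_norm_heatV_le
  have hK := K0_nonneg
  refine ⟨C₁ + C₂ + 2 * C₂ ^ 2 * K0, by positivity,
    fun {a b M u p} h c ℓ hℓ ha hb W hW hWe t ht => ?_⟩
  set C := C₁ + C₂ + 2 * C₂ ^ 2 * K0 with hC
  have hM := h.M_pos
  have hCK : 0 ≤ 2 * C₂ ^ 2 * K0 := by positivity
  have htc : 0 < t - c := sub_pos.2 ht.1
  rw [eLpNorm_exponent_top]
  refine eLpNormEssSup_le_of_ae_enorm_bound (ae_of_all _ fun x => ?_)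
  rw [← ofReal_norm]
  have h3 : ‖u t x‖ ≤ C₂ * (M * (√(t - c))⁻¹) + ‖u t x - heatV (u c) (t - c) x‖ := by
    have := norm_add_le (heatV (u c) (t - c) x) (u t x - heatV (u c) (t - c) x)
    rw [add_sub_cancel] at this
    linarith [h2 h c htc x]
  refine (ENNReal.ofReal_le_ofReal h3).trans ?_
  rw [ENNReal.ofReal_add (by positivity) (norm_nonneg _)]
  refine add_le_add ?_ ((h1 h x (by linarith) ht.1 (by linarith [ht.2])).trans ?_)
  · rw [← ENNReal.ofReal_mul (by positivity)]
    refine ENNReal.ofReal_le_ofReal ?_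
    rw [show (1 / 2 - 1 : ℝ) = -(1 / 2) by norm_num, Real.rpow_neg htc.le, ← Real.sqrt_eq_rpow,
      ← mul_assoc]
    gcongr
    linarith
  · refine mul_le_mul' (ENNReal.ofReal_le_ofReal (by linarith)) ?_
    refine setLIntegral_mono' measurableSet_Ioc fun s hs =>
      setLIntegral_mono' measurableSet_Ioi fun σ hσ => ?_
    have hσ0 : 0 < σ := (sub_nonneg.2 hs.2).trans_lt hσ
    have hs' : 0 < s - (c - ℓ) := by linarith [hs.1]
    have hWs : Measurable (W s) := hW.comp measurable_prodMk_left
    have e : u s = fun y => W s y + heatV (u (c - ℓ)) (s - (c - ℓ)) y := by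
      ext1 y
      rw [hWe s (by linarith [hs.1]), dev, sub_add_cancel]
    have hA : ∀ y, ‖heatV (u (c - ℓ)) (s - (c - ℓ)) y‖ ^ 2 ≤ C₂ ^ 2 * (M ^ 2 / ℓ) := fun y => by
      have h4 := h2 h (c - ℓ) hs' y
      have h5 : (√(s - (c - ℓ)))⁻¹ ≤ (√ℓ)⁻¹ := inv_anti₀ (Real.sqrt_pos.2 hℓ)
        (Real.sqrt_le_sqrt (by linarith [hs.1]))
      calc _ ≤ (C₂ * (M * (√ℓ)⁻¹)) ^ 2 := by
            gcongr
            exact h4.trans (by gcongr)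
        _ = _ := by
            rw [mul_pow, mul_pow, inv_pow, Real.sq_sqrt hℓ.le, div_eq_mul_inv]
    gcongr
    rw [e]
    refine (hav_sq_add_le hWs (by positivity) hA hσ0 x).trans (add_le_add (ENNReal.ofReal_le_ofReal ?_) le_rfl)
    calc 2 * (C₂ ^ 2 * (M ^ 2 / ℓ)) * K0 = (2 * C₂ ^ 2 * K0) * (M ^ 2 / ℓ) := by ring
      _ ≤ _ := by gcongr; linarith

/-- After integration in `t` the kernel `σ^{-3/2}` becomes `σ^{-3/2} min(σ, ℓ)`. Against constants
its integral is `O(√ℓ)`; against `havSup` it is dominated by `σ^{-1/2}`, and the Lorentz bound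
applies. The resulting `M`, `M²` and `M⁴` terms are collected using `1 ≤ M`. -/
theorem exists_lintegral_eLpNorm_le : ∃ C : ℝ, 0 < C ∧ ∀ {a b M : ℝ} {u : ℝ → E3 → E3}
    {p : ℝ → E3 → ℝ}, NSFlow a b M u p → ∀ {c ℓ : ℝ}, 0 < ℓ → a ≤ c - ℓ → c + ℓ ≤ b →
    ∫⁻ t in Ioo c (c + ℓ), eLpNorm (u t) ∞ volume ≤ ENNReal.ofReal (C * (M ^ 4 * √ℓ)) := by
  obtain ⟨C₁, hC₁, h1⟩ := NSFlow.exists_eLpNorm_le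
  obtain ⟨C₂, hC₂, h2⟩ := NSFlow.exists_lintegral_lorS_le
  have hK := K0_nonneg
  refine ⟨2 * C₁ + 4 * C₁ ^ 2 + 2 * C₁ * (2 * K0 + 1) * C₂, by positivity,
    fun {a b M u p} h c ℓ hℓ ha hb => ?_⟩
  have hM := h.M_pos
  obtain ⟨W, hW, hWe⟩ := h.exists_measurable_dev (c - ℓ)
  have hr : 0 < √ℓ := Real.sqrt_pos.2 hℓ
  set A := ENNReal.ofReal (C₁ * (M ^ 2 / ℓ)) with hA
  set g : ℝ × ℝ → ℝ≥0∞ := fun z =>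
    ENNReal.ofReal (z.2 ^ (-(3 / 2) : ℝ)) * (A + 2 * havSup (W z.1) z.2) with hg
  have m0 : Measurable fun z : ℝ × ℝ => ENNReal.ofReal (z.2 ^ (-(3 / 2) : ℝ)) := by fun_prop
  have m1 : Measurable g := m0.mul (measurable_const.add ((measurable_havSup hW).const_mul 2))
  have b1 : ∫⁻ t in Ioo c (c + ℓ), ENNReal.ofReal ((t - c) ^ (1 / 2 - 1 : ℝ)) ≤
      ENNReal.ofReal (2 * √ℓ) := by
    have e := lintegral_Ioc_rpow (p := 1 / 2) (by norm_num) hℓ.le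
    rw [← Real.sqrt_eq_rpow, show √ℓ / (1 / 2) = 2 * √ℓ by ring] at e
    rw [← e, ← setLIntegral_congr (Ioo_ae_eq_Ioc (μ := volume) (a := 0) (b := ℓ)),
      ← (measurePreserving_sub_right volume c).setLIntegral_comp_preimage_emb
        (measurableEmbedding_subRight c) (fun t => ENNReal.ofReal (t ^ (1 / 2 - 1 : ℝ))) (Ioo 0 ℓ)]
    simp [add_comm]
  have b2 : ∀ s ∈ Ioo c (c + ℓ), ∫⁻ σ in Ioi 0, ENNReal.ofReal (min σ (c + ℓ - c)) * g (s, σ) ≤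
      A * ENNReal.ofReal (4 * √ℓ) +
        ENNReal.ofReal (2 * (2 * K0 + 1)) * lorS (dev u (c - ℓ) s) := fun s hs => by
    have hWs : Measurable (W s) := hW.comp measurable_prodMk_left
    have m2 : Measurable fun σ : ℝ => ENNReal.ofReal (σ ^ (-(3 / 2) : ℝ)) *
        ENNReal.ofReal (min σ ℓ) := by fun_prop
    have m3 : Measurable (havSup (W s)) := (measurable_havSup hW).comp measurable_prodMk_left
    have e : ∀ σ, ENNReal.ofReal (min σ (c + ℓ - c)) * g (s, σ) =
        A * (ENNReal.ofReal (σ ^ (-(3 / 2) : ℝ)) * ENNReal.ofReal (min σ ℓ)) +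
        2 * (ENNReal.ofReal (σ ^ (-(3 / 2) : ℝ)) * ENNReal.ofReal (min σ ℓ) * havSup (W s) σ) :=
      fun σ => by
        rw [hg, add_sub_cancel_left]
        ring
    simp only [e]
    rw [lintegral_add_left (m2.const_mul A), lintegral_const_mul _ m2,
      lintegral_const_mul' _ _ ENNReal.ofNat_ne_top, ENNReal.ofReal_mul zero_le_two, ENNReal.ofReal_ofNat,
      mul_assoc, ← hWe s (by linarith [hs.1])]
    gcongr
    · exact lintegral_rpow_mul_min hℓ
    · exact lintegral_rpow_mul_min_mul_havSup_le hWs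
  have m4 : Measurable fun t : ℝ => ENNReal.ofReal ((t - c) ^ (1 / 2 - 1 : ℝ)) := by fun_prop
  calc ∫⁻ t in Ioo c (c + ℓ), eLpNorm (u t) ∞ volume
      ≤ ∫⁻ t in Ioo c (c + ℓ), (ENNReal.ofReal (C₁ * M) *
          ENNReal.ofReal ((t - c) ^ (1 / 2 - 1 : ℝ)) +
          ENNReal.ofReal C₁ * ∫⁻ s in Ioc c t, ∫⁻ σ in Ioi (t - s), g (s, σ)) :=
        setLIntegral_mono' measurableSet_Ioo fun t ht => h1 h hℓ ha hb hW hWe t ht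
    _ = ENNReal.ofReal (C₁ * M) * (∫⁻ t in Ioo c (c + ℓ),
          ENNReal.ofReal ((t - c) ^ (1 / 2 - 1 : ℝ))) + ENNReal.ofReal C₁ *
          ∫⁻ t in Ioo c (c + ℓ), ∫⁻ s in Ioc c t, ∫⁻ σ in Ioi (t - s), g (s, σ) := by
        rw [lintegral_add_left (m4.const_mul _), lintegral_const_mul _ m4,
          lintegral_const_mul' _ _ ENNReal.ofReal_ne_top]
    _ ≤ ENNReal.ofReal (C₁ * M) * ENNReal.ofReal (2 * √ℓ) + ENNReal.ofReal C₁ *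
          ∫⁻ s in Ioo c (c + ℓ), (A * ENNReal.ofReal (4 * √ℓ) +
            ENNReal.ofReal (2 * (2 * K0 + 1)) * lorS (dev u (c - ℓ) s)) := by
        exact add_le_add (mul_le_mul_right b1 _) (mul_le_mul_right ((lintegral_triangle_le m1 _ _).trans
          (setLIntegral_mono' measurableSet_Ioo b2)) _)
    _ = ENNReal.ofReal (C₁ * M) * ENNReal.ofReal (2 * √ℓ) + ENNReal.ofReal C₁ *
          (A * ENNReal.ofReal (4 * √ℓ) * ENNReal.ofReal ℓ + ENNReal.ofReal (2 * (2 * K0 + 1)) *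
            ∫⁻ s in Ioo c (c + ℓ), lorS (dev u (c - ℓ) s)) := by
        rw [lintegral_add_left measurable_const, setLIntegral_const, Real.volume_Ioo,
          add_sub_cancel_left, lintegral_const_mul' _ _ ENNReal.ofReal_ne_top]
    _ ≤ ENNReal.ofReal (C₁ * M) * ENNReal.ofReal (2 * √ℓ) + ENNReal.ofReal C₁ *
          (A * ENNReal.ofReal (4 * √ℓ) * ENNReal.ofReal ℓ + ENNReal.ofReal (2 * (2 * K0 + 1)) *
            ENNReal.ofReal (C₂ * (M ^ 4 * √ℓ))) := by
        gcongr
        exact h2 h hℓ ha hb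
    _ ≤ _ := by
        rw [hA, ← ENNReal.ofReal_mul (by positivity), ← ENNReal.ofReal_mul (by positivity),
          ← ENNReal.ofReal_mul (by positivity), ← ENNReal.ofReal_mul (by positivity),
          ← ENNReal.ofReal_add (by positivity) (by positivity),
          ← ENNReal.ofReal_mul (by positivity), ← ENNReal.ofReal_add (by positivity) (by positivity)]
        refine ENNReal.ofReal_le_ofReal ?_
        have p1 : M ≤ M ^ 4 := le_self_pow₀ h.one_le (by norm_num)
        have p2 : M ^ 2 ≤ M ^ 4 := pow_le_pow_right₀ h.one_le (by norm_num)
        calc _ = 2 * C₁ * (M * √ℓ) + 4 * C₁ ^ 2 * (M ^ 2 * √ℓ) +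
              2 * C₁ * (2 * K0 + 1) * C₂ * (M ^ 4 * √ℓ) := by field_simp; ring
          _ ≤ 2 * C₁ * (M ^ 4 * √ℓ) + 4 * C₁ ^ 2 * (M ^ 4 * √ℓ) +
              2 * C₁ * (2 * K0 + 1) * C₂ * (M ^ 4 * √ℓ) := by gcongr
          _ = _ := by ring

end NSFlow

end

/-! ### From the Lorentz bound to a flow uniformly in weak `L³` -/

section

variable {a b M : ℝ} {u : ℝ → E3 → E3} {p : ℝ → E3 → ℝ}

/-- Restrict the Lorentz integral to heights below `β`, where the distribution function is at least
its value at `β`. -/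
theorem weakL3_of_lorentzNorm_le {q : ℝ} (hq : 3 ≤ q) (hM : 0 < M) {f : E3 → E3}
    (h : lorentzNorm 3 q f ≤ ENNReal.ofReal M) : WeakL3 (q / 3 * M) f := by
  intro β hβ
  have hq0 : 0 < q := by linarith
  have hK : 1 ≤ q / 3 := by rw [le_div_iff₀ (by norm_num)]; linarith
  set m := volume {x | β < ‖f x‖} with hm
  have h1 : ENNReal.ofReal 3 * (m ^ (q / 3) * ENNReal.ofReal (β ^ q / q)) ≤ ENNReal.ofReal (M ^ q) := by
    rw [lorentzNorm, one_div, ENNReal.rpow_inv_le_iff hq0,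
      ENNReal.ofReal_rpow_of_nonneg hM.le hq0.le] at h
    refine le_trans (mul_le_mul_right ?_ _) h
    rw [← lintegral_Ioc_rpow hq0 hβ.le, ← lintegral_const_mul _ (by fun_prop)]
    refine le_trans (setLIntegral_mono' measurableSet_Ioc fun α hα => ?_)
      (lintegral_mono_set Ioc_subset_Ioi_self)
    rw [Real.rpow_sub_one hα.1.ne', ENNReal.ofReal_div_of_pos hα.1, ← mul_div_assoc, mul_comm]
    gcongr
    exact measure_mono fun x hx => hα.2.trans_lt hx
  have h2 : m ^ (q / 3) ≤ ENNReal.ofReal ((q / 3 * M / β) ^ q) := by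
    have e : ENNReal.ofReal 3 * (m ^ (q / 3) * ENNReal.ofReal (β ^ q / q)) =
        m ^ (q / 3) * ENNReal.ofReal (β ^ q / (q / 3)) := by
      rw [mul_left_comm, ← ENNReal.ofReal_mul (by norm_num)]
      congr 2
      field_simp
    have hβq : 0 < β ^ q / (q / 3) := by positivity
    rw [e] at h1
    rw [← ENNReal.mul_le_mul_iff_left (ENNReal.ofReal_pos.2 hβq).ne' ENNReal.ofReal_ne_top]
    refine h1.trans ?_
    rw [← ENNReal.ofReal_mul (by positivity)]
    refine ENNReal.ofReal_le_ofReal ?_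
    rw [Real.div_rpow (by positivity) hβ.le, Real.mul_rpow (by positivity) hM.le]
    -- The argument produces the constant `(q/3)^{1/q}`, enlarged to `q/3`.
    have h3 : q / 3 ≤ (q / 3) ^ q := by
      simpa using Real.rpow_le_rpow_of_exponent_le hK (by linarith : (1 : ℝ) ≤ q)
    calc M ^ q = (q / 3) * M ^ q / β ^ q * (β ^ q / (q / 3)) := by field_simp
      _ ≤ _ := by gcongr
  have h3 := ENNReal.rpow_le_rpow h2 (by positivity : 0 ≤ 3 / q)
  rw [← ENNReal.rpow_mul, ENNReal.ofReal_rpow_of_nonneg (by positivity) (by positivity),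
    ← Real.rpow_mul (by positivity), div_mul_div_cancel₀ (by norm_num), div_self hq0.ne',
    ENNReal.rpow_one, mul_div_cancel₀ _ hq0.ne'] at h3
  exact_mod_cast h3

/-- Lower semicontinuity of the measure of `{|v| > α}` under pointwise convergence, by Fatou. -/
theorem isClosed_weakL3 {v : ℝ → E3 → E3} (hv : Continuous fun z : ℝ × E3 => v z.1 z.2) :
    IsClosed {t | WeakL3 M (v t)} := by
  refine IsSeqClosed.isClosed fun s t hs ht α hα => ?_
  have hc : ∀ t, Continuous (v t) := fun t => hv.comp (by fun_prop : Continuous fun x : E3 => (t, x))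
  have hS : ∀ t, MeasurableSet {x | α < ‖v t x‖} := fun t =>
    measurableSet_lt measurable_const (hc t).norm.measurable
  rw [← lintegral_indicator_one (hS t)]
  calc ∫⁻ x, {x | α < ‖v t x‖}.indicator 1 x
      ≤ ∫⁻ x, liminf (fun n => {x | α < ‖v (s n) x‖}.indicator (1 : E3 → ℝ≥0∞) x) atTop := by
        refine lintegral_mono fun x => ?_
        by_cases hx : α < ‖v t x‖
        · have h1 : Tendsto (fun n => ‖v (s n) x‖) atTop (𝓝 ‖v t x‖) :=
            ((hv.comp (by fun_prop : Continuous fun t : ℝ => (t, x))).norm.tendsto t).comp ht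
          refine (indicator_le_self' (by simp) x).trans (le_liminf_of_le (by isBoundedDefault) ?_)
          filter_upwards [h1.eventually (lt_mem_nhds hx)] with n hn
          exact (indicator_of_mem (s := {x | α < ‖v (s n) x‖}) hn _).ge
        · exact (indicator_of_notMem (s := {x | α < ‖v t x‖}) hx _).le.trans zero_le
    _ ≤ liminf (fun n => ∫⁻ x, {x | α < ‖v (s n) x‖}.indicator 1 x) atTop :=
        lintegral_liminf_le fun n => measurable_one.indicator (hS (s n))
    _ ≤ liminf (fun _ : ℕ => ENNReal.ofReal ((M / α) ^ 3)) atTop := by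
        refine liminf_le_liminf (Eventually.of_forall fun n => ?_)
        rw [lintegral_indicator_one (hS (s n))]
        exact hs n α hα
    _ = _ := liminf_const _

/-- The flow, frozen before time `a` and after time `b`. -/
def freeze (u : ℝ → E3 → E3) {a b : ℝ} (hab : a ≤ b) (t : ℝ) : E3 → E3 := u (projIcc a b hab t)

theorem freeze_of_mem (u : ℝ → E3 → E3) (hab : a ≤ b) {t : ℝ} (ht : t ∈ Icc a b) :
    freeze u hab t = u t := by
  rw [freeze, projIcc_of_mem hab ht]

theorem IsClassicalSolution.freeze (h : IsClassicalSolution a b u p) (hab : a ≤ b) :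
    IsClassicalSolution a b (freeze u hab) p where
  smooth_u := h.smooth_u.congr fun z hz => congrFun (freeze_of_mem u hab hz.1) z.2
  smooth_p := h.smooth_p
  momentum t ht x := by
    rw [derivWithin_congr (fun s hs => congrFun (freeze_of_mem u hab hs) x)
      (congrFun (freeze_of_mem u hab ht) x), freeze_of_mem u hab ht]
    exact h.momentum t ht x
  incompressible t ht x := by
    rw [freeze_of_mem u hab ht]
    exact h.incompressible t ht x

/-- The essential supremum controls almost every time only, but the good times form a closed set.
Freezing the flow outside the interval makes continuity and the weak bound available for all real
times. -/
theorem NSFlow.of_supLorentzNorm_le {q : ℝ} (hq : 3 ≤ q) (hM : 1 ≤ M) (hab : a < b)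
    (h : IsClassicalSolution a b u p)
    (hL : supLorentzNorm 3 q (Icc a b) u ≤ ENNReal.ofReal M) :
    NSFlow a b (q / 3 * M) (freeze u hab.le) p := by
  have hK : 1 ≤ q / 3 := by rw [le_div_iff₀ (by norm_num)]; linarith
  have hcont : Continuous fun z : ℝ × E3 => freeze u hab.le z.1 z.2 :=
    h.smooth_u.continuousOn.comp_continuous
      (f := fun z : ℝ × E3 => ((projIcc a b hab.le z.1 : ℝ), z.2))
      ((continuous_subtype_val.comp (continuous_projIcc.comp continuous_fst)).prodMk continuous_snd)
      fun z => ⟨(projIcc a b hab.le z.1).2, mem_univ _⟩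
  refine ⟨hab, one_le_mul_of_one_le_of_one_le hK hM, h.freeze hab.le, hcont, fun t => ?_⟩
  set G := {t | WeakL3 (q / 3 * M) (freeze u hab.le t)} with hG
  have hGc : IsClosed G := isClosed_weakL3 hcont
  have hae : ∀ᵐ t ∂volume.restrict (Icc a b), t ∈ G := by
    filter_upwards [ENNReal.ae_le_essSup (fun t => lorentzNorm 3 q (u t)),
      ae_restrict_mem measurableSet_Icc] with t ht hmem
    change WeakL3 _ _
    rw [freeze_of_mem u hab.le hmem]
    exact weakL3_of_lorentzNorm_le hq (by linarith) (ht.trans hL)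
  -- An open null set is empty.
  have hE : Ioo a b ∩ Gᶜ = ∅ := by
    refine ((isOpen_Ioo.inter hGc.isOpen_compl).measure_eq_zero_iff volume).1 ?_
    rw [ae_restrict_iff' measurableSet_Icc] at hae
    refine measure_mono_null (fun t ht => ?_) hae
    exact fun hn => ht.2 (hn (Ioo_subset_Icc_self ht.1))
  have hsub : Icc a b ⊆ G := by
    rw [← closure_Ioo hab.ne]
    exact closure_minimal (fun t ht => by_contra fun hn => (hE ▸ ⟨ht, hn⟩ : t ∈ (∅ : Set ℝ))) hGc
  have hp := hsub (projIcc a b hab.le t).2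
  change WeakL3 _ (freeze u hab.le _) at hp
  rw [freeze_of_mem u hab.le (projIcc a b hab.le t).2] at hp
  exact hp

/-- An order-connected set differs from an open interval by at most its end points. In the second
half of `[a, b]` its length is at most `(b - a) / 2`, so the heat flow can start one length earlier.
-/
theorem exists_totalSpeed_le : ∃ C : ℝ, 0 < C ∧ ∀ {a b M : ℝ} {u : ℝ → E3 → E3}
    {p : ℝ → E3 → ℝ}, NSFlow a b M u p → ∀ I : Set ℝ, I.OrdConnected → I ⊆ Icc ((a + b) / 2) b →
    totalSpeed I u ≤ ENNReal.ofReal (C * (M ^ 4 * √(volume I).toReal)) := by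
  obtain ⟨C, hC, h1⟩ := NSFlow.exists_lintegral_eLpNorm_le
  refine ⟨C, hC, fun {a b M u p} h I hI hsub => ?_⟩
  rcases I.eq_empty_or_nonempty with rfl | hne
  · simp [totalSpeed]
  have hbb : BddBelow I := bddBelow_Icc.mono hsub
  have hba : BddAbove I := bddAbove_Icc.mono hsub
  set c := sInf I with hc
  set d := sSup I with hd
  have hIcc : I ⊆ Icc c d := subset_Icc_csInf_csSup hbb hba
  have hIoo : Ioo c d ⊆ I := IsConnected.Ioo_csInf_csSup_subset ⟨hne, hI.isPreconnected⟩ hbb hba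
  have hcm : (a + b) / 2 ≤ c := le_csInf hne fun x hx => (hsub hx).1
  have hdm : d ≤ b := csSup_le hne fun x hx => (hsub hx).2
  have hvol : volume I = ENNReal.ofReal (d - c) := le_antisymm
    ((measure_mono hIcc).trans_eq Real.volume_Icc) (Real.volume_Ioo.symm.trans_le (measure_mono hIoo))
  have hle : totalSpeed I u ≤ ∫⁻ t in Ioo c d, eLpNorm (u t) ∞ volume := by
    rw [setLIntegral_congr Ioo_ae_eq_Icc]
    exact lintegral_mono_set hIcc
  rcases le_or_gt d c with hdc | hdc
  · rw [Ioo_eq_empty hdc.not_gt] at hle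
    exact (hle.trans_eq (by simp)).trans zero_le
  · have := h1 h (c := c) (sub_pos.2 hdc) (by linarith) (by linarith)
    rw [add_sub_cancel] at this
    rw [hvol, ENNReal.toReal_ofReal (sub_pos.2 hdc).le]
    exact hle.trans this

end

end LorentzNS

end

/-! ### The main theorem -/

open LorentzNS in
theorem mainTheorem7 (q₀ : ℝ) (hq₀ : 3 ≤ q₀) (φ : E3 → ℝ) (hφ : IsLPBump φ) :
    ∃ C : ℝ, 0 < C ∧
      ∀ (t₀ T M : ℝ) (u : ℝ → E3 → E3) (p : ℝ → E3 → ℝ),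
        0 < T → 1 ≤ M →
        IsClassicalSolution (t₀ - T) t₀ u p →
        supLorentzNorm 3 q₀ (Icc (t₀ - T) t₀) u ≤ ENNReal.ofReal M →
        (∀ N : ℝ, 0 < N →
          (∀ t ∈ Icc (t₀ - T) t₀,
            IsLPProjection φ N (u t) (lpProj φ N (u t)) ∧
            IsLPProjection φ N (curl (u t)) (lpProj φ N (curl (u t)))) ∧
          ∀ t ∈ Icc (t₀ - T / 2) t₀, ∀ x : E3,
            ‖lpProj φ N (u t) x‖ ≤ C * (M * N) ∧
            (DifferentiableAt ℝ (lpProj φ N (u t)) x ∧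
              ‖fderiv ℝ (lpProj φ N (u t)) x‖ ≤ C * (M * N ^ 2)) ∧
            (DifferentiableWithinAt ℝ (fun s => lpProj φ N (u s) x) (Icc (t₀ - T) t₀) t ∧
              ‖derivWithin (fun s => lpProj φ N (u s) x) (Icc (t₀ - T) t₀) t‖
                ≤ C * (M ^ 2 * N ^ 3)) ∧
            ‖lpProj φ N (curl (u t)) x‖ ≤ C * (M * N ^ 2) ∧
            (DifferentiableAt ℝ (lpProj φ N (curl (u t))) x ∧
              ‖fderiv ℝ (lpProj φ N (curl (u t))) x‖ ≤ C * (M * N ^ 3)) ∧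
            (DifferentiableWithinAt ℝ (fun s => lpProj φ N (curl (u s)) x)
                (Icc (t₀ - T) t₀) t ∧
              ‖derivWithin (fun s => lpProj φ N (curl (u s)) x) (Icc (t₀ - T) t₀) t‖
                ≤ C * (M ^ 2 * N ^ 4))) ∧
        ∀ I : Set ℝ, I.OrdConnected → I ⊆ Icc (t₀ - T / 2) t₀ →
          totalSpeed I u ≤ ENNReal.ofReal (C * (M ^ 4 * Real.sqrt (volume I).toReal)) := by
  obtain ⟨C₁, hC₁, h1⟩ := NSFlow.exists_lp_bounds hφ
  obtain ⟨C₂, hC₂, h2⟩ := exists_totalSpeed_le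
  set K := q₀ / 3 with hK
  have hK1 : 1 ≤ K := by rw [hK, le_div_iff₀ (by norm_num)]; linarith
  -- The weak `L³` constant is `K M`, entering at most squared in the pointwise bounds and to the
  -- fourth power in the total speed.
  refine ⟨C₁ * K ^ 2 + C₂ * K ^ 4, by positivity, fun t₀ T M u p hT hM hsol hsup => ?_⟩
  have hab : t₀ - T < t₀ := by linarith
  have h := NSFlow.of_supLorentzNorm_le hq₀ hM hab hsol hsup
  rw [← hK] at h
  have hv : ∀ {t}, t ∈ Icc (t₀ - T) t₀ → freeze u hab.le t = u t := freeze_of_mem u hab.le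
  have hC2K : 0 ≤ C₂ * K ^ 4 := by positivity
  have e1 : ∀ {X : ℝ}, 0 ≤ X → C₁ * (K * M * X) ≤ (C₁ * K ^ 2 + C₂ * K ^ 4) * (M * X) :=
    fun {X} hX => by
      have hKK : K ≤ K ^ 2 := le_self_pow₀ hK1 two_ne_zero
      calc C₁ * (K * M * X) = C₁ * K * (M * X) := by ring
        _ ≤ (C₁ * K ^ 2 + C₂ * K ^ 4) * (M * X) := by
            gcongr
            exact (mul_le_mul_of_nonneg_left hKK hC₁.le).trans (le_add_of_nonneg_right hC2K)
  have e2 : ∀ {X : ℝ}, 0 ≤ X → C₁ * ((K * M) ^ 2 * X) ≤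
      (C₁ * K ^ 2 + C₂ * K ^ 4) * (M ^ 2 * X) := fun {X} hX => by
    calc C₁ * ((K * M) ^ 2 * X) = C₁ * K ^ 2 * (M ^ 2 * X) := by ring
      _ ≤ (C₁ * K ^ 2 + C₂ * K ^ 4) * (M ^ 2 * X) := by
          gcongr
          exact le_add_of_nonneg_right hC2K
  refine ⟨fun N hN => ⟨fun t ht => ?_, fun t ht x => ?_⟩, fun I hI hsub => ?_⟩
  · have l1 := h.isLPProjection hφ hN t
    have l2 := h.isLPProjection_curl hφ hN ht
    rw [hv ht] at l1 l2
    exact ⟨by rwa [lpProj_eq l1], by rwa [lpProj_eq l2]⟩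
  · have ht' : t ∈ Icc (t₀ - T) t₀ := ⟨by linarith [ht.1], ht.2⟩
    have hb := h1 h hN t ht' x
    -- Derivatives within the closed interval do not see the freezing outside it.
    have c1 : EqOn (fun s => lpProj φ N (u s) x) (fun s => lpProj φ N (freeze u hab.le s) x)
        (Icc (t₀ - T) t₀) := fun s hs => by simp only [hv hs]
    have c2 : EqOn (fun s => lpProj φ N (curl (u s)) x)
        (fun s => lpProj φ N (curl (freeze u hab.le s)) x) (Icc (t₀ - T) t₀) :=
      fun s hs => by simp only [hv hs]
    rw [← derivWithin_congr c1 (c1 ht'), ← derivWithin_congr c2 (c2 ht'), hv ht'] at hb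
    obtain ⟨b1, ⟨d2, b2⟩, ⟨d3, b3⟩, b4, ⟨d5, b5⟩, d6, b6⟩ := hb
    exact ⟨b1.trans (e1 hN.le), ⟨d2, b2.trans (e1 (by positivity))⟩,
      ⟨d3.congr c1 (c1 ht'), b3.trans (e2 (by positivity))⟩, b4.trans (e1 (by positivity)),
      ⟨d5, b5.trans (e1 (by positivity))⟩, d6.congr c2 (c2 ht'), b6.trans (e2 (by positivity))⟩
  · have hsub' : I ⊆ Icc ((t₀ - T + t₀) / 2) t₀ := fun t ht =>
      ⟨by linarith [(hsub ht).1], (hsub ht).2⟩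
    have hS : totalSpeed I u = totalSpeed I (freeze u hab.le) := by
      refine setLIntegral_congr_fun hI.measurableSet fun t ht => ?_
      simp only [hv (show t ∈ Icc (t₀ - T) t₀ from ⟨by linarith [(hsub ht).1], (hsub ht).2⟩)]
    rw [hS]
    refine (h2 h I hI hsub').trans (ENNReal.ofReal_le_ofReal ?_)
    calc C₂ * ((K * M) ^ 4 * √(volume I).toReal) =
          C₂ * K ^ 4 * (M ^ 4 * √(volume I).toReal) := by ring
      _ ≤ (C₁ * K ^ 2 + C₂ * K ^ 4) * (M ^ 4 * √(volume I).toReal) := by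
          gcongr
          exact le_add_of_nonneg_left (by positivity)
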